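/- **Setting.** Let $N,m\ge 1$ be integers and $\ell\in\mathbb C$. *The affine Lie algebra.* Let $\bar{\mathfrak g}=\mathfrak{sl}_m(\mathbb C)$ and $\mathfrak g=\bar{\mathfrak g}\otimes\mathbb C[t,t^{-1}]\oplus\mathbb Cc_{\mathfrak g}\oplus\mathbb Cd_{\mathfrak g}$, where $c_{\mathfrak g}$ is central, $[X\otimes f,Y\otimes g]=[X,Y]\otimes fg+\operatorname{tr}(XY)\,\operatorname{Res}_{t=0}(g\,df)\,c_{\mathfrak g}$ and $[d_{\mathfrak g},X\otimes f]=X\otimes t\frac{df}{dt}$. Put $\mathfrak g'=\bar{\mathfrak g}\otimes\mathbb C[t,t^{-1}]\oplus\mathbb Cc_{\mathfrak g}$. Let $\bar{\mathfrak h}$ and $\bar{\mathfrak n}_\pm$ be the traceless diagonal matrices and the strictly upper/lower triangular matrices in $\bar{\mathfrak g}$, $\mathfrak h=\bar{\mathfrak h}\oplus\mathbb Cc_{\mathfrak g}\oplus\mathbb Cd_{\mathfrak g}$ and $\mathfrak n_\pm=\bar{\mathfrak n}_\pm\oplus\bar{\mathfrak g}\otimes t^{\pm1}\mathbb C[t^{\pm1}]$.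 The category $\mathcal O(\ell)$ (resp. $\mathcal O^\dagger(\ell)$) consists of the $\mathfrak g$-modules that are finitely generated, $\mathfrak n_+$-locally finite (resp. $\mathfrak n_-$-locally finite), $\mathfrak h$-diagonalizable with finite-dimensional weight spaces, and on which $c_{\mathfrak g}$ acts by $\ell$ (resp. $-\ell$). Let $A\in\mathcal O(\ell)$ and $B\in\mathcal O^\dagger(\ell)$. *The spaces.* Let $V=\mathbb C^m$ be the vector representation of $\bar{\mathfrak g}$, $P=\bigoplus_{i=1}^N\mathbb Z\epsilon_i$, $\mathbb C[P]=\mathbb C[z_1^{\pm1},\dots,z_N^{\pm1}]$ with $e^{\eta}=z^\eta$ for $\eta\in P$, $X=\{z\in(\mathbb C^*)^N: z_i\ne z_j\text{ for }i\neq j\}$ and $\mathcal R(X)\supset\mathbb C[P]$ the ring of holomorphic functions on $X$. On $A\otimes\mathcal R(X)\otimes V^{\otimes N}\otimes B$ let $\theta_0$ and $\theta_{N+1}$ be the actions of $\mathfrak g$ on $A$ and on $B$, and for $1\le i\le N$ let $\theta_i(X\otimes f(t))$ be $f(z_i)$ times the action of $X$ on the $i$-th factor $V$, $\theta_i(d_{\mathfrak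 g})=\partial_i:=z_i\partial/\partial z_i$ and $\theta_i(c_{\mathfrak g})=0$. The diagonal action is $\theta=\sum_{i=0}^{N+1}\theta_i$; it preserves $A\otimes\mathbb C[P]\otimes V^{\otimes N}\otimes B$. For a Lie algebra $\mathfrak a$ acting on $M$, $\mathfrak aM$ is the span of all $Xv$ ($X\in\mathfrak a$, $v\in M$). Put $$\mathcal F(A,B)=\big(A\otimes\mathbb C[P]\otimes V^{\otimes N}\otimes B\big)\big/\mathfrak g'\big(A\otimes\mathbb C[P]\otimes V^{\otimes N}\otimes B\big).$$ *The KZ connections.* Let $\{J_k\}$ and $\{H_a\}$ be orthonormal bases of $\bar{\mathfrak g}$ and $\bar{\mathfrak h}$ for the form $\operatorname{tr}(XY)$, and let $E_{ab}$ be the matrix units. Put $$\bar r=\tfrac12\sum_aH_a\otimes H_a+\sum_{a<b}E_{ab}\otimes E_{ba},\qquad r=\bar r+\tfrac12(c_{\mathfrak g}\otimes d_{\mathfrak g}+d_{\mathfrak g}\otimes c_{\mathfrak g})+\sum_{n\ge1}\sum_k(J_k\otimes t^n)\otimes(J_k\otimes t^{-n}),$$ $\Omega=\bar r+T(\bar r)$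 with $T(x\otimes y)=y\otimes x$, and $\rho^\vee_{\mathfrak g}=\bar\rho^\vee+m\,d_{\mathfrak g}$, with $\bar\rho^\vee$ half the sum of the positive coroots of $\mathfrak{sl}_m$. Write $\theta_{ij}(x\otimes y)=\theta_i(x)\theta_j(y)$. For $1\le i\le N$ let $r_{(0\,i)}=\theta_{0\,i}(r)$ and $r_{(i\,N+1)}=\theta_{i\,N+1}(r)$; for $1\le i<j\le N$ let $r_{(ij)}=\theta_{ij}(\bar r)+\frac{z_i/z_j}{1-z_i/z_j}\theta_{ij}(\Omega)$. Define $$\nabla_i=\sum_{0\le j<i}r_{(ji)}-\sum_{i<j\le N+1}r_{(ij)}+\theta_i(\rho^\vee_{\mathfrak g})\qquad(1\le i\le N).$$ *The Cherednik–Dunkl operators.* For $w\in S_N$ let $\tau(w)$ act on $\mathcal R(X)\otimes V^{\otimes N}$ by $f(z_1,\dots,z_N)\mapsto f(z_{w(1)},\dots,z_{w(N)})$ and $v_1\otimes\cdots\otimes v_N\mapsto v_{w^{-1}(1)}\otimes\cdots\otimes v_{w^{-1}(N)}$, and trivially on $A$ and $B$. For $\xi=\sum_i\xi_i\epsilon_i^\vee\in\bar{\mathfrak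 t}=\bigoplus_{i=1}^N\mathbb C\epsilon_i^\vee$ put $\nabla_\xi=\sum_i\xi_i\nabla_i$, $\partial_\xi=\sum_i\xi_i\partial_i$. Let $\bar R_+=\{\epsilon_i-\epsilon_j:i<j\}$, $\bar R=\bar R_+\cup(-\bar R_+)$, $\bar\rho=\frac12\sum_{\alpha\in\bar R_+}\alpha$, $G=\prod_{\alpha\in\bar R}(1-e^{-\alpha})$, let $s_\alpha\in S_N$ be the transposition of $\alpha$, and $$\mathcal D_\xi=\nabla_\xi+\sum_{\alpha\in\bar R_+}\alpha(\xi)\frac{1-\tau(s_\alpha)}{1-e^{-\alpha}}-\bar\rho(\xi)-\frac{m-1}{2m}\,\frac{\partial_\xi G}{G}.$$ *The algebra.* Let $W=S_N\ltimes P$, with translations $t_\eta$ ($\eta\in P$), and $\mathfrak t'=\bar{\mathfrak t}\oplus\mathbb Cc$. The group $W$ acts on $\mathfrak t'$: $S_N$ permutes the $\epsilon_i^\vee$, $t_\eta(\xi)=\xi-\eta(\xi)c$ for $\xi\in\bar{\mathfrak t}$, and $c$ is fixed. Let $\alpha_i=\epsilon_i-\epsilon_{i+1}$ with $s_i=s_{\alpha_i}$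 for $1\le i<N$, $\alpha_0=\delta-(\epsilon_1-\epsilon_N)$ with $s_0=t_{\epsilon_1-\epsilon_N}s_{\epsilon_1-\epsilon_N}$, where $\delta$ vanishes on $\mathfrak t'$ and every $\epsilon_i$ vanishes on $c$, and $\pi=t_{\epsilon_1}s_1\cdots s_{N-1}$. The degenerate double affine Hecke algebra $\mathcal H$ of $\mathfrak{gl}_N$ is the unital $\mathbb C$-algebra generated by the group algebra $\mathbb C[W]$ and the symmetric algebra $S[\mathfrak t']$ with the relations $$s_i\,\xi-s_i(\xi)\,s_i=-\alpha_i(\xi)\quad(0\le i\le N-1),\qquad \pi\,\xi=\pi(\xi)\,\pi\qquad(\xi\in\mathfrak t')$$ (the first family is absent if $N=1$). **Theorem.** (i) On each vector of $A\otimes\mathcal R(X)\otimes V^{\otimes N}\otimes B$ only finitely many $n$ contribute to the sums in $r_{(0\,i)}$ and $r_{(i\,N+1)}$, so $\nabla_i$ and $\mathcal D_\xi$ are well defined. There is a unique homomorphism of algebras $$\mathcal H\to\operatorname{End}_{\mathbb C}\big(A\otimes\mathcal R(X)\otimes V^{\otimes N}\otimes B\big),\qquad c\mapsto\ell+m,\quad\xi\mapsto\mathcal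 D_\xi\ (\xi\in\bar{\mathfrak t}),\quad w\mapsto\tau(w)\ (w\in S_N),\quad t_\eta\mapsto z^\eta\ (\eta\in P).$$ Moreover multiplication by an arbitrary $f\in\mathcal R(X)$ satisfies the corresponding relations, for all $w\in S_N$ and $\xi\in\bar{\mathfrak t}$, $$\tau(w)f=({}^wf)\,\tau(w),\qquad[\mathcal D_\xi,f]=(\ell+m)\,\partial_\xi f+\sum_{\alpha\in\bar R_+}\alpha(\xi)\frac{f-{}^{s_\alpha}f}{1-e^{-\alpha}}\,\tau(s_\alpha),$$ where ${}^wf(z_1,\dots,z_N)=f(z_{w(1)},\dots,z_{w(N)})$. (ii) The subspaces $A\otimes\mathbb C[P]\otimes V^{\otimes N}\otimes B$ and $\mathfrak g'(A\otimes\mathbb C[P]\otimes V^{\otimes N}\otimes B)$ are preserved by this action. Hence it induces a (unique) action of $\mathcal H$ on $\mathcal F(A,B)$, in which $c$ acts by $\ell+m$. (iii) The construction is functorial: for $\mathfrak g$-homomorphisms $f_1:A\to A'$ and $f_2:B\to B'$ with $A'\in\mathcal O(\ell)$ and $B'\in\mathcal O^\dagger(\ell)$ the induced map $\mathcal F(A,B)\to\mathcal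 F(A',B')$ is a homomorphism of $\mathcal H$-modules, and these maps are compatible with identities and compositions. -/

import Mathlib

open scoped TensorProduct

noncomputable section

namespace AffineKZ

/-- The derivation `e^η ↦ φ(η) e^η` of the group algebra `ℂ[M]` attached to an additive map `φ : M → ℂ`. -/
def weightDerivation {M : Type*} [AddCommMonoid M] (φ : M →+ ℂ) :
    Derivation ℂ (AddMonoidAlgebra ℂ M) (AddMonoidAlgebra ℂ M) :=
  Derivation.mk'
    ((AddMonoidAlgebra.basis M ℂ).constr ℂ
      (fun η => φ η • (AddMonoidAlgebra.single η 1 : AddMonoidAlgebra ℂ M)))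
    (by
      have key : ∀ η : M, (AddMonoidAlgebra.basis M ℂ).constr ℂ
          (fun η => φ η • (AddMonoidAlgebra.single η 1 : AddMonoidAlgebra ℂ M))
          (AddMonoidAlgebra.single η 1) = φ η • AddMonoidAlgebra.single η 1 := by
        intro η
        have := (AddMonoidAlgebra.basis M ℂ).constr_basis ℂ
          (fun η => φ η • (AddMonoidAlgebra.single η 1 : AddMonoidAlgebra ℂ M)) η
        simpa using this
      intro a b
      induction a using AddMonoidAlgebra.induction_linear with
      | zero => simp
      | add f g hf hg => simp only [add_mul, map_add, hf, hg, smul_eq_mul, mul_add]; ring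
      | single η r =>
        induction b using AddMonoidAlgebra.induction_linear with
        | zero => simp
        | add f g hf hg => simp only [mul_add, map_add, hf, hg, smul_eq_mul, add_mul]; ring
        | single η' r' =>
          have e : ∀ (η : M) (r : ℂ), (AddMonoidAlgebra.single η r : AddMonoidAlgebra ℂ M)
              = r • AddMonoidAlgebra.single η 1 := by intro η r; simp
          rw [AddMonoidAlgebra.single_mul_single, e (η + η'), e η, e η', map_smul, map_smul, map_smul,
            key, key, key, map_add]
          simp only [smul_eq_mul, smul_mul_assoc, mul_smul_comm, AddMonoidAlgebra.single_mul_single,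
            mul_one, smul_smul, ← add_smul, add_comm η' η]
          congr 1; ring)

theorem weightDerivation_single {M : Type*} [AddCommMonoid M] (φ : M →+ ℂ) (η : M) :
    weightDerivation φ (AddMonoidAlgebra.single η 1) = φ η • AddMonoidAlgebra.single η 1 := by
  have := (AddMonoidAlgebra.basis M ℂ).constr_basis ℂ
    (fun η => φ η • (AddMonoidAlgebra.single η 1 : AddMonoidAlgebra ℂ M)) η
  simpa [weightDerivation] using this

/-! ### The affine Lie algebra of `sl_m` -/

/-- `sl_m(ℂ)`, traceless matrices. -/
def Sl (m : ℕ) : Type := LieAlgebra.SpecialLinear.sl (Fin m) ℂ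

attribute [local instance 100] LieRing.ofAssociativeRing

instance (m : ℕ) : LieRing (Sl m) :=
  inferInstanceAs (LieRing (LieAlgebra.SpecialLinear.sl (Fin m) ℂ))

instance (m : ℕ) : LieAlgebra ℂ (Sl m) :=
  inferInstanceAs (LieAlgebra ℂ (LieAlgebra.SpecialLinear.sl (Fin m) ℂ))

/-- The inclusion of `sl_m(ℂ)` in the matrices. -/
def Sl.toMatrix (m : ℕ) : Sl m →ₗ[ℂ] Matrix (Fin m) (Fin m) ℂ :=
  (LieAlgebra.SpecialLinear.sl (Fin m) ℂ).toSubmodule.subtype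

theorem Sl.toMatrix_lie (m : ℕ) (X Y : Sl m) :
    Sl.toMatrix m ⁅X, Y⁆ = Sl.toMatrix m X * Sl.toMatrix m Y - Sl.toMatrix m Y * Sl.toMatrix m X :=
  LieAlgebra.SpecialLinear.sl_bracket _ _ X Y


/-- The loop algebra `ℂ[t,t⁻¹] ⊗ sl_m`. -/
abbrev LoopSl (m : ℕ) : Type := AddMonoidAlgebra ℂ ℤ ⊗[ℂ] Sl m

/-- The invariant form `(X, Y) ↦ tr(XY)`. -/
def traceForm (m : ℕ) : Sl m →ₗ[ℂ] Sl m →ₗ[ℂ] ℂ :=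
  LinearMap.mk₂ ℂ (fun X Y => Matrix.trace (Sl.toMatrix m X * Sl.toMatrix m Y))
    (by intros; simp [add_mul]) (by intros; simp) (by intros; simp [mul_add]) (by intros; simp)

theorem traceForm_apply (m : ℕ) (X Y : Sl m) :
    traceForm m X Y = Matrix.trace (Sl.toMatrix m X * Sl.toMatrix m Y) := rfl

theorem traceForm_symm (m : ℕ) (X Y : Sl m) : traceForm m X Y = traceForm m Y X := by
  rw [traceForm_apply, traceForm_apply, Matrix.trace_mul_comm]

theorem traceForm_invariant (m : ℕ) (X Y Z : Sl m) :
    traceForm m ⁅X, Y⁆ Z = traceForm m X ⁅Y, Z⁆ := by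
  simp only [traceForm_apply, Sl.toMatrix_lie]
  rw [sub_mul, mul_sub, Matrix.trace_sub, Matrix.trace_sub, ← Matrix.mul_assoc, ← Matrix.mul_assoc,
    Matrix.trace_mul_cycle (Sl.toMatrix m X) (Sl.toMatrix m Z)]

theorem traceForm_skew (m : ℕ) (X Y Z : Sl m) :
    traceForm m ⁅X, Y⁆ Z = - traceForm m Y ⁅X, Z⁆ := by
  rw [← traceForm_invariant, ← lie_skew X Y, map_neg, LinearMap.neg_apply]

/-- The loop `X ⊗ tⁿ`. -/
def loopMonomial (m : ℕ) (n : ℤ) : Sl m →ₗ[ℂ] LoopSl m :=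
  TensorProduct.mk ℂ (AddMonoidAlgebra ℂ ℤ) (Sl m) (AddMonoidAlgebra.single n 1)

theorem loopMonomial_eq (m : ℕ) (n : ℤ) (X : Sl m) :
    loopMonomial m n X = (AddMonoidAlgebra.single n 1 : AddMonoidAlgebra ℂ ℤ) ⊗ₜ[ℂ] X := rfl

theorem loop_ext {m : ℕ} {E : Type*} [AddCommGroup E] [Module ℂ E] {f g : LoopSl m →ₗ[ℂ] E}
    (h : ∀ n X, f (loopMonomial m n X) = g (loopMonomial m n X)) : f = g := by
  apply TensorProduct.ext
  apply (AddMonoidAlgebra.basis ℤ ℂ).ext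
  intro n
  refine LinearMap.ext fun X => ?_
  simpa [loopMonomial_eq] using h n X

/-- `(f, g) ↦ Res_{t=0} (df/dt) g dt`. -/
def residueForm : AddMonoidAlgebra ℂ ℤ →ₗ[ℂ] AddMonoidAlgebra ℂ ℤ →ₗ[ℂ] ℂ :=
  LinearMap.mk₂ ℂ (fun f g => (weightDerivation (Int.castAddHom ℂ) f * g).coeff 0)
    (by intros; simp [add_mul]) (by intros; simp) (by intros; simp [mul_add]) (by intros; simp)

/-- The bracket of `sl_m` as a bilinear map. -/
def slBracket (m : ℕ) : Sl m →ₗ[ℂ] Sl m →ₗ[ℂ] Sl m :=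
  LinearMap.mk₂ ℂ (fun X Y => ⁅X, Y⁆) add_lie smul_lie lie_add (fun a X Y => lie_smul a X Y)

/-- The bracket of loops, `[X ⊗ f, Y ⊗ g] = [X, Y] ⊗ fg`. -/
def loopBracket (m : ℕ) : LoopSl m →ₗ[ℂ] LoopSl m →ₗ[ℂ] LoopSl m :=
  TensorProduct.map₂ (LinearMap.mul ℂ (AddMonoidAlgebra ℂ ℤ)) (slBracket m)

/-- The cocycle `(X ⊗ f, Y ⊗ g) ↦ tr(XY) Res_{t=0} (df/dt) g dt`. -/
def loopCocycle (m : ℕ) : LoopSl m →ₗ[ℂ] LoopSl m →ₗ[ℂ] ℂ :=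
  (TensorProduct.map₂ residueForm (traceForm m)).compr₂ (TensorProduct.lid ℂ ℂ).toLinearMap

/-- The derivation `t d/dt` of the loop algebra. -/
def loopDegree (m : ℕ) : LoopSl m →ₗ[ℂ] LoopSl m :=
  LinearMap.rTensor (Sl m) (weightDerivation (Int.castAddHom ℂ)).toLinearMap

theorem loopBracket_monomial (m : ℕ) (p q : ℤ) (X Y : Sl m) :
    loopBracket m (loopMonomial m p X) (loopMonomial m q Y) = loopMonomial m (p + q) ⁅X, Y⁆ := by
  simp only [loopMonomial_eq, loopBracket, TensorProduct.map₂_apply_tmul, TensorProduct.map_tmul,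
    LinearMap.mul_apply', AddMonoidAlgebra.single_mul_single, one_mul]
  rfl

theorem loopCocycle_monomial (m : ℕ) (p q : ℤ) (X Y : Sl m) :
    loopCocycle m (loopMonomial m p X) (loopMonomial m q Y) =
      if p + q = 0 then (p : ℂ) * traceForm m X Y else 0 := by
  rw [loopMonomial_eq, loopMonomial_eq, loopCocycle, LinearMap.compr₂_apply,
    TensorProduct.map₂_apply_tmul, TensorProduct.map_tmul, LinearEquiv.coe_coe, TensorProduct.lid_tmul, residueForm,
    LinearMap.mk₂_apply, weightDerivation_single, smul_mul_assoc,
    AddMonoidAlgebra.single_mul_single, AddMonoidAlgebra.coeff_smul, Finsupp.smul_apply,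
    AddMonoidAlgebra.coeff_single, Finsupp.single_apply]
  split_ifs <;> simp

theorem loopDegree_monomial (m : ℕ) (n : ℤ) (X : Sl m) :
    loopDegree m (loopMonomial m n X) = (n : ℂ) • loopMonomial m n X := by
  rw [loopMonomial_eq, loopDegree, LinearMap.rTensor_tmul, Derivation.coeFn_coe,
    weightDerivation_single, TensorProduct.smul_tmul']
  rfl

theorem loopBracket_add_flip (m : ℕ) (x y : LoopSl m) :
    loopBracket m x y + loopBracket m y x = 0 := by
  have : loopBracket m + (loopBracket m).flip = 0 := by
    refine loop_ext fun p X => loop_ext fun q Y => ?_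
    rw [LinearMap.add_apply, LinearMap.add_apply, LinearMap.flip_apply, loopBracket_monomial,
      loopBracket_monomial, add_comm q p, ← map_add, ← lie_skew, neg_add_cancel, map_zero]
    rfl
  exact LinearMap.congr_fun₂ this x y

theorem loopBracket_skew (m : ℕ) (x y : LoopSl m) :
    loopBracket m x y = - loopBracket m y x :=
  eq_neg_of_add_eq_zero_left (loopBracket_add_flip m x y)

theorem loopBracket_self (m : ℕ) (x : LoopSl m) : loopBracket m x x = 0 := by
  have h := loopBracket_add_flip m x x
  rw [← two_smul ℂ] at h
  exact (smul_eq_zero.mp h).resolve_left two_ne_zero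

theorem loopBracket_leibniz (m : ℕ) (x y z : LoopSl m) :
    loopBracket m x (loopBracket m y z) =
      loopBracket m (loopBracket m x y) z + loopBracket m y (loopBracket m x z) := by
  let f₁ : LoopSl m →ₗ[ℂ] LoopSl m →ₗ[ℂ] LoopSl m →ₗ[ℂ] LoopSl m :=
    LinearMap.mk₂ ℂ (fun x y => (loopBracket m x) ∘ₗ loopBracket m y)
      (by intros; simp [LinearMap.add_comp]) (by intros; simp [LinearMap.smul_comp])
      (by intros; simp [LinearMap.comp_add]) (by intros; simp [LinearMap.comp_smul])
  have : f₁ = (loopBracket m).compr₂ (loopBracket m) + f₁.flip := by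
    refine loop_ext fun p X => loop_ext fun q Y => loop_ext fun r Z => ?_
    simp only [f₁, LinearMap.add_apply, LinearMap.flip_apply, LinearMap.compr₂_apply,
      LinearMap.mk₂_apply, LinearMap.comp_apply, loopBracket_monomial]
    rw [show q + (p + r) = p + (q + r) by ring, show p + q + r = p + (q + r) by ring, ← map_add,
      ← leibniz_lie]
  exact LinearMap.congr_fun (LinearMap.congr_fun₂ this x y) z

theorem loopDegree_bracket (m : ℕ) (x y : LoopSl m) :
    loopDegree m (loopBracket m x y) =
      loopBracket m (loopDegree m x) y + loopBracket m x (loopDegree m y) := by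
  have : (loopBracket m).compr₂ (loopDegree m) =
      (loopBracket m).comp (loopDegree m) + (loopBracket m).compl₂ (loopDegree m) := by
    refine loop_ext fun p X => loop_ext fun q Y => ?_
    simp only [LinearMap.compr₂_apply, LinearMap.add_apply, LinearMap.comp_apply,
      LinearMap.compl₂_apply, loopDegree_monomial, loopBracket_monomial, map_smul,
      LinearMap.smul_apply, ← add_smul]
    push_cast; rfl
  exact LinearMap.congr_fun₂ this x y

theorem loopCocycle_degree (m : ℕ) (x y : LoopSl m) :
    loopCocycle m (loopDegree m x) y + loopCocycle m x (loopDegree m y) = 0 := by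
  have : (loopCocycle m).comp (loopDegree m) + (loopCocycle m).compl₂ (loopDegree m) = 0 := by
    refine loop_ext fun p X => loop_ext fun q Y => ?_
    simp only [LinearMap.add_apply, LinearMap.comp_apply, LinearMap.compl₂_apply,
      loopDegree_monomial, map_smul, LinearMap.smul_apply, loopCocycle_monomial, smul_eq_mul,
      LinearMap.zero_apply]
    split_ifs with h
    · have : (p : ℂ) + q = 0 := by exact_mod_cast h
      linear_combination (p * traceForm m X Y) * this
    · simp
  exact LinearMap.congr_fun₂ this x y

theorem loopCocycle_skew (m : ℕ) (x y : LoopSl m) :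
    loopCocycle m x y + loopCocycle m y x = 0 := by
  have : loopCocycle m + (loopCocycle m).flip = 0 := by
    refine loop_ext fun p X => loop_ext fun q Y => ?_
    simp only [LinearMap.add_apply, LinearMap.flip_apply, loopCocycle_monomial,
      LinearMap.zero_apply, traceForm_symm m Y X, add_comm q p]
    split_ifs with h
    · have : (p : ℂ) + q = 0 := by exact_mod_cast h
      linear_combination (traceForm m X Y) * this
    · simp
  exact LinearMap.congr_fun₂ this x y

theorem loopCocycle_self (m : ℕ) (x : LoopSl m) : loopCocycle m x x = 0 := by
  have := loopCocycle_skew m x x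
  linear_combination this / 2

theorem loopCocycle_bracket (m : ℕ) (x y z : LoopSl m) :
    loopCocycle m x (loopBracket m y z) =
      loopCocycle m (loopBracket m x y) z + loopCocycle m y (loopBracket m x z) := by
  let f₁ : LoopSl m →ₗ[ℂ] LoopSl m →ₗ[ℂ] LoopSl m →ₗ[ℂ] ℂ :=
    LinearMap.mk₂ ℂ (fun x y => (loopCocycle m x) ∘ₗ loopBracket m y)
      (by intros; simp [LinearMap.add_comp]) (by intros; simp [LinearMap.smul_comp])
      (by intros; simp [LinearMap.comp_add]) (by intros; simp [LinearMap.comp_smul])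
  have : f₁ = (loopBracket m).compr₂ (loopCocycle m) + f₁.flip := by
    refine loop_ext fun p X => loop_ext fun q Y => loop_ext fun r Z => ?_
    simp only [f₁, LinearMap.add_apply, LinearMap.flip_apply, LinearMap.compr₂_apply,
      LinearMap.mk₂_apply, LinearMap.comp_apply, loopBracket_monomial, loopCocycle_monomial]
    have e₂ : traceForm m Y ⁅X, Z⁆ = - traceForm m X ⁅Y, Z⁆ := by
      rw [← traceForm_invariant m X Y Z, traceForm_skew, neg_neg]
    rw [traceForm_invariant m X Y Z, e₂, show q + (p + r) = p + (q + r) by ring,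
      show p + q + r = p + (q + r) by ring]
    split_ifs with h
    · push_cast; ring
    · simp
  exact LinearMap.congr_fun (LinearMap.congr_fun₂ this x y) z

/-- The affine Lie algebra `sl_m ⊗ ℂ[t,t⁻¹] ⊕ ℂ c ⊕ ℂ d`: the element with components `x`, `a`, `b`
is `x + a c + b d`. -/
@[ext] structure AffineSl (m : ℕ) : Type where
  loop : LoopSl m
  central : ℂ
  degree : ℂ

namespace AffineSl

variable {m : ℕ}

/-- The underlying vector space. -/
def toProd : AffineSl m ≃ LoopSl m × ℂ × ℂ where
  toFun x := (x.loop, x.central, x.degree)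
  invFun x := ⟨x.1, x.2.1, x.2.2⟩
  left_inv _ := rfl
  right_inv _ := rfl

instance : AddCommGroup (AffineSl m) := toProd.addCommGroup

instance : Module ℂ (AffineSl m) := toProd.module ℂ

@[simp] theorem loop_zero : (0 : AffineSl m).loop = 0 := rfl
@[simp] theorem central_zero : (0 : AffineSl m).central = 0 := rfl
@[simp] theorem degree_zero : (0 : AffineSl m).degree = 0 := rfl
@[simp] theorem loop_add (x y : AffineSl m) : (x + y).loop = x.loop + y.loop := rfl
@[simp] theorem central_add (x y : AffineSl m) : (x + y).central = x.central + y.central := rfl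
@[simp] theorem degree_add (x y : AffineSl m) : (x + y).degree = x.degree + y.degree := rfl
@[simp] theorem loop_smul (a : ℂ) (x : AffineSl m) : (a • x).loop = a • x.loop := rfl
@[simp] theorem central_smul (a : ℂ) (x : AffineSl m) : (a • x).central = a • x.central := rfl
@[simp] theorem degree_smul (a : ℂ) (x : AffineSl m) : (a • x).degree = a • x.degree := rfl

/-- `[X ⊗ f, Y ⊗ g] = [X, Y] ⊗ fg + tr(XY) Res(g df) c`, `[d, X ⊗ f] = X ⊗ t df/dt`, `c` central. -/
instance : Bracket (AffineSl m) (AffineSl m) where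
  bracket x y :=
    ⟨loopBracket m x.loop y.loop + x.degree • loopDegree m y.loop - y.degree • loopDegree m x.loop,
      loopCocycle m x.loop y.loop, 0⟩

@[simp] theorem loop_lie (x y : AffineSl m) : ⁅x, y⁆.loop =
    loopBracket m x.loop y.loop + x.degree • loopDegree m y.loop
      - y.degree • loopDegree m x.loop := rfl
@[simp] theorem central_lie (x y : AffineSl m) :
    ⁅x, y⁆.central = loopCocycle m x.loop y.loop := rfl
@[simp] theorem degree_lie (x y : AffineSl m) : ⁅x, y⁆.degree = 0 := rfl

instance : LieRing (AffineSl m) where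
  add_lie x y z := by
    ext1
    · simp only [loop_lie, loop_add, degree_add, add_smul, map_add, smul_add, LinearMap.add_apply]
      abel
    · simp
    · simp
  lie_add x y z := by
    ext1
    · simp only [loop_lie, loop_add, degree_add, add_smul, map_add, smul_add]
      abel
    · simp
    · simp
  lie_self x := by
    ext1
    · simp [loopBracket_self]
    · simp [loopCocycle_self]
    · simp
  leibniz_lie x y z := by
    ext1
    · simp only [loop_lie, loop_add, degree_lie, map_add, map_sub, map_smul, LinearMap.add_apply,
        LinearMap.sub_apply, LinearMap.smul_apply, loopDegree_bracket,
        loopBracket_leibniz m x.loop y.loop z.loop, zero_smul, smul_add, smul_sub]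
      rw [loopBracket_skew m y.loop (loopDegree m x.loop)]
      simp only [smul_neg]
      module
    · simp only [central_lie, loop_lie, central_add, map_add, map_sub, map_smul, LinearMap.add_apply,
        LinearMap.sub_apply, LinearMap.smul_apply, smul_eq_mul,
        loopCocycle_bracket m x.loop y.loop]
      have h₁ := loopCocycle_degree m x.loop y.loop
      have h₂ := loopCocycle_degree m x.loop z.loop
      have h₃ := loopCocycle_degree m y.loop z.loop
      have h₄ := loopCocycle_skew m y.loop (loopDegree m x.loop)
      linear_combination (-z.degree) * h₁  + y.degree * h₂ - x.degree * h₃ + z.degree * h₄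
    · simp

instance : LieAlgebra ℂ (AffineSl m) where
  lie_smul a x y := by
    ext1
    · simp only [loop_lie, loop_smul, degree_smul, map_smul, smul_add, smul_sub, smul_smul,
        mul_comm, smul_eq_mul]
    · simp
    · simp

end AffineSl


/-! ### Subalgebras and the categories of modules -/

namespace AffineSl

variable {m : ℕ}

/-- `X ⊗ tⁿ` as an element of the affine Lie algebra. -/
def monomial (n : ℤ) : Sl m →ₗ[ℂ] AffineSl m where
  toFun X := ⟨loopMonomial m n X, 0, 0⟩
  map_add' X Y := by ext1 <;> simp
  map_smul' a X := by ext1 <;> simp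

/-- The central element. -/
def c : AffineSl m := ⟨0, 1, 0⟩

/-- The degree element. -/
def d : AffineSl m := ⟨0, 0, 1⟩

/-- The derived algebra `sl_m ⊗ ℂ[t,t⁻¹] ⊕ ℂ c`. -/
def derived (m : ℕ) : Submodule ℂ (AffineSl m) where
  carrier := {x | x.degree = 0}
  add_mem' {x y} hx hy := by simp_all
  zero_mem' := by simp
  smul_mem' a x hx := by simp_all

/-- The Cartan subalgebra of `sl_m`: diagonal matrices. -/
def diagonal (m : ℕ) : Submodule ℂ (Sl m) where
  carrier := {X | ∀ a b, a ≠ b → Sl.toMatrix m X a b = 0}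
  add_mem' {X Y} hX hY a b h := by simp [hX a b h, hY a b h]
  zero_mem' a b _ := by simp
  smul_mem' z X hX a b h := by simp [hX a b h]

/-- The sum of the positive root spaces of `sl_m`: strictly upper triangular matrices. -/
def strictUpper (m : ℕ) : Submodule ℂ (Sl m) where
  carrier := {X | ∀ a b, b ≤ a → Sl.toMatrix m X a b = 0}
  add_mem' {X Y} hX hY a b h := by simp [hX a b h, hY a b h]
  zero_mem' a b _ := by simp
  smul_mem' z X hX a b h := by simp [hX a b h]

/-- The sum of the negative root spaces of `sl_m`: strictly lower triangular matrices. -/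
def strictLower (m : ℕ) : Submodule ℂ (Sl m) where
  carrier := {X | ∀ a b, a ≤ b → Sl.toMatrix m X a b = 0}
  add_mem' {X Y} hX hY a b h := by simp [hX a b h, hY a b h]
  zero_mem' a b _ := by simp
  smul_mem' z X hX a b h := by simp [hX a b h]

/-- The subalgebra `n₊`: strictly upper triangular matrices plus `sl_m ⊗ t ℂ[t]`. -/
def nPlus (m : ℕ) : Submodule ℂ (AffineSl m) :=
  (strictUpper m).map (monomial 0) ⊔ ⨆ n : {n : ℤ // 0 < n}, LinearMap.range (monomial (m := m) n)

/-- The subalgebra `n₋`: strictly lower triangular matrices plus `sl_m ⊗ t⁻¹ ℂ[t⁻¹]`. -/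
def nMinus (m : ℕ) : Submodule ℂ (AffineSl m) :=
  (strictLower m).map (monomial 0) ⊔ ⨆ n : {n : ℤ // n < 0}, LinearMap.range (monomial (m := m) n)

/-- The Cartan subalgebra: traceless diagonal matrices plus `ℂ c ⊕ ℂ d`. -/
def cartan (m : ℕ) : Submodule ℂ (AffineSl m) :=
  (diagonal m).map (monomial 0) ⊔ Submodule.span ℂ {c, d}

end AffineSl

section CategoryO

variable {m : ℕ} (A : Type*) [AddCommGroup A] [Module ℂ A] [LieRingModule (AffineSl m) A]
  [LieModule ℂ (AffineSl m) A]

/-- The weight space of weight `wt`. -/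
def weightSpace (wt : Module.Dual ℂ (AffineSl.cartan m)) : Submodule ℂ A where
  carrier := {v | ∀ H : AffineSl.cartan m, ⁅(H : AffineSl m), v⁆ = wt H • v}
  add_mem' {v w} hv hw H := by rw [lie_add, hv H, hw H, smul_add]
  zero_mem' H := by simp
  smul_mem' a v hv H := by rw [lie_smul, hv H, smul_comm]

/-- Every vector lies in a finite-dimensional subspace stable under the subalgebra `n`. -/
def LocallyFinite (n : Submodule ℂ (AffineSl m)) : Prop :=
  ∀ v : A, ∃ U : Submodule ℂ A, v ∈ U ∧ FiniteDimensional ℂ U ∧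
    ∀ X ∈ n, ∀ u ∈ U, ⁅X, u⁆ ∈ U

/-- Finitely generated, diagonalizable over the Cartan subalgebra, with finite-dimensional weight
spaces. -/
structure IsWeightModule (m : ℕ) (A : Type*) [AddCommGroup A] [Module ℂ A]
    [LieRingModule (AffineSl m) A] [LieModule ℂ (AffineSl m) A] : Prop where
  finitelyGenerated : ∃ s : Finset A, LieSubmodule.lieSpan ℂ (AffineSl m) (s : Set A) = ⊤
  diagonalizable : ⨆ wt : Module.Dual ℂ (AffineSl.cartan m), weightSpace A wt = ⊤
  finiteDimensional (wt : Module.Dual ℂ (AffineSl.cartan m)) :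
    FiniteDimensional ℂ (weightSpace A wt)

/-- The central element acts by the scalar `ℓ`. -/
def HasLevel (ℓ : ℂ) : Prop := ∀ v : A, ⁅(AffineSl.c : AffineSl m), v⁆ = ℓ • v

/-- Membership in `𝒪(ℓ)`: modules of category `𝒪` of level `ℓ`. -/
structure CategoryO (m : ℕ) (ℓ : ℂ) (A : Type*) [AddCommGroup A] [Module ℂ A]
    [LieRingModule (AffineSl m) A] [LieModule ℂ (AffineSl m) A] : Prop
    extends IsWeightModule m A where
  locallyFinite : LocallyFinite A (AffineSl.nPlus m)
  level : HasLevel (m := m) A ℓ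

/-- Membership in `𝒪†(ℓ)`: the lowest weight version, of level `-ℓ`. -/
structure CategoryODagger (m : ℕ) (ℓ : ℂ) (B : Type*) [AddCommGroup B] [Module ℂ B]
    [LieRingModule (AffineSl m) B] [LieModule ℂ (AffineSl m) B] : Prop
    extends IsWeightModule m B where
  locallyFinite : LocallyFinite B (AffineSl.nMinus m)
  level : HasLevel (m := m) B (-ℓ)

end CategoryO

/-! ### Holomorphic functions on the configuration space -/

/-- The manifold `X`: points of `(ℂ^*)^N` with pairwise distinct coordinates. -/
def configSpace (N : ℕ) : Set (Fin N → ℂ) := {z | (∀ i, z i ≠ 0) ∧ ∀ i j, i ≠ j → z i ≠ z j}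

theorem isOpen_configSpace (N : ℕ) : IsOpen (configSpace N) := by
  have h : configSpace N = (⋂ i, {z : Fin N → ℂ | z i ≠ 0}) ∩
      ⋂ i, ⋂ j, ⋂ (_ : i ≠ j), {z : Fin N → ℂ | z i ≠ z j} := by
    ext z; simp [configSpace]
  rw [h]
  refine (isOpen_iInter_of_finite fun i => ?_).inter (isOpen_iInter_of_finite fun i =>
    isOpen_iInter_of_finite fun j => isOpen_iInter_of_finite fun _ => ?_)
  · exact isOpen_ne_fun (continuous_apply i) continuous_const
  · exact isOpen_ne_fun (continuous_apply i) (continuous_apply j)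

/-- The ring `ℛ(X)` of holomorphic functions on `X`. -/
def holSubalgebra (N : ℕ) : Subalgebra ℂ (configSpace N → ℂ) where
  carrier := {f | ∃ F : (Fin N → ℂ) → ℂ, AnalyticOnNhd ℂ F (configSpace N) ∧
    ∀ z : configSpace N, F z = f z}
  mul_mem' := by
    rintro f g ⟨F, hF, hFf⟩ ⟨G, hG, hGg⟩
    exact ⟨F * G, hF.mul hG, fun z => by simp [hFf, hGg]⟩
  add_mem' := by
    rintro f g ⟨F, hF, hFf⟩ ⟨G, hG, hGg⟩
    exact ⟨F + G, hF.add hG, fun z => by simp [hFf, hGg]⟩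
  algebraMap_mem' a := ⟨fun _ => a, analyticOnNhd_const, fun _ => rfl⟩

/-- `ℛ(X)` as a type. -/
abbrev Hol (N : ℕ) : Type := holSubalgebra N

/-- Extension by zero outside the open set `X`. -/
def Hol.extend {N : ℕ} (f : Hol N) : (Fin N → ℂ) → ℂ :=
  Function.extend Subtype.val (f : configSpace N → ℂ) 0

theorem Hol.extend_apply {N : ℕ} (f : Hol N) (z : configSpace N) :
    f.extend z = (f : configSpace N → ℂ) z :=
  Subtype.val_injective.extend_apply _ _ z

theorem Hol.analyticOnNhd {N : ℕ} (f : Hol N) : AnalyticOnNhd ℂ f.extend (configSpace N) := by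
  obtain ⟨F, hF, hFf⟩ := f.2
  refine hF.congr (isOpen_configSpace N) fun z hz => ?_
  rw [show z = ((⟨z, hz⟩ : configSpace N) : Fin N → ℂ) from rfl, Hol.extend_apply, hFf]

/-- The coordinate function `z_i`, an invertible function on `X`. -/
def Hol.coord {N : ℕ} (i : Fin N) : (Hol N)ˣ where
  val := ⟨fun z => z.1 i, fun z => z i, (ContinuousLinearMap.proj (R := ℂ) (φ := fun _ : Fin N => ℂ) i).analyticOnNhd _,
    fun _ => rfl⟩
  inv := ⟨fun z => (z.1 i)⁻¹, fun z => (z i)⁻¹, 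
    ((ContinuousLinearMap.proj (R := ℂ) (φ := fun _ : Fin N => ℂ) i).analyticOnNhd _).inv
      (fun z hz => hz.1 i), fun _ => rfl⟩
  val_inv := by ext z; exact mul_inv_cancel₀ (z.2.1 i)
  inv_val := by ext z; exact inv_mul_cancel₀ (z.2.1 i)

/-- The derivation `z_i ∂/∂z_i` of `ℛ(X)`. -/
def Hol.euler {N : ℕ} (i : Fin N) : Derivation ℂ (Hol N) (Hol N) :=
  Derivation.mk'
    { toFun := fun f => ⟨fun z => z.1 i * fderiv ℂ f.extend z.1 (Pi.single i 1),
        fun z => z i * fderiv ℂ f.extend z (Pi.single i 1),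
        ((ContinuousLinearMap.proj (R := ℂ) (φ := fun _ : Fin N => ℂ) i).analyticOnNhd _).mul
          ((ContinuousLinearMap.apply ℂ ℂ (Pi.single i 1 : Fin N → ℂ)).comp_analyticOnNhd
            f.analyticOnNhd.fderiv), fun _ => rfl⟩
      map_add' := by
        intro f g
        ext z
        have e : (f + g).extend =ᶠ[nhds z.1] f.extend + g.extend := by
          filter_upwards [(isOpen_configSpace N).mem_nhds z.2] with w hw
          simpa using Hol.extend_apply (f + g) ⟨w, hw⟩ |>.trans
            (congrArg₂ (· + ·) (Hol.extend_apply f ⟨w, hw⟩).symm (Hol.extend_apply g ⟨w, hw⟩).symm)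
        have hf := (f.analyticOnNhd z.1 z.2).differentiableAt
        have hg := (g.analyticOnNhd z.1 z.2).differentiableAt
        change z.1 i * fderiv ℂ (f + g).extend z.1 (Pi.single i 1) =
          z.1 i * fderiv ℂ f.extend z.1 (Pi.single i 1) + z.1 i * fderiv ℂ g.extend z.1 (Pi.single i 1)
        rw [e.fderiv_eq, fderiv_add hf hg, _root_.add_apply, mul_add]
      map_smul' := by
        intro a f
        ext z
        have e : (a • f).extend =ᶠ[nhds z.1] a • f.extend := by
          filter_upwards [(isOpen_configSpace N).mem_nhds z.2] with w hw
          simpa using Hol.extend_apply (a • f) ⟨w, hw⟩ |>.trans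
            (congrArg (a * ·) (Hol.extend_apply f ⟨w, hw⟩).symm)
        have hf := (f.analyticOnNhd z.1 z.2).differentiableAt
        change z.1 i * fderiv ℂ (a • f).extend z.1 (Pi.single i 1) =
          a * (z.1 i * fderiv ℂ f.extend z.1 (Pi.single i 1))
        rw [e.fderiv_eq, fderiv_const_smul hf, _root_.smul_apply, smul_eq_mul]
        ring }
    (by
      intro f g
      ext z
      have e : (f * g).extend =ᶠ[nhds z.1] f.extend * g.extend := by
        filter_upwards [(isOpen_configSpace N).mem_nhds z.2] with w hw
        simpa using Hol.extend_apply (f * g) ⟨w, hw⟩ |>.trans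
          (congrArg₂ (· * ·) (Hol.extend_apply f ⟨w, hw⟩).symm (Hol.extend_apply g ⟨w, hw⟩).symm)
      have hf := (f.analyticOnNhd z.1 z.2).differentiableAt
      have hg := (g.analyticOnNhd z.1 z.2).differentiableAt
      change z.1 i * fderiv ℂ (f * g).extend z.1 (Pi.single i 1) =
        (f : configSpace N → ℂ) z * (z.1 i * fderiv ℂ g.extend z.1 (Pi.single i 1)) +
          (g : configSpace N → ℂ) z * (z.1 i * fderiv ℂ f.extend z.1 (Pi.single i 1))
      rw [e.fderiv_eq, fderiv_mul hf hg, ← Hol.extend_apply, ← Hol.extend_apply]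
      simp only [_root_.add_apply, _root_.smul_apply, smul_eq_mul]
      ring)

/-- A nowhere vanishing holomorphic function is invertible. -/
theorem Hol.isUnit_of_ne_zero {N : ℕ} (f : Hol N)
    (h : ∀ z, (f : configSpace N → ℂ) z ≠ 0) : IsUnit f := by
  refine ⟨⟨f, ⟨fun z => ((f : configSpace N → ℂ) z)⁻¹, fun z => (f.extend z)⁻¹,
    f.analyticOnNhd.inv fun z hz => ?_, fun z => ?_⟩, ?_, ?_⟩, rfl⟩
  · exact (Hol.extend_apply f ⟨z, hz⟩).trans_ne (h ⟨z, hz⟩)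
  · exact congrArg (·⁻¹) (Hol.extend_apply f z)
  · ext z; exact mul_inv_cancel₀ (h z)
  · ext z; exact inv_mul_cancel₀ (h z)

theorem perm_mem_configSpace {N : ℕ} (w : Equiv.Perm (Fin N)) {z : Fin N → ℂ}
    (hz : z ∈ configSpace N) : z ∘ w ∈ configSpace N :=
  ⟨fun i => hz.1 (w i), fun _ _ h => hz.2 _ _ fun e => h (w.injective e)⟩

/-- The action `(w f)(z_1, …, z_N) = f(z_{w(1)}, …, z_{w(N)})` of the symmetric group on `ℛ(X)`;
it sends `z_i` to `z_{w(i)}`. -/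
def Hol.perm {N : ℕ} (w : Equiv.Perm (Fin N)) : Hol N →ₐ[ℂ] Hol N where
  toFun f := ⟨fun z => (f : configSpace N → ℂ) ⟨z.1 ∘ w, perm_mem_configSpace w z.2⟩,
    fun z => f.extend (z ∘ w), by
      have h : AnalyticOnNhd ℂ (fun z : Fin N → ℂ => z ∘ w) (configSpace N) :=
        (ContinuousLinearMap.pi fun i => ContinuousLinearMap.proj (R := ℂ)
          (φ := fun _ : Fin N => ℂ) (w i)).analyticOnNhd _
      exact f.analyticOnNhd.comp h fun z hz => perm_mem_configSpace w hz,
    fun z => Hol.extend_apply f ⟨z.1 ∘ w, perm_mem_configSpace w z.2⟩⟩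
  map_one' := rfl
  map_mul' _ _ := rfl
  map_zero' := rfl
  map_add' _ _ := rfl
  commutes' _ := rfl


/-- The data shared by `ℂ[P] = ℂ[z_1^{±1}, …, z_N^{±1}]` and `ℛ(X)` which the evaluation modules use:
the invertible elements `z_i` and the derivations `z_i ∂/∂z_i`. -/
class TorusAlgebra (N : ℕ) (S : Type*) [CommRing S] [Algebra ℂ S] where
  coord : Fin N → Sˣ
  euler : Fin N → Derivation ℂ S S
  euler_coord (i j : Fin N) : euler i (coord j : S) = if i = j then (coord j : S) else 0

/-- The group algebra of the lattice `P = ℤ^N`, that is, the Laurent polynomials. -/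
abbrev Laurent (N : ℕ) : Type := AddMonoidAlgebra ℂ (Fin N → ℤ)

/-- The Laurent monomial `z_i`. -/
def Laurent.coord {N : ℕ} (i : Fin N) : (Laurent N)ˣ where
  val := AddMonoidAlgebra.single (Pi.single i 1) 1
  inv := AddMonoidAlgebra.single (-Pi.single i 1) 1
  val_inv := by rw [AddMonoidAlgebra.single_mul_single, add_neg_cancel, one_mul]; rfl
  inv_val := by rw [AddMonoidAlgebra.single_mul_single, neg_add_cancel, one_mul]; rfl

instance (N : ℕ) : TorusAlgebra N (Laurent N) where
  coord := Laurent.coord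
  euler i := weightDerivation ((Int.castAddHom ℂ).comp (Pi.evalAddMonoidHom (fun _ => ℤ) i))
  euler_coord i j := by
    refine (weightDerivation_single _ _).trans ?_
    by_cases h : i = j
    · subst h; simp [Laurent.coord]
    · simp [h]

instance (N : ℕ) : TorusAlgebra N (Hol N) where
  coord := Hol.coord
  euler := Hol.euler
  euler_coord i j := by
    ext z
    have e : (Hol.coord j : Hol N).extend =ᶠ[nhds z.1] fun w => w j := by
      filter_upwards [(isOpen_configSpace N).mem_nhds z.2] with w hw
      exact Hol.extend_apply _ ⟨w, hw⟩
    have h1 : ((Hol.euler i (Hol.coord j : Hol N) : Hol N) : configSpace N → ℂ) z =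
      z.1 i * fderiv ℂ (Hol.coord j : Hol N).extend z.1 (Pi.single i 1) := rfl
    have h2 : fderiv ℂ (fun w : Fin N → ℂ => w j) z.1 =
        ContinuousLinearMap.proj (R := ℂ) (φ := fun _ : Fin N => ℂ) j :=
      (ContinuousLinearMap.proj (R := ℂ) (φ := fun _ : Fin N => ℂ) j).fderiv
    rw [h1, e.fderiv_eq, h2, ContinuousLinearMap.proj_apply]
    by_cases h : i = j
    · subst h; simp [Hol.coord]
    · simp [h, Ne.symm h]

section Torus

variable {N : ℕ} (S : Type*) [CommRing S] [Algebra ℂ S] [TorusAlgebra N S]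

/-- The monomial `z^η = ∏ z_i^{η_i}`. -/
def coordMonomial : Multiplicative (Fin N → ℤ) →* Sˣ where
  toFun η := ∏ i, (TorusAlgebra.coord i : Sˣ) ^ (Multiplicative.toAdd η i)
  map_one' := by simp
  map_mul' η η' := by simp [zpow_add, Finset.prod_mul_distrib]

/-- The substitution `f(t) ↦ f(z_i)`. -/
def evalAt (i : Fin N) : AddMonoidAlgebra ℂ ℤ →ₐ[ℂ] S :=
  AddMonoidAlgebra.lift ℂ S ℤ ((Units.coeHom S).comp (zpowersHom Sˣ (TorusAlgebra.coord i)))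

end Torus

/-- Laurent polynomials regarded as holomorphic functions on `X`. -/
def laurentToHol (N : ℕ) : Laurent N →ₐ[ℂ] Hol N :=
  AddMonoidAlgebra.lift ℂ (Hol N) (Fin N → ℤ) ((Units.coeHom (Hol N)).comp (coordMonomial (Hol N)))

/-! ### The tensor products and the maps `θ_i` -/

/-- The `N`-th tensor power of the vector representation `ℂ^m`. -/
abbrev VecPower (N m : ℕ) : Type := ⨂[ℂ] _ : Fin N, (Fin m → ℂ)

/-- `A ⊗ S ⊗ (ℂ^m)^{⊗N} ⊗ B`. -/
abbrev TensorSpace (N m : ℕ) (S A B : Type*) [AddCommGroup S] [Module ℂ S] [AddCommGroup A]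
    [Module ℂ A] [AddCommGroup B] [Module ℂ B] : Type _ :=
  A ⊗[ℂ] (S ⊗[ℂ] (VecPower N m ⊗[ℂ] B))

/-- The action of `sl_m` on the `i`-th factor of the tensor power. -/
def siteAction (N m : ℕ) (i : Fin N) : Sl m →ₗ[ℂ] Module.End ℂ (VecPower N m) :=
  (PiTensorProduct.mapMultilinear ℂ (fun _ : Fin N => Fin m → ℂ)
      (fun _ : Fin N => Fin m → ℂ)).toLinearMap (fun _ => LinearMap.id) i ∘ₗ
    (Matrix.toLin' (R := ℂ) (m := Fin m) (n := Fin m)).toLinearMap ∘ₗ Sl.toMatrix m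

section Theta

variable {m : ℕ} (N : ℕ) (S A B : Type*) [CommRing S] [Algebra ℂ S] [TorusAlgebra N S]
  [AddCommGroup A] [Module ℂ A] [LieRingModule (AffineSl m) A] [LieModule ℂ (AffineSl m) A]
  [AddCommGroup B] [Module ℂ B] [LieRingModule (AffineSl m) B] [LieModule ℂ (AffineSl m) B]

/-- The action on a module as a linear map to endomorphisms. -/
def actionMap (A : Type*) [AddCommGroup A] [Module ℂ A] [LieRingModule (AffineSl m) A]
    [LieModule ℂ (AffineSl m) A] : AffineSl m →ₗ[ℂ] Module.End ℂ A :=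
  LinearMap.mk₂ ℂ (fun X v => ⁅X, v⁆) add_lie smul_lie lie_add (fun a X v => lie_smul a X v)

/-- `θ_0`: the action on the factor `A`. -/
def thetaLeft : AffineSl m →ₗ[ℂ] Module.End ℂ (TensorSpace N m S A B) :=
  LinearMap.rTensorHom (S ⊗[ℂ] (VecPower N m ⊗[ℂ] B)) ∘ₗ actionMap A

/-- `θ_{N+1}`: the action on the factor `B`. -/
def thetaRight : AffineSl m →ₗ[ℂ] Module.End ℂ (TensorSpace N m S A B) :=
  LinearMap.lTensorHom A ∘ₗ LinearMap.lTensorHom S ∘ₗ LinearMap.lTensorHom (VecPower N m) ∘ₗ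
    actionMap B

/-- The action `X ⊗ f(t) ↦ f(z_i) X_i` of loops at the `i`-th site. -/
def thetaLoop (i : Fin N) : LoopSl m →ₗ[ℂ] Module.End ℂ (S ⊗[ℂ] (VecPower N m ⊗[ℂ] B)) :=
  TensorProduct.homTensorHomMap (RingHom.id ℂ) S (VecPower N m ⊗[ℂ] B) S (VecPower N m ⊗[ℂ] B) ∘ₗ
    TensorProduct.map (LinearMap.mul ℂ S ∘ₗ (evalAt S i).toLinearMap)
      (LinearMap.rTensorHom B ∘ₗ siteAction N m i)

/-- `θ_i`: `X ⊗ f(t)` acts by `f(z_i) X_i`, `d` by `z_i ∂/∂z_i`, and `c` by `0`. -/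
def theta (i : Fin N) : AffineSl m →ₗ[ℂ] Module.End ℂ (TensorSpace N m S A B) where
  toFun X := LinearMap.lTensor A (thetaLoop N S B i X.loop +
    X.degree • LinearMap.rTensor (VecPower N m ⊗[ℂ] B) (TorusAlgebra.euler i).toLinearMap)
  map_add' X Y := by
    rw [← LinearMap.lTensor_add, AffineSl.loop_add, AffineSl.degree_add, map_add, add_smul]
    congr 1; abel
  map_smul' a X := by
    rw [RingHom.id_apply, ← LinearMap.lTensor_smul, AffineSl.loop_smul, AffineSl.degree_smul,
      map_smul, smul_add, smul_smul, smul_eq_mul]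

/-- The diagonal action, the sum of all `θ_i`. -/
def thetaTotal : AffineSl m →ₗ[ℂ] Module.End ℂ (TensorSpace N m S A B) :=
  thetaLeft N S A B + ∑ i, theta N S A B i + thetaRight N S A B

/-- The span of all `X v` with `X` in the derived algebra, for the diagonal action. -/
def derivedSpan (m : ℕ) (N : ℕ) (S A B : Type*) [CommRing S] [Algebra ℂ S] [TorusAlgebra N S]
    [AddCommGroup A] [Module ℂ A] [LieRingModule (AffineSl m) A] [LieModule ℂ (AffineSl m) A]
    [AddCommGroup B] [Module ℂ B] [LieRingModule (AffineSl m) B] [LieModule ℂ (AffineSl m) B] :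
    Submodule ℂ (TensorSpace N m S A B) :=
  ⨆ X : AffineSl.derived m, LinearMap.range (thetaTotal N S A B (X : AffineSl m))

end Theta



/-! ### The universal classical r-matrix -/

theorem sub_trace_mem (m : ℕ) (M : Matrix (Fin m) (Fin m) ℂ) :
    M - (Matrix.trace M / m) • (1 : Matrix (Fin m) (Fin m) ℂ) ∈
      LieAlgebra.SpecialLinear.sl (Fin m) ℂ := by
  refine LinearMap.mem_ker.mpr ?_
  rcases Nat.eq_zero_or_pos m with rfl | h
  · simp [Matrix.trace]
  · have : (m : ℂ) ≠ 0 := by exact_mod_cast h.ne'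
    simp [Matrix.trace_one, this]

/-- The projection `M ↦ M - (tr M / m) 1` of matrices onto `sl_m`. -/
def traceless (m : ℕ) : Matrix (Fin m) (Fin m) ℂ →ₗ[ℂ] Sl m where
  toFun M := ⟨M - (Matrix.trace M / m) • 1, sub_trace_mem m M⟩
  map_add' M M' := by
    apply Subtype.ext
    change (M + M') - (Matrix.trace (M + M') / m) • (1 : Matrix (Fin m) (Fin m) ℂ) =
      (M - (Matrix.trace M / m) • (1 : Matrix (Fin m) (Fin m) ℂ)) +
        (M' - (Matrix.trace M' / m) • (1 : Matrix (Fin m) (Fin m) ℂ))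
    rw [Matrix.trace_add, add_div, add_smul]; abel
  map_smul' a M := by
    apply Subtype.ext
    change (a • M) - (Matrix.trace (a • M) / m) • (1 : Matrix (Fin m) (Fin m) ℂ) =
      a • (M - (Matrix.trace M / m) • (1 : Matrix (Fin m) (Fin m) ℂ))
    rw [Matrix.trace_smul, smul_sub, smul_smul, smul_eq_mul, mul_div_assoc]

theorem toMatrix_traceless (m : ℕ) (M : Matrix (Fin m) (Fin m) ℂ) :
    Sl.toMatrix m (traceless m M) = M - (Matrix.trace M / m) • 1 := rfl

theorem traceless_toMatrix (m : ℕ) (X : Sl m) : traceless m (Sl.toMatrix m X) = X := by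
  apply Subtype.ext
  have h : Matrix.trace (Sl.toMatrix m X) = 0 := LinearMap.mem_ker.mp X.2
  change Sl.toMatrix m X - (Matrix.trace (Sl.toMatrix m X) / m) • (1 : Matrix _ _ ℂ) = Sl.toMatrix m X
  rw [h]; simp

/-- The traceless part of the matrix unit `E_{ab}`; for `a ≠ b` it is `E_{ab}`, and for `a < b` these are
root vectors with `tr(E_{ab} E_{ba}) = 1`. -/
def slUnit (m : ℕ) (a b : Fin m) : Sl m := traceless m (Matrix.single a b 1)

/-- The tensor `∑_k J_k ⊗ J_k` for an orthonormal basis of `sl_m`; see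
`sum_orthonormal_eq_casimir`. -/
def casimir (m : ℕ) : Sl m ⊗[ℂ] Sl m := ∑ a, ∑ b, slUnit m a b ⊗ₜ[ℂ] slUnit m b a

/-- The tensor `∑_a H_a ⊗ H_a` for an orthonormal basis of the diagonal matrices; see
`sum_orthonormal_eq_cartanCasimir`. -/
def cartanCasimir (m : ℕ) : Sl m ⊗[ℂ] Sl m := ∑ a, slUnit m a a ⊗ₜ[ℂ] slUnit m a a

theorem sum_tmul_eq_of_orthonormal {E ι κ : Type*} [AddCommGroup E] [Module ℂ E] [Fintype ι]
    [Fintype κ] [DecidableEq κ] (β : E →ₗ[ℂ] E →ₗ[ℂ] ℂ) (u v : ι → E) (J : κ → E) (U : Submodule ℂ E)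
    (hu : ∀ x ∈ U, ∑ s, β x (v s) • u s = x) (hv : ∀ s, v s ∈ U) 
    (hJ : Submodule.span ℂ (Set.range J) = U)
    (hβ : ∀ k l, β (J k) (J l) = if k = l then 1 else 0) :
    ∑ k, J k ⊗ₜ[ℂ] J k = ∑ s, u s ⊗ₜ[ℂ] v s := by
  have hJU : ∀ k, J k ∈ U := fun k => hJ ▸ Submodule.subset_span ⟨k, rfl⟩
  have hexp : ∀ x ∈ U, ∑ k, β (J k) x • J k = x := by
    intro x hx
    rw [← hJ] at hx
    induction hx using Submodule.span_induction with
    | mem x h => obtain ⟨l, rfl⟩ := h; simp [hβ]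
    | zero => simp
    | add x y _ _ hx hy => simp only [map_add, add_smul, Finset.sum_add_distrib, hx, hy]
    | smul a x _ hx =>
      simp only [map_smul, smul_eq_mul, mul_smul, ← Finset.smul_sum, hx]
  calc ∑ k, J k ⊗ₜ[ℂ] J k = ∑ k, (∑ s, β (J k) (v s) • u s) ⊗ₜ[ℂ] J k := by
        refine Finset.sum_congr rfl fun k _ => ?_
        rw [hu (J k) (hJU k)]
    _ = ∑ s, u s ⊗ₜ[ℂ] (∑ k, β (J k) (v s) • J k) := by
        simp only [TensorProduct.sum_tmul, TensorProduct.tmul_sum, TensorProduct.smul_tmul]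
        rw [Finset.sum_comm]
    _ = ∑ s, u s ⊗ₜ[ℂ] v s := by
        refine Finset.sum_congr rfl fun s _ => ?_
        rw [hexp (v s) (hv s)]

theorem traceForm_slUnit (m : ℕ) (X : Sl m) (a b : Fin m) :
    traceForm m X (slUnit m b a) = Sl.toMatrix m X a b := by
  have h : Matrix.trace (Sl.toMatrix m X) = 0 := LinearMap.mem_ker.mp X.2
  rw [traceForm_apply, slUnit, toMatrix_traceless, mul_sub, Matrix.trace_sub, Matrix.mul_smul,
    Matrix.trace_smul, mul_one, h, smul_zero, sub_zero, Matrix.trace_mul_single]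
  simp

/-- `casimir` is `∑_k J_k ⊗ J_k` for every orthonormal basis `J` of `sl_m`. -/
theorem sum_orthonormal_eq_casimir (m : ℕ) {κ : Type*} [Fintype κ] [DecidableEq κ] (J : κ → Sl m)
    (hJ : Submodule.span ℂ (Set.range J) = ⊤)
    (hβ : ∀ k l, traceForm m (J k) (J l) = if k = l then 1 else 0) :
    ∑ k, J k ⊗ₜ[ℂ] J k = casimir m := by
  rw [sum_tmul_eq_of_orthonormal (traceForm m) (fun s : Fin m × Fin m => slUnit m s.1 s.2)
    (fun s => slUnit m s.2 s.1) J ⊤ ?_ (fun _ => trivial) hJ hβ, casimir, Fintype.sum_prod_type]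
  intro X _
  simp only [traceForm_slUnit, Fintype.sum_prod_type]
  conv_rhs => rw [← traceless_toMatrix m X, Matrix.matrix_eq_sum_single (Sl.toMatrix m X)]
  simp only [map_sum, slUnit, ← map_smul, Matrix.smul_single, smul_eq_mul, mul_one]

theorem slUnit_mem_diagonal (m : ℕ) (a : Fin m) : slUnit m a a ∈ AffineSl.diagonal m := by
  intro b c h
  rw [slUnit, toMatrix_traceless, Matrix.sub_apply, Matrix.smul_apply, Matrix.one_apply_ne h,
    Matrix.single_apply]
  have : ¬ (a = b ∧ a = c) := fun ⟨h1, h2⟩ => h (h1 ▸ h2)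
  simp [this]

/-- `cartanCasimir` is `∑_a H_a ⊗ H_a` for every orthonormal basis `H` of the diagonal matrices. -/
theorem sum_orthonormal_eq_cartanCasimir (m : ℕ) {κ : Type*} [Fintype κ] [DecidableEq κ]
    (H : κ → Sl m) (hH : Submodule.span ℂ (Set.range H) = AffineSl.diagonal m)
    (hβ : ∀ k l, traceForm m (H k) (H l) = if k = l then 1 else 0) :
    ∑ k, H k ⊗ₜ[ℂ] H k = cartanCasimir m := by
  rw [sum_tmul_eq_of_orthonormal (traceForm m) (fun a => slUnit m a a)
    (fun a => slUnit m a a) H (AffineSl.diagonal m) ?_ (slUnit_mem_diagonal m) hH hβ, cartanCasimir]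
  intro X hX
  simp only [traceForm_slUnit]
  conv_rhs => rw [← traceless_toMatrix m X, Matrix.matrix_eq_sum_single (Sl.toMatrix m X)]
  simp only [map_sum, slUnit, ← map_smul, Matrix.smul_single, smul_eq_mul, mul_one]
  refine Finset.sum_congr rfl fun a _ => ?_
  rw [Finset.sum_eq_single a]
  · intro b _ hb
    rw [hX a b hb.symm, Matrix.single_zero, map_zero]
  · simp

/-- The classical r-matrix `½ ∑ H_a ⊗ H_a + ∑_{γ > 0} E_γ ⊗ E_{-γ}` of `sl_m`. -/
def classicalR (m : ℕ) : Sl m ⊗[ℂ] Sl m :=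
  (1 / 2 : ℂ) • cartanCasimir m + ∑ a, ∑ b ∈ Finset.Ioi a, slUnit m a b ⊗ₜ[ℂ] slUnit m b a

namespace AffineSl

/-- `X ⊗ Y ↦ (X ⊗ t^p) ⊗ (Y ⊗ t^q)`. -/
def tensorMonomial (m : ℕ) (p q : ℤ) : Sl m ⊗[ℂ] Sl m →ₗ[ℂ] AffineSl m ⊗[ℂ] AffineSl m :=
  TensorProduct.map (monomial p) (monomial q)

/-- The part `r̄ + ½ (c ⊗ d + d ⊗ c)` of the universal r-matrix
`r̄ + ½ (c ⊗ d + d ⊗ c) + ∑_{n ≥ 1} ∑_k (J_k ⊗ tⁿ) ⊗ (J_k ⊗ t⁻ⁿ)`. -/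
def rFinite (m : ℕ) : AffineSl m ⊗[ℂ] AffineSl m :=
  tensorMonomial m 0 0 (classicalR m) + (1 / 2 : ℂ) • (c ⊗ₜ[ℂ] d + d ⊗ₜ[ℂ] c)

/-- The term `∑_k (J_k ⊗ tⁿ) ⊗ (J_k ⊗ t⁻ⁿ)` of the universal r-matrix. -/
def rTerm (m : ℕ) (n : ℕ) : AffineSl m ⊗[ℂ] AffineSl m :=
  tensorMonomial m n (-n) (casimir m)

/-- `Ω = r̄ + T(r̄)`, with `T` the transposition. -/
def omega (m : ℕ) : AffineSl m ⊗[ℂ] AffineSl m :=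
  tensorMonomial m 0 0 (classicalR m + TensorProduct.comm ℂ (Sl m) (Sl m) (classicalR m))

/-- The element `ρ^∨ + m d`, with `ρ^∨` half the sum of the positive coroots of `sl_m`. -/
def rhoCheck (m : ℕ) : AffineSl m :=
  monomial 0 ((1 / 2 : ℂ) • ∑ a, ∑ b ∈ Finset.Ioi a, (slUnit m a a - slUnit m b b)) + (m : ℂ) • d

end AffineSl

/-! ### The KZ connections and the Cherednik-Dunkl operators -/

section KZ

variable {m N : ℕ} (A B : Type*)
  [AddCommGroup A] [Module ℂ A] [LieRingModule (AffineSl m) A] [LieModule ℂ (AffineSl m) A]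
  [AddCommGroup B] [Module ℂ B] [LieRingModule (AffineSl m) B] [LieModule ℂ (AffineSl m) B]

/-- `φ ⊗ ψ`, that is, `X ⊗ Y ↦ φ(X) ψ(Y)`. -/
def pairAction {E : Type*} [AddCommGroup E] [Module ℂ E] (φ ψ : AffineSl m →ₗ[ℂ] Module.End ℂ E) :
    AffineSl m ⊗[ℂ] AffineSl m →ₗ[ℂ] Module.End ℂ E :=
  TensorProduct.lift ((LinearMap.mul ℂ (Module.End ℂ E)).compl₁₂ φ ψ)

/-- `A ⊗ ℛ(X) ⊗ (ℂ^m)^{⊗N} ⊗ B`. -/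
abbrev HolSpace (N m : ℕ) (A B : Type*) [AddCommGroup A] [Module ℂ A] [AddCommGroup B]
    [Module ℂ B] : Type _ := TensorSpace N m (Hol N) A B

/-- Multiplication by a function. -/
def mulOp (m : ℕ) (A B : Type*) [AddCommGroup A] [Module ℂ A] [AddCommGroup B] [Module ℂ B]
    (f : Hol N) : Module.End ℂ (HolSpace N m A B) :=
  LinearMap.lTensor A (LinearMap.rTensor (VecPower N m ⊗[ℂ] B) (LinearMap.mul ℂ (Hol N) f))

/-- The function `z_i / z_j`. -/
def ratio (i j : Fin N) : Hol N := (Hol.coord i : Hol N) * ((Hol.coord j)⁻¹ : (Hol N)ˣ)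

theorem isUnit_one_sub_ratio {i j : Fin N} (h : i ≠ j) : IsUnit (1 - ratio i j) := by
  refine Hol.isUnit_of_ne_zero _ fun z => ?_
  change 1 - z.1 i * (z.1 j)⁻¹ ≠ 0
  rw [← div_eq_mul_inv, sub_ne_zero, ne_comm, Ne, div_eq_one_iff_eq (z.2.1 j)]
  exact z.2.2 i j h

/-- `r_{(0i)} = θ_{0i}(r)`; the infinite sum is finite on every vector if `A` is in category `𝒪`. -/
def rLeft (i : Fin N) (x : HolSpace N m A B) : HolSpace N m A B :=
  pairAction (thetaLeft N (Hol N) A B) (theta N (Hol N) A B i) (AffineSl.rFinite m) x +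
    ∑ᶠ n : ℕ, pairAction (thetaLeft N (Hol N) A B) (theta N (Hol N) A B i)
      (AffineSl.rTerm m (n + 1)) x

/-- `r_{(i,N+1)} = θ_{i,N+1}(r)`; the infinite sum is finite on every vector if `B` is in `𝒪†`. -/
def rRight (i : Fin N) (x : HolSpace N m A B) : HolSpace N m A B :=
  pairAction (theta N (Hol N) A B i) (thetaRight N (Hol N) A B) (AffineSl.rFinite m) x +
    ∑ᶠ n : ℕ, pairAction (theta N (Hol N) A B i) (thetaRight N (Hol N) A B)
      (AffineSl.rTerm m (n + 1)) x

/-- `r_{(ij)} = θ_{ij}(r̄) + (z_i/z_j) / (1 - z_i/z_j) θ_{ij}(Ω)` for `1 ≤ i < j ≤ N`. -/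
def rMiddle (i j : Fin N) : Module.End ℂ (HolSpace N m A B) :=
  pairAction (theta N (Hol N) A B i) (theta N (Hol N) A B j)
      (AffineSl.tensorMonomial m 0 0 (classicalR m)) +
    mulOp m A B (ratio i j * Ring.inverse (1 - ratio i j)) *
      pairAction (theta N (Hol N) A B i) (theta N (Hol N) A B j) (AffineSl.omega m)

/-- The KZ connection `∇_i = ∑_{0 ≤ j < i} r_{(ji)} - ∑_{i < j ≤ N+1} r_{(ij)} + θ_i(ρ^∨)`. -/
def kz (i : Fin N) (x : HolSpace N m A B) : HolSpace N m A B :=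
  rLeft A B i x + ∑ j ∈ Finset.Iio i, rMiddle A B j i x - ∑ j ∈ Finset.Ioi i, rMiddle A B i j x
    - rRight A B i x + theta N (Hol N) A B i (AffineSl.rhoCheck m) x

/-- The diagonal action of a permutation on functions and on the tensor power; it moves the `i`-th
vector to the position `w(i)`. -/
def tau (m : ℕ) (A B : Type*) [AddCommGroup A] [Module ℂ A] [AddCommGroup B] [Module ℂ B]
    (w : Equiv.Perm (Fin N)) : Module.End ℂ (HolSpace N m A B) :=
  LinearMap.lTensor A (TensorProduct.map (Hol.perm w).toLinearMap
    (LinearMap.rTensor B (PiTensorProduct.reindex ℂ (fun _ : Fin N => Fin m → ℂ) w).toLinearMap))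

/-- The derivation `∂_ξ = ∑ ξ_i z_i ∂/∂z_i`. -/
def eulerAlong (ξ : Fin N → ℂ) (f : Hol N) : Hol N := ∑ i, ξ i • Hol.euler i f

/-- `G = ∏_{i ≠ j} (1 - z_j/z_i)`, the product of `1 - e^{-α}` over all roots. -/
def discriminant (N : ℕ) : Hol N :=
  ∏ p ∈ (Finset.univ : Finset (Fin N)).offDiag, (1 - ratio p.2 p.1)

theorem isUnit_discriminant (N : ℕ) : IsUnit (discriminant N) := by
  rw [discriminant, IsUnit.prod_iff]
  intro p hp
  exact isUnit_one_sub_ratio (Finset.mem_offDiag.mp hp).2.2.symm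

/-- The generalized Cherednik-Dunkl operator
`𝒟_ξ = ∇_ξ + ∑_{α > 0} α(ξ) (1 - s_α)/(1 - e^{-α}) - ρ(ξ) - (m-1)/(2m) ∂_ξ log G`, where
`α = ε_i - ε_j` with `i < j`, `e^{-α} = z_j/z_i` and `∂_ξ log G = G⁻¹ ∂_ξ G`. -/
def dunkl (ξ : Fin N → ℂ) (x : HolSpace N m A B) : HolSpace N m A B :=
  ∑ i, ξ i • kz A B i x
    + ∑ i, ∑ j ∈ Finset.Ioi i, (ξ i - ξ j) •
        mulOp m A B (Ring.inverse (1 - ratio j i)) (x - tau m A B (Equiv.swap i j) x)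
    - ((1 / 2 : ℂ) * ∑ i, ∑ j ∈ Finset.Ioi i, (ξ i - ξ j)) • x
    - (((m : ℂ) - 1) / (2 * m)) •
        mulOp m A B (eulerAlong ξ (discriminant N) * Ring.inverse (discriminant N)) x

end KZ

/-! ### The degenerate double affine Hecke algebra -/

/-- The action of the symmetric group on the lattice `P = ℤ^N`, written multiplicatively:
`w(ε_i) = ε_{w(i)}`. -/
def latticePerm (N : ℕ) : Equiv.Perm (Fin N) →* MulAut (Multiplicative (Fin N → ℤ)) where
  toFun w := AddEquiv.toMultiplicative
    { toFun := fun η => η ∘ w.symm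
      invFun := fun η => η ∘ w
      left_inv := fun η => by ext i; simp
      right_inv := fun η => by ext i; simp
      map_add' := fun _ _ => rfl }
  map_one' := rfl
  map_mul' _ _ := rfl

/-- The extended affine Weyl group `W = S_N ⋉ P`. -/
abbrev AffineWeyl (N : ℕ) : Type :=
  SemidirectProduct (Multiplicative (Fin N → ℤ)) (Equiv.Perm (Fin N)) (latticePerm N)

namespace AffineWeyl

variable {N : ℕ}

/-- The translation `t_η`. -/
def translation (η : Fin N → ℤ) : AffineWeyl N := SemidirectProduct.inl (Multiplicative.ofAdd η)

/-- A permutation as an element of `W`. -/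
def ofPerm (w : Equiv.Perm (Fin N)) : AffineWeyl N := SemidirectProduct.inr w

/-- The space `⊕ ℂ ε_i^∨ ⊕ ℂ c`; the pair `(ξ, k)` is `∑ ξ_i ε_i^∨ + k c`. -/
abbrev Cartan (N : ℕ) : Type := (Fin N → ℂ) × ℂ

/-- The action of `W` on `⊕ ℂ ε_i^∨ ⊕ ℂ c`: permutations permute the `ε_i^∨`, translations act by
`t_η(ξ) = ξ - η(ξ) c`, and `c` is fixed. -/
def act (w : AffineWeyl N) (ξ : Cartan N) : Cartan N :=
  (ξ.1 ∘ w.right.symm,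
    ξ.2 - ∑ i, (Multiplicative.toAdd w.left i : ℂ) * ξ.1 (w.right.symm i))

/-- The affine reflection `s_α = t_{-k(ε_i - ε_j)} s_{ε_i - ε_j}` for `α = ε_i - ε_j + kδ`. -/
def reflection (i j : Fin N) (k : ℤ) : AffineWeyl N :=
  translation (-(k • (Pi.single i 1 - Pi.single j 1))) * ofPerm (Equiv.swap i j)

variable [NeZero N]

/-- The simple reflections. The index `i` runs over `ℤ/N`; for `i + 1 < N` (counting from `0`) the simple
root is `ε_i - ε_{i+1}`, and for the last index it is `α_0 = δ - (ε_first - ε_last)`. -/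
def simpleReflection (i : Fin N) : AffineWeyl N :=
  reflection i (i + 1) (if i + 1 = 0 then 1 else 0)

/-- The value of the `i`-th simple root on `⊕ ℂ ε_i^∨ ⊕ ℂ c` (where `δ` vanishes). -/
def simpleRoot (i : Fin N) (ξ : Cartan N) : ℂ := ξ.1 i - ξ.1 (i + 1)

/-- `π = t_{ε_1} s_1 ⋯ s_{N-1}`; the product `s_1 ⋯ s_{N-1}` is the cycle `i ↦ i + 1`. -/
def rotation (N : ℕ) [NeZero N] : AffineWeyl N :=
  translation (Pi.single 0 1) * ofPerm (finRotate N)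

end AffineWeyl

open AffineWeyl

section DDAHA

variable (N : ℕ) [NeZero N]

/-- Generators: the elements of `W` and of `⊕ ℂ ε_i^∨ ⊕ ℂ c`. -/
inductive DDAHAGen : Type
  | weyl (w : AffineWeyl N)
  | cartan (ξ : Cartan N)

variable {N} in
/-- The generator attached to an element of `W`. -/
abbrev genW (w : AffineWeyl N) : FreeAlgebra ℂ (DDAHAGen N) := FreeAlgebra.ι ℂ (.weyl w)

variable {N} in
/-- The generator attached to an element of `⊕ ℂ ε_i^∨ ⊕ ℂ c`. -/
abbrev genT (ξ : Cartan N) : FreeAlgebra ℂ (DDAHAGen N) := FreeAlgebra.ι ℂ (.cartan ξ)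

/-- The relations: those of the group algebra of `W` and of the symmetric algebra of
`⊕ ℂ ε_i^∨ ⊕ ℂ c`, together with `s_i ξ - s_i(ξ) s_i = -α_i(ξ)` for the simple reflections (absent if
`N = 1`, when there are no roots) and `π ξ = π(ξ) π`. -/
inductive DDAHARel : FreeAlgebra ℂ (DDAHAGen N) → FreeAlgebra ℂ (DDAHAGen N) → Prop
  | one : DDAHARel (genW 1) 1
  | mul (w w' : AffineWeyl N) : DDAHARel (genW (w * w')) (genW w * genW w')
  | add (ξ ξ' : Cartan N) : DDAHARel (genT (ξ + ξ')) (genT ξ + genT ξ')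
  | smul (a : ℂ) (ξ : Cartan N) : DDAHARel (genT (a • ξ)) (a • genT ξ)
  | comm (ξ ξ' : Cartan N) : DDAHARel (genT ξ * genT ξ') (genT ξ' * genT ξ)
  | simple (i : Fin N) (h : i ≠ i + 1) (ξ : Cartan N) :
      DDAHARel (genW (simpleReflection i) * genT ξ -
          genT (act (simpleReflection i) ξ) * genW (simpleReflection i))
        (algebraMap ℂ _ (-simpleRoot i ξ))
  | rotation (ξ : Cartan N) :
      DDAHARel (genW (AffineWeyl.rotation N) * genT ξ)
        (genT (act (AffineWeyl.rotation N) ξ) * genW (AffineWeyl.rotation N))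

/-- The degenerate double affine Hecke algebra `ℋ` of `gl_N`. -/
abbrev DDAHA : Type := RingQuot (DDAHARel N)

variable {N} in
/-- The image of `W` in `ℋ`. -/
def DDAHA.weyl (w : AffineWeyl N) : DDAHA N :=
  RingQuot.mkAlgHom ℂ (DDAHARel N) (genW w)

variable {N} in
/-- The image of `⊕ ℂ ε_i^∨ ⊕ ℂ c` in `ℋ`. -/
def DDAHA.cartan (ξ : Cartan N) : DDAHA N :=
  RingQuot.mkAlgHom ℂ (DDAHARel N) (genT ξ)

end DDAHA

/-! ### The action and the coinvariants -/

section Action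

variable {m N : ℕ} [NeZero N] (ℓ : ℂ) (A B : Type*)
  [AddCommGroup A] [Module ℂ A] [LieRingModule (AffineSl m) A] [LieModule ℂ (AffineSl m) A]
  [AddCommGroup B] [Module ℂ B] [LieRingModule (AffineSl m) B] [LieModule ℂ (AffineSl m) B]

/-- `ρ` is the action of `ℋ` on `A ⊗ ℛ(X) ⊗ (ℂ^m)^{⊗N} ⊗ B` given by `c ↦ ℓ + m`, `ξ ↦ 𝒟_ξ`, `w ↦ τ(w)` and
`t_η ↦` multiplication by `z^η`. -/
structure IsKZAction (ρ : DDAHA N →ₐ[ℂ] Module.End ℂ (HolSpace N m A B)) : Prop where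
  central : ρ (DDAHA.cartan (0, 1)) = algebraMap ℂ _ (ℓ + m)
  cartan (ξ : Fin N → ℂ) (x : HolSpace N m A B) : ρ (DDAHA.cartan (ξ, 0)) x = dunkl A B ξ x
  perm (w : Equiv.Perm (Fin N)) : ρ (DDAHA.weyl (ofPerm w)) = tau m A B w
  translation (η : Fin N → ℤ) : ρ (DDAHA.weyl (translation η)) =
    mulOp m A B (laurentToHol N (AddMonoidAlgebra.single η 1))

/-- `A ⊗ ℂ[P] ⊗ (ℂ^m)^{⊗N} ⊗ B`. -/
abbrev LaurentSpace (N m : ℕ) (A B : Type*) [AddCommGroup A] [Module ℂ A] [AddCommGroup B]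
    [Module ℂ B] : Type _ := TensorSpace N m (Laurent N) A B

/-- The inclusion of `A ⊗ ℂ[P] ⊗ (ℂ^m)^{⊗N} ⊗ B` in `A ⊗ ℛ(X) ⊗ (ℂ^m)^{⊗N} ⊗ B`. -/
def inclusion (N m : ℕ) (A B : Type*) [AddCommGroup A] [Module ℂ A] [AddCommGroup B]
    [Module ℂ B] :
    LaurentSpace N m A B →ₗ[ℂ] HolSpace N m A B :=
  LinearMap.lTensor A (LinearMap.rTensor (VecPower N m ⊗[ℂ] B) (laurentToHol N).toLinearMap)

/-- `ℱ(A, B)`: the coinvariants of `A ⊗ ℂ[P] ⊗ (ℂ^m)^{⊗N} ⊗ B` under the derived algebra. -/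
abbrev Coinvariants (N m : ℕ) (A B : Type*)
    [AddCommGroup A] [Module ℂ A] [LieRingModule (AffineSl m) A] [LieModule ℂ (AffineSl m) A]
    [AddCommGroup B] [Module ℂ B] [LieRingModule (AffineSl m) B] [LieModule ℂ (AffineSl m) B] :
    Type _ :=
  LaurentSpace N m A B ⧸ derivedSpan m N (Laurent N) A B

variable {A B} in
/-- `σ` is the action on `ℱ(A, B)` induced by `ρ`: if `ρ(h)` maps `x` to `y` inside
`A ⊗ ℂ[P] ⊗ (ℂ^m)^{⊗N} ⊗ B`, then `σ(h)` maps the class of `x` to the class of `y`. -/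
def IsInducedAction (ρ : DDAHA N →ₐ[ℂ] Module.End ℂ (HolSpace N m A B))
    (σ : DDAHA N →ₐ[ℂ] Module.End ℂ (Coinvariants N m A B)) : Prop :=
  ∀ (h : DDAHA N) (x y : LaurentSpace N m A B), ρ h (inclusion N m A B x) = inclusion N m A B y →
    σ h (Submodule.Quotient.mk x) = Submodule.Quotient.mk y

end Action

theorem thetaLoop_comp {m : ℕ} (N : ℕ) {B B' : Type*} [AddCommGroup B] [Module ℂ B]
    [AddCommGroup B'] [Module ℂ B'] (S : Type*) [CommRing S] [Algebra ℂ S] [TorusAlgebra N S]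
    (g : B →ₗ[ℂ] B') (i : Fin N) (x : LoopSl m) :
    LinearMap.lTensor S (LinearMap.lTensor (VecPower N m) g) ∘ₗ thetaLoop N S B i x =
      thetaLoop N S B' i x ∘ₗ LinearMap.lTensor S (LinearMap.lTensor (VecPower N m) g) := by
  induction x using TensorProduct.induction_on with
  | zero => simp
  | add x y hx hy => rw [map_add, map_add, LinearMap.comp_add, LinearMap.add_comp, hx, hy]
  | tmul f X =>
    refine TensorProduct.ext' fun s u => ?_
    induction u using TensorProduct.induction_on with
    | zero => simp
    | add u v hu hv => rw [TensorProduct.tmul_add, map_add, map_add, hu, hv]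
    | tmul w b => rfl

section Functoriality

variable {m : ℕ} (N : ℕ) {A A' B B' : Type*}
  [AddCommGroup A] [Module ℂ A] [LieRingModule (AffineSl m) A] [LieModule ℂ (AffineSl m) A]
  [AddCommGroup A'] [Module ℂ A'] [LieRingModule (AffineSl m) A'] [LieModule ℂ (AffineSl m) A']
  [AddCommGroup B] [Module ℂ B] [LieRingModule (AffineSl m) B] [LieModule ℂ (AffineSl m) B]
  [AddCommGroup B'] [Module ℂ B'] [LieRingModule (AffineSl m) B'] [LieModule ℂ (AffineSl m) B']

/-- The map induced by homomorphisms `A → A'` and `B → B'` on the tensor products. -/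
def spaceMap (f : A →ₗ⁅ℂ, AffineSl m⁆ A') (g : B →ₗ⁅ℂ, AffineSl m⁆ B') :
    LaurentSpace N m A B →ₗ[ℂ] LaurentSpace N m A' B' :=
  TensorProduct.map f (LinearMap.lTensor (Laurent N) (LinearMap.lTensor (VecPower N m) g))

theorem spaceMap_thetaTotal (f : A →ₗ⁅ℂ, AffineSl m⁆ A') (g : B →ₗ⁅ℂ, AffineSl m⁆ B')
    (X : AffineSl m) (x : LaurentSpace N m A B) :
    spaceMap N f g (thetaTotal N (Laurent N) A B X x) =
      thetaTotal N (Laurent N) A' B' X (spaceMap N f g x) := by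
  induction x using TensorProduct.induction_on with
  | zero => simp
  | add x y hx hy => simp only [map_add, hx, hy]
  | tmul a u =>
    have hL : spaceMap N f g (thetaLeft N (Laurent N) A B X (a ⊗ₜ u)) =
        thetaLeft N (Laurent N) A' B' X (spaceMap N f g (a ⊗ₜ u)) :=
      congrArg (fun v => v ⊗ₜ[ℂ] (LinearMap.lTensor (Laurent N)
        (LinearMap.lTensor (VecPower N m) (g : B →ₗ[ℂ] B')) u)) (f.map_lie X a)
    have hR : spaceMap N f g (thetaRight N (Laurent N) A B X (a ⊗ₜ u)) =
        thetaRight N (Laurent N) A' B' X (spaceMap N f g (a ⊗ₜ u)) := by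
      have hg : (g : B →ₗ[ℂ] B') ∘ₗ actionMap B X = actionMap B' X ∘ₗ (g : B →ₗ[ℂ] B') :=
        LinearMap.ext fun b => g.map_lie X b
      refine congrArg (fun v => f a ⊗ₜ[ℂ] v) (?_ :
        LinearMap.lTensor (Laurent N) (LinearMap.lTensor (VecPower N m) (g : B →ₗ[ℂ] B'))
          (LinearMap.lTensor (Laurent N) (LinearMap.lTensor (VecPower N m) (actionMap B X)) u) =
        LinearMap.lTensor (Laurent N) (LinearMap.lTensor (VecPower N m) (actionMap B' X))
          (LinearMap.lTensor (Laurent N) (LinearMap.lTensor (VecPower N m) (g : B →ₗ[ℂ] B')) u))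
      rw [← LinearMap.lTensor_comp_apply, ← LinearMap.lTensor_comp, hg, LinearMap.lTensor_comp,
        LinearMap.lTensor_comp_apply]
    have hM (i : Fin N) : spaceMap N f g (theta N (Laurent N) A B i X (a ⊗ₜ u)) =
        theta N (Laurent N) A' B' i X (spaceMap N f g (a ⊗ₜ u)) := by
      refine congrArg (fun v => f a ⊗ₜ[ℂ] v) (?_ :
        LinearMap.lTensor (Laurent N) (LinearMap.lTensor (VecPower N m) (g : B →ₗ[ℂ] B'))
          (thetaLoop N (Laurent N) B i X.loop u + X.degree • LinearMap.rTensor (VecPower N m ⊗[ℂ] B)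
            (TorusAlgebra.euler i).toLinearMap u) =
        thetaLoop N (Laurent N) B' i X.loop
            (LinearMap.lTensor (Laurent N) (LinearMap.lTensor (VecPower N m) (g : B →ₗ[ℂ] B')) u) +
          X.degree • LinearMap.rTensor (VecPower N m ⊗[ℂ] B') (TorusAlgebra.euler i).toLinearMap
            (LinearMap.lTensor (Laurent N) (LinearMap.lTensor (VecPower N m) (g : B →ₗ[ℂ] B')) u))
      rw [map_add, map_smul, ← LinearMap.comp_apply _ (thetaLoop N (Laurent N) B i X.loop),
        thetaLoop_comp, LinearMap.comp_apply, ← LinearMap.comp_apply (LinearMap.lTensor _ _)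
          (LinearMap.rTensor _ _), LinearMap.lTensor_comp_rTensor,
        ← LinearMap.rTensor_comp_lTensor, LinearMap.comp_apply]
    simp only [thetaTotal, LinearMap.add_apply, LinearMap.sum_apply, map_add, map_sum, hL, hR, hM]

/-- The map `ℱ(A, B) → ℱ(A', B')` induced by homomorphisms of modules. -/
def coinvariantsMap (f : A →ₗ⁅ℂ, AffineSl m⁆ A') (g : B →ₗ⁅ℂ, AffineSl m⁆ B') :
    Coinvariants N m A B →ₗ[ℂ] Coinvariants N m A' B' :=
  Submodule.mapQ _ _ (spaceMap N f g) (by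
    refine iSup_le fun X => ?_
    rintro _ ⟨x, rfl⟩
    refine Submodule.mem_comap.mpr ?_
    rw [spaceMap_thetaTotal]
    exact le_iSup (fun X : AffineSl.derived m =>
      LinearMap.range (thetaTotal N (Laurent N) A' B' (X : AffineSl m))) X ⟨_, rfl⟩)

end Functoriality

end AffineKZ

end

noncomputable section

set_option linter.unusedSectionVars false

namespace AffineKZ

attribute [local instance 100] LieRing.ofAssociativeRing

/-! ### Commutators of tensors in families of matrix units -/

section Units

variable {ι R : Type*} [Fintype ι] [Ring R] [Algebra ℂ R]

/-! The theorem is reduced to a few commutator identities between operators on `A ⊗ ℛ(X) ⊗ V^{⊗N} ⊗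
B`. Replace `sl_m` by the matrix units of `gl_m` and put `M_ij = r̃_ij - φ_ij (P_ij - τ(s_ij))`,
where `r̃ = ∑ h_ab E_ab ⊗ E_ba`, `P_ij` is the flip and `φ_ij = z_i/(z_i - z_j)` (this is `mid`).
The trace corrections caused by this replacement cancel against the terms `(1 - τ(s_α))/(1 -
e^{-α})`, `ρ̄(ξ)` and `∂_ξ log G` of `𝒟_ξ` (`opMiddle_eq`, `dunkl_eq`). The part `c ⊗ d + d ⊗ c` of
`r` and the summand `m d` of `ρ^∨` combine to `(ℓ + m) ∂_i`. What remains is `𝒟_i = (ℓ + m) ∂_i +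
L_i - R_i + ρ_i + ∑_{j<i} M_ji - ∑_{j>i} M_ij` (`dunklOp`), where `L_i` and `R_i` are pointwise
limits of truncated sums over currents on `A` and `B`. The truncations stabilize on every vector
because a current of high degree kills it (`eventually_monomial_lie_eq_zero`).

Commutativity. Since `τ(s_ij)` is `P_ij` times a permutation of the variables, `M_ij = r̃_ij - Δ_ij
P_ij` with a divided difference `Δ_ij`. The Yang-Baxter equation for `M` (`mid_cybe`) then follows
from the one for `r̃` and two quadratic identities between divided differences (`divDiff_braid`).
The same equation with `A` in place of one site, `⁅L_i, L_j⁆ + ⁅L_i + L_j, M_ij⁆ = 0`, comes from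
`truncated_cybe`: the factor `φ_ij` turns differences of powers into geometric sums, which cancel
the brackets of currents up to terms of high degree. The `𝒟_i` are therefore of Gaudin type and
commute (`lie_gaudin`, `dunklOp_comm`).

Weyl group. Because `M_ij + M_ji = τ(s_ij)`, the operator `𝒟_i` is the sum of a family permuted by
`S_N` and of `∑_{j<i} τ(s_ij)`. The relations for the finite simple reflections and for `π` become
statements about which transpositions occur, and conjugation by `π` yields the affine reflection.

Coinvariants. Divided differences preserve Laurent polynomials, hence so does everything in the
action. To preserve `𝔤'(…)`, the brackets with `θ(X ⊗ t^{±1})` suffice, because `sl_m` is perfect.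
Telescoping of the truncated sums gives `⁅θ(X ⊗ t^e), 𝒟_i⁆ = defect(θ)`, an expression additive in
`θ` which clearly maps into `𝔤'(…)`. The terms of another shape are multiples of `z_i^e X_i`: from
the cocycle of `A` or `B`, from the `i`-th site paired with itself, and from `∂_i`. They cancel
precisely for the coefficient `ℓ + m` of `∂_i` (`opTotal_lie_dunklOp`). Functoriality holds because
all operators are algebraic expressions, or pointwise limits of such, in operators compatible with
module homomorphisms. -/

/-- `∑ h_{ab} A_{ab} U_{ba}`. -/
def pairing (A U : ι → ι → R) (h : ι → ι → ℂ) : R := ∑ a, ∑ b, h a b • (A a b * U b a)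

/-- `∑ c_{abx} A_{ab} U_{xa} V_{bx}`. -/
def tripleOut (A U V : ι → ι → R) (c : ι → ι → ι → ℂ) : R :=
  ∑ a, ∑ b, ∑ x, c a b x • (A a b * U x a * V b x)

theorem tripleOut_add (A U V : ι → ι → R) (c c' : ι → ι → ι → ℂ) :
    tripleOut A U V (c + c') = tripleOut A U V c + tripleOut A U V c' := by
  simp only [tripleOut, Pi.add_apply, add_smul, Finset.sum_add_distrib]

theorem tripleOut_sub (A U V : ι → ι → R) (c c' : ι → ι → ι → ℂ) :
    tripleOut A U V (c - c') = tripleOut A U V c - tripleOut A U V c' := by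
  simp only [tripleOut, Pi.sub_apply, sub_smul, Finset.sum_sub_distrib]

theorem pairing_flip {A U : ι → ι → R} (h : ι → ι → ℂ)
    (hAU : ∀ a b c d, Commute (A a b) (U c d)) :
    pairing A U h = pairing U A (fun a b => h b a) := by
  rw [pairing, pairing, Finset.sum_comm]
  refine Finset.sum_congr rfl fun a _ => Finset.sum_congr rfl fun b _ => ?_
  rw [(hAU b a a b).eq]

theorem pairing_add (A U : ι → ι → R) (h h' : ι → ι → ℂ) :
    pairing A U (fun a b => h a b + h' a b) = pairing A U h + pairing A U h' := by
  simp only [pairing, add_smul, Finset.sum_add_distrib]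

theorem pairing_commute {A U : ι → ι → R} {y : R} (h : ι → ι → ℂ) (hA : ∀ a b, Commute y (A a b))
    (hU : ∀ a b, Commute y (U a b)) : Commute y (pairing A U h) :=
  Commute.sum_right _ _ _ fun a _ => Commute.sum_right _ _ _ fun b _ =>
    ((hA a b).mul_right (hU b a)).smul_right _

theorem pairing_mul_intertwine {A U A' U' : ι → ι → R} {y : R} (h : ι → ι → ℂ)
    (hA : ∀ a b, y * A a b = A' a b * y) (hU : ∀ a b, y * U a b = U' a b * y) :
    y * pairing A U h = pairing A' U' h * y := by
  simp only [pairing, Finset.mul_sum, Finset.sum_mul, mul_smul_comm, smul_mul_assoc]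
  refine Finset.sum_congr rfl fun a _ => Finset.sum_congr rfl fun b _ => ?_
  rw [← mul_assoc, hA, mul_assoc, hU, mul_assoc]

/-- The commutator of two tensors sharing their first factors. -/
theorem lie_pairing [DecidableEq ι] {A A' A'' U V : ι → ι → R} (h h' : ι → ι → ℂ)
    (hA : ∀ a b c d, ⁅A a b, A' c d⁆ = (if b = c then A'' a d else 0) - if d = a then A'' c b else 0)
    (hUA : ∀ a b c d, Commute (U a b) (A' c d)) (hVA : ∀ a b c d, Commute (V a b) (A c d))
    (hUV : ∀ a b c d, Commute (U a b) (V c d)) :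
    ⁅pairing A U h, pairing A' V h'⁆ =
      tripleOut A'' U V (fun a b x => h a x * h' x b) -
        tripleOut A'' V U (fun a b x => h x b * h' a x) := by
  have key : ∀ a b c d, ⁅h a b • (A a b * U b a), h' c d • (A' c d * V d c)⁆ =
      (if b = c then (h a b * h' c d) • (A'' a d * U b a * V d c) else 0) -
        if d = a then (h a b * h' c d) • (A'' c b * V d c * U b a) else 0 := by
    intro a b c d
    -- Only the shared legs fail to commute, so the commutator factors through `⁅A a b, A' c d⁆`;
    -- the two Kronecker deltas of that bracket then collapse the fourfold sums to the two triple
    -- sums.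
    have e : (A a b * U b a) * (A' c d * V d c) - (A' c d * V d c) * (A a b * U b a) =
        ⁅A a b, A' c d⁆ * U b a * V d c := by
      rw [Ring.lie_def, sub_mul, sub_mul]
      congr 1
      · rw [mul_assoc, ← mul_assoc (U b a), (hUA b a c d).eq]; simp only [mul_assoc]
      · rw [mul_assoc, ← mul_assoc (V d c), (hVA d c a b).eq, mul_assoc, ← (hUV b a d c).eq]
        simp only [mul_assoc]
    rw [Ring.lie_def, smul_mul_smul_comm, smul_mul_smul_comm, mul_comm (h' c d), ← smul_sub, e, hA,
      sub_mul, sub_mul, smul_sub]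
    congr 1
    · split_ifs <;> simp
    · split_ifs
      · rw [mul_assoc, (hUV b a d c).eq, mul_assoc]
      · simp
  have s1 : ∑ a, ∑ b, ∑ c, ∑ d,
      (if b = c then (h a b * h' c d) • (A'' a d * U b a * V d c) else 0) =
      tripleOut A'' U V (fun a b x => h a x * h' x b) := by
    rw [tripleOut]
    refine Finset.sum_congr rfl fun a _ => ?_
    rw [Finset.sum_comm (t := Finset.univ) (s := Finset.univ)
      (f := fun b x => (h a x * h' x b) • (A'' a b * U x a * V b x))]
    refine Finset.sum_congr rfl fun b _ => ?_
    rw [Finset.sum_comm]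
    refine Finset.sum_congr rfl fun d _ => ?_
    simp
  have s2 : ∑ a, ∑ b, ∑ c, ∑ d,
      (if d = a then (h a b * h' c d) • (A'' c b * V d c * U b a) else 0) =
      tripleOut A'' V U (fun a b x => h x b * h' a x) := by
    rw [tripleOut]
    simp only [Finset.sum_ite_eq', Finset.mem_univ, if_true]
    calc ∑ a, ∑ b, ∑ c, (h a b * h' c a) • (A'' c b * V a c * U b a)
        = ∑ a, ∑ c, ∑ b, (h a b * h' c a) • (A'' c b * V a c * U b a) :=
          Finset.sum_congr rfl fun a _ => Finset.sum_comm
      _ = ∑ c, ∑ a, ∑ b, (h a b * h' c a) • (A'' c b * V a c * U b a) := Finset.sum_comm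
      _ = _ := Finset.sum_congr rfl fun c _ => Finset.sum_comm
  rw [← s1, ← s2]
  simp only [pairing, sum_lie]
  simp only [lie_sum, key, Finset.sum_sub_distrib]

/-- The indices of `A_ab U_xa V_bx` form a closed loop, which can be read starting from any leg.
This gives a common normal form with `A` first, in which triple sums from different commutators can
be compared. -/
theorem tripleOut_rotate {A U V : ι → ι → R} (c : ι → ι → ι → ℂ)
    (hAU : ∀ a b c d, Commute (A a b) (U c d)) (hAV : ∀ a b c d, Commute (A a b) (V c d)) :
    tripleOut A U V c = tripleOut U V A (fun a b x => c b x a) := by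
  simp only [tripleOut]
  calc ∑ a, ∑ b, ∑ x, c a b x • (A a b * U x a * V b x)
      = ∑ a, ∑ x, ∑ b, c a b x • (A a b * U x a * V b x) :=
        Finset.sum_congr rfl fun a _ => Finset.sum_comm
    _ = ∑ x, ∑ a, ∑ b, c a b x • (A a b * U x a * V b x) := Finset.sum_comm
    _ = _ := Finset.sum_congr rfl fun x _ => Finset.sum_congr rfl fun a _ =>
        Finset.sum_congr rfl fun b _ => by
          rw [(hAU a b x a).eq, mul_assoc, (hAV a b b x).eq, mul_assoc]

end Units

/-! ### The classical Yang–Baxter equation for `gl_n` and for truncated universal r-matrices. -/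

section Core

variable {ι R : Type*} [Fintype ι] [DecidableEq ι] [Ring R] [Algebra ℂ R]

/-- The commutation relations of matrix units. -/
def UnitRel (A A' A'' : ι → ι → R) : Prop :=
  ∀ a b c d, ⁅A a b, A' c d⁆ = (if b = c then A'' a d else 0) - if d = a then A'' c b else 0

/-- Elementwise commuting families. -/
def FamCommute (A U : ι → ι → R) : Prop := ∀ a b c d, Commute (A a b) (U c d)

theorem FamCommute.symm {A U : ι → ι → R} (h : FamCommute A U) : FamCommute U A :=
  fun a b c d => (h c d a b).symm

variable {A A' A'' U V : ι → ι → R} (h g : ι → ι → ℂ)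

/-- Flipping the first tensor puts the common leg `U` in front, so `lie_pairing` applies; rotating
the index loop brings `A` back to the front. -/
theorem lie_pairing_left (hU : UnitRel U U U) (hAU : FamCommute A U) (hAV : FamCommute A V)
    (hUV : FamCommute U V) :
    ⁅pairing A U h, pairing U V g⁆ = tripleOut A V U (fun a b x => h a b * g a x) -
      tripleOut A U V (fun a b x => h a b * g x b) := by
  rw [pairing_flip h hAU, lie_pairing _ _ hU hAU hUV.symm hAV, tripleOut_rotate _ hAU.symm hUV,
    tripleOut_rotate _ hUV hAU.symm, tripleOut_rotate _ hAV.symm hUV.symm]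

theorem lie_pairing_right (hV : UnitRel V V V) (hAU : FamCommute A U) (hAV : FamCommute A V)
    (hUV : FamCommute U V) :
    ⁅pairing A V h, pairing U V g⁆ = tripleOut A U V (fun a b x => h a b * g x a) -
      tripleOut A V U (fun a b x => h a b * g b x) := by
  rw [pairing_flip g hUV, lie_pairing_left h _ hV hAV hAU hUV.symm]

/-- The coefficients `h` of a classical r-matrix `∑ h_{ab} E_{ab} ⊗ E_{ba}` of `gl_n`. -/
structure IsHalf (h : ι → ι → ℂ) : Prop where
  add_flip (a b : ι) : h a b + h b a = 1
  cybe (a b x : ι) : h a x * h x b - h a b * h a x + h a b * h b x =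
    if a = x ∧ b = x then 1 / 4 else 0

variable {h} in
theorem IsHalf.flip (hh : IsHalf h) : IsHalf fun a b => h b a where
  add_flip a b := hh.add_flip b a
  cybe a b x := by
    have := hh.cybe b a x
    have h1 := hh.add_flip a x
    have h2 := hh.add_flip b x
    simp only [and_comm (a := a = x)]
    rw [← this]
    linear_combination (h b a) * h1 * (-1) + (h b a) * h2

variable {h} in
-- With `A` in front, the three brackets involve only the products `A U V` and `A V U` with a fixed
-- pattern of indices, so the equation reduces to two scalar identities between the coefficients
-- `h`.
theorem lie_pairing_cybe (hh : IsHalf h) (hA : UnitRel A A A) (hU : UnitRel U U U)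
    (hV : UnitRel V V V) (hAU : FamCommute A U) (hAV : FamCommute A V) (hUV : FamCommute U V) :
    ⁅pairing A U h, pairing A V h⁆ + ⁅pairing A U h + pairing A V h, pairing U V h⁆ = 0 := by
  -- The identity needed for the products `A U V`: it differs from `hh.cybe` only by two uses of
  -- `h_ab + h_ba = 1`.
  have e1 : ∀ a b x, h a x * h x b - h a b * h x b + h a b * h x a =
      if a = x ∧ b = x then 1 / 4 else 0 := by
    intro a b x
    rw [← hh.cybe]
    linear_combination (h a b) * (hh.add_flip a x) - (h a b) * hh.add_flip b x
  -- The exceptional value `1/4` occurs only at `a = b = x`, where both kinds of products agree, so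
  -- the two exceptions cancel.
  have e : tripleOut A U V (fun a b x => if a = x ∧ b = x then 1 / 4 else 0) =
      tripleOut A V U (fun a b x => if a = x ∧ b = x then 1 / 4 else 0) := by
    refine Finset.sum_congr rfl fun a _ => Finset.sum_congr rfl fun b _ =>
      Finset.sum_congr rfl fun x _ => ?_
    beta_reduce
    split_ifs with hx
    · obtain ⟨rfl, rfl⟩ := hx
      rw [mul_assoc, (hUV _ _ _ _).eq, mul_assoc]
    · simp
  rw [add_lie, lie_pairing h h hA hAU.symm hAV.symm hUV, lie_pairing_left h h hU hAU hAV hUV,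
    lie_pairing_right h h hV hAU hAV hUV]
  have hZ : tripleOut A U V (fun a b x => h a x * h x b) -
      tripleOut A U V (fun a b x => h a b * h x b) + tripleOut A U V (fun a b x => h a b * h x a) =
      tripleOut A U V (fun a b x => if a = x ∧ b = x then 1 / 4 else 0) := by
    rw [← tripleOut_sub, ← tripleOut_add]
    exact congrArg _ (funext₃ e1)
  have hX : tripleOut A V U (fun a b x => h x b * h a x) -
      tripleOut A V U (fun a b x => h a b * h a x) + tripleOut A V U (fun a b x => h a b * h b x) =
      tripleOut A V U (fun a b x => if a = x ∧ b = x then 1 / 4 else 0) := by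
    rw [← tripleOut_sub, ← tripleOut_add]
    exact congrArg _ (funext₃ fun a b x => (hh.cybe a b x ▸ by simp [mul_comm]))
  rw [← hZ, ← hX] at e
  rw [← sub_eq_zero] at e
  rw [← e]
  abel

/-- The tensor `∑ U_ab V_ba` is the invariant Casimir tensor of `gl_n`: it commutes with all `U_xy +
V_xy`, hence with any tensor whose second leg is diagonal in `U` and `V`, whatever the coefficients
`h`. -/
theorem lie_pairing_flip (hU : UnitRel U U U) (hV : UnitRel V V V)
    (hAU : FamCommute A U) (hAV : FamCommute A V) (hUV : FamCommute U V) :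
    ⁅pairing A U h + pairing A V h, pairing U V 1⁆ = 0 := by
  rw [add_lie, lie_pairing_left h _ hU hAU hAV hUV, lie_pairing_right h _ hV hAU hAV hUV]
  simp

/-- `∑_{n ≤ K} uⁿ ∑ A_n(E_{ab}) U_{ba}`, with the coefficients `h` for `n = 0`. -/
def truncated (A : ℕ → ι → ι → R) (U : ι → ι → R) (h : ι → ι → ℂ) (u : R) (K : ℕ) : R :=
  pairing (A 0) U h + ∑ n ∈ Finset.range K, u ^ (n + 1) * pairing (A (n + 1)) U 1

/-- The classical Yang-Baxter equation for the truncated universal r-matrix, up to terms of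
high degree. -/
theorem truncated_cybe {A : ℕ → ι → ι → R} {h : ι → ι → ℂ} (hh : IsHalf h)
    (hA : ∀ p q, UnitRel (A p) (A q) (A (p + q))) (hU : UnitRel U U U)
    (hV : UnitRel V V V) (hAU : ∀ n, FamCommute (A n) U) (hAV : ∀ n, FamCommute (A n) V)
    (hUV : FamCommute U V) {u v φ τ : R} (huv : Commute u v)
    (hu : ∀ n a b, Commute u (A n a b)) (hv : ∀ n a b, Commute v (A n a b))
    (hφ : ∀ n a b, Commute φ (A n a b)) (huU : ∀ a b, Commute u (U a b))
    (hvU : ∀ a b, Commute v (U a b)) (hφU : ∀ a b, Commute φ (U a b))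
    (huV : ∀ a b, Commute u (V a b)) (hvV : ∀ a b, Commute v (V a b))
    (hφV : ∀ a b, Commute φ (V a b)) (huφ : Commute u φ) (hvφ : Commute v φ)
    (hφuv : φ * (v - u) = v)
    (hτA : ∀ n a b, Commute τ (A n a b)) (hτU : ∀ a b, τ * U a b = V a b * τ)
    (hτV : ∀ a b, τ * V a b = U a b * τ) (hτu : τ * u = v * τ) (hτv : τ * v = u * τ) (K : ℕ) :
    ⁅truncated A U h u K, truncated A V h v K⁆ +
        ⁅truncated A U h u K + truncated A V h v K,
          pairing U V h - φ * (pairing U V 1 - τ)⁆ =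
      ∑ p ∈ Finset.range K, ∑ q ∈ Finset.range K, if K < p + q + 2 then
        u ^ (p + 1) * v ^ (q + 1) *
          (tripleOut (A (p + q + 2)) U V 1 - tripleOut (A (p + q + 2)) V U 1) else 0 := by
  set r := pairing U V h
  set P := pairing U V (1 : ι → ι → ℂ)
  set α : ℕ → R := fun n => pairing (A n) U 1 with hα
  set β : ℕ → R := fun n => pairing (A n) V 1 with hβ
  set B : ℕ → R := fun n => tripleOut (A n) U V 1 - tripleOut (A n) V U 1 with hB
  set R₁ := pairing (A 0) U h
  set R₂ := pairing (A 0) V h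
  -- In positive degree every bracket is `0` or `±1` times the single triple sum `B n`; the
  -- coefficients `h` of the degree zero parts disappear through `h_ab + h_ba = 1`.
  have f1 : ∀ p q, ⁅α p, β q⁆ = B (p + q) := by
    intro p q
    simp only [hα, hβ, hB]
    rw [lie_pairing 1 1 (hA p q) (hAU q).symm (hAV p).symm hUV]
    congr 2 <;> (ext; simp)
  have f2 : ∀ n, ⁅R₁, β n⁆ + ⁅β n, r⁆ = B n := by
    intro n
    have hA0 := hA 0 n
    rw [zero_add] at hA0
    simp only [R₁, r, hβ, hB]
    rw [lie_pairing h 1 hA0 (hAU n).symm (hAV 0).symm hUV,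
      lie_pairing_right 1 h hV (hAU n) (hAV n) hUV,
      show ∀ a b c d : R, a - b + (c - d) = (a + c) - (b + d) by intros; abel,
      ← tripleOut_add, ← tripleOut_add]
    congr 2 <;> (ext a b x; simp [hh.add_flip])
  have f3 : ∀ n, ⁅α n, R₂⁆ + ⁅α n, r⁆ = 0 := by
    intro n
    have hA0 := hA n 0
    rw [add_zero] at hA0
    simp only [R₂, r, hα]
    rw [lie_pairing 1 h hA0 (hAU 0).symm (hAV n).symm hUV,
      lie_pairing_left 1 h hU (hAU n) (hAV n) hUV]
    simp
  have f4 : ∀ n, ⁅α n, P⁆ = - B n := by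
    intro n
    simp only [P, hα, hB]
    rw [lie_pairing_left 1 1 hU (hAU n) (hAV n) hUV, neg_sub]
    congr 2 <;> (ext; simp)
  have f5 : ∀ n, ⁅β n, P⁆ = B n := by
    intro n
    simp only [P, hβ, hB]
    rw [lie_pairing_right 1 1 hV (hAU n) (hAV n) hUV]
    congr 2 <;> (ext; simp)
  have f6 : ⁅R₁, R₂⁆ + ⁅R₁ + R₂, r⁆ = 0 :=
    lie_pairing_cybe hh (hA 0 0) hU hV (hAU 0) (hAV 0) hUV
  have f7 : ⁅R₁ + R₂, P⁆ = 0 := lie_pairing_flip h hU hV (hAU 0) (hAV 0) hUV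
  have lie_mul {x y z : R} (hxz : Commute x z) : ⁅x * y, z⁆ = x * ⁅y, z⁆ := by
    rw [Ring.lie_def, Ring.lie_def, mul_sub, mul_assoc, ← mul_assoc z, ← hxz.eq, mul_assoc]
  have mul_lie {x y z : R} (hxz : Commute z x) : ⁅x, z * y⁆ = z * ⁅x, y⁆ := by
    rw [Ring.lie_def, Ring.lie_def, mul_sub, ← mul_assoc, ← hxz.eq, mul_assoc, mul_assoc]
  have ur : Commute u r := pairing_commute _ huU huV
  have vr : Commute v r := pairing_commute _ hvU hvV
  have uP : Commute u P := pairing_commute _ huU huV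
  have vP : Commute v P := pairing_commute _ hvU hvV
  have vα : ∀ n, Commute v (α n) := fun n => pairing_commute _ (hv n) hvU
  have uβ : ∀ n, Commute u (β n) := fun n => pairing_commute _ (hu n) huV
  have uR : Commute u R₂ := pairing_commute _ (hu 0) huV
  have vR : Commute v R₁ := pairing_commute _ (hv 0) hvU
  have φα : ∀ n, Commute φ (α n) := fun n => pairing_commute _ (hφ n) hφU
  have φβ : ∀ n, Commute φ (β n) := fun n => pairing_commute _ (hφ n) hφV
  have φR₁ : Commute φ R₁ := pairing_commute _ (hφ 0) hφU
  have φR₂ : Commute φ R₂ := pairing_commute _ (hφ 0) hφV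
  have t1 : truncated A U h u K = R₁ + ∑ n ∈ Finset.range K, u ^ (n + 1) * α (n + 1) := rfl
  have t2 : truncated A V h v K = R₂ + ∑ n ∈ Finset.range K, v ^ (n + 1) * β (n + 1) := rfl
  have hτ1 : τ * truncated A U h u K = truncated A V h v K * τ := by
    have hp : ∀ n, τ * u ^ n = v ^ n * τ := by
      intro n
      induction n with
      | zero => simp
      | succ n ih => rw [pow_succ, ← mul_assoc, ih, mul_assoc, hτu, pow_succ, mul_assoc]
    rw [truncated, truncated, mul_add, add_mul, Finset.mul_sum, Finset.sum_mul]
    congr 1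
    · exact pairing_mul_intertwine _ (fun a b => (hτA 0 a b).eq) hτU
    · refine Finset.sum_congr rfl fun n _ => ?_
      rw [← mul_assoc, hp, mul_assoc, pairing_mul_intertwine _ (fun a b => (hτA _ a b).eq) hτU,
        mul_assoc]
  have hτ2 : τ * truncated A V h v K = truncated A U h u K * τ := by
    have hp : ∀ n, τ * v ^ n = u ^ n * τ := by
      intro n
      induction n with
      | zero => simp
      | succ n ih => rw [pow_succ, ← mul_assoc, ih, mul_assoc, hτv, pow_succ, mul_assoc]
    rw [truncated, truncated, mul_add, add_mul, Finset.mul_sum, Finset.sum_mul]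
    congr 1
    · exact pairing_mul_intertwine _ (fun a b => (hτA 0 a b).eq) hτV
    · refine Finset.sum_congr rfl fun n _ => ?_
      rw [← mul_assoc, hp, mul_assoc, pairing_mul_intertwine _ (fun a b => (hτA _ a b).eq) hτV,
        mul_assoc]
  have hφL : Commute φ (truncated A U h u K + truncated A V h v K) := by
    rw [t1, t2]
    exact (φR₁.add_right (Commute.sum_right _ _ _ fun n _ =>
      (huφ.symm.pow_right _).mul_right (φα _))).add_right
      (φR₂.add_right (Commute.sum_right _ _ _ fun n _ => (hvφ.symm.pow_right _).mul_right (φβ _)))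
  -- Conjugation by `τ` exchanges the two truncated sums, so `τ` commutes with their sum and drops
  -- out; the degree zero parts commute with `P` by `f7`.
  have hφτ : ⁅truncated A U h u K + truncated A V h v K, φ * (P - τ)⁆ =
      ∑ n ∈ Finset.range K, φ * (v ^ (n + 1) - u ^ (n + 1)) * B (n + 1) := by
    rw [mul_lie hφL, lie_sub]
    have : ⁅truncated A U h u K + truncated A V h v K, τ⁆ = 0 := by
      rw [Ring.lie_def, add_mul, mul_add, hτ1, hτ2]; abel
    rw [this, sub_zero, t1, t2,
      show ∀ a b c d : R, a + b + (c + d) = (a + c) + (b + d) by intros; abel, add_lie, f7, zero_add,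
      add_lie, sum_lie, sum_lie, ← Finset.sum_add_distrib, Finset.mul_sum]
    refine Finset.sum_congr rfl fun n _ => ?_
    rw [lie_mul (uP.pow_left _), lie_mul (vP.pow_left _), f4, f5, mul_assoc, sub_mul, mul_neg]
    abel_nf
  -- By `φ (v - u) = v` the pole of `φ` is removed and a geometric sum in `u` and `v` remains. The
  -- pure power `v^(n+1)` is split off because it matches the bracket of the degree zero part with
  -- the positive part.
  have hgeom : ∀ n, φ * (v ^ (n + 1) - u ^ (n + 1)) =
      v ^ (n + 1) + ∑ i ∈ Finset.range n, u ^ (n - i) * v ^ (i + 1) := by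
    intro n
    rw [← huv.symm.mul_geom_sum₂, ← mul_assoc, hφuv, Finset.sum_range_succ, mul_add, add_comm]
    congr 1
    · rw [show n + 1 - 1 - n = 0 by omega, pow_zero, mul_one, ← pow_succ']
    · rw [Finset.mul_sum]
      refine Finset.sum_congr rfl fun i hi => ?_
      rw [← mul_assoc, ← pow_succ', (huv.symm.pow_pow _ _).eq, show n + 1 - 1 - i = n - i by omega]
  have hSS : ⁅∑ n ∈ Finset.range K, u ^ (n + 1) * α (n + 1),
      ∑ n ∈ Finset.range K, v ^ (n + 1) * β (n + 1)⁆ =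
      ∑ p ∈ Finset.range K, ∑ q ∈ Finset.range K,
        u ^ (p + 1) * v ^ (q + 1) * B (p + q + 2) := by
    rw [sum_lie]
    refine Finset.sum_congr rfl fun p _ => ?_
    rw [lie_sum]
    refine Finset.sum_congr rfl fun q _ => ?_
    rw [lie_mul (((huv.pow_right _).mul_right (uβ _)).pow_left _), mul_lie ((vα _).pow_left _), f1,
      mul_assoc, show p + 1 + (q + 1) = p + q + 2 by ring]
  have hRS : ⁅R₁, ∑ n ∈ Finset.range K, v ^ (n + 1) * β (n + 1)⁆ +
      ⁅∑ n ∈ Finset.range K, v ^ (n + 1) * β (n + 1), r⁆ =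
      ∑ n ∈ Finset.range K, v ^ (n + 1) * B (n + 1) := by
    rw [lie_sum, sum_lie, ← Finset.sum_add_distrib]
    refine Finset.sum_congr rfl fun n _ => ?_
    rw [mul_lie (vR.pow_left _), lie_mul (vr.pow_left _), ← mul_add, f2]
  have hSR : ⁅∑ n ∈ Finset.range K, u ^ (n + 1) * α (n + 1), R₂⁆ +
      ⁅∑ n ∈ Finset.range K, u ^ (n + 1) * α (n + 1), r⁆ = 0 := by
    rw [sum_lie, sum_lie, ← Finset.sum_add_distrib]
    refine Finset.sum_eq_zero fun n _ => ?_
    rw [lie_mul (uR.pow_left _), lie_mul (ur.pow_left _), ← mul_add, f3, mul_zero]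
  -- Under `(p, q) = (n - 1 - i, i)` the geometric sums are exactly the terms of the double bracket
  -- with `p + q + 2 ≤ K`. The terms with `p + q + 2 > K` have no partner and form the right-hand
  -- side of the theorem.
  have hre : ∑ n ∈ Finset.range K, ∑ i ∈ Finset.range n,
      u ^ (n - i) * v ^ (i + 1) * B (n + 1) =
      ∑ p ∈ Finset.range K, ∑ q ∈ Finset.range K, if K < p + q + 2 then 0 else
        u ^ (p + 1) * v ^ (q + 1) * B (p + q + 2) := by
    rw [Finset.sum_sigma', ← Finset.sum_product', Finset.sum_ite, Finset.sum_const_zero, zero_add]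
    refine Finset.sum_bij' (fun x _ => (x.1 - 1 - x.2, x.2)) (fun y _ => ⟨y.1 + y.2 + 1, y.2⟩)
      ?_ ?_ ?_ ?_ ?_
    · rintro ⟨n, i⟩ hx
      simp only [Finset.mem_sigma, Finset.mem_range, Finset.mem_filter, Finset.mem_product] at hx ⊢
      omega
    · rintro ⟨n, i⟩ hx
      simp only [Finset.mem_sigma, Finset.mem_range, Finset.mem_filter, Finset.mem_product] at hx ⊢
      omega
    · rintro ⟨n, i⟩ hx
      simp only [Finset.mem_sigma, Finset.mem_range] at hx
      simp only [Sigma.mk.injEq, heq_eq_eq, and_true]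
      omega
    · rintro ⟨n, i⟩ hx
      simp
    · rintro ⟨n, i⟩ hx
      simp only [Finset.mem_sigma, Finset.mem_range] at hx
      simp only
      rw [show n - 1 - i + 1 = n - i by omega, show n - 1 - i + i + 2 = n + 1 by omega]
  have hsplit : ∑ p ∈ Finset.range K, ∑ q ∈ Finset.range K,
        u ^ (p + 1) * v ^ (q + 1) * B (p + q + 2) =
      (∑ p ∈ Finset.range K, ∑ q ∈ Finset.range K, if K < p + q + 2 then
        u ^ (p + 1) * v ^ (q + 1) * B (p + q + 2) else 0) +
      ∑ p ∈ Finset.range K, ∑ q ∈ Finset.range K, if K < p + q + 2 then 0 else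
        u ^ (p + 1) * v ^ (q + 1) * B (p + q + 2) := by
    simp only [← Finset.sum_add_distrib]
    refine Finset.sum_congr rfl fun p _ => Finset.sum_congr rfl fun q _ => ?_
    split_ifs <;> simp
  have hφsum : ∑ n ∈ Finset.range K, φ * (v ^ (n + 1) - u ^ (n + 1)) * B (n + 1) =
      ∑ n ∈ Finset.range K, v ^ (n + 1) * B (n + 1) +
        ∑ n ∈ Finset.range K, ∑ i ∈ Finset.range n, u ^ (n - i) * v ^ (i + 1) * B (n + 1) := by
    rw [← Finset.sum_add_distrib]
    refine Finset.sum_congr rfl fun n _ => ?_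
    rw [hgeom, add_mul, Finset.sum_mul]
  rw [lie_sub, hφτ, hφsum, hre, t1, t2]
  set S₁ := ∑ n ∈ Finset.range K, u ^ (n + 1) * α (n + 1)
  set S₂ := ∑ n ∈ Finset.range K, v ^ (n + 1) * β (n + 1)
  have expand : ⁅R₁ + S₁, R₂ + S₂⁆ + ⁅R₁ + S₁ + (R₂ + S₂), r⁆ =
      (⁅R₁, R₂⁆ + ⁅R₁ + R₂, r⁆) + (⁅R₁, S₂⁆ + ⁅S₂, r⁆) + (⁅S₁, R₂⁆ + ⁅S₁, r⁆) + ⁅S₁, S₂⁆ := by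
    simp only [add_lie, lie_add]; abel
  rw [← add_sub_assoc, expand, f6, hRS, hSR, hSS, hsplit]
  abel

end Core

/-! ### Commutators in an associative ring. -/

section

variable {R : Type*} [Ring R]

theorem lie_mul_left_of_commute {x y z : R} (hxz : Commute x z) : ⁅x * y, z⁆ = x * ⁅y, z⁆ := by
  rw [Ring.lie_def, Ring.lie_def, mul_sub, mul_assoc, ← mul_assoc z, ← hxz.eq, mul_assoc]

theorem lie_mul_right_of_commute {x y z : R} (hxz : Commute z x) : ⁅x, z * y⁆ = z * ⁅x, y⁆ := by
  rw [Ring.lie_def, Ring.lie_def, mul_sub, ← mul_assoc, ← hxz.eq, mul_assoc, mul_assoc]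

theorem lie_eq_zero_of_commute {x y : R} (h : Commute x y) : ⁅x, y⁆ = 0 := by
  rw [Ring.lie_def, h.eq, sub_self]

theorem lie_leibniz_mul (x y z : R) : ⁅x, y * z⁆ = ⁅x, y⁆ * z + y * ⁅x, z⁆ := by
  simp only [Ring.lie_def]; noncomm_ring

end

/-! ### Yang–Baxter operators with divided differences, and sums of Gaudin type. -/

section Middle

variable {ι R : Type*} [Fintype ι] [DecidableEq ι] [Ring R] [Algebra ℂ R]

/-- Expand in powers of the `D`'s. The part without `D` is the equation for `r`. The linear parts in
`D₁₂` and `D₂₃` vanish by invariance of the flips, while `D₁₃` leaves a difference of two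
three-cycles. All products of two flips in the quadratic part are one of these same three-cycles,
`P₁₂P₁₃` or `P₁₃P₁₂`, and `e1`, `e2` say that their total coefficients vanish. -/
theorem middle_cybe {U V W : ι → ι → R} {h : ι → ι → ℂ} (hh : IsHalf h) (hU : UnitRel U U U)
    (hV : UnitRel V V V) (hW : UnitRel W W W) (hUV : FamCommute U V) (hUW : FamCommute U W)
    (hVW : FamCommute V W) {D₁₂ D₁₃ D₂₃ : R}
    (c12U : ∀ a b, Commute D₁₂ (U a b)) (c12V : ∀ a b, Commute D₁₂ (V a b))
    (c12W : ∀ a b, Commute D₁₂ (W a b))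
    (c13U : ∀ a b, Commute D₁₃ (U a b)) (c13V : ∀ a b, Commute D₁₃ (V a b))
    (c13W : ∀ a b, Commute D₁₃ (W a b))
    (c23U : ∀ a b, Commute D₂₃ (U a b)) (c23V : ∀ a b, Commute D₂₃ (V a b))
    (c23W : ∀ a b, Commute D₂₃ (W a b))
    (p12U : ∀ a b, pairing U V 1 * U a b = V a b * pairing U V 1)
    (p12V : ∀ a b, pairing U V 1 * V a b = U a b * pairing U V 1)
    (p13U : ∀ a b, pairing U W 1 * U a b = W a b * pairing U W 1)
    (p13W : ∀ a b, pairing U W 1 * W a b = U a b * pairing U W 1)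
    (e1 : D₁₂ * D₁₃ - D₂₃ * D₁₂ + D₁₃ * D₂₃ = D₁₃)
    (e2 : D₁₃ * D₁₂ - D₁₂ * D₂₃ + D₂₃ * D₁₃ = D₁₃) :
    ⁅pairing U V h - D₁₂ * pairing U V 1, pairing U W h - D₁₃ * pairing U W 1⁆ +
      ⁅(pairing U V h - D₁₂ * pairing U V 1) + (pairing U W h - D₁₃ * pairing U W 1),
        pairing V W h - D₂₃ * pairing V W 1⁆ = 0 := by
  set r₁₂ := pairing U V h
  set r₁₃ := pairing U W h
  set r₂₃ := pairing V W h
  set P₁₂ := pairing U V (1 : ι → ι → ℂ)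
  set P₁₃ := pairing U W (1 : ι → ι → ℂ)
  set P₂₃ := pairing V W (1 : ι → ι → ℂ)
  have hp12W : ∀ a b, Commute P₁₂ (W a b) := fun a b =>
    (pairing_commute _ (fun c d => (hUW c d a b).symm) (fun c d => (hVW c d a b).symm)).symm
  have hp13V : ∀ a b, Commute P₁₃ (V a b) := fun a b =>
    (pairing_commute _ (fun c d => (hUV c d a b).symm) (fun c d => (hVW a b c d))).symm
  have cyb : ⁅r₁₂, r₁₃⁆ + ⁅r₁₂ + r₁₃, r₂₃⁆ = 0 := lie_pairing_cybe hh hU hV hW hUV hUW hVW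
  have g23 : ⁅r₁₂ + r₁₃, P₂₃⁆ = 0 := lie_pairing_flip h hV hW hUV hUW hVW
  have g12 : ⁅P₁₂, r₁₃⁆ + ⁅P₁₂, r₂₃⁆ = 0 := by
    have := lie_pairing_flip (fun a b => h b a) hU hV hUW.symm hVW.symm hUV
    rw [← pairing_flip h hUW, ← pairing_flip h hVW] at this
    rw [← lie_add, ← lie_skew, this, neg_zero]
  -- products of flips
  have a1 : P₁₂ * P₁₃ = P₂₃ * P₁₂ := pairing_mul_intertwine _ p12U fun a b => (hp12W a b).eq
  have a2 : P₁₃ * P₂₃ = P₁₂ * P₁₃ := by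
    have : P₁₃ * P₂₃ = pairing V U 1 * P₁₃ :=
      pairing_mul_intertwine _ (fun a b => (hp13V a b).eq) p13W
    rw [this, pairing_flip 1 hUV.symm]; rfl
  have b1 : P₁₃ * P₁₂ = P₂₃ * P₁₃ := by
    have : P₁₃ * P₁₂ = pairing W V 1 * P₁₃ :=
      pairing_mul_intertwine _ p13U (fun a b => (hp13V a b).eq)
    rw [this, pairing_flip 1 hVW.symm]; rfl
  have b2 : P₁₂ * P₂₃ = P₁₃ * P₁₂ := pairing_mul_intertwine _ p12V fun a b => (hp12W a b).eq
  -- Conjugation by `P₁₃` exchanges `r₁₂` and `r₂₃` up to transposition, and `r` plus its transpose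
  -- is the flip. The order of the legs is reversed, so unlike `g12` and `g23` the bracket does not
  -- vanish.
  have g13 : ⁅r₁₂, P₁₃⁆ + ⁅P₁₃, r₂₃⁆ = P₁₂ * P₁₃ - P₁₃ * P₁₂ := by
    have x1 : P₁₃ * r₁₂ = pairing V W (fun a b => h b a) * P₁₃ := by
      rw [pairing_mul_intertwine (A' := W) (U' := V) _ p13U (fun a b => (hp13V a b).eq),
        pairing_flip h hVW.symm]
    have x2 : P₁₃ * r₂₃ = pairing U V (fun a b => h b a) * P₁₃ := by
      rw [pairing_mul_intertwine (A' := V) (U' := U) _ (fun a b => (hp13V a b).eq) p13W,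
        pairing_flip h hUV.symm]
    have s1 : P₁₂ = r₁₂ + pairing U V (fun a b => h b a) := by
      rw [← pairing_add]
      simp only [hh.add_flip]; rfl
    have s2 : P₂₃ = r₂₃ + pairing V W (fun a b => h b a) := by
      rw [← pairing_add]
      simp only [hh.add_flip]; rfl
    rw [Ring.lie_def, Ring.lie_def, x1, x2, b1, s1, s2, add_mul, add_mul]
    abel
  have mv {D y : R} (hU' : ∀ a b, Commute D (U a b)) (hV' : ∀ a b, Commute D (V a b))
      (hW' : ∀ a b, Commute D (W a b)) : Commute D r₁₂ ∧ Commute D r₁₃ ∧ Commute D r₂₃ ∧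
      Commute D P₁₂ ∧ Commute D P₁₃ ∧ Commute D P₂₃ :=
    ⟨pairing_commute _ hU' hV', pairing_commute _ hU' hW', pairing_commute _ hV' hW',
      pairing_commute _ hU' hV', pairing_commute _ hU' hW', pairing_commute _ hV' hW'⟩
  obtain ⟨d1, d2, d3, d4, d5, d6⟩ := mv (y := 0) c12U c12V c12W
  obtain ⟨d1', d2', d3', d4', d5', d6'⟩ := mv (y := 0) c13U c13V c13W
  obtain ⟨d1'', d2'', d3'', d4'', d5'', d6''⟩ := mv (y := 0) c23U c23V c23W
  have prod {D D' P P' : R} (h1 : Commute P D') (h2 : Commute P' D) :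
      ⁅D * P, D' * P'⁆ = D * D' * (P * P') - D' * D * (P' * P) := by
    rw [Ring.lie_def, h1.mul_mul_mul_comm, h2.mul_mul_mul_comm]
  have q1 : ⁅D₁₂ * P₁₂, D₁₃ * P₁₃⁆ = D₁₂ * D₁₃ * (P₁₂ * P₁₃) - D₁₃ * D₁₂ * (P₁₃ * P₁₂) :=
    prod d4'.symm d5.symm
  have q2 : ⁅D₁₂ * P₁₂, D₂₃ * P₂₃⁆ = D₁₂ * D₂₃ * (P₁₃ * P₁₂) - D₂₃ * D₁₂ * (P₁₂ * P₁₃) := by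
    rw [prod d4''.symm d6.symm, b2, ← a1]
  have q3 : ⁅D₁₃ * P₁₃, D₂₃ * P₂₃⁆ = D₁₃ * D₂₃ * (P₁₂ * P₁₃) - D₂₃ * D₁₃ * (P₁₃ * P₁₂) := by
    rw [prod d5''.symm d6'.symm, a2, ← b1]
  have expand : ⁅r₁₂ - D₁₂ * P₁₂, r₁₃ - D₁₃ * P₁₃⁆ +
      ⁅(r₁₂ - D₁₂ * P₁₂) + (r₁₃ - D₁₃ * P₁₃), r₂₃ - D₂₃ * P₂₃⁆ =
      (⁅r₁₂, r₁₃⁆ + ⁅r₁₂ + r₁₃, r₂₃⁆) - ⁅r₁₂ + r₁₃, D₂₃ * P₂₃⁆ -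
      (⁅D₁₂ * P₁₂, r₁₃⁆ + ⁅D₁₂ * P₁₂, r₂₃⁆) - (⁅r₁₂, D₁₃ * P₁₃⁆ + ⁅D₁₃ * P₁₃, r₂₃⁆) +
      (⁅D₁₂ * P₁₂, D₁₃ * P₁₃⁆ + ⁅D₁₂ * P₁₂, D₂₃ * P₂₃⁆ + ⁅D₁₃ * P₁₃, D₂₃ * P₂₃⁆) := by
    simp only [add_lie, sub_lie, lie_sub]; abel
  rw [expand, cyb, lie_mul_right_of_commute (d1''.add_right d2''), g23,
    lie_mul_left_of_commute d2, lie_mul_left_of_commute d3, ← mul_add, g12,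
    lie_mul_right_of_commute d1', lie_mul_left_of_commute d3', ← mul_add, g13, q1, q2, q3]
  calc _ = (D₁₂ * D₁₃ - D₂₃ * D₁₂ + D₁₃ * D₂₃ - D₁₃) * (P₁₂ * P₁₃) -
        (D₁₃ * D₁₂ - D₁₂ * D₂₃ + D₂₃ * D₁₃ - D₁₃) * (P₁₃ * P₁₂) := by
        simp only [sub_mul, add_mul, mul_sub, mul_zero]; abel
    _ = 0 := by rw [e1, e2, sub_self, zero_mul, zero_mul, sub_zero]

/-- Commutator of Gaudin type sums. -/
theorem lie_gaudin {N : Type*} [Fintype N] [DecidableEq N] {K : N → R} {Q : N → N → R} {i j : N}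
    (hij : i ≠ j) (hanti : ∀ i j, Q j i = - Q i j) (hdiag : ∀ i, Q i i = 0)
    (hdisj : ∀ k l, k ≠ i → k ≠ j → l ≠ i → l ≠ j → k ≠ l → ⁅Q i k, Q j l⁆ = 0)
    (hcybe : ∀ k, k ≠ i → k ≠ j → ⁅Q i j, Q j k⁆ + ⁅Q j k, Q k i⁆ + ⁅Q k i, Q i j⁆ = 0)
    (hKi : ∀ k, k ≠ i → ⁅K i, Q j k⁆ = 0) (hKj : ∀ k, k ≠ j → ⁅K j, Q i k⁆ = 0) :
    ⁅K i + ∑ k, Q i k, K j + ∑ k, Q j k⁆ = ⁅K i, K j⁆ - ⁅K i + K j, Q i j⁆ := by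
  have h1 : ⁅K i, ∑ k, Q j k⁆ = - ⁅K i, Q i j⁆ := by
    rw [lie_sum, Finset.sum_eq_single i (fun k _ hk => hKi k hk) (by simp), hanti, lie_neg]
  have h2 : ⁅∑ k, Q i k, K j⁆ = - ⁅K j, Q i j⁆ := by
    rw [← lie_skew, lie_sum, Finset.sum_eq_single j (fun k _ hk => hKj k hk) (by simp)]
  -- Brackets involving four distinct sites vanish; for each third site `k` the remaining terms
  -- group into one Yang–Baxter combination for the triple `i, j, k`.
  have h3 : ⁅∑ k, Q i k, ∑ k, Q j k⁆ = 0 := by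
    have split : ∀ f : N → R, ∑ k, f k = f i + f j +
        ∑ k ∈ Finset.univ.filter fun k => k ≠ i ∧ k ≠ j, f k := by
      intro f
      rw [← Finset.sum_filter_add_sum_filter_not Finset.univ (fun k => k ≠ i ∧ k ≠ j) f, add_comm]
      congr 1
      rw [← Finset.sum_pair hij]
      refine Finset.sum_congr ?_ fun _ _ => rfl
      ext k
      simp only [Finset.mem_filter, Finset.mem_univ, true_and, Finset.mem_insert,
        Finset.mem_singleton]
      tauto
    rw [split (Q i), split (Q j), hdiag, hdiag, zero_add, add_zero, add_lie, lie_add, lie_add,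
      hanti i j, lie_neg, lie_self, neg_zero, zero_add, lie_neg, sum_lie_sum]
    have : ∀ k ∈ Finset.univ.filter (fun k => k ≠ i ∧ k ≠ j),
        ∑ l ∈ Finset.univ.filter (fun k => k ≠ i ∧ k ≠ j), ⁅Q i k, Q j l⁆ = ⁅Q i k, Q j k⁆ := by
      intro k hk
      refine Finset.sum_eq_single k (fun l hl hlk => ?_) (fun h => absurd hk h)
      simp only [Finset.mem_filter, Finset.mem_univ, true_and] at hk hl
      exact hdisj k l hk.1 hk.2 hl.1 hl.2 hlk.symm
    rw [Finset.sum_congr rfl this, lie_sum, sum_lie, ← Finset.sum_neg_distrib,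
      ← Finset.sum_add_distrib, ← Finset.sum_add_distrib]
    refine Finset.sum_eq_zero fun k hk => ?_
    simp only [Finset.mem_filter, Finset.mem_univ, true_and] at hk
    have := hcybe k hk.1 hk.2
    rw [hanti i k, lie_neg, neg_lie] at this
    rw [← lie_skew (Q i k) (Q j k), ← this]
    abel
  rw [add_lie, lie_add, lie_add, h1, h2, h3, add_lie]
  abel

end Middle

/-! ### Commutators of elements of degree `±1` with truncated sums over currents. -/

section Derived

variable {ι R : Type*} [Fintype ι] [DecidableEq ι] [Ring R] [Algebra ℂ R]
  {A C : ℕ → ι → ι → R} {U D Z : ι → ι → R} {h : ι → ι → ℂ} {y w u u' : R}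

theorem pairing_lie {A U C D : ι → ι → R} {y w : R} (hyA : ∀ a b, ⁅y, A a b⁆ = C a b)
    (hwU : ∀ a b, ⁅w, U a b⁆ = D a b) (hyU : ∀ a b, Commute y (U a b))
    (hwA : ∀ a b, Commute w (A a b)) :
    ⁅y, pairing A U h⁆ = pairing C U h ∧ ⁅w, pairing A U h⁆ = pairing A D h := by
  constructor <;> simp only [pairing, lie_sum] <;>
    refine Finset.sum_congr rfl fun a _ => Finset.sum_congr rfl fun b _ => ?_
  · rw [← hyA, Ring.lie_def, Ring.lie_def, mul_smul_comm, smul_mul_assoc, ← smul_sub, sub_mul,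
      mul_assoc (A a b) y, (hyU b a).eq]; simp only [mul_assoc]
  · rw [← hwU, Ring.lie_def, Ring.lie_def, mul_smul_comm, smul_mul_assoc, ← smul_sub, mul_sub,
      ← mul_assoc w, (hwA a b).eq]; simp only [mul_assoc]

/-- The bracket with `y` raises the degree of a current by one, while by the invariance `hinv` the
bracket with `u' w` gives minus the term one degree lower. The sum telescopes: only the top term and
the degree zero boundary survive, the latter because its coefficients are `h` instead of `1`. -/
theorem lie_truncated_pos (hyA : ∀ n a b, ⁅y, A n a b⁆ = C (n + 1) a b)
    (hwU : ∀ a b, ⁅w, U a b⁆ = D a b) (hyU : ∀ a b, Commute y (U a b))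
    (hwA : ∀ n a b, Commute w (A n a b)) (hinv : ∀ n, pairing (C n) U 1 + pairing (A n) D 1 = 0)
    (hu' : u' * u = 1) (huy : Commute u y) (huw : Commute u w) 
    (hu'A : ∀ n a b, Commute u' (A n a b)) (hu'U : ∀ a b, Commute u' (U a b))
    (hu'u : Commute u' u) (K : ℕ) :
    ⁅y + u' * w, truncated A U h u K⁆ = pairing (C 1) U h + u' * pairing (A 0) D h -
      pairing (C 1) U 1 + u ^ K * pairing (C (K + 1)) U 1 := by
  have hp : ∀ n h, ⁅y, pairing (A n) U h⁆ = pairing (C (n + 1)) U h := fun n h =>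
    (pairing_lie (hyA n) hwU hyU (hwA n)).1
  have hq : ∀ n h, ⁅w, pairing (A n) U h⁆ = pairing (A n) D h := fun n h =>
    (pairing_lie (hyA n) hwU hyU (hwA n)).2
  have hc : ∀ n h, Commute u' (pairing (A n) U h) := fun n h => pairing_commute h (hu'A n) hu'U
  have hs : ⁅y + u' * w, ∑ n ∈ Finset.range K, u ^ (n + 1) * pairing (A (n + 1)) U 1⁆ =
      ∑ n ∈ Finset.range K, (u ^ (n + 1) * pairing (C (n + 1 + 1)) U 1 -
        u ^ n * pairing (C (n + 1)) U 1) := by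
    rw [lie_sum]
    refine Finset.sum_congr rfl fun n _ => ?_
    rw [add_lie, lie_mul_right_of_commute (huy.pow_left _), hp, sub_eq_add_neg,
      lie_mul_left_of_commute ((hu'u.pow_right _).mul_right (hc _ _)),
      lie_mul_right_of_commute (huw.pow_left _), hq,
      eq_neg_of_add_eq_zero_right (hinv (n + 1)), pow_succ' u n, ← mul_assoc, ← mul_assoc,
      hu', one_mul, mul_neg]
  rw [truncated, lie_add, hs, Finset.sum_range_sub fun n => u ^ n * pairing (C (n + 1)) U 1, pow_zero, one_mul, add_lie, hp,
    lie_mul_left_of_commute (hc _ _), hq]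
  abel

/-- The same telescoping with `y` of degree `-1`. The family `Z` is the central term met when a
current of degree one is brought to degree zero. -/
theorem lie_truncated_neg (hyA : ∀ n a b, ⁅y, A (n + 1) a b⁆ = C n a b + if n = 0 then Z a b else 0)
    {C' : ι → ι → R} (hyA0 : ∀ a b, ⁅y, A 0 a b⁆ = C' a b)
    (hwU : ∀ a b, ⁅w, U a b⁆ = D a b) (hyU : ∀ a b, Commute y (U a b))
    (hwA : ∀ n a b, Commute w (A n a b)) (hinv : ∀ n, pairing (C n) U 1 + pairing (A n) D 1 = 0)
    (huy : Commute u y) (huw : Commute u w)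
    (huA : ∀ n a b, Commute u (A n a b)) (huU : ∀ a b, Commute u (U a b)) (K : ℕ) :
    ⁅y + u * w, truncated A U h u (K + 1)⁆ = pairing C' U h + u * pairing (A 0) D h +
      u * pairing (C 0) U 1 + u * pairing Z U 1 - u ^ (K + 2) * pairing (C (K + 1)) U 1 := by
  have hq : ∀ n h, ⁅w, pairing (A n) U h⁆ = pairing (A n) D h := fun n h =>
    (pairing_lie (y := 0) (C := 0) (by simp) hwU (by simp) (hwA n)).2
  have hp0 : ∀ h, ⁅y, pairing (A 0) U h⁆ = pairing C' U h := fun h =>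
    (pairing_lie hyA0 hwU hyU (hwA 0)).1
  have hp : ∀ n, ⁅y, pairing (A (n + 1)) U 1⁆ =
      pairing (C n) U 1 + if n = 0 then pairing Z U 1 else 0 := fun n => by
    rw [(pairing_lie (hyA n) hwU hyU (hwA (n + 1))).1]
    simp only [pairing, add_mul, smul_add, Finset.sum_add_distrib]
    split_ifs <;> simp
  have hc : ∀ n h, Commute u (pairing (A n) U h) := fun n h => pairing_commute h (huA n) huU
  have hs : ⁅y + u * w, ∑ n ∈ Finset.range (K + 1), u ^ (n + 1) * pairing (A (n + 1)) U 1⁆ =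
      u * pairing Z U 1 - ∑ n ∈ Finset.range (K + 1), (u ^ (n + 1 + 1) * pairing (C (n + 1)) U 1 -
        u ^ (n + 1) * pairing (C n) U 1) := by
    -- The truncation at `K + 1` guarantees that the current of degree one, hence the central term,
    -- is present.
    have hz : u * pairing Z U 1 = ∑ n ∈ Finset.range (K + 1), if n = 0 then u * pairing Z U 1 else 0 := by
      simp
    rw [lie_sum, hz, ← Finset.sum_sub_distrib]
    refine Finset.sum_congr rfl fun n _ => ?_
    rw [add_lie, lie_mul_right_of_commute (huy.pow_left _), hp,
      lie_mul_left_of_commute (((Commute.refl u).pow_right _).mul_right (hc _ _)),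
      lie_mul_right_of_commute (huw.pow_left _), hq,
      eq_neg_of_add_eq_zero_right (hinv (n + 1)), ← mul_assoc, ← pow_succ', mul_neg, mul_add]
    split_ifs with hn
    · subst hn; rw [zero_add, pow_one]; abel
    · rw [mul_zero]; abel
  rw [truncated, lie_add, hs, Finset.sum_range_sub fun n => u ^ (n + 1) * pairing (C n) U 1, zero_add, pow_one, add_lie, hp0,
    lie_mul_left_of_commute (hc _ _), hq]
  abel

end Derived

/-! ### Functions on the configuration space -/

section Functions

variable {N : ℕ}

theorem Hol.perm_mul (w w' : Equiv.Perm (Fin N)) (f : Hol N) :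
    Hol.perm (w * w') f = Hol.perm w (Hol.perm w' f) := rfl

theorem Hol.perm_one (f : Hol N) : Hol.perm 1 f = f := rfl

theorem Hol.perm_coord (w : Equiv.Perm (Fin N)) (i : Fin N) :
    Hol.perm w (Hol.coord i : Hol N) = Hol.coord (w i) := rfl

theorem Hol.perm_coord_inv (w : Equiv.Perm (Fin N)) (i : Fin N) :
    Hol.perm w ((Hol.coord i)⁻¹ : (Hol N)ˣ) = ((Hol.coord (w i))⁻¹ : (Hol N)ˣ) := rfl

theorem Hol.extend_eventuallyEq (f : Hol N) {F : (Fin N → ℂ) → ℂ}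
    (h : ∀ z : configSpace N, F z = f.1 z) (z : configSpace N) : f.extend =ᶠ[nhds z.1] F := by
  filter_upwards [(isOpen_configSpace N).mem_nhds z.2] with w hw
  exact (Hol.extend_apply f ⟨w, hw⟩).trans (h ⟨w, hw⟩).symm

theorem Hol.euler_apply (i : Fin N) (f : Hol N) (z : configSpace N) :
    (Hol.euler i f).1 z = z.1 i * fderiv ℂ f.extend z.1 (Pi.single i 1) := rfl

theorem Hol.perm_euler (w : Equiv.Perm (Fin N)) (i : Fin N) (f : Hol N) :
    Hol.perm w (Hol.euler i f) = Hol.euler (w i) (Hol.perm w f) := by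
  ext z
  set L : (Fin N → ℂ) →L[ℂ] (Fin N → ℂ) := ContinuousLinearMap.pi fun i =>
    ContinuousLinearMap.proj (R := ℂ) (φ := fun _ : Fin N => ℂ) (w i) with hL
  have hLz : ∀ y, L y = y ∘ w := fun _ => rfl
  have e : (Hol.perm w f).extend =ᶠ[nhds z.1] f.extend ∘ L := by
    refine Hol.extend_eventuallyEq _ (fun y => ?_) z
    exact Hol.extend_apply f ⟨y.1 ∘ w, perm_mem_configSpace w y.2⟩
  have hd : DifferentiableAt ℂ f.extend (L z.1) :=
    (f.analyticOnNhd _ (perm_mem_configSpace w z.2)).differentiableAt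
  have h1 : (Hol.perm w (Hol.euler i f)).1 z =
    z.1 (w i) * fderiv ℂ f.extend (z.1 ∘ w) (Pi.single i 1) := rfl
  rw [h1, Hol.euler_apply, e.fderiv_eq, fderiv_comp _ hd L.differentiableAt, L.fderiv]
  congr 1
  change _ = fderiv ℂ f.extend (z.1 ∘ w) (L (Pi.single (w i) 1))
  congr 1
  rw [hLz]
  ext k
  by_cases hk : k = i
  · subst hk; simp
  · rw [Function.comp_apply, Pi.single_eq_of_ne hk, Pi.single_eq_of_ne (w.injective.ne hk)]

/-- For `i ≠ j` the factor `z_j` is constant in the direction `i`, so both sides are `z_i z_j` times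
a second derivative, which is symmetric by analyticity. -/
theorem Hol.euler_comm (i j : Fin N) (f : Hol N) :
    Hol.euler i (Hol.euler j f) = Hol.euler j (Hol.euler i f) := by
  by_cases hij : i = j
  · rw [hij]
  have key : ∀ i j : Fin N, i ≠ j → ∀ z : configSpace N, (Hol.euler i (Hol.euler j f)).1 z =
      z.1 i * (z.1 j * fderiv ℂ (fderiv ℂ f.extend) z.1 (Pi.single i 1) (Pi.single j 1)) := by
    intro i j hij z
    have e : (Hol.euler j f).extend =ᶠ[nhds z.1]
        fun y => y j * fderiv ℂ f.extend y (Pi.single j 1) :=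
      Hol.extend_eventuallyEq _ (fun y => rfl) z
    have hd : DifferentiableAt ℂ (fderiv ℂ f.extend) z.1 :=
      (f.analyticOnNhd.fderiv _ z.2).differentiableAt
    have h1 : HasFDerivAt (fun y : Fin N → ℂ => y j)
        (ContinuousLinearMap.proj (R := ℂ) (φ := fun _ : Fin N => ℂ) j) z.1 :=
      (ContinuousLinearMap.proj (R := ℂ) (φ := fun _ : Fin N => ℂ) j).hasFDerivAt
    have h2 : HasFDerivAt (fun y => fderiv ℂ f.extend y (Pi.single j 1))
        ((ContinuousLinearMap.apply ℂ ℂ (Pi.single j 1 : Fin N → ℂ)) ∘L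
          (fderiv ℂ (fderiv ℂ f.extend) z.1)) z.1 :=
      (ContinuousLinearMap.apply ℂ ℂ (Pi.single j 1 : Fin N → ℂ)).hasFDerivAt.comp z.1
        hd.hasFDerivAt
    rw [Hol.euler_apply, e.fderiv_eq, (h1.fun_mul h2).fderiv]
    simp [Pi.single_eq_of_ne (Ne.symm hij)]
  ext z
  have hsymm : IsSymmSndFDerivAt ℂ f.extend z.1 :=
    ((f.analyticOnNhd _ z.2).contDiffAt (n := ⊤)).isSymmSndFDerivAt (by simp)
  have := key i j hij z
  have h' := key j i (Ne.symm hij) z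
  rw [this, h', hsymm.eq]
  ring

/-- The function `z_i / (z_i - z_j)`. -/
def phi (i j : Fin N) : Hol N := Ring.inverse (1 - ratio j i)

theorem phi_apply {i j : Fin N} (h : i ≠ j) (z : configSpace N) :
    (phi i j).1 z = z.1 i / (z.1 i - z.1 j) := by
  have e : (1 - ratio j i) * phi i j = 1 := Ring.mul_inverse_cancel _ (isUnit_one_sub_ratio h.symm)
  have := congrArg (fun f : Hol N => f.1 z) e
  change (1 - z.1 j * (z.1 i)⁻¹) * (phi i j).1 z = 1 at this
  have hi := z.2.1 i
  have hij : z.1 i - z.1 j ≠ 0 := sub_ne_zero.mpr (z.2.2 i j h)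
  rw [eq_div_iff hij]
  field_simp at this
  linear_combination this

theorem phi_mul {i j : Fin N} (h : i ≠ j) :
    phi i j * ((Hol.coord i : Hol N) - Hol.coord j) = Hol.coord i := by
  ext z
  change (phi i j).1 z * (z.1 i - z.1 j) = z.1 i
  rw [phi_apply h, div_mul_cancel₀ _ (sub_ne_zero.mpr (z.2.2 i j h))]

theorem phi_mul_inv {i j : Fin N} (h : i ≠ j) :
    phi i j * (((Hol.coord j)⁻¹ : (Hol N)ˣ) - ((Hol.coord i)⁻¹ : (Hol N)ˣ) : Hol N) =
      ((Hol.coord j)⁻¹ : (Hol N)ˣ) := by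
  ext z
  change (phi i j).1 z * ((z.1 j)⁻¹ - (z.1 i)⁻¹) = (z.1 j)⁻¹
  rw [phi_apply h]
  have hi := z.2.1 i
  have hj := z.2.1 j
  have hij : z.1 i - z.1 j ≠ 0 := sub_ne_zero.mpr (z.2.2 i j h)
  field_simp

theorem phi_add {i j : Fin N} (h : i ≠ j) : phi i j + phi j i = 1 := by
  ext z
  change (phi i j).1 z + (phi j i).1 z = 1
  rw [phi_apply h, phi_apply h.symm]
  have hij : z.1 i - z.1 j ≠ 0 := sub_ne_zero.mpr (z.2.2 i j h)
  have hji : z.1 j - z.1 i ≠ 0 := sub_ne_zero.mpr (z.2.2 j i h.symm)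
  field_simp
  ring

theorem ratio_mul_inverse {i j : Fin N} (h : i ≠ j) :
    ratio i j * Ring.inverse (1 - ratio i j) = - phi i j := by
  ext z
  change z.1 i * (z.1 j)⁻¹ * (phi j i).1 z = - (phi i j).1 z
  rw [phi_apply h, phi_apply h.symm]
  have hj := z.2.1 j
  have hij : z.1 i - z.1 j ≠ 0 := sub_ne_zero.mpr (z.2.2 i j h)
  have hji : z.1 j - z.1 i ≠ 0 := sub_ne_zero.mpr (z.2.2 j i h.symm)
  field_simp
  ring

theorem perm_phi (w : Equiv.Perm (Fin N)) {i j : Fin N} (h : i ≠ j) :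
    Hol.perm w (phi i j) = phi (w i) (w j) := by
  ext z
  have := phi_apply h ⟨z.1 ∘ w, perm_mem_configSpace w z.2⟩
  rw [phi_apply (w.injective.ne h)]
  exact this

theorem isUnit_coord_sub {i j : Fin N} (h : i ≠ j) :
    IsUnit ((Hol.coord i : Hol N) - Hol.coord j) :=
  Hol.isUnit_of_ne_zero _ fun z => sub_ne_zero.mpr (z.2.2 i j h)

theorem Hol.euler_coord (i j : Fin N) :
    Hol.euler i (Hol.coord j : Hol N) = if i = j then (Hol.coord j : Hol N) else 0 :=
  TorusAlgebra.euler_coord i j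

theorem euler_phi_of_ne {i j k : Fin N} (h : i ≠ j) (hi : k ≠ i) (hj : k ≠ j) :
    Hol.euler k (phi i j) = 0 := by
  have := congrArg (Hol.euler k) (phi_mul h)
  rw [Derivation.leibniz, map_sub, Hol.euler_coord, Hol.euler_coord, if_neg hi, if_neg hj, sub_zero,
    smul_zero, zero_add, smul_eq_mul] at this
  exact (isUnit_coord_sub h).mul_right_eq_zero.mp this

/-- Here `φ_ij` is homogeneous of degree zero in `z_i, z_j`. It is enough to differentiate `φ_ij
(z_i - z_j) = z_i` and to cancel the unit `z_i - z_j`. -/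
theorem euler_phi_add {i j : Fin N} (h : i ≠ j) :
    Hol.euler i (phi i j) + Hol.euler j (phi i j) = 0 := by
  have h1 := congrArg (Hol.euler i) (phi_mul h)
  have h2 := congrArg (Hol.euler j) (phi_mul h)
  rw [Derivation.leibniz, map_sub, Hol.euler_coord, Hol.euler_coord] at h1 h2
  rw [if_pos rfl, if_neg h, smul_eq_mul, smul_eq_mul] at h1
  rw [if_pos rfl, if_neg h.symm, smul_eq_mul, smul_eq_mul] at h2
  have h3 := phi_mul h
  refine (isUnit_coord_sub h).mul_right_eq_zero.mp ?_
  linear_combination h1 + h2 - h3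

theorem euler_logDeriv_one_sub_ratio (k : Fin N) {i j : Fin N} (h : i ≠ j) :
    Hol.euler k (1 - ratio j i) * Ring.inverse (1 - ratio j i) =
      ((if k = i then 1 else 0) - if k = j then 1 else 0) * (phi i j - 1) := by
  have hu := isUnit_one_sub_ratio (N := N) h.symm
  have hr : ratio j i * Hol.coord i = (Hol.coord j : Hol N) := by
    rw [ratio, mul_assoc, Units.inv_mul, mul_one]
  have h1 := congrArg (Hol.euler k) hr
  rw [Derivation.leibniz, Hol.euler_coord, Hol.euler_coord, smul_eq_mul, smul_eq_mul] at h1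
  have h2 : Hol.euler k (ratio j i) = ((if k = j then 1 else 0) - if k = i then 1 else 0) * ratio j i := by
    refine (Hol.coord i).isUnit.mul_left_cancel ?_
    split_ifs at h1 ⊢ <;> first | linear_combination h1 | linear_combination h1 - hr
  have h3 : (1 - ratio j i) * Ring.inverse (1 - ratio j i) = 1 := Ring.mul_inverse_cancel _ hu
  rw [map_sub, Derivation.map_one_eq_zero, h2, phi]
  linear_combination (((if k = i then 1 else 0) - if k = j then 1 else 0) : Hol N) * -h3

theorem logDeriv_prod {S ι : Type*} [CommRing S] [Algebra ℂ S] [DecidableEq ι] (D : Derivation ℂ S S)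
    (s : Finset ι) (f : ι → S) (h : ∀ i ∈ s, IsUnit (f i)) :
    D (∏ i ∈ s, f i) * Ring.inverse (∏ i ∈ s, f i) = ∑ i ∈ s, D (f i) * Ring.inverse (f i) := by
  induction s using Finset.induction_on with
  | empty => simp
  | insert a s ha ih =>
    have hs := ih fun i hi => h i (Finset.mem_insert_of_mem hi)
    have h1 := Ring.mul_inverse_cancel _ (h a (Finset.mem_insert_self a s))
    have h2 : (∏ i ∈ s, f i) * Ring.inverse (∏ i ∈ s, f i) = 1 :=
      Ring.mul_inverse_cancel _ ((IsUnit.prod_iff).mpr fun i hi => h i (Finset.mem_insert_of_mem hi))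
    rw [Finset.prod_insert ha, Finset.sum_insert ha, ← hs, Ring.mul_inverse_rev, Derivation.leibniz,
      smul_eq_mul, smul_eq_mul]
    linear_combination (D (∏ i ∈ s, f i) * Ring.inverse (∏ i ∈ s, f i)) * h1 +
      (D (f a) * Ring.inverse (f a)) * h2

theorem sum_offDiag {E : Type*} [AddCommMonoid E] (g : Fin N → Fin N → E) :
    ∑ p ∈ (Finset.univ : Finset (Fin N)).offDiag, g p.1 p.2 =
      ∑ i, ∑ j ∈ Finset.Ioi i, (g i j + g j i) := by
  have h1 : ∑ i, ∑ j ∈ Finset.Ioi i, g j i = ∑ i, ∑ j ∈ Finset.Iio i, g i j := by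
    rw [Finset.sum_comm' (t' := Finset.univ) (s' := fun j => Finset.Iio j)]
    simp
  simp only [Finset.sum_add_distrib, h1]
  have h2 : (Finset.univ : Finset (Fin N)).offDiag =
      (Finset.univ ×ˢ Finset.univ).filter fun p => p.1 ≠ p.2 := by
    ext p; simp
  rw [← Finset.sum_add_distrib, h2, Finset.sum_filter, Finset.sum_product]
  refine Finset.sum_congr rfl fun i _ => ?_
  rw [← Finset.sum_filter, add_comm, ← Finset.sum_disjUnion (Finset.disjoint_left.mpr fun j h h' =>
    lt_asymm (Finset.mem_Iio.mp h) (Finset.mem_Ioi.mp h'))]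
  refine Finset.sum_congr ?_ fun _ _ => rfl
  ext j
  simp [lt_or_lt_iff_ne, eq_comm]

/-- The roots `α` and `-α` contribute `α(ξ)(φ_ij - 1)` and `-α(ξ)(φ_ji - 1)`, and `φ_ij + φ_ji = 1`.
-/
theorem logDeriv_discriminant (ξ : Fin N → ℂ) :
    eulerAlong ξ (discriminant N) * Ring.inverse (discriminant N) =
      ∑ i, ∑ j ∈ Finset.Ioi i, (ξ i - ξ j) • (2 * phi i j - 1) := by
  have h1 : ∀ k, Hol.euler k (discriminant N) * Ring.inverse (discriminant N) =
      ∑ p ∈ (Finset.univ : Finset (Fin N)).offDiag,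
        ((if k = p.1 then 1 else 0) - if k = p.2 then 1 else 0) * (phi p.1 p.2 - 1) := by
    intro k
    rw [discriminant, logDeriv_prod _ _ _ fun p hp =>
      isUnit_one_sub_ratio (Finset.mem_offDiag.mp hp).2.2.symm]
    exact Finset.sum_congr rfl fun p hp =>
      euler_logDeriv_one_sub_ratio k (Finset.mem_offDiag.mp hp).2.2
  have h2 : ∀ p : Fin N × Fin N, ∑ k, ξ k • ((((if k = p.1 then 1 else 0) -
      if k = p.2 then 1 else 0) * (phi p.1 p.2 - 1) : Hol N)) =
      (ξ p.1 - ξ p.2) • (phi p.1 p.2 - 1) := by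
    intro p
    simp only [sub_mul, smul_sub, Finset.sum_sub_distrib, ite_mul, one_mul, zero_mul, smul_ite,
      smul_zero, Finset.sum_ite_eq', Finset.mem_univ, if_true, sub_smul]
    abel
  rw [eulerAlong, Finset.sum_mul]
  simp only [smul_mul_assoc, h1, Finset.smul_sum]
  rw [Finset.sum_comm]
  simp only [h2]
  rw [sum_offDiag fun i j => (ξ i - ξ j) • (phi i j - 1)]
  refine Finset.sum_congr rfl fun i _ => Finset.sum_congr rfl fun j hj => ?_
  have := phi_add (Finset.mem_Ioi.mp hj).ne
  rw [← eq_sub_iff_add_eq'] at this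
  rw [this, two_mul]
  module

/-- The divided difference `f ↦ z_i (f - s_{ij} f) / (z_i - z_j)`. -/
def divDiff (i j : Fin N) : Module.End ℂ (Hol N) :=
  LinearMap.mul ℂ (Hol N) (phi i j) * (1 - (Hol.perm (Equiv.swap i j)).toLinearMap)

theorem divDiff_eq (i j : Fin N) (f : Hol N) :
    divDiff i j f = phi i j * (f - Hol.perm (Equiv.swap i j) f) := rfl

/-- The extra permutation `w` is there because an iterated divided difference evaluates the inner
one at permuted points. -/
theorem divDiff_apply {i j : Fin N} (h : i ≠ j) (f : Hol N) (z : configSpace N)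
    (w : Equiv.Perm (Fin N)) :
    (Hol.perm w (divDiff i j f)).1 z = z.1 (w i) / (z.1 (w i) - z.1 (w j)) *
      ((Hol.perm w f).1 z - (Hol.perm (w * Equiv.swap i j) f).1 z) := by
  rw [divDiff_eq, map_mul, map_sub, perm_phi w h, ← Hol.perm_mul]
  exact congrArg (· * _) (phi_apply (w.injective.ne h) z)

theorem divDiff_apply_one {i j : Fin N} (h : i ≠ j) (f : Hol N) (z : configSpace N) :
    (divDiff i j f).1 z = z.1 i / (z.1 i - z.1 j) *
      (f.1 z - (Hol.perm (Equiv.swap i j) f).1 z) :=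
  divDiff_apply h f z 1

/-- The six products of two distinct transpositions among three letters are only two three-cycles.
The equalities rewrite them to two normal forms, so that equal permutations become equal
expressions. -/
theorem swap_mul_swap_rotate {i j k : Fin N} (hij : i ≠ j) (hik : i ≠ k) (hjk : j ≠ k) :
    Equiv.swap j k * Equiv.swap i j = Equiv.swap i j * Equiv.swap i k ∧
      Equiv.swap i k * Equiv.swap j k = Equiv.swap i j * Equiv.swap i k ∧
      Equiv.swap i j * Equiv.swap j k = Equiv.swap i k * Equiv.swap i j ∧
      Equiv.swap j k * Equiv.swap i k = Equiv.swap i k * Equiv.swap i j := by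
  have key : ∀ a b c d : Fin N, Equiv.swap a b * Equiv.swap c d =
      Equiv.swap (Equiv.swap a b c) (Equiv.swap a b d) * Equiv.swap a b := fun a b c d =>
    Equiv.mul_swap_eq_swap_mul _ _ _
  have h3 : Equiv.swap i j * Equiv.swap j k = Equiv.swap i k * Equiv.swap i j := by
    rw [key i j j k, Equiv.swap_apply_right, Equiv.swap_apply_of_ne_of_ne hik.symm hjk.symm]
  refine ⟨?_, ?_, h3, ?_⟩
  · rw [key i j i k, Equiv.swap_apply_left, Equiv.swap_apply_of_ne_of_ne hik.symm hjk.symm]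
  · rw [key i k j k, Equiv.swap_apply_right, Equiv.swap_apply_of_ne_of_ne hij.symm hjk,
      Equiv.swap_comm j i]
  · rw [key j k i k, Equiv.swap_apply_right, Equiv.swap_apply_of_ne_of_ne hij hik, h3]

/-- Evaluated at a point, both sides are combinations of values of `f` at permuted points with
rational coefficients. Once the permutations are in normal form, the coefficients agree as rational
functions of `z_i, z_j, z_k`. -/
theorem divDiff_braid {i j k : Fin N} (hij : i ≠ j) (hik : i ≠ k) (hjk : j ≠ k) :
    divDiff i j * divDiff i k - divDiff j k * divDiff i j + divDiff i k * divDiff j k =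
        divDiff i k ∧
      divDiff i k * divDiff i j - divDiff i j * divDiff j k + divDiff j k * divDiff i k =
        divDiff i k := by
  obtain ⟨e1, e2, e3, e4⟩ := swap_mul_swap_rotate hij hik hjk
  have s1 : Equiv.swap i j k = k := Equiv.swap_apply_of_ne_of_ne hik.symm hjk.symm
  have s2 : Equiv.swap i k j = j := Equiv.swap_apply_of_ne_of_ne hij.symm hjk
  have s3 : Equiv.swap j k i = i := Equiv.swap_apply_of_ne_of_ne hij hik
  constructor <;>
  · refine LinearMap.ext fun f => Subtype.ext (funext fun z => ?_)
    have h1 : z.1 i - z.1 j ≠ 0 := sub_ne_zero.mpr (z.2.2 i j hij)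
    have h2 : z.1 i - z.1 k ≠ 0 := sub_ne_zero.mpr (z.2.2 i k hik)
    have h3 : z.1 j - z.1 k ≠ 0 := sub_ne_zero.mpr (z.2.2 j k hjk)
    have h1' : z.1 j - z.1 i ≠ 0 := sub_ne_zero.mpr (z.2.2 j i hij.symm)
    have h2' : z.1 k - z.1 i ≠ 0 := sub_ne_zero.mpr (z.2.2 k i hik.symm)
    have h3' : z.1 k - z.1 j ≠ 0 := sub_ne_zero.mpr (z.2.2 k j hjk.symm)
    change (divDiff _ _ (divDiff _ _ f)).1 z - (divDiff _ _ (divDiff _ _ f)).1 z +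
      (divDiff _ _ (divDiff _ _ f)).1 z = (divDiff i k f).1 z
    simp only [divDiff_apply_one hij, divDiff_apply_one hik, divDiff_apply_one hjk,
      divDiff_apply hij, divDiff_apply hik, divDiff_apply hjk, e1, e2, e3, e4, s1, s2, s3,
      Equiv.swap_apply_left, Equiv.swap_apply_right]
    field_simp
    ring

end Functions

/-! ### Matrices acting on the tensor power -/

section Sites

variable {N m : ℕ}

/-- A matrix acting on the `i`-th factor of the tensor power. -/
def siteMat (N m : ℕ) (i : Fin N) : Matrix (Fin m) (Fin m) ℂ →ₗ[ℂ] Module.End ℂ (VecPower N m) :=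
  (PiTensorProduct.mapMultilinear ℂ (fun _ : Fin N => Fin m → ℂ)
      (fun _ : Fin N => Fin m → ℂ)).toLinearMap (fun _ => LinearMap.id) i ∘ₗ
    (Matrix.toLin' (R := ℂ) (m := Fin m) (n := Fin m)).toLinearMap

theorem siteMat_tprod (i : Fin N) (M : Matrix (Fin m) (Fin m) ℂ) (v : Fin N → Fin m → ℂ) :
    siteMat N m i M (PiTensorProduct.tprod ℂ v) =
      PiTensorProduct.tprod ℂ (Function.update v i (M.mulVec (v i))) := by
  change PiTensorProduct.map _ _ = _
  rw [PiTensorProduct.map_tprod]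
  congr 1
  ext1 k
  by_cases hk : k = i
  · subst hk; simp
  · simp [Function.update_of_ne hk]

theorem siteMat_mul (i : Fin N) (M M' : Matrix (Fin m) (Fin m) ℂ) :
    siteMat N m i (M * M') = siteMat N m i M * siteMat N m i M' := by
  refine PiTensorProduct.ext (MultilinearMap.ext fun v => ?_)
  simp [siteMat_tprod]

theorem siteMat_one (i : Fin N) : siteMat N m i 1 = 1 := by
  refine PiTensorProduct.ext (MultilinearMap.ext fun v => ?_)
  simp [siteMat_tprod]

theorem siteMat_commute {i j : Fin N} (h : i ≠ j) (M M' : Matrix (Fin m) (Fin m) ℂ) :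
    Commute (siteMat N m i M) (siteMat N m j M') := by
  refine PiTensorProduct.ext (MultilinearMap.ext fun v => ?_)
  simp [siteMat_tprod, Function.update_of_ne h, Function.update_of_ne h.symm, Function.update_comm h]

/-- The permutation of the factors of the tensor power. -/
def permVec (N m : ℕ) (w : Equiv.Perm (Fin N)) : Module.End ℂ (VecPower N m) :=
  (PiTensorProduct.reindex ℂ (fun _ : Fin N => Fin m → ℂ) w).toLinearMap

theorem permVec_tprod (w : Equiv.Perm (Fin N)) (v : Fin N → Fin m → ℂ) :
    permVec N m w (PiTensorProduct.tprod ℂ v) = PiTensorProduct.tprod ℂ (fun i => v (w.symm i)) :=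
  PiTensorProduct.reindex_tprod w v

theorem permVec_mul (w w' : Equiv.Perm (Fin N)) :
    permVec N m (w * w') = permVec N m w * permVec N m w' := by
  refine PiTensorProduct.ext (MultilinearMap.ext fun v => ?_)
  simp [permVec_tprod]
  rfl

theorem permVec_one : permVec N m 1 = 1 := by
  refine PiTensorProduct.ext (MultilinearMap.ext fun v => ?_)
  simp [permVec_tprod]
  rfl

theorem permVec_siteMat (w : Equiv.Perm (Fin N)) (i : Fin N) (M : Matrix (Fin m) (Fin m) ℂ) :
    permVec N m w * siteMat N m i M = siteMat N m (w i) M * permVec N m w := by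
  refine PiTensorProduct.ext (MultilinearMap.ext fun v => ?_)
  simp only [LinearMap.compMultilinearMap_apply, Module.End.mul_apply, siteMat_tprod, permVec_tprod]
  congr 1
  ext1 k
  by_cases hk : k = w i
  · subst hk; simp
  · rw [Function.update_of_ne hk, Function.update_of_ne]
    exact fun h => hk (by rw [← h, Equiv.apply_symm_apply])

/-- Expanding the `i`-th and `j`-th vectors in the standard basis shows that `∑ E_ab ⊗ E_ba`
exchanges them. -/
theorem sum_siteMat_swap {i j : Fin N} (h : i ≠ j) :
    ∑ a, ∑ b, siteMat N m i (Matrix.single a b 1) * siteMat N m j (Matrix.single b a 1) =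
      permVec N m (Equiv.swap i j) := by
  refine PiTensorProduct.ext (MultilinearMap.ext fun v => ?_)
  have h1 : ∀ a b, Function.update v j ((Matrix.single b a (1 : ℂ)).mulVec (v j)) i = v i :=
    fun a b => Function.update_of_ne h _ _
  have h2 : ∀ (a b : Fin m) (x : Fin m → ℂ),
      (Matrix.single a b (1 : ℂ)).mulVec x = x b • Pi.single a 1 := by
    intro a b x
    ext c
    simp [Matrix.single_mulVec, Pi.single_apply, Function.update_apply]
  have h3 : ∀ x : Fin m → ℂ, ∑ a, x a • (Pi.single a 1 : Fin m → ℂ) = x := by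
    intro x
    ext c
    simp [Finset.sum_apply, Pi.single_apply]
  simp only [LinearMap.compMultilinearMap_apply, LinearMap.sum_apply, Module.End.mul_apply,
    siteMat_tprod, permVec_tprod]
  simp only [h1]
  simp only [h2]
  -- The exchanged tuple is written with both vectors expanded in the standard basis, so that
  -- multilinearity yields the same double sum.
  have h4 : (fun k => v ((Equiv.swap i j).symm k)) =
      Function.update (Function.update v j (∑ b, v i b • (Pi.single b 1 : Fin m → ℂ))) i
        (∑ a, v j a • (Pi.single a 1 : Fin m → ℂ)) := by
    rw [h3, h3]
    ext1 k
    by_cases hk : k = i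
    · subst hk; simp
    · rw [Function.update_of_ne hk]
      by_cases hk' : k = j
      · subst hk'; simp
      · rw [Function.update_of_ne hk', Equiv.symm_swap, Equiv.swap_apply_of_ne_of_ne hk hk']
  have h5 : ∀ (s t : ℂ) (x y : Fin m → ℂ), PiTensorProduct.tprod ℂ
      (Function.update (Function.update v j (s • x)) i (t • y)) =
      (t * s) • PiTensorProduct.tprod ℂ (Function.update (Function.update v j x) i y) := by
    intro s t x y
    rw [MultilinearMap.map_update_smul, Function.update_comm h.symm, MultilinearMap.map_update_smul,
      Function.update_comm h, smul_smul]
  rw [h4, MultilinearMap.map_update_sum]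
  refine Finset.sum_congr rfl fun a _ => ?_
  rw [Function.update_comm h.symm, MultilinearMap.map_update_sum]
  refine Finset.sum_congr rfl fun b _ => ?_
  rw [Function.update_comm h, h5, h5, mul_comm]

end Sites

/-! ### Laurent polynomials as functions -/

section Laurent

variable {N : ℕ}

theorem weightDerivation_coeff {M : Type*} [AddCommMonoid M] (φ : M →+ ℂ) (f : AddMonoidAlgebra ℂ M)
    (η : M) : (weightDerivation φ f).coeff η = φ η * f.coeff η := by
  induction f using AddMonoidAlgebra.induction_linear with
  | zero => simp
  | add f g hf hg => simp [hf, hg, mul_add]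
  | single η' r =>
    have e : (AddMonoidAlgebra.single η' r : AddMonoidAlgebra ℂ M)
        = r • AddMonoidAlgebra.single η' 1 := by simp
    classical
    rw [e, (weightDerivation φ).map_smul, weightDerivation_single]
    by_cases h : η' = η
    · subst h; simp; ring
    · simp [AddMonoidAlgebra.coeff_single, h]

theorem laurentToHol_single (η : Fin N → ℤ) (r : ℂ) :
    laurentToHol N (AddMonoidAlgebra.single η r) =
      r • ((coordMonomial (Hol N) (Multiplicative.ofAdd η) : (Hol N)ˣ) : Hol N) := by
  rw [laurentToHol, AddMonoidAlgebra.lift_single]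
  rfl

theorem laurentToHol_single_one (η : Fin N → ℤ) :
    laurentToHol N (AddMonoidAlgebra.single η 1) =
      ((coordMonomial (Hol N) (Multiplicative.ofAdd η) : (Hol N)ˣ) : Hol N) := by
  rw [laurentToHol_single, one_smul]

theorem coordMonomial_single {S : Type*} [CommRing S] [Algebra ℂ S] [TorusAlgebra N S] (i : Fin N)
    (n : ℤ) : coordMonomial S (Multiplicative.ofAdd (Pi.single i n)) =
      (TorusAlgebra.coord i : Sˣ) ^ n := by
  change ∏ j, (TorusAlgebra.coord j : Sˣ) ^ ((Pi.single i n : Fin N → ℤ) j) = _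
  rw [Finset.prod_eq_single i]
  · simp
  · intro j _ hj; simp [Pi.single_eq_of_ne hj]
  · simp

theorem Derivation.apply_zpow {S : Type*} [CommRing S] [Algebra ℂ S] (D : Derivation ℂ S S) (u : Sˣ)
    (k : ℂ) (h : D u = k • (u : S)) (n : ℤ) :
    D ((u ^ n : Sˣ) : S) = ((n : ℂ) * k) • ((u ^ n : Sˣ) : S) := by
  have step : ∀ n : ℤ, D ((u ^ (n + 1) : Sˣ) : S) =
      (u : S) * D ((u ^ n : Sˣ) : S) + k • ((u ^ (n + 1) : Sˣ) : S) := by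
    intro n
    rw [zpow_add_one, Units.val_mul, Derivation.leibniz, h, smul_eq_mul, smul_eq_mul, mul_smul_comm,
      add_comm]
  induction n using Int.induction_on with
  | zero => simp
  | succ n ih =>
    rw [step, ih, mul_smul_comm, mul_comm (u : S), ← Units.val_mul, ← zpow_add_one, ← add_smul]
    push_cast; congr 1; ring
  | pred n ih =>
    have := step (-n - 1)
    rw [sub_add_cancel, ih] at this
    refine u.isUnit.mul_left_cancel ?_
    rw [← sub_eq_iff_eq_add] at this
    rw [← this, mul_smul_comm, mul_comm (u : S), ← Units.val_mul, ← zpow_add_one, sub_add_cancel,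
      ← sub_smul]
    push_cast; congr 1; ring

theorem euler_coordMonomial {S : Type*} [CommRing S] [Algebra ℂ S] [TorusAlgebra N S] (i : Fin N)
    (η : Fin N → ℤ) :
    TorusAlgebra.euler i ((coordMonomial S (Multiplicative.ofAdd η) : Sˣ) : S) =
      (η i : ℂ) • ((coordMonomial S (Multiplicative.ofAdd η) : Sˣ) : S) := by
  have h1 : ∀ j, TorusAlgebra.euler i (((TorusAlgebra.coord j : Sˣ) ^ η j : Sˣ) : S) =
      (if i = j then (η j : ℂ) else 0) • (((TorusAlgebra.coord j : Sˣ) ^ η j : Sˣ) : S) := by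
    intro j
    rw [Derivation.apply_zpow _ _ (if i = j then 1 else 0)]
    · split_ifs <;> simp
    · rw [TorusAlgebra.euler_coord]; split_ifs <;> simp
  have h2 : ∀ s : Finset (Fin N), TorusAlgebra.euler i
      (∏ j ∈ s, (((TorusAlgebra.coord j : Sˣ) ^ η j : Sˣ) : S)) =
      (∑ j ∈ s, if i = j then (η j : ℂ) else 0) •
        ∏ j ∈ s, (((TorusAlgebra.coord j : Sˣ) ^ η j : Sˣ) : S) := by
    intro s
    induction s using Finset.induction_on with
    | empty => simp
    | insert a s ha ih =>
      rw [Finset.prod_insert ha, Derivation.leibniz, ih, h1, Finset.sum_insert ha, smul_eq_mul,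
        smul_eq_mul, mul_smul_comm, mul_smul_comm, add_smul, mul_comm, add_comm]
  have h3 : ((coordMonomial S (Multiplicative.ofAdd η) : Sˣ) : S) =
      ∏ j, (((TorusAlgebra.coord j : Sˣ) ^ η j : Sˣ) : S) := Units.coe_prod _ _
  rw [h3, h2]
  simp

theorem laurentToHol_euler (i : Fin N) (f : Laurent N) :
    laurentToHol N (TorusAlgebra.euler i f) = Hol.euler i (laurentToHol N f) := by
  induction f using AddMonoidAlgebra.induction_linear with
  | zero => simp
  | add f g hf hg => simp only [map_add, hf, hg]
  | single η r =>
    have e : (AddMonoidAlgebra.single η r : Laurent N) = r • AddMonoidAlgebra.single η 1 := by simp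
    rw [e, (TorusAlgebra.euler i).map_smul, map_smul, map_smul, (Hol.euler i).map_smul]
    congr 1
    rw [laurentToHol_single_one]
    refine Eq.trans ?_ (euler_coordMonomial (S := Hol N) i η).symm
    change laurentToHol N (weightDerivation _ _) = _
    rw [weightDerivation_single, map_smul, laurentToHol_single_one]
    rfl

/-- Monomials are separated by the eigenvalues of the operators `z_i ∂_i`. If `f` in the kernel has
exponents `η ≠ η'` differing at `i`, then `z_i ∂_i f - η_i f` is in the kernel, has lost the
exponent `η` and still contains `η'`, which contradicts induction on the size of the support. A
single monomial maps to a unit of a nonzero ring. -/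
theorem laurentToHol_injective : Function.Injective (laurentToHol N) := by
  rw [injective_iff_map_eq_zero]
  suffices H : ∀ (n : ℕ) (f : Laurent N), f.coeff.support.card = n → laurentToHol N f = 0 → f = 0 from
    fun f hf => H _ f rfl hf
  intro n
  induction n using Nat.strong_induction_on with
  | _ n ih =>
  intro f hn hf
  by_contra hf0
  have hne : f.coeff.support.Nonempty := by
    rw [Finsupp.support_nonempty_iff]
    intro h
    exact hf0 (AddMonoidAlgebra.coeff_injective (by rw [h]; rfl))
  obtain ⟨η, hη⟩ := hne
  by_cases hall : ∀ η' ∈ f.coeff.support, η' = η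
  · have : f = AddMonoidAlgebra.single η (f.coeff η) := by
      apply AddMonoidAlgebra.coeff_injective
      ext η'
      rw [AddMonoidAlgebra.coeff_single, Finsupp.single_apply]
      split_ifs with h
      · rw [h]
      · by_contra h'
        exact h (hall η' (Finsupp.mem_support_iff.mpr h')).symm
    rw [this, laurentToHol_single] at hf
    have hz : IsUnit ((coordMonomial (Hol N) (Multiplicative.ofAdd η) : (Hol N)ˣ) : Hol N) :=
      Units.isUnit _
    have hc : f.coeff η ≠ 0 := Finsupp.mem_support_iff.mp hη
    have h0 := (smul_eq_zero.mp hf).resolve_left hc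
    have hnt : Nontrivial (Hol N) := by
      refine ⟨0, 1, fun h => ?_⟩
      -- The point `(1, 2, …, N)` shows that `X` is nonempty, hence `ℛ(X)` nontrivial.
      have hz : (fun i : Fin N => ((i : ℕ) + 1 : ℂ)) ∈ configSpace N :=
        ⟨fun i => Nat.cast_add_one_ne_zero _, fun i j hij h => hij (Fin.ext (by simpa using h))⟩
      exact zero_ne_one (congrArg (fun f : Hol N => f.1 ⟨_, hz⟩) h)
    exact hz.ne_zero h0
  · push Not at hall
    obtain ⟨η', hη', hne⟩ := hall
    obtain ⟨i, hi⟩ := Function.ne_iff.mp hne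
    set g : Laurent N := TorusAlgebra.euler i f - (η i : ℂ) • f with hg
    have hcoeff : ∀ κ, g.coeff κ = ((κ i : ℂ) - η i) * f.coeff κ := by
      intro κ
      have := weightDerivation_coeff
        ((Int.castAddHom ℂ).comp (Pi.evalAddMonoidHom (fun _ => ℤ) i)) f κ
      have h2 : (TorusAlgebra.euler i f : Laurent N).coeff κ = (κ i : ℂ) * f.coeff κ := this
      rw [hg, AddMonoidAlgebra.coeff_sub, Finsupp.sub_apply, h2, AddMonoidAlgebra.coeff_smul,
        Finsupp.smul_apply, smul_eq_mul, sub_mul]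
    have hg0 : laurentToHol N g = 0 := by
      rw [hg, map_sub, map_smul, laurentToHol_euler, hf, map_zero, smul_zero, sub_zero]
    have hlt : g.coeff.support.card < n := by
      rw [← hn]
      refine Finset.card_lt_card ⟨fun κ hκ => ?_, fun h => ?_⟩
      · rw [Finsupp.mem_support_iff, hcoeff] at hκ
        exact Finsupp.mem_support_iff.mpr (right_ne_zero_of_mul hκ)
      · have := Finsupp.mem_support_iff.mp (h hη)
        rw [hcoeff, sub_self, zero_mul] at this
        exact this rfl
    have hgz := ih _ hlt g rfl hg0
    have h1 := hcoeff η'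
    rw [hgz] at h1
    have h2 : ((η' i : ℂ) - η i) * f.coeff η' = 0 := h1.symm
    rcases mul_eq_zero.mp h2 with h | h
    · exact hi (by exact_mod_cast sub_eq_zero.mp h)
    · exact Finsupp.mem_support_iff.mp hη' h

theorem coord_zpow_mem_range (i : Fin N) (n : ℤ) :
    (((Hol.coord i) ^ n : (Hol N)ˣ) : Hol N) ∈ (laurentToHol N).range :=
  ⟨AddMonoidAlgebra.single (Pi.single i n) 1, by
    rw [AlgHom.toRingHom_eq_coe, RingHom.coe_coe, laurentToHol_single_one, coordMonomial_single]; rfl⟩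

theorem coordMonomial_mem {S : Type*} [CommRing S] [Algebra ℂ S] [TorusAlgebra N S]
    (T : Subalgebra ℂ S) (h1 : ∀ i : Fin N, ((TorusAlgebra.coord i : Sˣ) : S) ∈ T)
    (h2 : ∀ i : Fin N, (((TorusAlgebra.coord i : Sˣ)⁻¹ : Sˣ) : S) ∈ T) (η : Fin N → ℤ) :
    ((coordMonomial S (Multiplicative.ofAdd η) : Sˣ) : S) ∈ T := by
  have h3 : ((coordMonomial S (Multiplicative.ofAdd η) : Sˣ) : S) =
      ∏ j, (((TorusAlgebra.coord j : Sˣ) ^ η j : Sˣ) : S) := Units.coe_prod _ _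
  rw [h3]
  refine prod_mem fun j _ => ?_
  obtain ⟨n, hn | hn⟩ := (η j).eq_nat_or_neg
  · rw [hn, zpow_natCast, Units.val_pow_eq_pow_val]; exact pow_mem (h1 j) n
  · rw [hn, zpow_neg, zpow_natCast, ← inv_pow, Units.val_pow_eq_pow_val]; exact pow_mem (h2 j) n

theorem range_laurentToHol_le (T : Subalgebra ℂ (Hol N)) (h1 : ∀ i : Fin N, (Hol.coord i : Hol N) ∈ T)
    (h2 : ∀ i : Fin N, (((Hol.coord i)⁻¹ : (Hol N)ˣ) : Hol N) ∈ T) : (laurentToHol N).range ≤ T := by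
  rintro _ ⟨f, rfl⟩
  change laurentToHol N f ∈ T
  induction f using AddMonoidAlgebra.induction_linear with
  | zero => rw [map_zero]; exact T.zero_mem
  | add f g hf hg => rw [map_add]; exact T.add_mem hf hg
  | single η r =>
    rw [laurentToHol_single]
    exact T.smul_mem (coordMonomial_mem T h1 h2 η) r

theorem coord_mem_range (i : Fin N) : (Hol.coord i : Hol N) ∈ (laurentToHol N).range := by
  simpa using coord_zpow_mem_range i 1

theorem coord_inv_mem_range (i : Fin N) :
    (((Hol.coord i)⁻¹ : (Hol N)ˣ) : Hol N) ∈ (laurentToHol N).range := by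
  simpa using coord_zpow_mem_range i (-1)

theorem perm_mem_range (w : Equiv.Perm (Fin N)) {f : Hol N} (hf : f ∈ (laurentToHol N).range) :
    Hol.perm w f ∈ (laurentToHol N).range := by
  refine range_laurentToHol_le (((laurentToHol N).range).comap (Hol.perm w)) (fun i => ?_)
    (fun i => ?_) hf
  · exact coord_mem_range (w i)
  · exact coord_inv_mem_range (w i)

/-- By the twisted Leibniz rule, the Laurent polynomials whose divided difference is again one form
a subalgebra. It then suffices to treat `z_k` and `z_k⁻¹`, where the quotient is explicit. -/
theorem divDiff_mem_range {i j : Fin N} (h : i ≠ j) {f : Hol N} (hf : f ∈ (laurentToHol N).range) :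
    divDiff i j f ∈ (laurentToHol N).range := by
  let T : Subalgebra ℂ (Hol N) :=
    { carrier := {f | f ∈ (laurentToHol N).range ∧ divDiff i j f ∈ (laurentToHol N).range}
      mul_mem' := by
        rintro f g ⟨hf, hf'⟩ ⟨hg, hg'⟩
        refine ⟨mul_mem hf hg, ?_⟩
        have : divDiff i j (f * g) =
            divDiff i j f * g + Hol.perm (Equiv.swap i j) f * divDiff i j g := by
          simp only [divDiff_eq, map_mul]; ring
        rw [this]
        exact add_mem (mul_mem hf' hg) (mul_mem (perm_mem_range _ hf) hg')
      add_mem' := by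
        rintro f g ⟨hf, hf'⟩ ⟨hg, hg'⟩
        exact ⟨add_mem hf hg, by rw [map_add]; exact add_mem hf' hg'⟩
      algebraMap_mem' := fun a => ⟨Subalgebra.algebraMap_mem _ a, by
        rw [divDiff_eq, AlgHom.commutes, sub_self, mul_zero]; exact zero_mem _⟩ }
  have hc : ∀ k, divDiff i j (Hol.coord k : Hol N) =
      if k = i then (Hol.coord i : Hol N) else if k = j then - (Hol.coord i : Hol N) else 0 := by
    intro k
    rw [divDiff_eq, Hol.perm_coord]
    have := phi_mul h
    split_ifs with h1 h2
    · subst h1; rw [Equiv.swap_apply_left, this]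
    · subst h2; rw [Equiv.swap_apply_right]; linear_combination -this
    · rw [Equiv.swap_apply_of_ne_of_ne h1 h2, sub_self, mul_zero]
  have hci : ∀ k, divDiff i j (((Hol.coord k)⁻¹ : (Hol N)ˣ) : Hol N) =
      if k = i then - (((Hol.coord j)⁻¹ : (Hol N)ˣ) : Hol N)
        else if k = j then (((Hol.coord j)⁻¹ : (Hol N)ˣ) : Hol N) else 0 := by
    intro k
    rw [divDiff_eq, Hol.perm_coord_inv]
    have := phi_mul_inv h
    split_ifs with h1 h2
    · subst h1; rw [Equiv.swap_apply_left]; linear_combination -this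
    · subst h2; rw [Equiv.swap_apply_right, this]
    · rw [Equiv.swap_apply_of_ne_of_ne h1 h2, sub_self, mul_zero]
  refine (range_laurentToHol_le T (fun k => ⟨coord_mem_range k, ?_⟩)
    (fun k => ⟨coord_inv_mem_range k, ?_⟩) hf).2
  · rw [hc]
    split_ifs
    exacts [coord_mem_range i, neg_mem (coord_mem_range i), zero_mem _]
  · rw [hci]
    split_ifs
    exacts [neg_mem (coord_inv_mem_range j), coord_inv_mem_range j, zero_mem _]

theorem perm_coordMonomial (w : Equiv.Perm (Fin N)) (η : Fin N → ℤ) :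
    Hol.perm w ((coordMonomial (Hol N) (Multiplicative.ofAdd η) : (Hol N)ˣ) : Hol N) =
      ((coordMonomial (Hol N) (Multiplicative.ofAdd (η ∘ w.symm)) : (Hol N)ˣ) : Hol N) := by
  have h1 : Units.map (Hol.perm w : Hol N →* Hol N) (coordMonomial (Hol N) (Multiplicative.ofAdd η)) =
      coordMonomial (Hol N) (Multiplicative.ofAdd (η ∘ w.symm)) := by
    change Units.map (Hol.perm w : Hol N →* Hol N) (∏ i, (Hol.coord i : (Hol N)ˣ) ^ η i) =
      ∏ i, (Hol.coord i : (Hol N)ˣ) ^ η (w.symm i)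
    rw [map_prod, ← Equiv.prod_comp w fun i => (Hol.coord i : (Hol N)ˣ) ^ η (w.symm i)]
    refine Finset.prod_congr rfl fun i _ => ?_
    rw [map_zpow, Equiv.symm_apply_apply]
    congr 1
  exact congrArg Units.val h1

end Laurent

/-! ### Operators on the tensor product acting on one factor -/

section Factors

variable {A S V B : Type*} [AddCommGroup A] [Module ℂ A] [AddCommGroup S] [Module ℂ S]
  [AddCommGroup V] [Module ℂ V] [AddCommGroup B] [Module ℂ B]

theorem lTensor_commute_rTensor {X Y : Type*} [AddCommMonoid X] [Module ℂ X] [AddCommMonoid Y]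
    [Module ℂ Y] (f : Module.End ℂ X) (g : Module.End ℂ Y) :
    Commute (Module.End.lTensorAlgHom ℂ Y X g) (Module.End.rTensorAlgHom ℂ X Y f) :=
  (LinearMap.lTensor_comp_rTensor X f g).trans (LinearMap.rTensor_comp_lTensor X f g).symm

variable (A S V B)

/-- Operators on the first of four tensor factors. -/
def factor₁ : Module.End ℂ A →ₐ[ℂ] Module.End ℂ (A ⊗[ℂ] (S ⊗[ℂ] (V ⊗[ℂ] B))) :=
  Module.End.rTensorAlgHom ℂ A _

/-- Operators on the second of four tensor factors. -/
def factor₂ : Module.End ℂ S →ₐ[ℂ] Module.End ℂ (A ⊗[ℂ] (S ⊗[ℂ] (V ⊗[ℂ] B))) :=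
  (Module.End.lTensorAlgHom ℂ _ A).comp (Module.End.rTensorAlgHom ℂ S _)

/-- Operators on the third of four tensor factors. -/
def factor₃ : Module.End ℂ V →ₐ[ℂ] Module.End ℂ (A ⊗[ℂ] (S ⊗[ℂ] (V ⊗[ℂ] B))) :=
  (Module.End.lTensorAlgHom ℂ _ A).comp ((Module.End.lTensorAlgHom ℂ _ S).comp
    (Module.End.rTensorAlgHom ℂ V _))

/-- Operators on the fourth of four tensor factors. -/
def factor₄ : Module.End ℂ B →ₐ[ℂ] Module.End ℂ (A ⊗[ℂ] (S ⊗[ℂ] (V ⊗[ℂ] B))) :=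
  (Module.End.lTensorAlgHom ℂ _ A).comp ((Module.End.lTensorAlgHom ℂ _ S).comp
    (Module.End.lTensorAlgHom ℂ _ V))

variable {A S V B} (a : Module.End ℂ A) (s : Module.End ℂ S) (v : Module.End ℂ V)
  (b : Module.End ℂ B)

theorem factor₂_commute_factor₁ : Commute (factor₂ A S V B s) (factor₁ A S V B a) :=
  lTensor_commute_rTensor _ _

theorem factor₃_commute_factor₁ : Commute (factor₃ A S V B v) (factor₁ A S V B a) :=
  lTensor_commute_rTensor _ _

theorem factor₄_commute_factor₁ : Commute (factor₄ A S V B b) (factor₁ A S V B a) :=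
  lTensor_commute_rTensor _ _

theorem factor₃_commute_factor₂ : Commute (factor₃ A S V B v) (factor₂ A S V B s) :=
  (lTensor_commute_rTensor _ _).map (Module.End.lTensorAlgHom ℂ _ A)

theorem factor₄_commute_factor₂ : Commute (factor₄ A S V B b) (factor₂ A S V B s) :=
  (lTensor_commute_rTensor _ _).map (Module.End.lTensorAlgHom ℂ _ A)

theorem factor₄_commute_factor₃ : Commute (factor₄ A S V B b) (factor₃ A S V B v) :=
  ((lTensor_commute_rTensor _ _).map (Module.End.lTensorAlgHom ℂ _ S)).map
    (Module.End.lTensorAlgHom ℂ _ A)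

theorem factor₂_mul_factor₃ : factor₂ A S V B s * factor₃ A S V B v =
    LinearMap.lTensor A (TensorProduct.map s (LinearMap.rTensor B v)) :=
  ((Module.End.lTensorAlgHom ℂ _ A).map_mul _ _).symm.trans
    (congrArg (LinearMap.lTensor A) (LinearMap.rTensor_comp_lTensor _ _ _))

end Factors

/-- The algebra of operators on `A ⊗ S ⊗ (ℂ^m)^{⊗N} ⊗ B`. -/
def TEnd (N m : ℕ) (S A B : Type*) [CommRing S] [Algebra ℂ S] [AddCommGroup A] [Module ℂ A]
    [AddCommGroup B] [Module ℂ B] : Type _ := Module.End ℂ (TensorSpace N m S A B)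

/-! ### Operators acting on single factors, matrix units at the sites, and permutations. -/

section Operators

variable {N m : ℕ} {S A B : Type*} [CommRing S] [Algebra ℂ S]
  [AddCommGroup A] [Module ℂ A] [AddCommGroup B] [Module ℂ B]

instance : Ring (TEnd N m S A B) := inferInstanceAs (Ring (Module.End ℂ (TensorSpace N m S A B)))

instance : Algebra ℂ (TEnd N m S A B) :=
  inferInstanceAs (Algebra ℂ (Module.End ℂ (TensorSpace N m S A B)))

variable (N m S A B)

/-- Operators on the factor `A`. -/
def opA : Module.End ℂ A →ₐ[ℂ] TEnd N m S A B := factor₁ A S (VecPower N m) B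

/-- Operators on the factor of functions. -/
def opF : Module.End ℂ S →ₐ[ℂ] TEnd N m S A B := factor₂ A S (VecPower N m) B

/-- Operators on the tensor power. -/
def opV : Module.End ℂ (VecPower N m) →ₐ[ℂ] TEnd N m S A B := factor₃ A S (VecPower N m) B

/-- Operators on the factor `B`. -/
def opB : Module.End ℂ B →ₐ[ℂ] TEnd N m S A B := factor₄ A S (VecPower N m) B

/-- Multiplication by a function. -/
def opM : S →ₐ[ℂ] TEnd N m S A B := (opF N m S A B).comp (Algebra.lmul ℂ S)

/-- A derivation acting on the factor of functions. -/
def opDer (δ : Derivation ℂ S S) : TEnd N m S A B := opF N m S A B δ.toLinearMap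

/-- A matrix acting on the `i`-th factor of the tensor power. -/
def opS (i : Fin N) : Matrix (Fin m) (Fin m) ℂ →ₗ[ℂ] TEnd N m S A B :=
  (opV N m S A B).toLinearMap ∘ₗ siteMat N m i

/-- The matrix units acting on the `i`-th factor of the tensor power. -/
def unitAt (i : Fin N) (a b : Fin m) : TEnd N m S A B := opS N m S A B i (Matrix.single a b 1)

/-- An automorphism of the functions combined with a permutation of the tensor factors. -/
def twist (σ : S →ₐ[ℂ] S) (w : Equiv.Perm (Fin N)) : TEnd N m S A B :=
  opF N m S A B σ.toLinearMap * opV N m S A B (permVec N m w)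

variable {N m S A B}

theorem opF_commute_opA (f : Module.End ℂ S) (a : Module.End ℂ A) :
    Commute (opF N m S A B f) (opA N m S A B a) := factor₂_commute_factor₁ _ _

theorem opV_commute_opA (v : Module.End ℂ (VecPower N m)) (a : Module.End ℂ A) :
    Commute (opV N m S A B v) (opA N m S A B a) := factor₃_commute_factor₁ _ _

theorem opB_commute_opA (b : Module.End ℂ B) (a : Module.End ℂ A) :
    Commute (opB N m S A B b) (opA N m S A B a) := factor₄_commute_factor₁ _ _

theorem opV_commute_opF (v : Module.End ℂ (VecPower N m)) (f : Module.End ℂ S) :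
    Commute (opV N m S A B v) (opF N m S A B f) := factor₃_commute_factor₂ _ _

theorem opB_commute_opF (b : Module.End ℂ B) (f : Module.End ℂ S) :
    Commute (opB N m S A B b) (opF N m S A B f) := factor₄_commute_factor₂ _ _

theorem opB_commute_opV (b : Module.End ℂ B) (v : Module.End ℂ (VecPower N m)) :
    Commute (opB N m S A B b) (opV N m S A B v) := factor₄_commute_factor₃ _ _

theorem opM_eq (f : S) : opM N m S A B f = opF N m S A B (LinearMap.mul ℂ S f) := rfl

theorem opM_commute_opA (f : S) (a : Module.End ℂ A) :
    Commute (opM N m S A B f) (opA N m S A B a) := opF_commute_opA _ _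

theorem opB_commute_opM (b : Module.End ℂ B) (f : S) :
    Commute (opB N m S A B b) (opM N m S A B f) := opB_commute_opF _ _

theorem opM_commute_opM (f g : S) : Commute (opM N m S A B f) (opM N m S A B g) :=
  (Commute.all f g).map (opM N m S A B)

theorem opDer_commute_opA (δ : Derivation ℂ S S) (a : Module.End ℂ A) :
    Commute (opDer N m S A B δ) (opA N m S A B a) := opF_commute_opA _ _

theorem opB_commute_opDer (b : Module.End ℂ B) (δ : Derivation ℂ S S) :
    Commute (opB N m S A B b) (opDer N m S A B δ) := opB_commute_opF _ _

theorem opDer_opM (δ : Derivation ℂ S S) (f : S) :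
    ⁅opDer N m S A B δ, opM N m S A B f⁆ = opM N m S A B (δ f) := by
  have h : (δ.toLinearMap : Module.End ℂ S) * LinearMap.mul ℂ S f -
      LinearMap.mul ℂ S f * δ.toLinearMap = LinearMap.mul ℂ S (δ f) := by
    ext1 g
    change δ (f * g) - f * δ g = δ f * g
    rw [Derivation.leibniz, smul_eq_mul, smul_eq_mul]
    ring
  rw [opM_eq, opM_eq, ← h, map_sub, map_mul, map_mul]
  rfl

theorem opDer_comm {δ δ' : Derivation ℂ S S} (h : ∀ f, δ (δ' f) = δ' (δ f)) :
    Commute (opDer N m S A B δ) (opDer N m S A B δ') :=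
  Commute.map (LinearMap.ext h : Commute (δ.toLinearMap : Module.End ℂ S) δ'.toLinearMap) _

theorem opS_mul (i : Fin N) (M M' : Matrix (Fin m) (Fin m) ℂ) :
    opS N m S A B i (M * M') = opS N m S A B i M * opS N m S A B i M' := by
  rw [opS, LinearMap.comp_apply, siteMat_mul]
  exact map_mul (opV N m S A B) _ _

theorem opS_one (i : Fin N) : opS N m S A B i 1 = 1 := by
  rw [opS, LinearMap.comp_apply, siteMat_one]
  exact map_one (opV N m S A B)

theorem opS_commute {i j : Fin N} (h : i ≠ j) (M M' : Matrix (Fin m) (Fin m) ℂ) :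
    Commute (opS N m S A B i M) (opS N m S A B j M') := (siteMat_commute h M M').map (opV N m S A B)

theorem opS_commute_opF (i : Fin N) (M : Matrix (Fin m) (Fin m) ℂ) (f : Module.End ℂ S) :
    Commute (opS N m S A B i M) (opF N m S A B f) := opV_commute_opF _ _

theorem opS_commute_opM (i : Fin N) (M : Matrix (Fin m) (Fin m) ℂ) (f : S) :
    Commute (opS N m S A B i M) (opM N m S A B f) := opV_commute_opF _ _

theorem opS_commute_opDer (i : Fin N) (M : Matrix (Fin m) (Fin m) ℂ) (δ : Derivation ℂ S S) :
    Commute (opS N m S A B i M) (opDer N m S A B δ) := opV_commute_opF _ _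

theorem opS_commute_opA (i : Fin N) (M : Matrix (Fin m) (Fin m) ℂ) (a : Module.End ℂ A) :
    Commute (opS N m S A B i M) (opA N m S A B a) := opV_commute_opA _ _

theorem opB_commute_opS (b : Module.End ℂ B) (i : Fin N) (M : Matrix (Fin m) (Fin m) ℂ) :
    Commute (opB N m S A B b) (opS N m S A B i M) := opB_commute_opV _ _

theorem permVec_opS (w : Equiv.Perm (Fin N)) (i : Fin N) (M : Matrix (Fin m) (Fin m) ℂ) :
    opV N m S A B (permVec N m w) * opS N m S A B i M =
      opS N m S A B (w i) M * opV N m S A B (permVec N m w) := by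
  have := congrArg (opV N m S A B) (permVec_siteMat w i M)
  rwa [map_mul, map_mul] at this

theorem twist_mul (σ σ' : S →ₐ[ℂ] S) (w w' : Equiv.Perm (Fin N)) :
    twist N m S A B (σ.comp σ') (w * w') = twist N m S A B σ w * twist N m S A B σ' w' := by
  rw [twist, twist, twist, (opV_commute_opF _ _).mul_mul_mul_comm, permVec_mul, map_mul,
    ← map_mul (opF N m S A B)]
  rfl

theorem twist_one : twist N m S A B (AlgHom.id ℂ S) 1 = 1 := by
  rw [twist, permVec_one, map_one, mul_one, ← map_one (opF N m S A B)]
  rfl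

theorem twist_opM (σ : S →ₐ[ℂ] S) (w : Equiv.Perm (Fin N)) (f : S) :
    twist N m S A B σ w * opM N m S A B f = opM N m S A B (σ f) * twist N m S A B σ w := by
  have h : (σ.toLinearMap : Module.End ℂ S) * LinearMap.mul ℂ S f =
      LinearMap.mul ℂ S (σ f) * σ.toLinearMap := by
    ext1 g
    exact map_mul σ f g
  rw [twist, opM_eq, opM_eq, mul_assoc, (opV_commute_opF _ _).eq, ← mul_assoc, ← mul_assoc,
    ← map_mul, h, map_mul]

theorem twist_opDer {σ : S →ₐ[ℂ] S} {δ δ' : Derivation ℂ S S} (h : ∀ f, σ (δ f) = δ' (σ f))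
    (w : Equiv.Perm (Fin N)) :
    twist N m S A B σ w * opDer N m S A B δ = opDer N m S A B δ' * twist N m S A B σ w := by
  have h : (σ.toLinearMap : Module.End ℂ S) * δ.toLinearMap = δ'.toLinearMap * σ.toLinearMap :=
    LinearMap.ext h
  rw [twist, opDer, mul_assoc, (opV_commute_opF _ _).eq, ← mul_assoc, ← mul_assoc, opDer,
    ← map_mul, h, map_mul]

theorem twist_opS (σ : S →ₐ[ℂ] S) (w : Equiv.Perm (Fin N)) (i : Fin N)
    (M : Matrix (Fin m) (Fin m) ℂ) :
    twist N m S A B σ w * opS N m S A B i M = opS N m S A B (w i) M * twist N m S A B σ w := by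
  rw [twist, mul_assoc, permVec_opS, ← mul_assoc, ← (opS_commute_opF _ _ _).eq, mul_assoc]

theorem twist_commute_opA (σ : S →ₐ[ℂ] S) (w : Equiv.Perm (Fin N)) (a : Module.End ℂ A) :
    Commute (twist N m S A B σ w) (opA N m S A B a) :=
  (opF_commute_opA _ _).mul_left (opV_commute_opA _ _)

theorem opB_commute_twist (b : Module.End ℂ B) (σ : S →ₐ[ℂ] S) (w : Equiv.Perm (Fin N)) :
    Commute (opB N m S A B b) (twist N m S A B σ w) :=
  (opB_commute_opF _ _).mul_right (opB_commute_opV _ _)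

theorem single_comm (a b c d : Fin m) :
    Matrix.single a b (1 : ℂ) * Matrix.single c d 1 - Matrix.single c d 1 * Matrix.single a b 1 =
      (if b = c then Matrix.single a d 1 else 0) - if d = a then Matrix.single c b 1 else 0 := by
  congr 1
  · split_ifs with h
    · subst h; simp
    · simp [h]
  · split_ifs with h
    · subst h; simp
    · simp [h]

theorem unitAt_rel (i : Fin N) :
    UnitRel (unitAt N m S A B i) (unitAt N m S A B i) (unitAt N m S A B i) := by
  intro a b c d
  rw [Ring.lie_def, unitAt, unitAt, ← opS_mul, ← opS_mul, ← map_sub, single_comm, map_sub,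
    apply_ite (opS N m S A B i), apply_ite (opS N m S A B i), map_zero]
  rfl

theorem unitAt_famCommute {i j : Fin N} (h : i ≠ j) :
    FamCommute (unitAt N m S A B i) (unitAt N m S A B j) := fun _ _ _ _ => opS_commute h _ _

theorem pairing_unitAt_one {i j : Fin N} (h : i ≠ j) :
    pairing (unitAt N m S A B i) (unitAt N m S A B j) 1 =
      opV N m S A B (permVec N m (Equiv.swap i j)) := by
  rw [← sum_siteMat_swap h]
  simp only [pairing, unitAt, Pi.one_apply, one_smul, map_sum, map_mul]
  rfl

end Operators

/-! ### The affine Lie algebra in terms of matrix units -/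

section Affine

variable {m : ℕ}

theorem toMatrix_injective : Function.Injective (Sl.toMatrix m) := Subtype.val_injective

theorem trace_toMatrix (X : Sl m) : Matrix.trace (Sl.toMatrix m X) = 0 := LinearMap.mem_ker.mp X.2

/-- The projection changes a matrix by a scalar, which is invisible in commutators, and a commutator
is already traceless. Hence the `slUnit`s satisfy the relations of the matrix units of `gl_m`. -/
theorem traceless_comm (M M' : Matrix (Fin m) (Fin m) ℂ) :
    ⁅traceless m M, traceless m M'⁆ = traceless m (M * M' - M' * M) := by
  apply toMatrix_injective
  rw [Sl.toMatrix_lie, toMatrix_traceless, toMatrix_traceless, toMatrix_traceless, Matrix.trace_sub,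
    Matrix.trace_mul_comm M M', sub_self, zero_div, zero_smul, sub_zero]
  simp only [sub_mul, mul_sub, smul_mul_assoc, mul_smul_comm, one_mul, mul_one]
  rw [smul_sub, smul_sub, smul_comm (M.trace / (m : ℂ))]
  abel

theorem slUnit_lie (a b c d : Fin m) : ⁅slUnit m a b, slUnit m c d⁆ =
    (if b = c then slUnit m a d else 0) - if d = a then slUnit m c b else 0 := by
  rw [slUnit, slUnit, traceless_comm, single_comm, map_sub, apply_ite (traceless m),
    apply_ite (traceless m), map_zero]
  rfl

namespace AffineSl

theorem monomial_lie (p q : ℤ) (X Y : Sl m) : ⁅monomial p X, monomial q Y⁆ =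
    monomial (p + q) ⁅X, Y⁆ + (if p + q = 0 then (p : ℂ) * traceForm m X Y else 0) • c := by
  have h : ∀ r : ℂ, (r • c : AffineSl m).loop = 0 ∧ (r • c : AffineSl m).central = r ∧
      (r • c : AffineSl m).degree = 0 := fun r => ⟨smul_zero r, mul_one r, mul_zero r⟩
  ext1
  · rw [loop_add, (h _).1]; simp [monomial, loopBracket_monomial]
  · rw [central_add, (h _).2.1]; simp [monomial, loopCocycle_monomial]
  · rw [degree_add, (h _).2.2]; simp [monomial]

end AffineSl

theorem actionMap_lie {A : Type*} [AddCommGroup A] [Module ℂ A] [LieRingModule (AffineSl m) A]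
    [LieModule ℂ (AffineSl m) A] (X Y : AffineSl m) :
    actionMap A ⁅X, Y⁆ = ⁅actionMap A X, actionMap A Y⁆ := by
  ext v
  exact lie_lie X Y v

theorem actionMap_c {A : Type*} [AddCommGroup A] [Module ℂ A] [LieRingModule (AffineSl m) A]
    [LieModule ℂ (AffineSl m) A] {ℓ : ℂ} (h : HasLevel (m := m) A ℓ) :
    actionMap A (AffineSl.c : AffineSl m) = algebraMap ℂ _ ℓ := by
  ext v
  exact h v

theorem actionMap_monomial_lie {A : Type*} [AddCommGroup A] [Module ℂ A]
    [LieRingModule (AffineSl m) A] [LieModule ℂ (AffineSl m) A] {ℓ : ℂ}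
    (h : HasLevel (m := m) A ℓ) (p q : ℤ) (X Y : Sl m) :
    ⁅actionMap A (AffineSl.monomial p X), actionMap A (AffineSl.monomial q Y)⁆ =
      actionMap A (AffineSl.monomial (p + q) ⁅X, Y⁆) +
        algebraMap ℂ _ (if p + q = 0 then (p : ℂ) * traceForm m X Y * ℓ else 0) := by
  rw [← actionMap_lie, AffineSl.monomial_lie, map_add, map_smul, actionMap_c h, Algebra.smul_def,
    ← map_mul]
  congr 2
  split_ifs <;> simp

/-- The coefficients of the standard classical r-matrix of `gl_m`. -/
def stdHalf (m : ℕ) (a b : Fin m) : ℂ := if a < b then 1 else if a = b then 1 / 2 else 0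

theorem stdHalf_isHalf (m : ℕ) : IsHalf (stdHalf m) where
  add_flip a b := by
    rcases lt_trichotomy a b with h | h | h
    · simp [stdHalf, h, h.not_gt, h.ne']
    · subst h; simp [stdHalf]; norm_num
    · simp [stdHalf, h, h.not_gt, h.ne']
  cybe a b x := by
    -- The identity depends only on the relative order of `a, b, x` and is checked in each
    -- consistent case.
    rcases lt_trichotomy a b with h | h | h <;> rcases lt_trichotomy a x with h' | h' | h' <;>
    rcases lt_trichotomy b x with h'' | h'' | h'' <;> first
    | (exfalso; omega)
    | (simp only [stdHalf, h, h', h'', h.not_gt, h'.not_gt, h''.not_gt, h.ne, h'.ne, h''.ne, h.ne',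
        h'.ne', h''.ne']; norm_num)
    | (subst_vars; simp_all [stdHalf, not_lt_of_gt, ne_of_lt, ne_of_gt]; try norm_num)

end Affine

/-! ### Traces, and the comparison of `sl_m` with `gl_m` at a site. -/

section Sites

variable {N m : ℕ} {S A B : Type*} [CommRing S] [Algebra ℂ S]
  [AddCommGroup A] [Module ℂ A] [AddCommGroup B] [Module ℂ B]

theorem sum_single_diag : ∑ a : Fin m, Matrix.single a a (1 : ℂ) = 1 := by
  ext i j
  rw [Matrix.sum_apply]
  simp [Matrix.single_apply, Matrix.one_apply, ite_and]

theorem sum_slUnit_diag [NeZero m] : ∑ a, slUnit m a a = 0 := by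
  simp only [slUnit]
  rw [← map_sum, sum_single_diag]
  apply toMatrix_injective
  rw [toMatrix_traceless, Matrix.trace_one, Fintype.card_fin, map_zero,
    div_self (Nat.cast_ne_zero.mpr (NeZero.ne m)), one_smul, sub_self]

theorem sum_unitAt_diag (i : Fin N) : ∑ a, unitAt N m S A B i a a = 1 := by
  simp only [unitAt]
  rw [← map_sum, sum_single_diag, opS_one]

/-- The correction `1/m` on the diagonal is the only difference between `sl_m` and `gl_m`; it
produces the numerical constants in the definition of `𝒟_ξ`. -/
theorem opS_slUnit (i : Fin N) (a b : Fin m) : opS N m S A B i (Sl.toMatrix m (slUnit m a b)) =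
    unitAt N m S A B i a b - if a = b then algebraMap ℂ _ (1 / m : ℂ) else 0 := by
  rw [slUnit, toMatrix_traceless, map_sub, map_smul, opS_one, ← Algebra.algebraMap_eq_smul_one,
    unitAt]
  congr 1
  split_ifs with h
  · subst h; simp
  · simp [h]

end Sites

/-! ### The maps `θ_i` in terms of the operators on the factors -/

section Theta

variable {N m : ℕ} {S A B : Type*} [CommRing S] [Algebra ℂ S] [TorusAlgebra N S]
  [AddCommGroup A] [Module ℂ A] [LieRingModule (AffineSl m) A] [LieModule ℂ (AffineSl m) A]
  [AddCommGroup B] [Module ℂ B] [LieRingModule (AffineSl m) B] [LieModule ℂ (AffineSl m) B]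

variable (S) in
/-- The function `z_i ^ n`. -/
def coordPow (i : Fin N) (n : ℤ) : S := ((TorusAlgebra.coord i ^ n : Sˣ) : S)

variable (N m S A B) in
/-- `θ_0` with values in the algebra of operators. -/
def opLeft : AffineSl m →ₗ[ℂ] TEnd N m S A B :=
  thetaLeft N S A B

variable (N m S A B) in
/-- `θ_{N+1}` with values in the algebra of operators. -/
def opRight : AffineSl m →ₗ[ℂ] TEnd N m S A B :=
  thetaRight N S A B

variable (N m S A B) in
/-- `θ_i` with values in the algebra of operators. -/
def opSite (i : Fin N) : AffineSl m →ₗ[ℂ] TEnd N m S A B :=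
  theta N S A B i

theorem opLeft_eq (X : AffineSl m) : opLeft N m S A B X = opA N m S A B (actionMap A X) := rfl

theorem opRight_eq (X : AffineSl m) : opRight N m S A B X = opB N m S A B (actionMap B X) := rfl

theorem evalAt_single (i : Fin N) (n : ℤ) :
    evalAt S i (AddMonoidAlgebra.single n 1) = coordPow S i n := by
  rw [evalAt, AddMonoidAlgebra.lift_single, one_smul]
  rfl

theorem opSite_monomial (i : Fin N) (n : ℤ) (X : Sl m) :
    opSite N m S A B i (AffineSl.monomial n X) =
      opM N m S A B (coordPow S i n) * opS N m S A B i (Sl.toMatrix m X) := by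
  have h : thetaLoop N S B i (loopMonomial m n X) =
      TensorProduct.map (LinearMap.mul ℂ S (coordPow S i n))
        (LinearMap.rTensor B (siteMat N m i (Sl.toMatrix m X))) := by
    rw [← evalAt_single]
    rfl
  have h' : opSite N m S A B i (AffineSl.monomial n X) = LinearMap.lTensor A
      (thetaLoop N S B i (loopMonomial m n X) + (0 : ℂ) •
        LinearMap.rTensor (VecPower N m ⊗[ℂ] B) (TorusAlgebra.euler i).toLinearMap) := rfl
  rw [h', zero_smul, add_zero, h]
  exact (factor₂_mul_factor₃ _ _).symm

theorem opSite_c (i : Fin N) : opSite N m S A B i (AffineSl.c : AffineSl m) = 0 := by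
  have h' : opSite N m S A B i (AffineSl.c : AffineSl m) = LinearMap.lTensor A
      (thetaLoop N S B i (0 : LoopSl m) + (0 : ℂ) •
        LinearMap.rTensor (VecPower N m ⊗[ℂ] B) (TorusAlgebra.euler i).toLinearMap) := rfl
  rw [h', zero_smul, add_zero, map_zero, LinearMap.lTensor_zero]
  rfl

theorem opSite_d (i : Fin N) :
    opSite N m S A B i (AffineSl.d : AffineSl m) = opDer N m S A B (TorusAlgebra.euler i) := by
  have h' : opSite N m S A B i (AffineSl.d : AffineSl m) = LinearMap.lTensor A
      (thetaLoop N S B i (0 : LoopSl m) + (1 : ℂ) •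
        LinearMap.rTensor (VecPower N m ⊗[ℂ] B) (TorusAlgebra.euler i).toLinearMap) := rfl
  rw [h', one_smul, map_zero, zero_add]
  rfl

theorem opLeft_c {ℓ : ℂ} (h : HasLevel (m := m) A ℓ) :
    opLeft N m S A B (AffineSl.c : AffineSl m) = algebraMap ℂ _ ℓ := by
  rw [opLeft_eq, actionMap_c h, AlgHom.commutes]

theorem opRight_c {ℓ : ℂ} (h : HasLevel (m := m) B ℓ) :
    opRight N m S A B (AffineSl.c : AffineSl m) = algebraMap ℂ _ ℓ := by
  rw [opRight_eq, actionMap_c h, AlgHom.commutes]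

theorem opLeft_monomial_lie {ℓ : ℂ} (h : HasLevel (m := m) A ℓ) (p q : ℤ) (X Y : Sl m) :
    ⁅opLeft N m S A B (AffineSl.monomial p X), opLeft N m S A B (AffineSl.monomial q Y)⁆ =
      opLeft N m S A B (AffineSl.monomial (p + q) ⁅X, Y⁆) +
        algebraMap ℂ _ (if p + q = 0 then (p : ℂ) * traceForm m X Y * ℓ else 0) := by
  have := congrArg (opA N m S A B) (actionMap_monomial_lie h p q X Y)
  rwa [Ring.lie_def, map_sub, map_mul, map_mul, map_add, AlgHom.commutes] at this

theorem opRight_monomial_lie {ℓ : ℂ} (h : HasLevel (m := m) B ℓ) (p q : ℤ) (X Y : Sl m) :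
    ⁅opRight N m S A B (AffineSl.monomial p X), opRight N m S A B (AffineSl.monomial q Y)⁆ =
      opRight N m S A B (AffineSl.monomial (p + q) ⁅X, Y⁆) +
        algebraMap ℂ _ (if p + q = 0 then (p : ℂ) * traceForm m X Y * ℓ else 0) := by
  have := congrArg (opB N m S A B) (actionMap_monomial_lie h p q X Y)
  rwa [Ring.lie_def, map_sub, map_mul, map_mul, map_add, AlgHom.commutes] at this

variable (N m S A B) in
/-- The currents `E_{ab} ⊗ t^n` acting on `A`. -/
def leftCurrent (n : ℕ) (a b : Fin m) : TEnd N m S A B :=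
  opLeft N m S A B (AffineSl.monomial n (slUnit m a b))

variable (N m S A B) in
/-- The currents `E_{ab} ⊗ t^{-n}` acting on `B`. -/
def rightCurrent (n : ℕ) (a b : Fin m) : TEnd N m S A B :=
  opRight N m S A B (AffineSl.monomial (-n) (slUnit m a b))

/-- Among nonnegative powers of `t` the cocycle could only contribute for `p = q = 0`, and there its
coefficient `p` vanishes. So these currents satisfy the loop relations without central term. -/
theorem leftCurrent_rel {ℓ : ℂ} (h : HasLevel (m := m) A ℓ) (p q : ℕ) :
    UnitRel (leftCurrent N m S A B p) (leftCurrent N m S A B q) (leftCurrent N m S A B (p + q)) := by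
  intro a b c d
  have h0 : (if (p : ℤ) + q = 0 then ((p : ℤ) : ℂ) * traceForm m (slUnit m a b) (slUnit m c d) * ℓ
      else 0) = 0 := by
    split_ifs with h0
    · have : p = 0 := by omega
      simp [this]
    · rfl
  simp only [leftCurrent, Nat.cast_add]
  rw [opLeft_monomial_lie h, h0, map_zero, add_zero, slUnit_lie, map_sub,
    map_sub, apply_ite (AffineSl.monomial _), apply_ite (AffineSl.monomial _),
    apply_ite (opLeft N m S A B), apply_ite (opLeft N m S A B), map_zero, map_zero]

theorem rightCurrent_rel {ℓ : ℂ} (h : HasLevel (m := m) B ℓ) (p q : ℕ) :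
    UnitRel (rightCurrent N m S A B p) (rightCurrent N m S A B q) (rightCurrent N m S A B (p + q)) := by
  intro a b c d
  have h0 : (if -(p : ℤ) + -(q : ℤ) = 0 then
      ((-(p : ℤ) : ℤ) : ℂ) * traceForm m (slUnit m a b) (slUnit m c d) * ℓ else 0) = 0 := by
    split_ifs with h0
    · have : p = 0 := by omega
      simp [this]
    · rfl
  simp only [rightCurrent, Nat.cast_add, neg_add]
  rw [opRight_monomial_lie h, h0, map_zero, add_zero, slUnit_lie,
    map_sub, map_sub, apply_ite (AffineSl.monomial _), apply_ite (AffineSl.monomial _),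
    apply_ite (opRight N m S A B), apply_ite (opRight N m S A B), map_zero, map_zero]

end Theta

/-! ### The classical r-matrix in terms of matrix units -/

section ClassicalR

variable {ι R : Type*} [Fintype ι] [DecidableEq ι] [Ring R] [Algebra ℂ R]

/-- If `h` is constant on the diagonal and `∑ A_aa = 0`, the correction vanishes. This is why `sl_m`
may be replaced by `gl_m` at a site paired with a traceless family of currents. -/
theorem pairing_sub_scalar (A U : ι → ι → R) (h : ι → ι → ℂ) (κ : ℂ) :
    pairing A (fun a b => U a b - if a = b then algebraMap ℂ R κ else 0) h =
      pairing A U h - κ • ∑ a, h a a • A a a := by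
  simp only [pairing, mul_sub, smul_sub, Finset.sum_sub_distrib, mul_ite, mul_zero, smul_ite,
    smul_zero, Finset.sum_ite_eq', Finset.mem_univ, if_true, Finset.smul_sum]
  congr 1
  refine Finset.sum_congr rfl fun a _ => ?_
  rw [Algebra.algebraMap_eq_smul_one, mul_smul_comm, mul_one, smul_comm]

/-- Each leg contributes `-ηκ` and the product of the two corrections contributes `nηκ² = ηκ` with
`n = card ι`, since `nκ = 1`. For two sites `κ = 1/m`. -/
theorem pairing_sub_scalar_both {U V : ι → ι → R} (hU : ∑ a, U a a = 1) (hV : ∑ a, V a a = 1)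
    {h : ι → ι → ℂ} {η κ : ℂ} (hd : ∀ a, h a a = η) (hκ : κ * Fintype.card ι = 1) :
    pairing (fun a b => U a b - if a = b then algebraMap ℂ R κ else 0)
      (fun a b => V a b - if a = b then algebraMap ℂ R κ else 0) h =
      pairing U V h - algebraMap ℂ R (η * κ) := by
  have h1 : pairing (fun a b => U a b - if a = b then algebraMap ℂ R κ else 0) V h =
      pairing U V h - κ • ∑ a, h a a • V a a := by
    simp only [pairing, sub_mul, smul_sub, Finset.sum_sub_distrib, ite_mul, zero_mul, smul_ite,
      smul_zero, Finset.sum_ite_eq, Finset.mem_univ, if_true, Finset.smul_sum]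
    congr 1
    refine Finset.sum_congr rfl fun a _ => ?_
    rw [Algebra.algebraMap_eq_smul_one, smul_mul_assoc, one_mul, smul_comm]
  rw [pairing_sub_scalar, h1]
  simp only [hd, if_true, ← Finset.smul_sum, hV, Finset.sum_sub_distrib, hU, Finset.sum_const,
    Finset.card_univ]
  rw [Algebra.algebraMap_eq_smul_one, Algebra.algebraMap_eq_smul_one, ← Nat.cast_smul_eq_nsmul ℂ,
    smul_smul _ κ, mul_comm _ κ, hκ, one_smul, sub_self, smul_zero, smul_zero, sub_zero, smul_smul,
    mul_comm]

theorem pairAction_tmul {m : ℕ} {E : Type*} [AddCommGroup E] [Module ℂ E]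
    (f g : AffineSl m →ₗ[ℂ] Module.End ℂ E) (X Y : AffineSl m) :
    pairAction f g (X ⊗ₜ Y) = f X * g Y := rfl

theorem classicalR_eq (m : ℕ) :
    classicalR m = ∑ a, ∑ b, stdHalf m a b • slUnit m a b ⊗ₜ[ℂ] slUnit m b a := by
  rw [classicalR, cartanCasimir, Finset.smul_sum, ← Finset.sum_add_distrib]
  refine Finset.sum_congr rfl fun a _ => ?_
  have h : ∀ b, stdHalf m a b • slUnit m a b ⊗ₜ[ℂ] slUnit m b a =
      (if b = a then (1 / 2 : ℂ) • slUnit m a a ⊗ₜ[ℂ] slUnit m a a else 0) +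
        if b ∈ Finset.Ioi a then slUnit m a b ⊗ₜ[ℂ] slUnit m b a else 0 := by
    intro b
    rcases lt_trichotomy a b with h | h | h
    · simp [stdHalf, h, h.ne']
    · subst h; simp [stdHalf]
    · simp [stdHalf, h.ne, h.ne', h.not_gt]
  simp only [h, Finset.sum_add_distrib, Finset.sum_ite_eq', Finset.mem_univ, if_true,
    Finset.sum_ite_mem, Finset.univ_inter]

theorem classicalR_add_comm (m : ℕ) :
    classicalR m + TensorProduct.comm ℂ (Sl m) (Sl m) (classicalR m) = casimir m := by
  simp only [classicalR_eq, map_sum, map_smul, TensorProduct.comm_tmul]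
  rw [Finset.sum_comm (f := fun a b => stdHalf m a b • slUnit m b a ⊗ₜ[ℂ] slUnit m a b), casimir,
    ← Finset.sum_add_distrib]
  refine Finset.sum_congr rfl fun a _ => ?_
  rw [← Finset.sum_add_distrib]
  refine Finset.sum_congr rfl fun b _ => ?_
  rw [← add_smul, (stdHalf_isHalf m).add_flip, one_smul]

theorem pairAction_classicalR {m : ℕ} {E : Type*} [AddCommGroup E] [Module ℂ E]
    (f g : AffineSl m →ₗ[ℂ] Module.End ℂ E) (p q : ℤ) :
    pairAction f g (AffineSl.tensorMonomial m p q (classicalR m)) =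
      pairing (fun a b => f (AffineSl.monomial p (slUnit m a b)))
        (fun a b => g (AffineSl.monomial q (slUnit m a b))) (stdHalf m) := by
  simp only [classicalR_eq, map_sum, map_smul, AffineSl.tensorMonomial, TensorProduct.map_tmul,
    pairAction_tmul, pairing]

theorem pairAction_casimir {m : ℕ} {E : Type*} [AddCommGroup E] [Module ℂ E]
    (f g : AffineSl m →ₗ[ℂ] Module.End ℂ E) (p q : ℤ) :
    pairAction f g (AffineSl.tensorMonomial m p q (casimir m)) =
      pairing (fun a b => f (AffineSl.monomial p (slUnit m a b)))
        (fun a b => g (AffineSl.monomial q (slUnit m a b))) 1 := by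
  simp only [casimir, map_sum, AffineSl.tensorMonomial, TensorProduct.map_tmul,
    pairAction_tmul, pairing, Pi.one_apply, one_smul]

end ClassicalR

/-! ### The operators attached to pairs of sites -/

section Middle

variable {N m : ℕ} {A B : Type*} [AddCommGroup A] [Module ℂ A] [AddCommGroup B] [Module ℂ B]

/-- The algebra of operators on `A ⊗ ℛ(X) ⊗ (ℂ^m)^{⊗N} ⊗ B`. -/
abbrev HEnd (N m : ℕ) (A B : Type*) [AddCommGroup A] [Module ℂ A] [AddCommGroup B] [Module ℂ B] :
    Type _ := TEnd N m (Hol N) A B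

instance (N m : ℕ) (A B : Type*) [AddCommGroup A] [Module ℂ A] [AddCommGroup B]
    [Module ℂ B] : Ring (HEnd N m A B) := inferInstance

instance (N m : ℕ) (A B : Type*) [AddCommGroup A] [Module ℂ A] [AddCommGroup B]
    [Module ℂ B] : Mul (HEnd N m A B) := inferInstance

instance (N m : ℕ) (A B : Type*) [AddCommGroup A] [Module ℂ A] [AddCommGroup B]
    [Module ℂ B] : Semigroup (HEnd N m A B) := inferInstance

instance (N m : ℕ) (A B : Type*) [AddCommGroup A] [Module ℂ A] [AddCommGroup B]
    [Module ℂ B] : Distrib (HEnd N m A B) := inferInstance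

instance (N m : ℕ) (A B : Type*) [AddCommGroup A] [Module ℂ A] [AddCommGroup B]
    [Module ℂ B] : NonUnitalNonAssocRing (HEnd N m A B) := inferInstance

instance (N m : ℕ) (A B : Type*) [AddCommGroup A] [Module ℂ A] [AddCommGroup B]
    [Module ℂ B] : NonUnitalNonAssocSemiring (HEnd N m A B) := inferInstance

instance (N m : ℕ) (A B : Type*) [AddCommGroup A] [Module ℂ A] [AddCommGroup B]
    [Module ℂ B] : Semiring (HEnd N m A B) := inferInstance

instance (N m : ℕ) (A B : Type*) [AddCommGroup A] [Module ℂ A] [AddCommGroup B]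
    [Module ℂ B] : AddCommMonoid (HEnd N m A B) := inferInstance

instance (N m : ℕ) (A B : Type*) [AddCommGroup A] [Module ℂ A] [AddCommGroup B]
    [Module ℂ B] : AddCommGroup (HEnd N m A B) := inferInstance

instance (N m : ℕ) (A B : Type*) [AddCommGroup A] [Module ℂ A] [AddCommGroup B]
    [Module ℂ B] : Algebra ℂ (HEnd N m A B) := inferInstance

instance (N m : ℕ) (A B : Type*) [AddCommGroup A] [Module ℂ A] [AddCommGroup B]
    [Module ℂ B] : Module ℂ (HEnd N m A B) := inferInstance

variable (N m A B) in
/-- The operator `τ(w)`. -/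
def opT (w : Equiv.Perm (Fin N)) : HEnd N m A B := twist N m (Hol N) A B (Hol.perm w) w

variable (N m A B) in
/-- The operator `z_i ∂/∂z_i`. -/
def opD (i : Fin N) : HEnd N m A B := opDer N m (Hol N) A B (Hol.euler i)

theorem opT_mul (w w' : Equiv.Perm (Fin N)) :
    opT N m A B (w * w') = opT N m A B w * opT N m A B w' := by
  have h : Hol.perm (w * w') = (Hol.perm w).comp (Hol.perm w') := AlgHom.ext (Hol.perm_mul w w')
  rw [opT, h, twist_mul, opT, opT]

theorem opT_one : opT N m A B (1 : Equiv.Perm (Fin N)) = 1 := by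
  have h : Hol.perm 1 = AlgHom.id ℂ (Hol N) := AlgHom.ext Hol.perm_one
  rw [opT, h, twist_one]

theorem opT_opM (w : Equiv.Perm (Fin N)) (f : Hol N) :
    opT N m A B w * opM N m (Hol N) A B f = opM N m (Hol N) A B (Hol.perm w f) * opT N m A B w :=
  twist_opM _ _ _

theorem opT_opD (w : Equiv.Perm (Fin N)) (i : Fin N) :
    opT N m A B w * opD N m A B i = opD N m A B (w i) * opT N m A B w :=
  twist_opDer (Hol.perm_euler w i) w

theorem opT_opS (w : Equiv.Perm (Fin N)) (i : Fin N) (M : Matrix (Fin m) (Fin m) ℂ) :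
    opT N m A B w * opS N m (Hol N) A B i M = opS N m (Hol N) A B (w i) M * opT N m A B w :=
  twist_opS _ _ _ _

theorem opT_unitAt (w : Equiv.Perm (Fin N)) (i : Fin N) (a b : Fin m) :
    opT N m A B w * unitAt N m (Hol N) A B i a b =
      unitAt N m (Hol N) A B (w i) a b * opT N m A B w := opT_opS _ _ _

theorem opT_swap_comm (i j : Fin N) :
    opT N m A B (Equiv.swap j i) = opT N m A B (Equiv.swap i j) := by
  rw [Equiv.swap_comm]

theorem opT_swap_sq (i j : Fin N) :
    opT N m A B (Equiv.swap i j) * opT N m A B (Equiv.swap i j) = 1 := by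
  rw [← opT_mul, Equiv.swap_mul_self, opT_one]

theorem opD_opM (i : Fin N) (f : Hol N) :
    ⁅opD N m A B i, opM N m (Hol N) A B f⁆ = opM N m (Hol N) A B (Hol.euler i f) := opDer_opM _ _

theorem opD_comm (i j : Fin N) : Commute (opD N m A B i) (opD N m A B j) :=
  opDer_comm (Hol.euler_comm i j)

theorem opT_opM_commute {i j : Fin N} {f : Hol N} (h : Hol.perm (Equiv.swap i j) f = f) :
    Commute (opT N m A B (Equiv.swap i j)) (opM N m (Hol N) A B f) := by
  have := opT_opM (m := m) (A := A) (B := B) (Equiv.swap i j) f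
  rwa [h] at this

theorem opT_swap_commute_opS {i j k : Fin N} (hi : k ≠ i) (hj : k ≠ j)
    (M : Matrix (Fin m) (Fin m) ℂ) :
    Commute (opT N m A B (Equiv.swap i j)) (opS N m (Hol N) A B k M) := by
  have := opT_opS (A := A) (B := B) (Equiv.swap i j) k M
  rwa [Equiv.swap_apply_of_ne_of_ne hi hj] at this

theorem opT_swap_commute_opD {i j k : Fin N} (hi : k ≠ i) (hj : k ≠ j) :
    Commute (opT N m A B (Equiv.swap i j)) (opD N m A B k) := by
  have := opT_opD (m := m) (A := A) (B := B) (Equiv.swap i j) k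
  rwa [Equiv.swap_apply_of_ne_of_ne hi hj] at this

theorem opT_commute_opA (w : Equiv.Perm (Fin N)) (a : Module.End ℂ A) :
    Commute (opT N m A B w) (opA N m (Hol N) A B a) := twist_commute_opA _ _ _

theorem opB_commute_opT (b : Module.End ℂ B) (w : Equiv.Perm (Fin N)) :
    Commute (opB N m (Hol N) A B b) (opT N m A B w) := opB_commute_twist _ _ _

variable (N m A B) in
/-- The operator `r̃_{ij} - z_i/(z_i - z_j) (P_{ij} - τ(s_{ij}))`, where `r̃` is the classical r-matrix
of `gl_m` and `P` the flip. -/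
def mid (i j : Fin N) : HEnd N m A B :=
  pairing (unitAt N m (Hol N) A B i) (unitAt N m (Hol N) A B j) (stdHalf m) -
    opM N m (Hol N) A B (phi i j) *
      (pairing (unitAt N m (Hol N) A B i) (unitAt N m (Hol N) A B j) 1 -
        opT N m A B (Equiv.swap i j))

theorem opT_eq {i j : Fin N} (h : i ≠ j) : opT N m A B (Equiv.swap i j) =
    opF N m (Hol N) A B (Hol.perm (Equiv.swap i j)).toLinearMap *
      pairing (unitAt N m (Hol N) A B i) (unitAt N m (Hol N) A B j) 1 := by
  rw [pairing_unitAt_one h]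
  rfl

/-- Since `τ(s_ij)` is the flip times the exchange of variables, `φ_ij (P_ij - τ(s_ij))` is a
divided difference times the flip. In this form there is no pole, and `middle_cybe` applies. -/
theorem mid_eq {i j : Fin N} (h : i ≠ j) : mid N m A B i j =
    pairing (unitAt N m (Hol N) A B i) (unitAt N m (Hol N) A B j) (stdHalf m) -
      opF N m (Hol N) A B (divDiff i j) *
        pairing (unitAt N m (Hol N) A B i) (unitAt N m (Hol N) A B j) 1 := by
  rw [mid, opT_eq h, divDiff, map_mul, map_sub, map_one, opM_eq]
  simp only [mul_sub, sub_mul, mul_assoc, mul_one]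

theorem pairing_unitAt_symm {i j : Fin N} (h : i ≠ j) :
    pairing (unitAt N m (Hol N) A B j) (unitAt N m (Hol N) A B i) 1 =
      pairing (unitAt N m (Hol N) A B i) (unitAt N m (Hol N) A B j) 1 :=
  pairing_flip _ (unitAt_famCommute h.symm)

/-- By `h_ab + h_ba = 1` the r-matrices add up to `P_ij`, and by `φ_ij + φ_ji = 1` the subtracted
terms add up to `P_ij - τ(s_ij)`. -/
theorem mid_add {i j : Fin N} (h : i ≠ j) :
    mid N m A B i j + mid N m A B j i = opT N m A B (Equiv.swap i j) := by
  have h1 : pairing (unitAt N m (Hol N) A B j) (unitAt N m (Hol N) A B i) (stdHalf m) =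
      pairing (unitAt N m (Hol N) A B i) (unitAt N m (Hol N) A B j) fun a b => stdHalf m b a :=
    pairing_flip _ (unitAt_famCommute h.symm)
  have h2 := pairing_add (unitAt N m (Hol N) A B i) (unitAt N m (Hol N) A B j) (stdHalf m)
    fun a b => stdHalf m b a
  have h3 : (fun a b => stdHalf m a b + stdHalf m b a) = 1 :=
    funext fun a => funext fun b => (stdHalf_isHalf m).add_flip a b
  have h4 := congrArg (opM N m (Hol N) A B) (phi_add h)
  rw [map_add, map_one] at h4
  rw [h3] at h2
  rw [mid, mid, pairing_unitAt_symm h, opT_swap_comm, h1, eq_sub_of_add_eq' h2.symm,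
    eq_sub_of_add_eq' h4, sub_mul, one_mul]
  abel

theorem opT_mid (w : Equiv.Perm (Fin N)) {i j : Fin N} (h : i ≠ j) :
    opT N m A B w * mid N m A B i j = mid N m A B (w i) (w j) * opT N m A B w := by
  have hp (g) := pairing_mul_intertwine g (opT_unitAt (A := A) (B := B) (m := m) w i)
    (opT_unitAt w j)
  have hs : opT N m A B w * opT N m A B (Equiv.swap i j) =
      opT N m A B (Equiv.swap (w i) (w j)) * opT N m A B w := by
    rw [← opT_mul, ← opT_mul, Equiv.mul_swap_eq_swap_mul]
  rw [mid, mid, mul_sub, ← mul_assoc, opT_opM, perm_phi w h, mul_assoc, mul_sub, hp, hp, hs,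
    sub_mul, mul_assoc, sub_mul]

theorem mid_commute {y : HEnd N m A B} {i j : Fin N}
    (hi : ∀ a b, Commute y (unitAt N m (Hol N) A B i a b))
    (hj : ∀ a b, Commute y (unitAt N m (Hol N) A B j a b))
    (hf : Commute y (opM N m (Hol N) A B (phi i j)))
    (ht : Commute y (opT N m A B (Equiv.swap i j))) : Commute y (mid N m A B i j) :=
  (pairing_commute _ hi hj).sub_right (hf.mul_right ((pairing_commute _ hi hj).sub_right ht))

theorem mid_commute_mid {i j k l : Fin N} (hij : i ≠ j) (hkl : k ≠ l) (hik : i ≠ k) (hil : i ≠ l)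
    (hjk : j ≠ k) (hjl : j ≠ l) : Commute (mid N m A B i j) (mid N m A B k l) := by
  refine mid_commute (fun a b => ?_) (fun a b => ?_) ?_ ?_
  · exact (mid_commute (fun c d => opS_commute hik.symm _ _)
      (fun c d => opS_commute hjk.symm _ _) (opS_commute_opM _ _ _)
      (opT_swap_commute_opS hik.symm hjk.symm _).symm).symm
  · exact (mid_commute (fun c d => opS_commute hil.symm _ _)
      (fun c d => opS_commute hjl.symm _ _) (opS_commute_opM _ _ _)
      (opT_swap_commute_opS hil.symm hjl.symm _).symm).symm
  · refine (mid_commute (fun c d => (opS_commute_opM _ _ _).symm)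
      (fun c d => (opS_commute_opM _ _ _).symm) (opM_commute_opM _ _) ?_).symm
    refine (opT_opM_commute ?_).symm
    rw [perm_phi _ hkl, Equiv.swap_apply_of_ne_of_ne hik.symm hjk.symm,
      Equiv.swap_apply_of_ne_of_ne hil.symm hjl.symm]
  · have := opT_mid (m := m) (A := A) (B := B) (Equiv.swap k l) hij
    rw [Equiv.swap_apply_of_ne_of_ne hik hil, Equiv.swap_apply_of_ne_of_ne hjk hjl] at this
    exact this.symm

/-- An instance of `middle_cybe` in which the `D`'s are divided differences; its two quadratic
hypotheses are `divDiff_braid`. -/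
theorem mid_cybe {i j k : Fin N} (hij : i ≠ j) (hik : i ≠ k) (hjk : j ≠ k) :
    ⁅mid N m A B i j, mid N m A B i k⁆ +
      ⁅mid N m A B i j + mid N m A B i k, mid N m A B j k⁆ = 0 := by
  have hb := divDiff_braid hij hik hjk
  have e1 := congrArg (opF N m (Hol N) A B) hb.1
  have e2 := congrArg (opF N m (Hol N) A B) hb.2
  have hc : ∀ (f : Module.End ℂ (Hol N)) i a b,
      Commute (opF N m (Hol N) A B f) (unitAt N m (Hol N) A B i a b) :=
    fun f i a b => (opS_commute_opF _ _ _).symm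
  have hP : ∀ {i j : Fin N}, i ≠ j → ∀ k a b,
      pairing (unitAt N m (Hol N) A B i) (unitAt N m (Hol N) A B j) 1 *
        unitAt N m (Hol N) A B k a b = unitAt N m (Hol N) A B (Equiv.swap i j k) a b *
          pairing (unitAt N m (Hol N) A B i) (unitAt N m (Hol N) A B j) 1 := by
    intro i j h k a b
    rw [pairing_unitAt_one h]
    exact permVec_opS _ _ _
  simp only [map_add, map_sub, map_mul] at e1 e2
  rw [mid_eq hij, mid_eq hik, mid_eq hjk]
  refine middle_cybe (stdHalf_isHalf m) (unitAt_rel i) (unitAt_rel j) (unitAt_rel k)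
    (unitAt_famCommute hij) (unitAt_famCommute hik) (unitAt_famCommute hjk) (hc _ _) (hc _ _)
    (hc _ _) (hc _ _) (hc _ _) (hc _ _) (hc _ _) (hc _ _) (hc _ _) ?_ ?_ ?_ ?_ e1 e2 <;>
  intro a b
  · rw [hP hij, Equiv.swap_apply_left]
  · rw [hP hij, Equiv.swap_apply_right]
  · rw [hP hik, Equiv.swap_apply_left]
  · rw [hP hik, Equiv.swap_apply_right]

/-- `M_{ij}` preserves diagonal matrices acting on the sum of two sites. -/
theorem opS_add_commute_mid {i j : Fin N} (h : i ≠ j) (v : Fin m → ℂ) :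
    Commute (opS N m (Hol N) A B i (Matrix.diagonal v) + opS N m (Hol N) A B j (Matrix.diagonal v))
      (mid N m A B i j) := by
  have hu : ∀ (k : Fin N) (a b : Fin m), ⁅opS N m (Hol N) A B k (Matrix.diagonal v),
      unitAt N m (Hol N) A B k a b⁆ = (v a - v b) • unitAt N m (Hol N) A B k a b := by
    intro k a b
    rw [Ring.lie_def, unitAt, ← opS_mul, ← opS_mul, ← map_sub, ← map_smul]
    congr 1
    ext c d
    rw [Matrix.sub_apply, Matrix.diagonal_mul, Matrix.mul_diagonal, Matrix.smul_apply,
      Matrix.single_apply]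
    split_ifs with hcd
    · rw [hcd.1, hcd.2, smul_eq_mul]; ring
    · simp
  have hp (g : Fin m → Fin m → ℂ) : Commute
      (opS N m (Hol N) A B i (Matrix.diagonal v) + opS N m (Hol N) A B j (Matrix.diagonal v))
      (pairing (unitAt N m (Hol N) A B i) (unitAt N m (Hol N) A B j) g) := by
    have := pairing_lie (h := g) (hu i) (hu j) (fun a b => opS_commute h _ _)
      (fun a b => opS_commute h.symm _ _)
    refine (commute_iff_lie_eq).mpr ?_
    rw [add_lie, this.1, this.2, pairing, pairing, ← Finset.sum_add_distrib]
    refine Finset.sum_eq_zero fun a _ => ?_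
    rw [← Finset.sum_add_distrib]
    refine Finset.sum_eq_zero fun b _ => ?_
    rw [smul_mul_assoc, mul_smul_comm, ← smul_add, ← add_smul]
    simp
  refine (hp _).sub_right (Commute.mul_right ?_ ((hp _).sub_right ?_))
  · exact (opS_commute_opM _ _ _).add_left (opS_commute_opM _ _ _)
  · refine Commute.symm (?_ : _ * _ = _ * _)
    rw [mul_add, opT_opS, opT_opS, Equiv.swap_apply_left, Equiv.swap_apply_right, add_mul, add_comm]

theorem opD_add_commute_mid {i j : Fin N} (h : i ≠ j) :
    Commute (opD N m A B i + opD N m A B j) (mid N m A B i j) := by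
  have hp (g : Fin m → Fin m → ℂ) : Commute (opD N m A B i + opD N m A B j)
      (pairing (unitAt N m (Hol N) A B i) (unitAt N m (Hol N) A B j) g) :=
    pairing_commute _
      (fun a b => ((opS_commute_opDer _ _ _).add_right (opS_commute_opDer _ _ _)).symm)
      (fun a b => ((opS_commute_opDer _ _ _).add_right (opS_commute_opDer _ _ _)).symm)
  refine (hp _).sub_right (Commute.mul_right ?_ ((hp _).sub_right ?_))
  · refine (commute_iff_lie_eq).mpr ?_
    rw [add_lie, opD_opM, opD_opM, ← map_add, euler_phi_add h, map_zero]
  · refine Commute.symm (?_ : _ * _ = _ * _)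
    rw [mul_add, opT_opD, opT_opD, Equiv.swap_apply_left, Equiv.swap_apply_right, add_mul, add_comm]

theorem opD_commute_mid {i j k : Fin N} (h : i ≠ j) (hi : k ≠ i) (hj : k ≠ j) :
    Commute (opD N m A B k) (mid N m A B i j) := by
  refine mid_commute (fun a b => (opS_commute_opDer _ _ _).symm)
    (fun a b => (opS_commute_opDer _ _ _).symm) ?_ (opT_swap_commute_opD hi hj).symm
  refine (commute_iff_lie_eq).mpr ?_
  rw [opD_opM, euler_phi_of_ne h hi hj, map_zero]

theorem opS_commute_mid {i j k : Fin N} (hi : k ≠ i) (hj : k ≠ j)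
    (M : Matrix (Fin m) (Fin m) ℂ) :
    Commute (opS N m (Hol N) A B k M) (mid N m A B i j) :=
  mid_commute (fun a b => opS_commute hi _ _) (fun a b => opS_commute hj _ _)
    (opS_commute_opM _ _ _) (opT_swap_commute_opS hi hj M).symm

/-- Of the constituents of `M_ij` only `τ(s_ij)` fails to commute with functions. -/
theorem mid_lie_opM (i j : Fin N) (f : Hol N) :
    ⁅mid N m A B i j, opM N m (Hol N) A B f⁆ =
      opM N m (Hol N) A B (phi i j * (Hol.perm (Equiv.swap i j) f - f)) *
        opT N m A B (Equiv.swap i j) := by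
  have hp (g : Fin m → Fin m → ℂ) : Commute (opM N m (Hol N) A B f)
      (pairing (unitAt N m (Hol N) A B i) (unitAt N m (Hol N) A B j) g) :=
    pairing_commute _ (fun a b => (opS_commute_opM _ _ _).symm)
      (fun a b => (opS_commute_opM _ _ _).symm)
  rw [mid, sub_lie, lie_eq_zero_of_commute (hp _).symm,
    lie_mul_left_of_commute (opM_commute_opM _ _), sub_lie, lie_eq_zero_of_commute (hp _).symm,
    Ring.lie_def, opT_opM, ← sub_mul, ← map_sub, map_mul]
  simp only [zero_sub, mul_neg, neg_neg, mul_assoc]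

end Middle

/-! ### Dunkl operators built from operators with the formal properties of `r_{(0i)}`, `r_{(i,N+1)}` -/

section Abstract

variable {N m : ℕ} {A B : Type*} [AddCommGroup A] [Module ℂ A] [AddCommGroup B] [Module ℂ B]

/-- Operators attached to the sites which permute under `τ(w)` and commute with functions and with the
operators at other sites. -/
structure SiteOps (L : Fin N → HEnd N m A B) : Prop where
  opD {i j : Fin N} (h : i ≠ j) : Commute (opD N m A B j) (L i)
  opS {i j : Fin N} (h : i ≠ j) (M : Matrix (Fin m) (Fin m) ℂ) :
    Commute (opS N m (Hol N) A B j M) (L i)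
  opM (f : Hol N) (i : Fin N) : Commute (opM N m (Hol N) A B f) (L i)
  opT (w : Equiv.Perm (Fin N)) (i : Fin N) : opT N m A B w * L i = L (w i) * opT N m A B w

theorem SiteOps.mid {L : Fin N → HEnd N m A B} (hL : SiteOps L) {i j k : Fin N} (hi : k ≠ i)
    (hj : k ≠ j) : Commute (L k) (mid N m A B i j) :=
  mid_commute (fun _ _ => (hL.opS hi _).symm) (fun _ _ => (hL.opS hj _).symm)
    (hL.opM _ _).symm (by
      have := hL.opT (Equiv.swap i j) k
      rw [Equiv.swap_apply_of_ne_of_ne hi hj] at this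
      exact this.symm)

/-- The formal properties of the operators `L_i` and `R_i` acting on the site `i` together with `A` and
`B` respectively. -/
structure CurrentOps (L R : Fin N → HEnd N m A B) : Prop where
  left : SiteOps L
  right : SiteOps R
  cybe_left {i j : Fin N} (h : i ≠ j) : ⁅L i, L j⁆ + ⁅L i + L j, mid N m A B i j⁆ = 0
  cybe_right {i j : Fin N} (h : i ≠ j) : ⁅R i, R j⁆ - ⁅R i + R j, mid N m A B i j⁆ = 0
  left_right {i j : Fin N} (h : i ≠ j) : Commute (L i) (R j)

/-- The diagonal entries of half the sum of the positive coroots. -/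
def rhoDiag (m : ℕ) (a : Fin m) : ℂ := ∑ b, stdHalf m a b - m / 2

/-- The part of the Dunkl operator which involves a single site. -/
def oneSite (k : ℂ) (L R : Fin N → HEnd N m A B) (i : Fin N) : HEnd N m A B :=
  k • opD N m A B i + L i - R i + opS N m (Hol N) A B i (Matrix.diagonal (rhoDiag m))

/-- The Dunkl operator in the direction of a basis vector. -/
def dunklOp (k : ℂ) (L R : Fin N → HEnd N m A B) (i : Fin N) : HEnd N m A B :=
  oneSite k L R i + (∑ j ∈ Finset.Iio i, mid N m A B j i - ∑ j ∈ Finset.Ioi i, mid N m A B i j)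

variable {k : ℂ} {L R : Fin N → HEnd N m A B}

theorem oneSite_commute_mid (h : CurrentOps L R) {i j l : Fin N} (hij : i ≠ j) (hi : l ≠ i)
    (hj : l ≠ j) : Commute (oneSite k L R l) (mid N m A B i j) :=
  ((((opD_commute_mid hij hi hj).smul_left k).add_left (h.left.mid hi hj)).sub_left
    (h.right.mid hi hj)).add_left (opS_commute_mid hi hj _)

/-- All mixed brackets vanish, and both `∂_i + ∂_j` and the diagonal matrices commute with `M_ij`.
What remains is the sum of the equations for `L` and `R`; as `R` enters with a minus sign, it
contributes `⁅R_i, R_j⁆ - ⁅R_i + R_j, M_ij⁆`. -/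
theorem lie_oneSite (h : CurrentOps L R) {i j : Fin N} (hij : i ≠ j) :
    ⁅oneSite k L R i, oneSite k L R j⁆ +
      ⁅oneSite k L R i + oneSite k L R j, mid N m A B i j⁆ = 0 := by
  have hD := lie_eq_zero_of_commute (opD_add_commute_mid (A := A) (B := B) (m := m) hij)
  have hS := lie_eq_zero_of_commute (opS_add_commute_mid (A := A) (B := B) hij (rhoDiag m))
  have hl := h.cybe_left hij
  have hr := h.cybe_right hij
  have e1 := lie_eq_zero_of_commute (opD_comm (m := m) (A := A) (B := B) i j)
  have e2 := lie_eq_zero_of_commute (h.left.opD hij.symm)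
  have e3 := lie_eq_zero_of_commute (h.right.opD hij.symm)
  have e4 := lie_eq_zero_of_commute (h.left.opD hij).symm
  have e5 := lie_eq_zero_of_commute (h.right.opD hij).symm
  have e6 := lie_eq_zero_of_commute (h.left.opS hij.symm (Matrix.diagonal (rhoDiag m)))
  have e7 := lie_eq_zero_of_commute (h.right.opS hij.symm (Matrix.diagonal (rhoDiag m)))
  have e8 := lie_eq_zero_of_commute (h.left.opS hij (Matrix.diagonal (rhoDiag m))).symm
  have e9 := lie_eq_zero_of_commute (h.right.opS hij (Matrix.diagonal (rhoDiag m))).symm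
  have e10 := lie_eq_zero_of_commute (h.left_right hij)
  have e11 := lie_eq_zero_of_commute (h.left_right hij.symm).symm
  have e12 := lie_eq_zero_of_commute (opS_commute (S := Hol N) (A := A) (B := B) hij
    (Matrix.diagonal (rhoDiag m)) (Matrix.diagonal (rhoDiag m)))
  have e13 := lie_eq_zero_of_commute (opS_commute_opDer (A := A) (B := B) i
    (Matrix.diagonal (rhoDiag m)) (Hol.euler j))
  have e14 := lie_eq_zero_of_commute (opS_commute_opDer (A := A) (B := B) j
    (Matrix.diagonal (rhoDiag m)) (Hol.euler i)).symm
  change ⁅opS N m (Hol N) A B i (Matrix.diagonal (rhoDiag m)), opD N m A B j⁆ = 0 at e13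
  change ⁅opD N m A B i, opS N m (Hol N) A B j (Matrix.diagonal (rhoDiag m))⁆ = 0 at e14
  have h1 : ⁅oneSite k L R i, oneSite k L R j⁆ = ⁅L i, L j⁆ + ⁅R i, R j⁆ := by
    simp only [oneSite, add_lie, lie_add, sub_lie, lie_sub, smul_lie, lie_smul, e1, e2, e3, e4, e5,
      e6, e7, e8, e9, e10, e11, e12, e13, e14]
    simp only [smul_zero, zero_add, add_zero, sub_zero, zero_sub, neg_neg, sub_neg_eq_add]
  have h2 : oneSite k L R i + oneSite k L R j = k • (opD N m A B i + opD N m A B j) + (L i + L j) -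
      (R i + R j) + (opS N m (Hol N) A B i (Matrix.diagonal (rhoDiag m)) +
        opS N m (Hol N) A B j (Matrix.diagonal (rhoDiag m))) := by
    simp only [oneSite, smul_add]
    abel
  rw [h1, h2, add_lie, sub_lie, add_lie, smul_lie, hD, hS, smul_zero, zero_add, add_zero]
  calc _ = (⁅L i, L j⁆ + ⁅L i + L j, mid N m A B i j⁆) +
        (⁅R i, R j⁆ - ⁅R i + R j, mid N m A B i j⁆) := by abel
    _ = 0 := by rw [hl, hr, add_zero]

theorem sum_iio_sub_sum_ioi {E : Type*} [AddCommGroup E] (f : Fin N → Fin N → E) (i : Fin N) :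
    ∑ j ∈ Finset.Iio i, f j i - ∑ j ∈ Finset.Ioi i, f i j =
      ∑ j, if i < j then - f i j else if j < i then f j i else 0 := by
  have : ∀ j, (if i < j then - f i j else if j < i then f j i else 0) =
      (if j ∈ Finset.Iio i then f j i else 0) - if j ∈ Finset.Ioi i then f i j else 0 := by
    intro j
    rcases lt_trichotomy i j with h | h | h
    · simp [h, h.not_gt]
    · subst h; simp
    · simp [h, h.not_gt]
  simp only [this, Finset.sum_sub_distrib, Finset.sum_ite_mem, Finset.univ_inter]

/-- The operators are of the Gaudin form of `lie_gaudin`, so commutativity follows from the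
Yang–Baxter equations for triples of sites and from `lie_oneSite` for the pair. -/
theorem dunklOp_comm (h : CurrentOps L R) (i j : Fin N) :
    Commute (dunklOp k L R i) (dunklOp k L R j) := by
  wlog hij : i < j generalizing i j
  · rcases (not_lt.mp hij).eq_or_lt with e | e
    · rw [e]
    · exact (this j i e).symm
  -- The operators `M_ij` are not antisymmetric, since `M_ij + M_ji = τ(s_ij)`. Therefore `-M_ij` is
  -- taken only for `i < j` and extended antisymmetrically.
  set Q : Fin N → Fin N → HEnd N m A B := fun i j =>
    if i < j then - mid N m A B i j else if j < i then mid N m A B j i else 0 with hQ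
  have Qlt : ∀ {i j}, i < j → Q i j = - mid N m A B i j := fun h => if_pos h
  have Qgt : ∀ {i j}, j < i → Q i j = mid N m A B j i := fun h => by
    simp only [hQ, if_neg h.not_gt, if_pos h]
  have hanti : ∀ i j, Q j i = - Q i j := by
    intro i j
    rcases lt_trichotomy i j with h | h | h
    · rw [Qlt h, Qgt h, neg_neg]
    · subst h; simp [hQ]
    · rw [Qlt h, Qgt h]
  have hcomm : ∀ {y : HEnd N m A B} {i j : Fin N}, i ≠ j → Commute y (mid N m A B i j) →
      Commute y (mid N m A B j i) → ⁅y, Q i j⁆ = 0 := by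
    intro y i j hij h1 h2
    rcases lt_or_gt_of_ne hij with h | h
    · rw [Qlt h, lie_neg, lie_eq_zero_of_commute h1, neg_zero]
    · rw [Qgt h, lie_eq_zero_of_commute h2]
  -- The cyclic Yang–Baxter equation is `mid_cybe` for increasing triples; the other orders follow
  -- from its cyclic invariance and its antisymmetry under exchange of two sites.
  have sorted : ∀ {i j k : Fin N}, i < j → j < k →
      ⁅Q i j, Q j k⁆ + ⁅Q j k, Q k i⁆ + ⁅Q k i, Q i j⁆ = 0 := by
    intro i j k hij hjk
    rw [Qlt hij, Qlt hjk, Qgt (hij.trans hjk)]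
    have := mid_cybe (m := m) (A := A) (B := B) hij.ne (hij.trans hjk).ne hjk.ne
    rw [add_lie] at this
    rw [← this]
    simp only [neg_lie, lie_neg, neg_neg, ← lie_skew (mid N m A B i k)]
    abel
  have skew : ∀ {i j k : Fin N}, ⁅Q j i, Q i k⁆ + ⁅Q i k, Q k j⁆ + ⁅Q k j, Q j i⁆ = 0 →
      ⁅Q i j, Q j k⁆ + ⁅Q j k, Q k i⁆ + ⁅Q k i, Q i j⁆ = 0 := by
    intro i j k h
    rw [hanti i j, hanti k i, hanti j k] at h
    simp only [neg_lie, lie_neg, neg_neg] at h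
    rw [← lie_skew (Q i j) (Q j k), ← lie_skew (Q j k) (Q k i), ← lie_skew (Q k i) (Q i j),
      ← neg_zero, ← h]
    abel
  have rot : ∀ {i j k : Fin N}, ⁅Q j k, Q k i⁆ + ⁅Q k i, Q i j⁆ + ⁅Q i j, Q j k⁆ = 0 →
      ⁅Q i j, Q j k⁆ + ⁅Q j k, Q k i⁆ + ⁅Q k i, Q i j⁆ = 0 := by
    intro i j k h
    rw [← h]; abel
  have hc : ∀ l, l ≠ i → l ≠ j → ⁅Q i j, Q j l⁆ + ⁅Q j l, Q l i⁆ + ⁅Q l i, Q i j⁆ = 0 := by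
    intro l hi hj
    rcases lt_or_gt_of_ne hj with hj | hj
    · rcases lt_or_gt_of_ne hi with hi | hi
      · exact rot (rot (sorted hi hij))
      · exact skew (rot (sorted hi hj))
    · exact sorted hij hj
  have hD : ∀ i, dunklOp k L R i = oneSite k L R i + ∑ j, Q i j := fun i => by
    rw [dunklOp, sum_iio_sub_sum_ioi]
  rw [commute_iff_lie_eq, hD, hD, lie_gaudin hij.ne hanti (fun i => by simp [hQ]) ?_ hc ?_ ?_]
  · rw [Qlt hij, lie_neg, sub_neg_eq_add]
    exact lie_oneSite h hij.ne
  · intro a b hai haj hbi hbj hab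
    refine hcomm hbj.symm ?_ ?_ <;> refine (commute_iff_lie_eq.mpr ?_).symm
    · exact hcomm hai.symm (mid_commute_mid hbj.symm hai.symm hij.ne' haj.symm hbi hab.symm)
        (mid_commute_mid hbj.symm hai haj.symm hij.ne' hab.symm hbi)
    · exact hcomm hai.symm (mid_commute_mid hbj hai.symm hbi hab.symm hij.ne' haj.symm)
        (mid_commute_mid hbj hai hab.symm hbi haj.symm hij.ne')
  · intro l hl
    by_cases hj : j = l
    · subst hj; simp [hQ]
    · exact hcomm hj (oneSite_commute_mid h hj hij.ne hl.symm)
        (oneSite_commute_mid h (Ne.symm hj) hl.symm hij.ne)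
  · intro l hl
    by_cases hi : i = l
    · subst hi; simp [hQ]
    · exact hcomm hi (oneSite_commute_mid h hi hij.ne' hl.symm)
        (oneSite_commute_mid h (Ne.symm hi) hl.symm hij.ne')

/-- The part of the Dunkl operator which is permuted by the symmetric group. -/
def equivariantPart (k : ℂ) (L R : Fin N → HEnd N m A B) (i : Fin N) : HEnd N m A B :=
  oneSite k L R i - ∑ j ∈ Finset.univ.erase i, mid N m A B i j

/-- By `mid_add`, `M_ji` is traded for `τ(s_ij) - M_ij` when `j < i`. The dependence on the order of
the sites is then concentrated in a sum of transpositions, as for Jucys–Murphy elements. -/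
theorem dunklOp_eq (i : Fin N) : dunklOp k L R i = equivariantPart k L R i +
    ∑ j ∈ Finset.Iio i, opT N m A B (Equiv.swap i j) := by
  have h1 : ∀ j ∈ Finset.Iio i, mid N m A B j i =
      opT N m A B (Equiv.swap i j) - mid N m A B i j := fun j hj => by
    rw [← mid_add (Finset.mem_Iio.mp hj).ne', add_sub_cancel_left]
  have h2 : Finset.univ.erase i = (Finset.Iio i).disjUnion (Finset.Ioi i)
      (Finset.disjoint_left.mpr fun j h h' =>
        (Finset.mem_Iio.mp h).not_gt (Finset.mem_Ioi.mp h')) := by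
    ext j; simp
  rw [dunklOp, equivariantPart, Finset.sum_congr rfl h1, h2, Finset.sum_disjUnion,
    Finset.sum_sub_distrib]
  abel

theorem opT_equivariantPart (h : CurrentOps L R) (w : Equiv.Perm (Fin N)) (i : Fin N) :
    opT N m A B w * equivariantPart k L R i = equivariantPart k L R (w i) * opT N m A B w := by
  have hs : opT N m A B w * ∑ j ∈ Finset.univ.erase i, mid N m A B i j =
      (∑ j ∈ Finset.univ.erase (w i), mid N m A B (w i) j) * opT N m A B w := by
    rw [Finset.mul_sum, Finset.sum_mul]
    refine Finset.sum_bij (fun j _ => w j) (fun j hj => ?_) (fun _ _ _ _ h => w.injective h)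
      (fun j hj => ⟨w.symm j, ?_, w.apply_symm_apply j⟩) (fun j hj => ?_)
    · simpa using hj
    · simp only [Finset.mem_erase, Finset.mem_univ, and_true] at hj ⊢
      rintro rfl
      simp at hj
    · exact opT_mid w (Finset.ne_of_mem_erase hj).symm
  rw [equivariantPart, equivariantPart, mul_sub, sub_mul, hs, oneSite, oneSite]
  simp only [mul_add, mul_sub, add_mul, sub_mul, mul_smul_comm, smul_mul_assoc, opT_opD,
    h.left.opT, h.right.opT, opT_opS]

theorem dunklOp_lie_opM (h : CurrentOps L R) (i : Fin N) (f : Hol N) :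
    ⁅dunklOp k L R i, opM N m (Hol N) A B f⁆ = k • opM N m (Hol N) A B (Hol.euler i f) +
      (∑ j ∈ Finset.Iio i, ⁅mid N m A B j i, opM N m (Hol N) A B f⁆ -
        ∑ j ∈ Finset.Ioi i, ⁅mid N m A B i j, opM N m (Hol N) A B f⁆) := by
  simp only [dunklOp, oneSite, add_lie, sub_lie, sum_lie, smul_lie, opD_opM,
    lie_eq_zero_of_commute (h.left.opM f i).symm, lie_eq_zero_of_commute (h.right.opM f i).symm,
    lie_eq_zero_of_commute (opS_commute_opM _ _ _), add_zero, sub_zero]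

theorem sum_smul_iio_sub_ioi {E : Type*} [AddCommGroup E] [Module ℂ E] (ξ : Fin N → ℂ)
    (f : Fin N → Fin N → E) :
    ∑ i, ξ i • (∑ j ∈ Finset.Iio i, f j i - ∑ j ∈ Finset.Ioi i, f i j) =
      - ∑ i, ∑ j ∈ Finset.Ioi i, (ξ i - ξ j) • f i j := by
  have h1 : ∑ i, ∑ j ∈ Finset.Iio i, ξ i • f j i = ∑ i, ∑ j ∈ Finset.Ioi i, ξ j • f i j := by
    rw [Finset.sum_comm' (t' := Finset.univ) (s' := fun j => Finset.Ioi j)]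
    simp
  simp only [smul_sub, Finset.smul_sum, Finset.sum_sub_distrib, sub_smul, h1]
  abel

/-- The Dunkl operator in the direction `ξ`. -/
def dunklAlong (k : ℂ) (L R : Fin N → HEnd N m A B) (ξ : Fin N → ℂ) : HEnd N m A B :=
  ∑ i, ξ i • dunklOp k L R i

theorem dunklAlong_lie_opM (h : CurrentOps L R) (ξ : Fin N → ℂ) (f : Hol N) :
    ⁅dunklAlong k L R ξ, opM N m (Hol N) A B f⁆ = k • opM N m (Hol N) A B (eulerAlong ξ f) +
      ∑ i, ∑ j ∈ Finset.Ioi i, (ξ i - ξ j) •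
        (opM N m (Hol N) A B ((f - Hol.perm (Equiv.swap i j) f) * phi i j) *
          opT N m A B (Equiv.swap i j)) := by
  simp only [dunklAlong, sum_lie, smul_lie, dunklOp_lie_opM h, smul_add, Finset.sum_add_distrib,
    sum_smul_iio_sub_ioi, mid_lie_opM, eulerAlong, map_sum, map_smul, Finset.smul_sum,
    smul_comm k, ← Finset.sum_neg_distrib, ← smul_neg, ← neg_mul, ← map_neg]
  refine congrArg (_ + ·) ?_
  refine Finset.sum_congr rfl fun i _ => Finset.sum_congr rfl fun j _ => ?_
  rw [show -(phi i j * (Hol.perm (Equiv.swap i j) f - f)) =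
    (f - Hol.perm (Equiv.swap i j) f) * phi i j by ring]

theorem dunklAlong_eq (ξ : Fin N → ℂ) : dunklAlong k L R ξ = ∑ i, ξ i • oneSite k L R i -
    ∑ i, ∑ j ∈ Finset.Ioi i, (ξ i - ξ j) • mid N m A B i j := by
  simp only [dunklAlong, dunklOp, smul_add, Finset.sum_add_distrib, sum_smul_iio_sub_ioi,
    ← sub_eq_add_neg]

theorem dunklAlong_comm (h : CurrentOps L R) (ξ ξ' : Fin N → ℂ) :
    Commute (dunklAlong k L R ξ) (dunklAlong k L R ξ') :=
  Commute.sum_left _ _ _ fun i _ => Commute.sum_right _ _ _ fun j _ =>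
    ((dunklOp_comm h i j).smul_right _).smul_left _

end Abstract

open Filter

/-! ### Pointwise eventually constant sequences of operators -/

section Limits

variable {N m : ℕ} {S A B : Type*} [CommRing S] [Algebra ℂ S]
  [AddCommGroup A] [Module ℂ A] [AddCommGroup B] [Module ℂ B]

variable (N m S A B) in
/-- Operators as linear endomorphisms. -/
def ev : TEnd N m S A B →ₐ[ℂ] Module.End ℂ (TensorSpace N m S A B) :=
  AlgHom.id ℂ (Module.End ℂ (TensorSpace N m S A B))

theorem ev_injective : Function.Injective (ev N m S A B) := fun _ _ h => h

theorem ev_mul_apply (f g : TEnd N m S A B) (x : TensorSpace N m S A B) :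
    ev N m S A B (f * g) x = ev N m S A B f (ev N m S A B g x) := rfl

theorem ev_add_apply (f g : TEnd N m S A B) (x : TensorSpace N m S A B) :
    ev N m S A B (f + g) x = ev N m S A B f x + ev N m S A B g x := rfl

theorem ev_sub_apply (f g : TEnd N m S A B) (x : TensorSpace N m S A B) :
    ev N m S A B (f - g) x = ev N m S A B f x - ev N m S A B g x := rfl

theorem ev_smul_apply (k : ℂ) (f : TEnd N m S A B) (x : TensorSpace N m S A B) :
    ev N m S A B (k • f) x = k • ev N m S A B f x := rfl

theorem ev_one_apply (x : TensorSpace N m S A B) : ev N m S A B 1 x = x := rfl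

theorem ev_sum_apply {ι : Type*} (s : Finset ι) (f : ι → TEnd N m S A B)
    (x : TensorSpace N m S A B) :
    ev N m S A B (∑ i ∈ s, f i) x = ∑ i ∈ s, ev N m S A B (f i) x := by
  rw [map_sum, LinearMap.sum_apply]

/-- On every vector, the sequence is eventually equal to the limit. -/
def IsPtLim (T : ℕ → TEnd N m S A B) (f : TEnd N m S A B) : Prop :=
  ∀ x, ∀ᶠ K in atTop, ev N m S A B (T K) x = ev N m S A B f x

namespace IsPtLim

variable {T U : ℕ → TEnd N m S A B} {f g : TEnd N m S A B}

theorem const (f : TEnd N m S A B) : IsPtLim (fun _ => f) f := fun _ => Eventually.of_forall fun _ => rfl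

theorem add (hT : IsPtLim T f) (hU : IsPtLim U g) : IsPtLim (fun K => T K + U K) (f + g) := by
  intro x
  filter_upwards [hT x, hU x] with K h1 h2
  rw [ev_add_apply, ev_add_apply, h1, h2]

theorem sub (hT : IsPtLim T f) (hU : IsPtLim U g) : IsPtLim (fun K => T K - U K) (f - g) := by
  intro x
  filter_upwards [hT x, hU x] with K h1 h2
  rw [ev_sub_apply, ev_sub_apply, h1, h2]

theorem mul (hT : IsPtLim T f) (hU : IsPtLim U g) : IsPtLim (fun K => T K * U K) (f * g) := by
  intro x
  filter_upwards [hT (ev N m S A B g x), hU x] with K h1 h2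
  rw [ev_mul_apply, ev_mul_apply, h2, h1]

theorem lie (hT : IsPtLim T f) (hU : IsPtLim U g) : IsPtLim (fun K => ⁅T K, U K⁆) ⁅f, g⁆ :=
  (hT.mul hU).sub (hU.mul hT)

theorem comp_add (hT : IsPtLim T f) (n : ℕ) : IsPtLim (fun K => T (K + n)) f := fun x =>
  (tendsto_add_atTop_nat n).eventually (hT x)

theorem unique (hT : IsPtLim T f) (hT' : IsPtLim T g) : f = g := by
  refine ev_injective (LinearMap.ext fun x => ?_)
  obtain ⟨K, h1, h2⟩ := ((hT x).and (hT' x)).exists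
  rw [← h1, h2]

theorem commute (hT : IsPtLim T f) (h : ∀ K, Commute g (T K)) : Commute g f := by
  refine IsPtLim.unique ((const g).mul hT) ?_
  have := hT.mul (const g)
  simpa only [← (h _).eq] using this

/-- The pointwise limit is linear because on finitely many vectors it agrees with one and the same
linear operator `T K`. -/
theorem exists_of_forall (h : ∀ x, ∃ y, ∀ᶠ K in atTop, ev N m S A B (T K) x = y) :
    ∃ f, IsPtLim T f := by
  choose f hf using h
  refine ⟨(⟨⟨f, fun x y => ?_⟩, fun k x => ?_⟩ : TensorSpace N m S A B →ₗ[ℂ] TensorSpace N m S A B),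
    hf⟩
  · obtain ⟨K, h1, h2, h3⟩ := ((hf x).and ((hf y).and (hf (x + y)))).exists
    rw [← h1, ← h2, ← h3, map_add]
  · obtain ⟨K, h1, h2⟩ := ((hf x).and (hf (k • x))).exists
    change f (k • x) = k • f x
    rw [← h1, ← h2, map_smul]

end IsPtLim

theorem eventually_sum_range_eq {E : Type*} [AddCommMonoid E] {t : ℕ → E}
    (ht : ∀ᶠ n in atTop, t n = 0) :
    (Function.support t).Finite ∧ ∀ᶠ K in atTop, ∑ n ∈ Finset.range K, t n = ∑ᶠ n, t n := by
  obtain ⟨n₀, hn⟩ := eventually_atTop.mp ht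
  have hs : ∀ K, n₀ ≤ K → Function.support t ⊆ Finset.range K := by
    intro K hK n hn'
    by_contra h
    exact hn' (hn n (hK.trans (by simpa using h)))
  exact ⟨(Finset.finite_toSet _).subset (hs n₀ le_rfl),
    eventually_atTop.mpr ⟨n₀, fun K hK => (finsum_eq_sum_of_support_subset t (hs K hK)).symm⟩⟩

end Limits

/-! ### Truncated sums over currents -/

section Truncated

variable {ι R : Type*} [Fintype ι] [Ring R] [Algebra ℂ R] {J : ℕ → ι → ι → R} {U V : ι → ι → R}
  {h : ι → ι → ℂ} {u v y : R}

theorem truncated_mul_intertwine (hJ : ∀ n a b, Commute y (J n a b))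
    (hU : ∀ a b, y * U a b = V a b * y) (hu : y * u = v * y) (K : ℕ) :
    y * truncated J U h u K = truncated J V h v K * y := by
  have hp : ∀ n, y * u ^ n = v ^ n * y := fun n => SemiconjBy.pow_right hu n
  have hq : ∀ n g, y * pairing (J n) U g = pairing (J n) V g * y := fun n g =>
    pairing_mul_intertwine g (fun a b => hJ n a b) hU
  rw [truncated, truncated, mul_add, add_mul, hq, Finset.mul_sum, Finset.sum_mul]
  congr 1
  refine Finset.sum_congr rfl fun n _ => ?_
  rw [← mul_assoc, hp, mul_assoc, hq, mul_assoc]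

theorem truncated_commute (hJ : ∀ n a b, Commute y (J n a b)) (hU : ∀ a b, Commute y (U a b))
    (hu : Commute y u) (K : ℕ) : Commute y (truncated J U h u K) :=
  truncated_mul_intertwine hJ hU hu K

end Truncated

/-! ### Limits of the truncated current sums and their Yang–Baxter equation. -/

section Currents

variable {N m : ℕ} {A B : Type*} [AddCommGroup A] [Module ℂ A] [AddCommGroup B] [Module ℂ B]

/-- Operators `J_n(E_{ab})` satisfying the commutation relations of the currents `E_{ab} ⊗ tⁿ`, commuting
with all operators at the sites, and almost all zero on every vector. -/
structure IsCurrent (J : ℕ → Fin m → Fin m → HEnd N m A B) : Prop where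
  rel (p q : ℕ) : UnitRel (J p) (J q) (J (p + q))
  opM (f : Hol N) (n : ℕ) (a b : Fin m) : Commute (opM N m (Hol N) A B f) (J n a b)
  opD (i : Fin N) (n : ℕ) (a b : Fin m) : Commute (opD N m A B i) (J n a b)
  opS (i : Fin N) (M : Matrix (Fin m) (Fin m) ℂ) (n : ℕ) (a b : Fin m) :
    Commute (opS N m (Hol N) A B i M) (J n a b)
  opT (w : Equiv.Perm (Fin N)) (n : ℕ) (a b : Fin m) : Commute (opT N m A B w) (J n a b)
  smooth (x : HolSpace N m A B) : ∀ᶠ n in atTop, ∀ a b, ev N m (Hol N) A B (J n a b) x = 0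

/-- The truncation of `∑_n f_i^n ∑ J_n(E_{ab}) E_{ba}^{(i)}`. -/
def siteTrunc (J : ℕ → Fin m → Fin m → HEnd N m A B) (h : Fin m → Fin m → ℂ) (f : Fin N → Hol N)
    (i : Fin N) (K : ℕ) : HEnd N m A B :=
  truncated J (unitAt N m (Hol N) A B i) h (opM N m (Hol N) A B (f i)) K

variable {J : ℕ → Fin m → Fin m → HEnd N m A B} {h : Fin m → Fin m → ℂ} {f : Fin N → Hol N}

theorem IsCurrent.pairing_smooth (hJ : IsCurrent J) (U : Fin m → Fin m → HEnd N m A B)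
    (x : HolSpace N m A B) :
    ∀ᶠ n in atTop, ev N m (Hol N) A B (pairing (J n) U h) x = 0 := by
  -- Only the finitely many vectors `U_ba x` are involved, so one bound on the degree serves for all
  -- of them.
  have : ∀ᶠ n in atTop, ∀ a b, ∀ c d, ev N m (Hol N) A B (J n c d)
      (ev N m (Hol N) A B (U b a) x) = 0 :=
    eventually_all.mpr fun a => eventually_all.mpr fun b => hJ.smooth _
  filter_upwards [this] with n hn
  rw [pairing, ev_sum_apply]
  refine Finset.sum_eq_zero fun a _ => ?_
  rw [ev_sum_apply]
  refine Finset.sum_eq_zero fun b _ => ?_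
  rw [ev_smul_apply, ev_mul_apply, hn, smul_zero]

theorem IsCurrent.tripleOut_smooth (hJ : IsCurrent J) (U V : Fin m → Fin m → HEnd N m A B)
    (c : Fin m → Fin m → Fin m → ℂ) (x : HolSpace N m A B) :
    ∀ᶠ n in atTop, ev N m (Hol N) A B (tripleOut (J n) U V c) x = 0 := by
  have : ∀ᶠ n in atTop, ∀ a b y, ∀ c d, ev N m (Hol N) A B (J n c d)
      (ev N m (Hol N) A B (U y a) (ev N m (Hol N) A B (V b y) x)) = 0 :=
    eventually_all.mpr fun a => eventually_all.mpr fun b => eventually_all.mpr fun y => hJ.smooth _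
  filter_upwards [this] with n hn
  rw [tripleOut, ev_sum_apply]
  refine Finset.sum_eq_zero fun a _ => ?_
  rw [ev_sum_apply]
  refine Finset.sum_eq_zero fun b _ => ?_
  rw [ev_sum_apply]
  refine Finset.sum_eq_zero fun y _ => ?_
  rw [ev_smul_apply, mul_assoc, ev_mul_apply, ev_mul_apply, hn, smul_zero]

theorem IsCurrent.term_smooth (hJ : IsCurrent J) (i : Fin N) (x : HolSpace N m A B) :
    ∀ᶠ n in atTop, ev N m (Hol N) A B (AffineKZ.opM N m (Hol N) A B (f i) ^ (n + 1) *
      pairing (J (n + 1)) (unitAt N m (Hol N) A B i) 1) x = 0 := by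
  filter_upwards [(tendsto_add_atTop_nat 1).eventually
    (hJ.pairing_smooth (h := 1) (unitAt N m (Hol N) A B i) x)] with n hn
  rw [ev_mul_apply, hn, map_zero]

theorem IsCurrent.eventually_siteTrunc (hJ : IsCurrent J) (i : Fin N) (x : HolSpace N m A B) :
    ∀ᶠ K in atTop, ev N m (Hol N) A B (siteTrunc J h f i K) x =
      ev N m (Hol N) A B (pairing (J 0) (unitAt N m (Hol N) A B i) h) x +
        ∑ᶠ n, ev N m (Hol N) A B (AffineKZ.opM N m (Hol N) A B (f i) ^ (n + 1) *
          pairing (J (n + 1)) (unitAt N m (Hol N) A B i) 1) x := by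
  filter_upwards [(eventually_sum_range_eq (hJ.term_smooth (f := f) i x)).2] with K hK
  rw [siteTrunc, truncated, ev_add_apply, ev_sum_apply, hK]

theorem IsCurrent.exists_lim (hJ : IsCurrent J) :
    ∃ L : Fin N → HEnd N m A B, ∀ i, IsPtLim (siteTrunc J h f i) (L i) := by
  choose L hL using fun i => IsPtLim.exists_of_forall (T := siteTrunc J h f i)
    fun x => ⟨_, hJ.eventually_siteTrunc i x⟩
  exact ⟨L, hL⟩

variable {L : Fin N → HEnd N m A B}

theorem IsCurrent.siteOps (hJ : IsCurrent J) (hL : ∀ i, IsPtLim (siteTrunc J h f i) (L i))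
    (hf : ∀ w i, Hol.perm w (f i) = f (w i)) (hf' : ∀ i j, i ≠ j → Hol.euler j (f i) = 0) :
    SiteOps L where
  opD {i j} hij := (hL i).commute fun K => truncated_commute (hJ.opD j)
    (fun a b => (opS_commute_opDer _ _ _).symm)
    (commute_iff_lie_eq.mpr (by rw [opD_opM, hf' i j hij, map_zero])) K
  opS {i j} hij M := (hL i).commute fun K => truncated_commute (hJ.opS j M)
    (fun a b => opS_commute hij.symm _ _) (opS_commute_opM _ _ _) K
  opM g i := (hL i).commute fun K => truncated_commute (hJ.opM g)
    (fun a b => (opS_commute_opM _ _ _).symm) (opM_commute_opM _ _) K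
  opT w i := by
    refine IsPtLim.unique ((IsPtLim.const (AffineKZ.opT N m A B w)).mul (hL i)) ?_
    have h1 : ∀ K, AffineKZ.opT N m A B w * siteTrunc J h f i K =
        siteTrunc J h f (w i) K * AffineKZ.opT N m A B w := fun K =>
      truncated_mul_intertwine (hJ.opT w) (opT_unitAt w i) (by rw [opT_opM, hf]) K
    simp only [h1]
    exact (hL (w i)).mul (IsPtLim.const _)

/-- The truncations satisfy the equation up to terms containing currents of degree greater than `K`;
on a fixed vector these vanish for large `K`. -/
theorem IsCurrent.cybe (hJ : IsCurrent J) (hh : IsHalf h)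
    (hL : ∀ i, IsPtLim (siteTrunc J h f i) (L i)) (hf : ∀ w i, Hol.perm w (f i) = f (w i))
    {i j : Fin N} (hij : i ≠ j) {φ : Hol N} (hφ : φ * (f j - f i) = f j) :
    ⁅L i, L j⁆ + ⁅L i + L j, pairing (unitAt N m (Hol N) A B i) (unitAt N m (Hol N) A B j) h -
      AffineKZ.opM N m (Hol N) A B φ *
        (pairing (unitAt N m (Hol N) A B i) (unitAt N m (Hol N) A B j) 1 -
          AffineKZ.opT N m A B (Equiv.swap i j))⁆ = 0 := by
  have hlim := ((hL i).lie (hL j)).add (((hL i).add (hL j)).lie (IsPtLim.const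
    (pairing (unitAt N m (Hol N) A B i) (unitAt N m (Hol N) A B j) h -
      AffineKZ.opM N m (Hol N) A B φ *
        (pairing (unitAt N m (Hol N) A B i) (unitAt N m (Hol N) A B j) 1 -
          AffineKZ.opT N m A B (Equiv.swap i j)))))
  have hM : ∀ (g : Hol N) (k : Fin N) (a b : Fin m), Commute (AffineKZ.opM N m (Hol N) A B g)
      (unitAt N m (Hol N) A B k a b) := fun _ _ _ _ => (opS_commute_opM _ _ _).symm
  have key := truncated_cybe hh hJ.rel (unitAt_rel i) (unitAt_rel j)
    (fun n a b c d => (hJ.opS i (Matrix.single c d 1) n a b).symm)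
    (fun n a b c d => (hJ.opS j (Matrix.single c d 1) n a b).symm) (unitAt_famCommute hij)
    (opM_commute_opM (f i) (f j)) (hJ.opM _) (hJ.opM _) (hJ.opM φ) (hM _ i) (hM _ i) (hM _ i)
    (hM _ j) (hM _ j) (hM _ j) (opM_commute_opM _ _) (opM_commute_opM _ _)
    (by rw [← map_sub, ← map_mul, hφ]) (hJ.opT (Equiv.swap i j))
    (fun a b => by rw [opT_unitAt, Equiv.swap_apply_left])
    (fun a b => by rw [opT_unitAt, Equiv.swap_apply_right])
    (by rw [opT_opM, hf, Equiv.swap_apply_left]) (by rw [opT_opM, hf, Equiv.swap_apply_right])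
  refine hlim.unique fun x => ?_
  -- The triple sums act on `x` before the powers of the functions do, so the bound `n₀` depends on
  -- `x` alone and not on the exponents.
  obtain ⟨n₀, hn⟩ := eventually_atTop.mp ((hJ.tripleOut_smooth (unitAt N m (Hol N) A B i)
    (unitAt N m (Hol N) A B j) 1 x).and (hJ.tripleOut_smooth (unitAt N m (Hol N) A B j)
    (unitAt N m (Hol N) A B i) 1 x))
  filter_upwards [eventually_ge_atTop n₀] with K hK
  rw [siteTrunc, siteTrunc, key, ev_sum_apply]
  refine Finset.sum_eq_zero fun p _ => ?_
  rw [ev_sum_apply]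
  refine Finset.sum_eq_zero fun q _ => ?_
  split_ifs with hpq
  · have := hn (p + q + 2) (by omega)
    rw [ev_mul_apply, ev_sub_apply, this.1, this.2, sub_zero, map_zero]
  · rfl

theorem siteTrunc_commute {J' : ℕ → Fin m → Fin m → HEnd N m A B} (hJ : IsCurrent J)
    (hJ' : IsCurrent J') (hJJ' : ∀ n n', FamCommute (J n) (J' n')) {h' : Fin m → Fin m → ℂ}
    {f' : Fin N → Hol N} {L' : Fin N → HEnd N m A B}
    (hL : ∀ i, IsPtLim (siteTrunc J h f i) (L i)) (hL' : ∀ i, IsPtLim (siteTrunc J' h' f' i) (L' i))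
    {i j : Fin N} (hij : i ≠ j) : Commute (L i) (L' j) := by
  refine ((hL i).commute fun K => Commute.symm ?_).symm
  refine (hL' j).commute fun K' => ?_
  refine truncated_commute (fun n a b => Commute.symm ?_) (fun a b => Commute.symm ?_)
    (Commute.symm ?_) K'
  · exact truncated_commute (fun n' c d => (hJJ' n' n c d a b).symm)
      (fun c d => (hJ'.opS i _ n a b).symm) (hJ'.opM _ n a b).symm K
  · exact truncated_commute (fun n' c d => hJ.opS j _ n' c d) (fun c d => opS_commute hij.symm _ _)
      (opS_commute_opM _ _ _) K
  · exact truncated_commute (fun n' c d => hJ.opM _ n' c d)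
      (fun c d => (opS_commute_opM _ _ _).symm) (opM_commute_opM _ _) K

end Currents

/-! ### Local finiteness -/

section Smooth

variable {m : ℕ} {A : Type*} [AddCommGroup A] [Module ℂ A] [LieRingModule (AffineSl m) A]
  [LieModule ℂ (AffineSl m) A]

theorem d_mem_cartan : (AffineSl.d : AffineSl m) ∈ AffineSl.cartan m :=
  Submodule.mem_sup_right (Submodule.subset_span (by simp))

theorem d_lie_monomial (n : ℤ) (X : Sl m) :
    ⁅(AffineSl.d : AffineSl m), AffineSl.monomial n X⁆ = (n : ℂ) • AffineSl.monomial n X := by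
  ext1
  · simp [AffineSl.monomial, AffineSl.d, loopDegree_monomial]
  · simp [AffineSl.monomial, AffineSl.d]
  · simp [AffineSl.monomial]

/-- For a weight vector `v` the nonzero vectors among the `(X_k ⊗ t^{sk}) v` are eigenvectors of `d`
with distinct eigenvalues, hence linearly independent. They lie in a finite-dimensional subspace, so
only finitely many degrees contribute, uniformly in `X`. -/
theorem eventually_monomial_lie_eq_zero (hw : IsWeightModule m A) {s : ℤ} (hs : s ≠ 0)
    {n : Submodule ℂ (AffineSl m)} (hn : ∀ k : ℕ, 0 < k → ∀ X, AffineSl.monomial (s * k) X ∈ n)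
    (hf : LocallyFinite A n) (v : A) :
    ∀ᶠ k : ℕ in atTop, ∀ X : Sl m, ⁅AffineSl.monomial (s * k) X, v⁆ = 0 := by
  have hv : v ∈ ⨆ wt : Module.Dual ℂ (AffineSl.cartan m), weightSpace A wt :=
    hw.diagonalizable ▸ Submodule.mem_top
  induction hv using Submodule.iSup_induction' with
  | zero => exact Eventually.of_forall fun k X => lie_zero _
  | add x y _ _ hx hy =>
    filter_upwards [hx, hy] with k h1 h2 X
    rw [lie_add, h1, h2, add_zero]
  | mem wt v hv =>
    obtain ⟨U, hvU, hU, hstab⟩ := hf v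
    set S : Set ℕ := {k | 0 < k ∧ ∃ X : Sl m, ⁅AffineSl.monomial (s * k) X, v⁆ ≠ 0}
    choose! X hX using fun (k : S) => k.2.2
    have hli : LinearIndependent ℂ fun k : S => ⁅AffineSl.monomial (s * k) (X k), v⁆ := by
      refine Module.End.eigenvectors_linearIndependent' (actionMap A (AffineSl.d : AffineSl m))
        (fun k : S => wt ⟨_, d_mem_cartan⟩ + ((s * (k : ℕ) : ℤ) : ℂ)) (fun k l hkl => ?_) _
        fun k => ⟨Module.End.mem_eigenspace_iff.mpr ?_, hX k⟩
      · have : s * ((k : ℕ) : ℤ) = s * ((l : ℕ) : ℤ) := by exact_mod_cast add_left_cancel hkl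
        exact Subtype.ext (by exact_mod_cast mul_left_cancel₀ hs this)
      · change ⁅(AffineSl.d : AffineSl m), ⁅AffineSl.monomial (s * k) (X k), v⁆⁆ = _
        rw [leibniz_lie, d_lie_monomial, smul_lie, hv ⟨_, d_mem_cartan⟩, lie_smul, ← add_smul,
          add_comm]
    have hli' : LinearIndependent ℂ fun k : S =>
        (⟨⁅AffineSl.monomial (s * k) (X k), v⁆, hstab _ (hn _ k.2.1 _) _ hvU⟩ : U) :=
      LinearIndependent.of_comp U.subtype hli
    have := hli'.finite_of_isNoetherian
    have hfin : S.Finite := Set.toFinite S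
    filter_upwards [eventually_gt_atTop 0, Nat.cofinite_eq_atTop ▸ hfin.compl_mem_cofinite] with k hk hkS X
    by_contra h
    exact hkS ⟨hk, X, h⟩

theorem eventually_rTensor {E F κ : Type*} [AddCommGroup E] [Module ℂ E] [AddCommGroup F] [Module ℂ F]
    {T : ℕ → κ → Module.End ℂ E} (h : ∀ v, ∀ᶠ n in atTop, ∀ k, T n k v = 0) (x : E ⊗[ℂ] F) :
    ∀ᶠ n in atTop, ∀ k, LinearMap.rTensor F (T n k) x = 0 := by
  induction x using TensorProduct.induction_on with
  | zero => exact Eventually.of_forall fun n k => map_zero _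
  | tmul e f =>
    filter_upwards [h e] with n hn k
    rw [LinearMap.rTensor_tmul, hn, TensorProduct.zero_tmul]
  | add x y hx hy =>
    filter_upwards [hx, hy] with n h1 h2 k
    rw [map_add, h1, h2, add_zero]

theorem eventually_lTensor {E F κ : Type*} [AddCommGroup E] [Module ℂ E] [AddCommGroup F] [Module ℂ F]
    {T : ℕ → κ → Module.End ℂ F} (h : ∀ v, ∀ᶠ n in atTop, ∀ k, T n k v = 0) (x : E ⊗[ℂ] F) :
    ∀ᶠ n in atTop, ∀ k, LinearMap.lTensor E (T n k) x = 0 := by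
  induction x using TensorProduct.induction_on with
  | zero => exact Eventually.of_forall fun n k => map_zero _
  | tmul e f =>
    filter_upwards [h f] with n hn k
    rw [LinearMap.lTensor_tmul, hn, TensorProduct.tmul_zero]
  | add x y hx hy =>
    filter_upwards [hx, hy] with n h1 h2 k
    rw [map_add, h1, h2, add_zero]

end Smooth

/-! ### The current operators of `A ∈ 𝒪(ℓ)` and `B ∈ 𝒪†(ℓ)`. -/

section Concrete

variable {N m : ℕ} {ℓ : ℂ} {A B : Type*}
  [AddCommGroup A] [Module ℂ A] [LieRingModule (AffineSl m) A] [LieModule ℂ (AffineSl m) A]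
  [AddCommGroup B] [Module ℂ B] [LieRingModule (AffineSl m) B] [LieModule ℂ (AffineSl m) B]

theorem leftCurrent_smooth {S : Type*} [CommRing S] [Algebra ℂ S]
    (hA : CategoryO m ℓ A) (x : TensorSpace N m S A B) :
    ∀ᶠ n : ℕ in atTop, ∀ X, ev N m S A B (opLeft N m S A B (AffineSl.monomial n X)) x = 0 := by
  refine eventually_rTensor (T := fun (n : ℕ) X => actionMap A (AffineSl.monomial n X))
    (fun v => ?_) x
  have := eventually_monomial_lie_eq_zero hA.toIsWeightModule one_ne_zero
    (n := AffineSl.nPlus m) (fun k hk X => ?_) hA.locallyFinite v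
  · simp only [one_mul] at this
    exact this
  · refine Submodule.mem_sup_right (Submodule.mem_iSup_of_mem ⟨1 * (k : ℤ), ?_⟩ ⟨X, rfl⟩)
    omega

theorem rightCurrent_smooth {S : Type*} [CommRing S] [Algebra ℂ S]
    (hB : CategoryODagger m ℓ B) (x : TensorSpace N m S A B) :
    ∀ᶠ n : ℕ in atTop, ∀ X, ev N m S A B (opRight N m S A B (AffineSl.monomial (-n) X)) x = 0 := by
  refine eventually_lTensor (eventually_lTensor (eventually_lTensor
    (T := fun (n : ℕ) X => actionMap B (AffineSl.monomial (-n) X)) fun v => ?_)) x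
  have := eventually_monomial_lie_eq_zero hB.toIsWeightModule (neg_ne_zero.mpr one_ne_zero)
    (n := AffineSl.nMinus m) (fun k hk X => ?_) hB.locallyFinite v
  · simp only [neg_one_mul] at this
    exact this
  · refine Submodule.mem_sup_right (Submodule.mem_iSup_of_mem ⟨-1 * (k : ℤ), ?_⟩ ⟨X, rfl⟩)
    omega

theorem leftCurrent_isCurrent (hA : CategoryO m ℓ A) :
    IsCurrent (leftCurrent N m (Hol N) A B) where
  rel := leftCurrent_rel hA.level
  opM _ _ _ _ := opM_commute_opA _ _
  opD _ _ _ _ := opDer_commute_opA _ _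
  opS _ _ _ _ _ := opS_commute_opA _ _ _
  opT _ _ _ _ := opT_commute_opA _ _
  smooth x := (leftCurrent_smooth hA x).mono fun _ h _ _ => h _

theorem rightCurrent_isCurrent (hB : CategoryODagger m ℓ B) :
    IsCurrent (rightCurrent N m (Hol N) A B) where
  rel := rightCurrent_rel hB.level
  opM _ _ _ _ := (opB_commute_opM _ _).symm
  opD _ _ _ _ := (opB_commute_opDer _ _).symm
  opS _ _ _ _ _ := (opB_commute_opS _ _ _).symm
  opT _ _ _ _ := (opB_commute_opT _ _).symm
  smooth x := (rightCurrent_smooth hB x).mono fun _ h _ _ => h _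

theorem sum_leftCurrent [NeZero m] (n : ℕ) : ∑ a, leftCurrent N m (Hol N) A B n a a = 0 := by
  simp only [leftCurrent]
  rw [← map_sum, ← map_sum, sum_slUnit_diag, map_zero, map_zero]

theorem sum_rightCurrent [NeZero m] (n : ℕ) : ∑ a, rightCurrent N m (Hol N) A B n a a = 0 := by
  simp only [rightCurrent]
  rw [← map_sum, ← map_sum, sum_slUnit_diag, map_zero, map_zero]

variable (A B) in
/-- Limits of the truncations of `r_{(0i)}` and `r_{(i,N+1)}`. -/
structure IsRLimit (L R : Fin N → HEnd N m A B) : Prop where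
  left (i : Fin N) : IsPtLim (siteTrunc (leftCurrent N m (Hol N) A B) (stdHalf m)
    (fun i => coordPow (Hol N) i (-1)) i) (L i)
  right (i : Fin N) : IsPtLim (siteTrunc (rightCurrent N m (Hol N) A B) (fun a b => stdHalf m b a)
    (fun i => coordPow (Hol N) i 1) i) (R i)

theorem exists_isRLimit (hA : CategoryO m ℓ A) (hB : CategoryODagger m ℓ B) :
    ∃ L R : Fin N → HEnd N m A B, IsRLimit A B L R := by
  obtain ⟨L, hL⟩ := (leftCurrent_isCurrent (N := N) (B := B) hA).exists_lim
  obtain ⟨R, hR⟩ := (rightCurrent_isCurrent (N := N) (A := A) hB).exists_lim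
  exact ⟨L, R, hL, hR⟩

theorem coordPow_one (i : Fin N) : coordPow (Hol N) i 1 = (Hol.coord i : Hol N) := by
  rw [coordPow, zpow_one]; rfl

theorem coordPow_neg_one (i : Fin N) :
    coordPow (Hol N) i (-1) = (((Hol.coord i)⁻¹ : (Hol N)ˣ) : Hol N) := by
  rw [coordPow, zpow_neg_one]; rfl

theorem IsRLimit.currentOps (hA : CategoryO m ℓ A) (hB : CategoryODagger m ℓ B)
    {L R : Fin N → HEnd N m A B} (h : IsRLimit A B L R) : CurrentOps L R where
  left := (leftCurrent_isCurrent hA).siteOps h.left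
    (fun w i => by rw [coordPow_neg_one, coordPow_neg_one, Hol.perm_coord_inv])
    (fun i j hij => by
      rw [coordPow, Derivation.apply_zpow _ _ 0, mul_zero, zero_smul]
      refine (Hol.euler_coord j i).trans ?_
      rw [if_neg hij.symm, zero_smul])
  right := (rightCurrent_isCurrent hB).siteOps h.right
    (fun w i => by rw [coordPow_one, coordPow_one, Hol.perm_coord])
    (fun i j hij => by rw [coordPow_one, Hol.euler_coord, if_neg hij.symm])
  cybe_left {i j} hij := (leftCurrent_isCurrent hA).cybe (stdHalf_isHalf m) h.left
    (fun w i => by rw [coordPow_neg_one, coordPow_neg_one, Hol.perm_coord_inv]) hij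
    (by rw [coordPow_neg_one, coordPow_neg_one, phi_mul_inv hij])
  cybe_right {i j} hij := by
    -- The operators `R_i` are written with the leg in `B` first, which transposes the coefficients
    -- `h`. Applying the equation to the pair `(j, i)` restores `M_ij`, and the reversed bracket
    -- `⁅R_j, R_i⁆` accounts for the sign.
    have := (rightCurrent_isCurrent hB).cybe (stdHalf_isHalf m).flip h.right
      (fun w i => by rw [coordPow_one, coordPow_one, Hol.perm_coord]) hij.symm
      (φ := phi i j) (by rw [coordPow_one, coordPow_one, phi_mul hij])
    rw [pairing_flip _ (unitAt_famCommute hij.symm), pairing_unitAt_symm hij, opT_swap_comm] at this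
    rw [← lie_skew, add_comm (R i), ← neg_zero, ← this, mid]
    abel
  left_right hij := siteTrunc_commute (leftCurrent_isCurrent hA) (rightCurrent_isCurrent hB)
    (fun _ _ _ _ _ _ => (opB_commute_opA _ _).symm) h.left h.right hij

end Concrete

/-! ### The Dunkl operators of the statement -/

section Matching

theorem map_pairing {ι R R' : Type*} [Fintype ι] [Ring R] [Algebra ℂ R] [Ring R'] [Algebra ℂ R']
    (φ : R →ₐ[ℂ] R') (X Y : ι → ι → R) (h : ι → ι → ℂ) :
    φ (pairing X Y h) = pairing (fun a b => φ (X a b)) (fun a b => φ (Y a b)) h := by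
  simp only [pairing, map_sum, map_smul, map_mul]

variable {N m : ℕ} {A B : Type*}
  [AddCommGroup A] [Module ℂ A] [LieRingModule (AffineSl m) A] [LieModule ℂ (AffineSl m) A]
  [AddCommGroup B] [Module ℂ B] [LieRingModule (AffineSl m) B] [LieModule ℂ (AffineSl m) B]

theorem thetaLeft_eq (X : AffineSl m) :
    thetaLeft N (Hol N) A B X = ev N m (Hol N) A B (opLeft N m (Hol N) A B X) := rfl

theorem thetaRight_eq (X : AffineSl m) :
    thetaRight N (Hol N) A B X = ev N m (Hol N) A B (opRight N m (Hol N) A B X) := rfl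

theorem theta_eq (i : Fin N) (X : AffineSl m) :
    theta N (Hol N) A B i X = ev N m (Hol N) A B (opSite N m (Hol N) A B i X) := rfl

theorem mulOp_eq (f : Hol N) : mulOp m A B f = ev N m (Hol N) A B (opM N m (Hol N) A B f) := rfl

theorem tau_eq (w : Equiv.Perm (Fin N)) : tau m A B w = ev N m (Hol N) A B (opT N m A B w) :=
  (factor₂_mul_factor₃ (A := A) (B := B) (Hol.perm w).toLinearMap (permVec N m w)).symm

theorem coordPow_zero (i : Fin N) : coordPow (Hol N) i 0 = 1 := by
  rw [coordPow, zpow_zero, Units.val_one]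

theorem coordPow_natCast (i : Fin N) (n : ℕ) (s : ℤ) :
    coordPow (Hol N) i (s * n) = coordPow (Hol N) i s ^ n := by
  rw [coordPow, zpow_mul, zpow_natCast, Units.val_pow_eq_pow_val, coordPow]

/-- The scalar correction of the diagonal matrix units is multiplied by `∑ J_n(E_aa) = 0`, because
`h` is constant on the diagonal; so `sl_m` and `gl_m` give the same operator. -/
theorem pairing_current_opSite {J : ℕ → Fin m → Fin m → HEnd N m A B} (hJ : IsCurrent J)
    (hJ0 : ∀ n, ∑ a, J n a a = 0) {h : Fin m → Fin m → ℂ} {η : ℂ} (hη : ∀ a, h a a = η) (i : Fin N)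
    (n : ℕ) (p : ℤ) :
    pairing (J n) (fun a b => opSite N m (Hol N) A B i (AffineSl.monomial p (slUnit m a b))) h =
      opM N m (Hol N) A B (coordPow (Hol N) i p) *
        pairing (J n) (unitAt N m (Hol N) A B i) h := by
  have h1 : pairing (J n) (unitAt N m (Hol N) A B i) h = pairing (J n) (fun a b =>
      unitAt N m (Hol N) A B i a b - if a = b then algebraMap ℂ _ (1 / m : ℂ) else 0) h := by
    rw [pairing_sub_scalar]
    simp only [hη, ← Finset.smul_sum, hJ0, smul_zero, sub_zero]
  rw [h1]
  simp only [pairing, Finset.mul_sum, opSite_monomial, opS_slUnit, mul_smul_comm]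
  refine Finset.sum_congr rfl fun a _ => Finset.sum_congr rfl fun b _ => ?_
  rw [← mul_assoc, ← mul_assoc, (hJ.opM _ n a b).eq]

variable [NeZero m] {ℓ : ℂ} (hA : CategoryO m ℓ A) (hB : CategoryODagger m ℓ B)

include hA in
theorem pairAction_left_rTerm (i : Fin N) (n : ℕ) :
    pairAction (thetaLeft N (Hol N) A B) (theta N (Hol N) A B i) (AffineSl.rTerm m (n + 1)) =
      ev N m (Hol N) A B (opM N m (Hol N) A B (coordPow (Hol N) i (-1)) ^ (n + 1) *
        pairing (leftCurrent N m (Hol N) A B (n + 1)) (unitAt N m (Hol N) A B i) 1) := by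
  rw [AffineSl.rTerm, pairAction_casimir, ← map_pow, ← coordPow_natCast, neg_one_mul,
    ← pairing_current_opSite (leftCurrent_isCurrent hA) sum_leftCurrent (h := 1) (η := 1)
      (fun _ => rfl), map_pairing]
  rfl

include hA in
-- In `½ (c ⊗ d + d ⊗ c)` only the summand with `c` on `A` acts, because `c` is zero at a site; it
-- gives `(ℓ/2) ∂_i`. On the side of `B`, of level `-ℓ`, the sign is reversed.
theorem pairAction_left_rFinite (i : Fin N) :
    pairAction (thetaLeft N (Hol N) A B) (theta N (Hol N) A B i) (AffineSl.rFinite m) =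
      ev N m (Hol N) A B (pairing (leftCurrent N m (Hol N) A B 0) (unitAt N m (Hol N) A B i)
        (stdHalf m) + (ℓ / 2) • opD N m A B i) := by
  have h1 := pairing_current_opSite (leftCurrent_isCurrent (N := N) (B := B) hA) sum_leftCurrent
    (h := stdHalf m) (η := 1 / 2) (fun a => by simp [stdHalf]) i 0 0
  rw [coordPow_zero, map_one, one_mul] at h1
  rw [AffineSl.rFinite, map_add, map_smul, map_add, pairAction_tmul, pairAction_tmul,
    pairAction_classicalR, theta_eq i AffineSl.c, opSite_c, map_zero, mul_zero, add_zero,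
    thetaLeft_eq, opLeft_c hA.level, theta_eq i AffineSl.d, opSite_d, map_add, ← h1, map_pairing,
    AlgHom.commutes, ← Algebra.smul_def, smul_smul, map_smul, mul_comm (1 / 2), mul_one_div]
  rfl

include hB in
theorem pairing_opSite_rightCurrent (i : Fin N) (n : ℕ) (p : ℤ) (h : Fin m → Fin m → ℂ) {η : ℂ}
    (hη : ∀ a, h a a = η) :
    pairing (fun a b => opSite N m (Hol N) A B i (AffineSl.monomial p (slUnit m a b)))
      (rightCurrent N m (Hol N) A B n) h = opM N m (Hol N) A B (coordPow (Hol N) i p) *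
        pairing (rightCurrent N m (Hol N) A B n) (unitAt N m (Hol N) A B i)
          fun a b => h b a := by
  rw [pairing_flip, pairing_current_opSite (rightCurrent_isCurrent hB) sum_rightCurrent
    (h := fun a b => h b a) hη]
  intro a b c d
  rw [opSite_monomial]
  exact ((rightCurrent_isCurrent hB).opM _ _ _ _).mul_left
    ((rightCurrent_isCurrent hB).opS _ _ _ _ _)

include hB in
theorem pairAction_right_rTerm (i : Fin N) (n : ℕ) :
    pairAction (theta N (Hol N) A B i) (thetaRight N (Hol N) A B) (AffineSl.rTerm m (n + 1)) =
      ev N m (Hol N) A B (opM N m (Hol N) A B (coordPow (Hol N) i 1) ^ (n + 1) *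
        pairing (rightCurrent N m (Hol N) A B (n + 1)) (unitAt N m (Hol N) A B i) 1) := by
  have h1 := pairing_opSite_rightCurrent (A := A) hB i (n + 1) (1 * ((n + 1 : ℕ) : ℤ)) 1 (η := 1)
    fun _ => rfl
  rw [coordPow_natCast, map_pow] at h1
  refine Eq.trans ?_ (congrArg (ev N m (Hol N) A B) h1)
  rw [AffineSl.rTerm, pairAction_casimir, map_pairing, one_mul]
  rfl

include hB in
theorem pairAction_right_rFinite (i : Fin N) :
    pairAction (theta N (Hol N) A B i) (thetaRight N (Hol N) A B) (AffineSl.rFinite m) =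
      ev N m (Hol N) A B (pairing (rightCurrent N m (Hol N) A B 0) (unitAt N m (Hol N) A B i)
        (fun a b => stdHalf m b a) - (ℓ / 2) • opD N m A B i) := by
  have h1 := pairing_opSite_rightCurrent (A := A) hB i 0 0 (stdHalf m) (η := 1 / 2)
    fun a => by simp [stdHalf]
  rw [coordPow_zero, map_one, one_mul] at h1
  have h2 : pairAction (theta N (Hol N) A B i) (thetaRight N (Hol N) A B)
      (AffineSl.tensorMonomial m 0 0 (classicalR m)) = ev N m (Hol N) A B (pairing
        (fun a b => opSite N m (Hol N) A B i (AffineSl.monomial 0 (slUnit m a b)))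
        (rightCurrent N m (Hol N) A B 0) (stdHalf m)) := by
    rw [pairAction_classicalR, map_pairing]
    rfl
  rw [AffineSl.rFinite, map_add, map_smul, map_add, pairAction_tmul, pairAction_tmul, h2, h1,
    theta_eq i AffineSl.c, opSite_c, map_zero, zero_mul, zero_add,
    thetaRight_eq, opRight_c hB.level, theta_eq i AffineSl.d, opSite_d, sub_eq_add_neg, ← neg_smul,
    map_add, AlgHom.commutes, ← Algebra.commutes, ← Algebra.smul_def, smul_smul, map_smul]
  congr 2
  ring

include hA in
theorem rLeft_eq {L R : Fin N → HEnd N m A B} (h : IsRLimit A B L R) (i : Fin N)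
    (x : HolSpace N m A B) :
    rLeft A B i x = ev N m (Hol N) A B (L i + (ℓ / 2) • opD N m A B i) x := by
  -- A single `K` beyond both thresholds identifies the value of the limit `L_i` with the finite sum
  -- defining `rLeft`.
  obtain ⟨K, h1, h2⟩ := ((h.left i x).and ((leftCurrent_isCurrent hA).eventually_siteTrunc
    (h := stdHalf m) (f := fun i => coordPow (Hol N) i (-1)) i x)).exists
  rw [rLeft, pairAction_left_rFinite hA, ev_add_apply, ev_add_apply, ← h1, h2]
  simp only [pairAction_left_rTerm hA]
  abel

include hB in
theorem rRight_eq {L R : Fin N → HEnd N m A B} (h : IsRLimit A B L R) (i : Fin N)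
    (x : HolSpace N m A B) :
    rRight A B i x = ev N m (Hol N) A B (R i - (ℓ / 2) • opD N m A B i) x := by
  obtain ⟨K, h1, h2⟩ := ((h.right i x).and ((rightCurrent_isCurrent hB).eventually_siteTrunc
    (h := fun a b => stdHalf m b a) (f := fun i => coordPow (Hol N) i 1) i x)).exists
  rw [rRight, pairAction_right_rFinite hB, ev_sub_apply, ev_sub_apply, ← h1, h2]
  simp only [pairAction_right_rTerm hB]
  abel

variable (N m A B) in
/-- The operator `r_{(ij)}` for sites `i`, `j`. -/
def opMiddle (i j : Fin N) : HEnd N m A B :=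
  pairing (unitAt N m (Hol N) A B i) (unitAt N m (Hol N) A B j) (stdHalf m) -
    algebraMap ℂ _ (1 / 2 * (1 / m) : ℂ) - opM N m (Hol N) A B (phi i j) *
      (pairing (unitAt N m (Hol N) A B i) (unitAt N m (Hol N) A B j) 1 - algebraMap ℂ _ (1 / m : ℂ))

theorem pairing_opSite {h : Fin m → Fin m → ℂ} {η : ℂ} (hη : ∀ a, h a a = η) (i j : Fin N) :
    pairing (fun a b => opSite N m (Hol N) A B i (AffineSl.monomial 0 (slUnit m a b)))
      (fun a b => opSite N m (Hol N) A B j (AffineSl.monomial 0 (slUnit m a b))) h =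
      pairing (unitAt N m (Hol N) A B i) (unitAt N m (Hol N) A B j) h -
        algebraMap ℂ _ (η * (1 / m) : ℂ) := by
  rw [← pairing_sub_scalar_both (sum_unitAt_diag i) (sum_unitAt_diag j) hη]
  · simp only [opSite_monomial, coordPow_zero, map_one, one_mul, opS_slUnit]
  · rw [Fintype.card_fin, one_div, inv_mul_cancel₀ (Nat.cast_ne_zero.mpr (NeZero.ne m))]

theorem rMiddle_eq {i j : Fin N} (hij : i ≠ j) :
    rMiddle A B i j = ev N m (Hol N) A B (opMiddle N m A B i j) := by
  have h1 := pairing_opSite (A := A) (B := B) (h := stdHalf m) (η := 1 / 2)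
    (fun a => by simp [stdHalf]) i j
  have h2 := pairing_opSite (A := A) (B := B) (m := m) (h := 1) (η := 1) (fun a => rfl) i j
  rw [one_mul] at h2
  have h3 : rMiddle A B i j = ev N m (Hol N) A B
      (pairing (fun a b => opSite N m (Hol N) A B i (AffineSl.monomial 0 (slUnit m a b)))
        (fun a b => opSite N m (Hol N) A B j (AffineSl.monomial 0 (slUnit m a b))) (stdHalf m) +
      opM N m (Hol N) A B (- phi i j) *
        pairing (fun a b => opSite N m (Hol N) A B i (AffineSl.monomial 0 (slUnit m a b)))
          (fun a b => opSite N m (Hol N) A B j (AffineSl.monomial 0 (slUnit m a b))) 1) := by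
    rw [rMiddle, AffineSl.omega, classicalR_add_comm, pairAction_classicalR, pairAction_casimir,
      ratio_mul_inverse hij, mulOp_eq, map_add, map_mul, map_pairing, map_pairing]
    rfl
  rw [h3, h1, h2, map_neg, neg_mul, ← sub_eq_add_neg, opMiddle]

/-- The `c`-th entry of half the sum of the positive coroots is half the difference of the numbers
of indices above and below `c`, and these two numbers add up to `m - 1`. -/
theorem toMatrix_rho : Sl.toMatrix m ((1 / 2 : ℂ) • ∑ a, ∑ b ∈ Finset.Ioi a,
    (slUnit m a a - slUnit m b b)) = Matrix.diagonal (rhoDiag m) := by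
  have hd : ∀ a b : Fin m, Sl.toMatrix m (slUnit m a a - slUnit m b b) =
      Matrix.diagonalAddMonoidHom (Fin m) ℂ (Pi.single a 1 - Pi.single b 1) := by
    intro a b
    rw [map_sub, slUnit, slUnit, toMatrix_traceless, toMatrix_traceless, Matrix.trace_single_eq_same,
      Matrix.trace_single_eq_same, sub_sub_sub_cancel_right, map_sub,
      Matrix.diagonalAddMonoidHom_apply, Matrix.diagonalAddMonoidHom_apply,
      Matrix.diagonal_single, Matrix.diagonal_single]
  have hs : ∑ a : Fin m, ∑ b ∈ Finset.Ioi a,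
      Matrix.diagonalAddMonoidHom (Fin m) ℂ (Pi.single a 1 - Pi.single b 1) =
      Matrix.diagonal (∑ a : Fin m, ∑ b ∈ Finset.Ioi a, (Pi.single a 1 - Pi.single b 1)) := by
    simp only [← Matrix.diagonalAddMonoidHom_apply, map_sum]
  simp only [map_smul, map_sum, hd]
  rw [hs, ← Matrix.diagonal_smul]
  congr 1
  ext c
  have h1 : ∀ a : Fin m, (∑ b ∈ Finset.Ioi a, (Pi.single a 1 - Pi.single b 1) : Fin m → ℂ) c =
      (if c = a then ((Finset.Ioi a).card : ℂ) else 0) - if a < c then 1 else 0 := by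
    intro a
    rw [Finset.sum_apply]
    simp [Pi.single_apply, Finset.sum_sub_distrib]
  have h2 : ∑ b, stdHalf m c b = (Finset.Ioi c).card + 1 / 2 := by
    have : ∀ b, stdHalf m c b = (if b ∈ Finset.Ioi c then 1 else 0) + if b = c then 1 / 2 else 0 := by
      intro b
      rcases lt_trichotomy c b with h | h | h
      · simp [stdHalf, h, h.ne']
      · subst h; simp [stdHalf]
      · simp [stdHalf, h.ne, h.ne', h.not_gt]
    simp only [this, Finset.sum_add_distrib, Finset.sum_ite_mem, Finset.univ_inter,
      Finset.sum_ite_eq', Finset.mem_univ, if_true, Finset.sum_const, nsmul_eq_mul, mul_one]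
  have h3 : ∑ a, (if a < c then (1 : ℂ) else 0) = (Finset.Iio c).card := by
    rw [Finset.sum_boole]; congr 2; ext; simp
  have h4 : ((Finset.Ioi c).card : ℂ) + (Finset.Iio c).card + 1 = m := by
    rw [Fin.card_Ioi, Fin.card_Iio]
    have := c.2
    norm_cast
    omega
  rw [Pi.smul_apply, Finset.sum_apply, rhoDiag, h2]
  simp only [h1]
  simp only [Finset.sum_sub_distrib, h3, Finset.sum_ite_eq, Finset.mem_univ, if_true,
    smul_eq_mul]
  linear_combination (-1 / 2 : ℂ) * h4

theorem opSite_rhoCheck (i : Fin N) : opSite N m (Hol N) A B i (AffineSl.rhoCheck m) =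
    opS N m (Hol N) A B i (Matrix.diagonal (rhoDiag m)) + (m : ℂ) • opD N m A B i := by
  rw [AffineSl.rhoCheck, map_add,
    map_smul (opSite N m (Hol N) A B i) (m : ℂ), opSite_d, opSite_monomial, toMatrix_rho, coordPow_zero,
    map_one, one_mul]
  rfl

include hA hB in
-- The coefficient of `∂_i` is `ℓ/2` from `A`, `ℓ/2` from `B` and `m` from `ρ^∨`: this is how the
-- central charge `ℓ + m` arises.
theorem kz_eq {L R : Fin N → HEnd N m A B} (h : IsRLimit A B L R) (i : Fin N)
    (x : HolSpace N m A B) :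
    kz A B i x = ev N m (Hol N) A B (oneSite (ℓ + m) L R i +
      (∑ j ∈ Finset.Iio i, opMiddle N m A B j i - ∑ j ∈ Finset.Ioi i, opMiddle N m A B i j)) x := by
  have h1 : ∑ j ∈ Finset.Iio i, rMiddle A B j i x =
      ev N m (Hol N) A B (∑ j ∈ Finset.Iio i, opMiddle N m A B j i) x := by
    rw [ev_sum_apply]
    exact Finset.sum_congr rfl fun j hj => by rw [rMiddle_eq (Finset.mem_Iio.mp hj).ne]
  have h2 : ∑ j ∈ Finset.Ioi i, rMiddle A B i j x =
      ev N m (Hol N) A B (∑ j ∈ Finset.Ioi i, opMiddle N m A B i j) x := by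
    rw [ev_sum_apply]
    exact Finset.sum_congr rfl fun j hj => by rw [rMiddle_eq (Finset.mem_Ioi.mp hj).ne]
  rw [kz, rLeft_eq hA h, rRight_eq hB h, theta_eq, opSite_rhoCheck, h1, h2, ← ev_add_apply,
    ← ev_sub_apply, ← ev_sub_apply, ← ev_add_apply]
  congr 2
  have h3 : ∀ D : HEnd N m A B, (ℓ + m) • D = (ℓ / 2) • D + (ℓ / 2) • D + (m : ℂ) • D := by
    intro D
    rw [← add_smul, ← add_smul]
    congr 1
    ring
  rw [oneSite, h3]
  abel

/-- The value of `κ` is forced: the trace corrections are `1/(2m) = 1/2 - κ` and `1/m = 1 - 2κ`. The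
three terms besides `M_ij` are the shapes of the three corrections added to `∇_ξ` in the definition
of `𝒟_ξ`. -/
theorem opMiddle_eq (i j : Fin N) (κ : ℂ) (hκ : κ = ((m : ℂ) - 1) / (2 * m)) :
    opMiddle N m A B i j = mid N m A B i j + opM N m (Hol N) A B (phi i j) *
        (1 - opT N m A B (Equiv.swap i j)) - algebraMap ℂ _ (1 / 2) -
      κ • opM N m (Hol N) A B (2 * phi i j - 1) := by
  have hm : (m : ℂ) ≠ 0 := Nat.cast_ne_zero.mpr (NeZero.ne m)
  have e1 : (1 / 2 * (1 / m) : ℂ) = 1 / 2 - κ := by rw [hκ]; field_simp; ring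
  have e2 : (1 / m : ℂ) = 1 - 2 * κ := by rw [hκ]; field_simp; ring
  rw [opMiddle, mid, e1, e2, map_sub (algebraMap ℂ _), map_sub (algebraMap ℂ _), map_sub (opM _ _ _ _ _),
    map_mul, map_mul, map_one, map_one, map_ofNat, map_ofNat, Algebra.algebraMap_eq_smul_one κ]
  simp only [mul_sub, smul_sub, mul_one, mul_smul_comm, mul_two, smul_add, two_mul]
  abel

include hA hB in
-- The pair terms of `∇_ξ` are `-∑_{i<j} (ξ_i - ξ_j) r_(ij)`. After inserting `opMiddle_eq`,
-- everything except the `M_ij` cancels against the reflection term, `ρ̄(ξ)` and the logarithmic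
-- derivative of `G`.
theorem dunkl_eq {L R : Fin N → HEnd N m A B} (h : IsRLimit A B L R) (ξ : Fin N → ℂ)
    (x : HolSpace N m A B) :
    dunkl A B ξ x = ev N m (Hol N) A B (dunklAlong (ℓ + m) L R ξ) x := by
  have h1 : dunkl A B ξ x = ev N m (Hol N) A B (∑ i, ξ i • (oneSite (ℓ + m) L R i +
      (∑ j ∈ Finset.Iio i, opMiddle N m A B j i - ∑ j ∈ Finset.Ioi i, opMiddle N m A B i j)) +
      ∑ i, ∑ j ∈ Finset.Ioi i, (ξ i - ξ j) • (opM N m (Hol N) A B (phi i j) *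
        (1 - opT N m A B (Equiv.swap i j))) -
      ((1 / 2 : ℂ) * ∑ i, ∑ j ∈ Finset.Ioi i, (ξ i - ξ j)) • 1 -
      (((m : ℂ) - 1) / (2 * m)) • opM N m (Hol N) A B
        (∑ i, ∑ j ∈ Finset.Ioi i, (ξ i - ξ j) • (2 * phi i j - 1))) x := by
    rw [dunkl, logDeriv_discriminant]
    simp only [kz_eq hA hB h, tau_eq, mulOp_eq, ev_sub_apply, ev_add_apply, ev_sum_apply,
      ev_smul_apply, ev_mul_apply, ev_one_apply, phi]
  rw [h1]
  congr 2
  simp only [opMiddle_eq _ _ _ rfl]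
  rw [dunklAlong_eq]
  simp only [smul_add (ξ _), Finset.sum_add_distrib, sum_smul_iio_sub_ioi]
  have e1 : ((1 / 2 : ℂ) * ∑ i, ∑ j ∈ Finset.Ioi i, (ξ i - ξ j)) • (1 : HEnd N m A B) =
      ∑ i, ∑ j ∈ Finset.Ioi i, (ξ i - ξ j) • algebraMap ℂ (HEnd N m A B) (1 / 2) := by
    simp only [Finset.mul_sum, Finset.sum_smul, Algebra.algebraMap_eq_smul_one, smul_smul, mul_comm]
  have e2 : (((m : ℂ) - 1) / (2 * m)) • opM N m (Hol N) A B
      (∑ i, ∑ j ∈ Finset.Ioi i, (ξ i - ξ j) • (2 * phi i j - 1)) =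
      ∑ i, ∑ j ∈ Finset.Ioi i, (ξ i - ξ j) • (((m : ℂ) - 1) / (2 * m)) •
        opM N m (Hol N) A B (2 * phi i j - 1) := by
    simp only [map_sum, map_smul, Finset.smul_sum, smul_comm (((m : ℂ) - 1) / (2 * m))]
  rw [e1, e2]
  simp only [smul_add, smul_sub, Finset.sum_add_distrib, Finset.sum_sub_distrib]
  abel

end Matching

/-! ### The extended affine Weyl group and its relations with the Dunkl operators. -/

open AffineWeyl

theorem AffineWeyl.act_mul {N : ℕ} (w w' : AffineWeyl N) (ξ : Cartan N) :
    act (w * w') ξ = act w (act w' ξ) := by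
  refine Prod.ext rfl ?_
  change ξ.2 - ∑ i, ((Multiplicative.toAdd w.left i + Multiplicative.toAdd w'.left (w.right.symm i) : ℤ) : ℂ) *
      ξ.1 (w'.right.symm (w.right.symm i)) =
    ξ.2 - ∑ i, (Multiplicative.toAdd w'.left i : ℂ) * ξ.1 (w'.right.symm i) -
      ∑ i, (Multiplicative.toAdd w.left i : ℂ) * ξ.1 (w'.right.symm (w.right.symm i))
  rw [sub_sub, ← Equiv.sum_comp w.right.symm (fun i =>
    (Multiplicative.toAdd w'.left i : ℂ) * ξ.1 (w'.right.symm i)), ← Finset.sum_add_distrib]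
  congr 1
  refine Finset.sum_congr rfl fun i _ => ?_
  push_cast
  ring

theorem AffineWeyl.act_one {N : ℕ} (ξ : Cartan N) : act (1 : AffineWeyl N) ξ = ξ := by
  refine Prod.ext rfl ?_
  change ξ.2 - ∑ i : Fin N, ((0 : ℤ) : ℂ) * _ = ξ.2
  simp

theorem AffineWeyl.ofPerm_mul_translation {N : ℕ} (w : Equiv.Perm (Fin N)) (η : Fin N → ℤ) :
    ofPerm w * translation η = translation (η ∘ w.symm) * ofPerm w := by
  refine SemidirectProduct.ext ?_ rfl
  change (1 : Multiplicative (Fin N → ℤ)) * latticePerm N w (Multiplicative.ofAdd η) =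
    Multiplicative.ofAdd (η ∘ w.symm) * 1
  rw [one_mul, mul_one]
  rfl

theorem AffineWeyl.translation_add {N : ℕ} (η η' : Fin N → ℤ) :
    translation (η + η') = translation η * translation η' :=
  map_mul SemidirectProduct.inl (Multiplicative.ofAdd η) (Multiplicative.ofAdd η')

theorem AffineWeyl.ofPerm_mul {N : ℕ} (w w' : Equiv.Perm (Fin N)) :
    ofPerm (w * w') = ofPerm w * ofPerm w' :=
  map_mul SemidirectProduct.inr w w'

theorem AffineWeyl.translation_mul_ofPerm {N : ℕ} (w : AffineWeyl N) :
    translation (Multiplicative.toAdd w.left) * ofPerm w.right = w :=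
  SemidirectProduct.inl_left_mul_inr_right w

theorem finRotate_eq_add_one {N : ℕ} [NeZero N] (i : Fin N) : finRotate N i = i + 1 :=
  finRotate_apply i

theorem val_add_one_ite {N : ℕ} [NeZero N] (i : Fin N) :
    ((i + 1 : Fin N) : ℕ) = if (i : ℕ) + 1 = N then 0 else (i : ℕ) + 1 := by
  obtain ⟨n, rfl⟩ := Nat.exists_eq_succ_of_ne_zero (NeZero.ne N)
  have := Fin.val_add_one i
  simp only [Fin.ext_iff, Fin.val_last] at this
  refine this.trans ?_
  simp

section Weyl

variable {N m : ℕ} {A B : Type*} [AddCommGroup A] [Module ℂ A] [AddCommGroup B] [Module ℂ B]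

variable (N m A B) in
/-- The action of the extended affine Weyl group by permutations and multiplication by monomials. -/
def weylOp : AffineWeyl N →* HEnd N m A B where
  toFun w := opM N m (Hol N) A B ((coordMonomial (Hol N) w.left : (Hol N)ˣ) : Hol N) *
    opT N m A B w.right
  map_one' := by
    rw [SemidirectProduct.one_left, SemidirectProduct.one_right, map_one, Units.val_one, map_one,
      opT_one, mul_one]
  map_mul' w w' := by
    have h : Hol.perm w.right ((coordMonomial (Hol N) w'.left : (Hol N)ˣ) : Hol N) =
        ((coordMonomial (Hol N) (latticePerm N w.right w'.left) : (Hol N)ˣ) : Hol N) :=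
      perm_coordMonomial w.right (Multiplicative.toAdd w'.left)
    rw [SemidirectProduct.mul_left, SemidirectProduct.mul_right, map_mul, Units.val_mul, map_mul,
      opT_mul, ← h, mul_assoc, ← mul_assoc _ (opT N m A B w.right), ← opT_opM]
    simp only [mul_assoc]

theorem weylOp_ofPerm (w : Equiv.Perm (Fin N)) :
    weylOp N m A B (ofPerm w) = opT N m A B w := by
  change opM N m (Hol N) A B ((coordMonomial (Hol N) 1 : (Hol N)ˣ) : Hol N) * opT N m A B w = _
  rw [map_one, Units.val_one, map_one, one_mul]

theorem weylOp_translation (η : Fin N → ℤ) : weylOp N m A B (translation η) =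
    opM N m (Hol N) A B ((coordMonomial (Hol N) (Multiplicative.ofAdd η) : (Hol N)ˣ) : Hol N) := by
  change opM N m (Hol N) A B _ * opT N m A B 1 = _
  rw [opT_one, mul_one]
  rfl

/-- The action of `⊕ ℂ ε_i^∨ ⊕ ℂ c`. -/
def cartanOp (k : ℂ) (L R : Fin N → HEnd N m A B) (ξ : Cartan N) : HEnd N m A B :=
  dunklAlong k L R ξ.1 + (ξ.2 * k) • 1

variable {k : ℂ} {L R : Fin N → HEnd N m A B}

theorem dunklAlong_add (ξ ξ' : Fin N → ℂ) :
    dunklAlong k L R (ξ + ξ') = dunklAlong k L R ξ + dunklAlong k L R ξ' := by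
  simp only [dunklAlong, Pi.add_apply, add_smul, Finset.sum_add_distrib]

theorem dunklAlong_smul (a : ℂ) (ξ : Fin N → ℂ) :
    dunklAlong k L R (a • ξ) = a • dunklAlong k L R ξ := by
  simp only [dunklAlong, Pi.smul_apply, smul_assoc, Finset.smul_sum]

theorem cartanOp_add (ξ ξ' : Cartan N) :
    cartanOp k L R (ξ + ξ') = cartanOp k L R ξ + cartanOp k L R ξ' := by
  simp only [cartanOp, Prod.fst_add, Prod.snd_add, dunklAlong_add, add_mul, add_smul]
  abel

theorem cartanOp_smul (a : ℂ) (ξ : Cartan N) :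
    cartanOp k L R (a • ξ) = a • cartanOp k L R ξ := by
  simp only [cartanOp, Prod.smul_fst, Prod.smul_snd, dunklAlong_smul, smul_eq_mul, mul_assoc,
    smul_add, mul_smul]

theorem cartanOp_comm (h : CurrentOps L R) (ξ ξ' : Cartan N) :
    Commute (cartanOp k L R ξ) (cartanOp k L R ξ') :=
  ((dunklAlong_comm h _ _).add_right ((Commute.one_right _).smul_right _)).add_left
    ((Commute.one_left _).smul_left _)

theorem opT_dunklOp (h : CurrentOps L R) (w : Equiv.Perm (Fin N)) (i : Fin N) :
    opT N m A B w * dunklOp k L R i = (equivariantPart k L R (w i) +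
      ∑ j ∈ Finset.Iio i, opT N m A B (Equiv.swap (w i) (w j))) * opT N m A B w := by
  rw [dunklOp_eq, mul_add, add_mul, opT_equivariantPart h, Finset.mul_sum, Finset.sum_mul]
  congr 1
  refine Finset.sum_congr rfl fun j _ => ?_
  rw [← opT_mul, ← opT_mul]
  congr 1
  exact Equiv.mul_swap_eq_swap_mul w i j

/-- The equivariant parts cancel. Exchanging two neighbours changes the order of no other pair, so
the sums of transpositions differ only by `τ(s_ij)`, whose square is `1`. -/
theorem opT_dunklAlong (h : CurrentOps L R) {i j : Fin N} (hij : (j : ℕ) = i + 1) (ξ : Fin N → ℂ) :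
    opT N m A B (Equiv.swap i j) * dunklAlong k L R ξ -
        dunklAlong k L R (ξ ∘ Equiv.swap i j) * opT N m A B (Equiv.swap i j) =
      (-(ξ i - ξ j)) • 1 := by
  set s := Equiv.swap i j with hs
  have h1 : dunklAlong k L R (ξ ∘ s) = ∑ a, ξ a • dunklOp k L R (s a) := by
    rw [dunklAlong, ← Equiv.sum_comp s]
    simp [hs]
  have h2 : ∀ a, dunklOp k L R (s a) = equivariantPart k L R (s a) +
      ∑ b, if s b < s a then opT N m A B (Equiv.swap (s a) (s b)) else 0 := by
    intro a
    rw [dunklOp_eq, Equiv.sum_comp s (fun b => if b < s a then opT N m A B (Equiv.swap (s a) b) else 0),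
      ← Finset.sum_filter]
    congr 2
    ext b; simp
  have h3 : ∀ a, ∑ b ∈ Finset.Iio a, opT N m A B (Equiv.swap (s a) (s b)) =
      ∑ b, if b < a then opT N m A B (Equiv.swap (s a) (s b)) else 0 := by
    intro a
    rw [← Finset.sum_filter]
    congr 1
    ext b; simp
  have hlt : i < j := by rw [Fin.lt_def]; omega
  have h4 : ∀ a b, ((if b < a then opT N m A B (Equiv.swap (s a) (s b)) else 0) -
      if s b < s a then opT N m A B (Equiv.swap (s a) (s b)) else 0) =
      (if a = j then if b = i then opT N m A B s else 0 else 0) -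
        if a = i then if b = j then opT N m A B s else 0 else 0 := by
    intro a b
    by_cases h1 : a = j ∧ b = i
    · obtain ⟨rfl, rfl⟩ := h1
      simp [hs, hlt, hlt.not_gt, hlt.ne', Equiv.swap_comm]
    by_cases h2 : a = i ∧ b = j
    · obtain ⟨rfl, rfl⟩ := h2
      simp [hs, hlt, hlt.not_gt, hlt.ne, Equiv.swap_comm]
    -- This is where the adjacency `j = i + 1` is used.
    have e : (b < a) = (s b < s a) := by
      simp only [hs, Equiv.swap_apply_def, eq_iff_iff]
      simp only [Fin.ext_iff] at h1 h2
      split_ifs with h3 h4 h5 h6 h7 h8 h9 <;> simp only [Fin.ext_iff, Fin.lt_def] at * <;> omega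
    simp only [e, sub_self]
    split_ifs <;> simp_all
  rw [h1, dunklAlong, Finset.mul_sum, Finset.sum_mul, ← Finset.sum_sub_distrib]
  have h5 : ∀ a, opT N m A B s * ξ a • dunklOp k L R a - ξ a • dunklOp k L R (s a) * opT N m A B s =
      (if a = j then ξ a else 0) • 1 - (if a = i then ξ a else 0) • 1 := by
    intro a
    rw [mul_smul_comm, smul_mul_assoc, ← smul_sub, opT_dunklOp h, h2, h3, ← sub_mul,
      add_sub_add_left_eq_sub, ← Finset.sum_sub_distrib]
    simp only [h4, Finset.sum_sub_distrib]
    split_ifs with e1 e2 e2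
    · exact absurd (e1.symm.trans e2) hlt.ne'
    · simp [hs, opT_swap_sq]
    · simp [hs, opT_swap_sq]
    · simp
  rw [Finset.sum_congr rfl fun a _ => h5 a, Finset.sum_sub_distrib, ← Finset.sum_smul, ← Finset.sum_smul,
    Finset.sum_ite_eq', Finset.sum_ite_eq', if_pos (Finset.mem_univ _), if_pos (Finset.mem_univ _),
    ← sub_smul, neg_sub]

theorem mid_lie_coord (i j l : Fin N) (h : i ≠ j) (hj : l ≠ j) :
    ⁅mid N m A B i j, opM N m (Hol N) A B (Hol.coord l : Hol N)⁆ =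
      if l = i then - (opM N m (Hol N) A B (Hol.coord l : Hol N) * opT N m A B (Equiv.swap i j))
      else 0 := by
  rw [mid_lie_opM, Hol.perm_coord]
  split_ifs with e
  · subst e
    have e1 : phi l j * ((Hol.coord j : Hol N) - Hol.coord l) = - (Hol.coord l : Hol N) := by
      linear_combination - phi_mul h
    rw [Equiv.swap_apply_left, e1, map_neg, neg_mul]
  · rw [Equiv.swap_apply_of_ne_of_ne e hj, sub_self, mul_zero, map_zero, zero_mul]

variable [NeZero N]

/-- Moving the first coordinate function to the left deletes the transposition `s_{0i}` when `i` is
not the first index, and inserts all `s_{0j}` when it is. The result is the sum of transpositions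
for the order in which the first index has become the last one. -/
theorem dunklOp_mul_coord_zero (h : CurrentOps L R) (i : Fin N) :
    dunklOp k L R i * opM N m (Hol N) A B (Hol.coord (0 : Fin N) : Hol N) =
      opM N m (Hol N) A B (Hol.coord (0 : Fin N) : Hol N) * (equivariantPart k L R i +
        (∑ j, if j ≠ 0 ∧ (j < i ∨ i = 0) then opT N m A B (Equiv.swap i j) else 0) +
          (if i = 0 then k else 0) • 1) := by
  have hz : ∀ j : Fin N, ¬ j < 0 := fun j hj => by
    rw [Fin.lt_def, Fin.val_zero] at hj; omega
  have hl := dunklOp_lie_opM (k := k) h i (Hol.coord (0 : Fin N) : Hol N)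
  rw [LieRing.of_associative_ring_bracket, sub_eq_iff_eq_add] at hl
  rw [hl, Hol.euler_coord, dunklOp_eq, mul_add, mul_add, mul_add]
  by_cases hi : i = 0
  · subst hi
    have e1 : Finset.Iio (0 : Fin N) = ∅ := by
      ext j; simp [hz]
    have e2 : ∀ j ∈ Finset.Ioi (0 : Fin N), ⁅mid N m A B 0 j, opM N m (Hol N) A B (Hol.coord (0 : Fin N) : Hol N)⁆ =
        - (opM N m (Hol N) A B (Hol.coord (0 : Fin N) : Hol N) * opT N m A B (Equiv.swap 0 j)) := by
      intro j hj
      have hj := (Finset.mem_Ioi.mp hj).ne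
      rw [mid_lie_coord 0 j 0 hj hj, if_pos rfl]
    have e3 : (∑ j : Fin N, if j ≠ 0 ∧ (j < 0 ∨ (0 : Fin N) = 0) then opT N m A B (Equiv.swap 0 j) else 0) =
        ∑ j ∈ Finset.Ioi (0 : Fin N), opT N m A B (Equiv.swap 0 j) := by
      rw [← Finset.sum_filter]
      congr 1
      ext j
      simp [Fin.pos_iff_ne_zero]
    rw [Finset.sum_congr rfl e2, e1, e3, if_pos rfl, if_pos rfl, Finset.sum_empty, Finset.sum_empty,
      Finset.sum_neg_distrib, Finset.mul_sum, mul_smul_comm, mul_one, mul_zero]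
    abel
  · have h0 : (0 : Fin N) < i := Fin.pos_iff_ne_zero.mpr hi
    have e1 : ∀ j ∈ Finset.Iio i, ⁅mid N m A B j i, opM N m (Hol N) A B (Hol.coord (0 : Fin N) : Hol N)⁆ =
        if j = 0 then - (opM N m (Hol N) A B (Hol.coord (0 : Fin N) : Hol N) * opT N m A B (Equiv.swap i j)) else 0 := by
      intro j hj
      rw [mid_lie_coord j i 0 (Finset.mem_Iio.mp hj).ne (Ne.symm hi), opT_swap_comm]
      simp only [eq_comm]
    have e2 : ∀ j ∈ Finset.Ioi i, ⁅mid N m A B i j, opM N m (Hol N) A B (Hol.coord (0 : Fin N) : Hol N)⁆ = 0 := by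
      intro j hj
      rw [mid_lie_coord i j 0 (Finset.mem_Ioi.mp hj).ne (h0.trans (Finset.mem_Ioi.mp hj)).ne,
        if_neg (Ne.symm hi)]
    have e3 : (∑ j : Fin N, if j ≠ 0 ∧ (j < i ∨ i = 0) then opT N m A B (Equiv.swap i j) else 0) =
        ∑ j ∈ (Finset.Iio i).erase 0, opT N m A B (Equiv.swap i j) := by
      rw [← Finset.sum_filter]
      congr 1
      ext j
      simp [hi]
    rw [Finset.sum_congr rfl e1, Finset.sum_congr rfl e2, e3, if_neg hi, if_neg hi, map_zero, smul_zero,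
      zero_smul, mul_zero, Finset.sum_const_zero, Finset.sum_ite_eq', if_pos (Finset.mem_Iio.mpr h0),
      ← Finset.add_sum_erase _ _ (Finset.mem_Iio.mpr h0), mul_add]
    abel

theorem weylOp_rotation : weylOp N m A B (AffineWeyl.rotation N) =
    opM N m (Hol N) A B (Hol.coord (0 : Fin N) : Hol N) * opT N m A B (finRotate N) := by
  rw [AffineWeyl.rotation, map_mul, weylOp_translation, weylOp_ofPerm, coordMonomial_single, zpow_one]
  rfl

/-- The cyclic shift carries the original order to the order with the first index put last, which is
the one produced by commuting with the first coordinate; the scalar `k` appears only when the shift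
wraps around. -/
theorem rotation_mul_dunklOp (h : CurrentOps L R) (i : Fin N) :
    weylOp N m A B (AffineWeyl.rotation N) * dunklOp k L R i =
      (dunklOp k L R (i + 1) - (if i + 1 = 0 then k else 0) • 1) *
        weylOp N m A B (AffineWeyl.rotation N) := by
  rw [weylOp_rotation, mul_assoc, opT_dunklOp h, ← mul_assoc, ← mul_assoc, sub_mul,
    dunklOp_mul_coord_zero h]
  congr 1
  -- The shift maps `{j < i}` onto the nonzero indices below `i + 1`, or onto all nonzero indices
  -- when `i + 1 = 0`.
  have e : ∑ j ∈ Finset.Iio i, opT N m A B (Equiv.swap (finRotate N i) (finRotate N j)) =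
      ∑ j, if j ≠ 0 ∧ (j < i + 1 ∨ i + 1 = 0) then opT N m A B (Equiv.swap (i + 1) j) else 0 := by
    rw [← Equiv.sum_comp (finRotate N), finRotate_eq_add_one, ← Finset.sum_filter]
    refine Finset.sum_congr ?_ fun j _ => rfl
    ext j
    have hi := i.2
    have hj := j.2
    simp only [Finset.mem_Iio, Finset.mem_filter, Finset.mem_univ, true_and, finRotate_eq_add_one,
      Fin.lt_def, Ne, Fin.ext_iff, Fin.val_zero, val_add_one_ite]
    split_ifs <;> simp <;> omega
  rw [e, finRotate_eq_add_one, mul_add _ (_ + _), smul_mul_assoc, one_mul, mul_smul_comm, mul_one,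
    add_sub_cancel_right]

theorem rotation_mul_cartanOp (h : CurrentOps L R) (ξ : Cartan N) :
    weylOp N m A B (AffineWeyl.rotation N) * cartanOp k L R ξ =
      cartanOp k L R (act (AffineWeyl.rotation N) ξ) * weylOp N m A B (AffineWeyl.rotation N) := by
  set u := weylOp N m A B (AffineWeyl.rotation N) with hu
  have h1 : act (AffineWeyl.rotation N) ξ =
      (ξ.1 ∘ (finRotate N).symm, ξ.2 - ξ.1 ((finRotate N).symm 0)) := by
    refine Prod.ext rfl ?_
    change ξ.2 - ∑ i, ((Multiplicative.toAdd ((Multiplicative.ofAdd (Pi.single 0 1 : Fin N → ℤ)) *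
      latticePerm N 1 1) i : ℤ) : ℂ) * ξ.1 ((finRotate N).symm i) = _
    rw [map_one, mul_one, toAdd_ofAdd, Finset.sum_eq_single 0]
    · simp
    · intro b _ hb
      simp [hb]
    · simp
  have h2 : dunklAlong k L R (ξ.1 ∘ (finRotate N).symm) = ∑ i, ξ.1 i • dunklOp k L R (i + 1) := by
    rw [dunklAlong, ← Equiv.sum_comp (finRotate N)]
    simp
  have h3 : ∑ i : Fin N, ξ.1 i * (if i + 1 = 0 then k else 0) = ξ.1 ((finRotate N).symm 0) * k := by
    rw [Finset.sum_eq_single ((finRotate N).symm 0)]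
    · rw [← finRotate_eq_add_one, Equiv.apply_symm_apply, if_pos rfl]
    · intro b _ hb
      rw [← finRotate_eq_add_one, if_neg, mul_zero]
      intro e
      exact hb (by rw [← e, Equiv.symm_apply_apply])
    · simp
  rw [h1, cartanOp, cartanOp, h2, dunklAlong, mul_add, add_mul, Finset.mul_sum, Finset.sum_mul]
  simp only [mul_smul_comm, smul_mul_assoc, hu, rotation_mul_dunklOp h, sub_mul, smul_sub,
    Finset.sum_sub_distrib, smul_smul, one_mul, mul_one, ← Finset.sum_smul, h3, sub_smul]
  abel

/-- Conjugation by `π` rotates the affine Dynkin diagram; in particular it carries the last finite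
simple reflection to the affine one. -/
theorem simpleReflection_mul_rotation (i : Fin N) (h : i + 1 ≠ i) (h' : i + 1 + 1 = 0) :
    simpleReflection (i + 1) * AffineWeyl.rotation N = AffineWeyl.rotation N * simpleReflection i := by
  have h0 : i + 1 ≠ 0 := by
    intro e
    rw [e, zero_add] at h'
    apply h
    rw [h', add_zero]
  have e1 : simpleReflection i = ofPerm (Equiv.swap i (i + 1)) := by
    rw [simpleReflection, reflection, if_neg h0, zero_smul, neg_zero]
    exact one_mul _
  have e2 : simpleReflection (i + 1) =
      translation (Pi.single 0 1 - Pi.single (i + 1) 1) * ofPerm (Equiv.swap (i + 1) 0) := by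
    rw [simpleReflection, reflection, if_pos h', one_smul, neg_sub, h']
  have e3 : finRotate N * Equiv.swap i (i + 1) = Equiv.swap (i + 1) 0 * finRotate N := by
    rw [Equiv.mul_swap_eq_swap_mul, finRotate_eq_add_one, finRotate_eq_add_one, h']
  have e4 : (Pi.single 0 1 : Fin N → ℤ) ∘ (Equiv.swap (i + 1) 0).symm = Pi.single (i + 1) 1 := by
    ext j
    simp only [Function.comp_apply, Equiv.symm_swap, Pi.single_apply, Equiv.swap_apply_def]
    split_ifs <;> simp_all
  rw [e1, e2, AffineWeyl.rotation, mul_assoc _ _ (ofPerm (Equiv.swap i (i + 1))), ← ofPerm_mul, e3, ofPerm_mul,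
    ← mul_assoc, mul_assoc _ _ (translation _), ofPerm_mul_translation, e4, ← mul_assoc, ← translation_add,
    sub_add_cancel, mul_assoc]

/-- For the finite simple reflections this is `opT_dunklAlong`. The affine relation is the conjugate
by the rotation `π` of a finite one. -/
theorem simpleReflection_mul_cartanOp (h : CurrentOps L R) (i : Fin N) (hi : i ≠ i + 1) (ξ : Cartan N) :
    weylOp N m A B (simpleReflection i) * cartanOp k L R ξ -
        cartanOp k L R (act (simpleReflection i) ξ) * weylOp N m A B (simpleReflection i) =
      (-simpleRoot i ξ) • 1 := by
  have key : ∀ (i : Fin N), i + 1 ≠ 0 → ∀ ξ : Cartan N,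
      weylOp N m A B (simpleReflection i) * cartanOp k L R ξ -
        cartanOp k L R (act (simpleReflection i) ξ) * weylOp N m A B (simpleReflection i) =
      (-simpleRoot i ξ) • 1 := by
    intro i h0 ξ
    have e1 : simpleReflection i = ofPerm (Equiv.swap i (i + 1)) := by
      rw [simpleReflection, reflection, if_neg h0, zero_smul, neg_zero]
      exact one_mul _
    have hv : ((i + 1 : Fin N) : ℕ) = i + 1 := by
      rw [val_add_one_ite, if_neg]
      intro e
      apply h0
      rw [Fin.ext_iff, val_add_one_ite, if_pos e, Fin.val_zero]
    have e2 : act (ofPerm (Equiv.swap i (i + 1))) ξ = (ξ.1 ∘ Equiv.swap i (i + 1), ξ.2) := by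
      refine Prod.ext rfl ?_
      change ξ.2 - ∑ i : Fin N, ((0 : ℤ) : ℂ) * _ = ξ.2
      simp
    rw [e1, weylOp_ofPerm, e2, simpleRoot, ← opT_dunklAlong h hv, cartanOp, cartanOp, mul_add, add_mul,
      mul_smul_comm, smul_mul_assoc, mul_one, one_mul, add_sub_add_right_eq_sub]
  by_cases h0 : i + 1 = 0
  · obtain ⟨j, rfl⟩ : ∃ j, j + 1 = i := ⟨i - 1, sub_add_cancel _ _⟩
    have hj : j + 1 ≠ j := by
      intro e
      apply hi
      rw [e, e]
    have hj0 : j + 1 ≠ 0 := by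
      intro e
      rw [e, zero_add] at h0
      exact hj (by rw [h0, add_zero])
    have hc := simpleReflection_mul_rotation j hj h0
    obtain ⟨ζ, rfl⟩ : ∃ ζ, act (AffineWeyl.rotation N) ζ = ξ :=
      ⟨act (AffineWeyl.rotation N)⁻¹ ξ, by rw [← act_mul, mul_inv_cancel, act_one]⟩
    have hu : IsUnit (weylOp N m A B (AffineWeyl.rotation N)) :=
      (Group.isUnit (AffineWeyl.rotation N)).map _
    -- The operator of `π` is invertible, so the affine relation may be checked after multiplying by
    -- it on the right and then moved through `π` to the finite relation for `j`.
    refine hu.mul_left_injective ?_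
    have e3 : simpleRoot (j + 1) (act (AffineWeyl.rotation N) ζ) = simpleRoot j ζ := by
      rw [simpleRoot, simpleRoot]
      have : ∀ a, (act (AffineWeyl.rotation N) ζ).1 (a + 1) = ζ.1 a := by
        intro a
        rw [← finRotate_eq_add_one]
        change ζ.1 ((finRotate N).symm (finRotate N a)) = _
        rw [Equiv.symm_apply_apply]
      rw [this, this]
    have e4 := congrArg (fun x => weylOp N m A B (AffineWeyl.rotation N) * x) (key j hj0 ζ)
    simp only [mul_sub, mul_smul_comm, mul_one] at e4
    simp only [sub_mul, smul_mul_assoc, one_mul]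
    rw [e3, ← e4, mul_assoc, ← rotation_mul_cartanOp h, ← mul_assoc, ← map_mul, hc, map_mul, mul_assoc,
      ← act_mul, hc, act_mul, mul_assoc (cartanOp _ _ _ _), ← map_mul, hc, map_mul, ← mul_assoc, ← mul_assoc,
      ← rotation_mul_cartanOp h, mul_assoc, mul_assoc]
  · exact key i h0 ξ

end Weyl

/-! ### The action of the degenerate double affine Hecke algebra -/

theorem DDAHA.weyl_mul {N : ℕ} [NeZero N] (w w' : AffineWeyl N) :
    DDAHA.weyl (w * w') = DDAHA.weyl w * DDAHA.weyl w' := by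
  rw [DDAHA.weyl, RingQuot.mkAlgHom_rel ℂ (DDAHARel.mul w w'), map_mul]
  rfl

theorem DDAHA.cartan_eq {N : ℕ} [NeZero N] (ξ : Cartan N) :
    DDAHA.cartan ξ = DDAHA.cartan (ξ.1, 0) + algebraMap ℂ _ ξ.2 * DDAHA.cartan (0, 1) := by
  have h : ξ = (ξ.1, 0) + ξ.2 • ((0, 1) : Cartan N) := by ext <;> simp
  conv_lhs => rw [h]
  rw [DDAHA.cartan, RingQuot.mkAlgHom_rel ℂ (DDAHARel.add _ _), map_add,
    RingQuot.mkAlgHom_rel ℂ (DDAHARel.smul _ _), map_smul, Algebra.smul_def]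
  rfl

/-- Translations, permutations, the `ξ` and `c` generate, because every `w` is a translation times a
permutation. Uniqueness, invariance of subspaces and functoriality are all checked on these
generators. -/
theorem DDAHA.induction {N : ℕ} [NeZero N] {C : DDAHA N → Prop}
    (algebraMap : ∀ a, C (algebraMap ℂ _ a)) (add : ∀ x y, C x → C y → C (x + y))
    (mul : ∀ x y, C x → C y → C (x * y)) (central : C (DDAHA.cartan (0, 1)))
    (cartan : ∀ ξ, C (DDAHA.cartan (ξ, 0))) (perm : ∀ w, C (DDAHA.weyl (ofPerm w)))
    (translation : ∀ η, C (DDAHA.weyl (translation η))) (x : DDAHA N) : C x := by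
  obtain ⟨x, rfl⟩ := RingQuot.mkAlgHom_surjective ℂ (DDAHARel N) x
  induction x using FreeAlgebra.induction with
  | grade0 a => rw [AlgHom.commutes]; exact algebraMap a
  | add x y hx hy => rw [map_add]; exact add _ _ hx hy
  | mul x y hx hy => rw [map_mul]; exact mul _ _ hx hy
  | grade1 g =>
    cases g with
    | weyl w =>
      change C (DDAHA.weyl w)
      rw [← translation_mul_ofPerm w, DDAHA.weyl_mul]
      exact mul _ _ (translation _) (perm _)
    | cartan ξ =>
      change C (DDAHA.cartan ξ)
      rw [DDAHA.cartan_eq]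
      exact add _ _ (cartan _) (mul _ _ (algebraMap _) central)

section Action

variable {N m : ℕ} [NeZero N] {A B : Type*} [AddCommGroup A] [Module ℂ A] [AddCommGroup B]
  [Module ℂ B] {k : ℂ} {L R : Fin N → HEnd N m A B}

variable (k) in
/-- The homomorphism from `ℋ` given by Dunkl operators, permutations and monomials. -/
def heckeHom (h : CurrentOps L R) : DDAHA N →ₐ[ℂ] HEnd N m A B :=
  RingQuot.liftAlgHom ℂ (s := DDAHARel N) ⟨FreeAlgebra.lift ℂ fun g => match g with
    | .weyl w => weylOp N m A B w
    | .cartan ξ => cartanOp k L R ξ, fun x y hxy => by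
      induction hxy with
      | one => simp
      | mul w w' => simp
      | add ξ ξ' => simp [cartanOp_add]
      | smul a ξ => simp [cartanOp_smul]
      | comm ξ ξ' => simpa using (cartanOp_comm h ξ ξ').eq
      | simple i hi ξ =>
        simp only [map_sub, map_mul, FreeAlgebra.lift_ι_apply, AlgHom.commutes]
        rw [simpleReflection_mul_cartanOp h i hi, Algebra.algebraMap_eq_smul_one]
      | rotation ξ => simpa using rotation_mul_cartanOp h ξ⟩

theorem heckeHom_weyl (h : CurrentOps L R) (w : AffineWeyl N) :
    heckeHom k h (DDAHA.weyl w) = weylOp N m A B w := by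
  rw [DDAHA.weyl, heckeHom, RingQuot.liftAlgHom_mkAlgHom_apply, FreeAlgebra.lift_ι_apply]

theorem heckeHom_cartan (h : CurrentOps L R) (ξ : Cartan N) :
    heckeHom k h (DDAHA.cartan ξ) = cartanOp k L R ξ := by
  rw [DDAHA.cartan, heckeHom, RingQuot.liftAlgHom_mkAlgHom_apply, FreeAlgebra.lift_ι_apply]

end Action

/-! ### Existence and uniqueness of the action on the holomorphic space. -/

section KZAction

variable {N m : ℕ} [NeZero N] {ℓ : ℂ} {A B : Type*}
  [AddCommGroup A] [Module ℂ A] [LieRingModule (AffineSl m) A] [LieModule ℂ (AffineSl m) A]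
  [AddCommGroup B] [Module ℂ B] [LieRingModule (AffineSl m) B] [LieModule ℂ (AffineSl m) B]

theorem isKZAction_heckeHom [NeZero m] (hA : CategoryO m ℓ A) (hB : CategoryODagger m ℓ B)
    {L R : Fin N → HEnd N m A B} (h : IsRLimit A B L R) :
    IsKZAction ℓ A B ((ev N m (Hol N) A B).comp (heckeHom (ℓ + m) (h.currentOps hA hB))) where
  central := by
    rw [AlgHom.comp_apply, heckeHom_cartan, cartanOp, dunklAlong]
    simp [Algebra.algebraMap_eq_smul_one]
  cartan ξ x := by
    rw [AlgHom.comp_apply, heckeHom_cartan, cartanOp, zero_mul, zero_smul, add_zero,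
      dunkl_eq hA hB h]
  perm w := by rw [AlgHom.comp_apply, heckeHom_weyl, weylOp_ofPerm, tau_eq]
  translation η := by
    rw [AlgHom.comp_apply, heckeHom_weyl, weylOp_translation, mulOp_eq, laurentToHol_single_one]

theorem IsKZAction.ext {ρ ρ' : DDAHA N →ₐ[ℂ] Module.End ℂ (HolSpace N m A B)}
    (h : IsKZAction ℓ A B ρ) (h' : IsKZAction ℓ A B ρ') : ρ = ρ' := by
  refine AlgHom.ext fun x => ?_
  induction x using DDAHA.induction with
  | algebraMap a => rw [AlgHom.commutes, AlgHom.commutes]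
  | add x y hx hy => rw [map_add, map_add, hx, hy]
  | mul x y hx hy => rw [map_mul, map_mul, hx, hy]
  | central => rw [h.central, h'.central]
  | cartan ξ => exact LinearMap.ext fun x => by rw [h.cartan, h'.cartan]
  | perm w => rw [h.perm, h'.perm]
  | translation η => rw [h.translation, h'.translation]

end KZAction

/-! ### Operators preserving the Laurent polynomials -/

section Stabilizer

variable {N m : ℕ} {S A B : Type*} [CommRing S] [Algebra ℂ S]
  [AddCommGroup A] [Module ℂ A] [AddCommGroup B] [Module ℂ B]

/-- The algebra of operators which preserve a subspace. -/
def stabilizer (V : Submodule ℂ (TensorSpace N m S A B)) : Subalgebra ℂ (TEnd N m S A B) where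
  carrier := {T | ∀ x ∈ V, ev N m S A B T x ∈ V}
  mul_mem' hT hU x hx := hT _ (hU x hx)
  add_mem' hT hU x hx := V.add_mem (hT x hx) (hU x hx)
  algebraMap_mem' a x hx := V.smul_mem a hx

/-- On a given vector the limit agrees with one of the truncations, so no closedness of the subspace
is needed. -/
theorem IsPtLim.mem_stabilizer {V : Submodule ℂ (TensorSpace N m S A B)}
    {T : ℕ → TEnd N m S A B} {f : TEnd N m S A B} (h : IsPtLim T f)
    (hT : ∀ K, T K ∈ stabilizer V) : f ∈ stabilizer V := fun x hx => by
  obtain ⟨K, hK⟩ := (h x).exists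
  exact hK ▸ hT K x hx

theorem pairing_mem {ι R : Type*} [Fintype ι] [Ring R] [Algebra ℂ R] (T : Subalgebra ℂ R)
    {J U : ι → ι → R} (h : ι → ι → ℂ) (hJ : ∀ a b, J a b ∈ T) (hU : ∀ a b, U a b ∈ T) :
    pairing J U h ∈ T :=
  T.sum_mem fun _ _ => T.sum_mem fun _ _ => T.smul_mem (T.mul_mem (hJ _ _) (hU _ _)) _

theorem truncated_mem {ι R : Type*} [Fintype ι] [Ring R] [Algebra ℂ R] (T : Subalgebra ℂ R)
    {J : ℕ → ι → ι → R} {U : ι → ι → R} (h : ι → ι → ℂ) {u : R} (hJ : ∀ n a b, J n a b ∈ T)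
    (hU : ∀ a b, U a b ∈ T) (hu : u ∈ T) (K : ℕ) : truncated J U h u K ∈ T :=
  T.add_mem (pairing_mem T h (hJ 0) hU) (T.sum_mem fun n _ =>
    T.mul_mem (T.pow_mem hu _) (pairing_mem T 1 (hJ _) hU))

variable (N m A B) in
/-- The operators which preserve `A ⊗ ℂ[P] ⊗ (ℂ^m)^{⊗N} ⊗ B`. -/
abbrev laurentStab : Subalgebra ℂ (HEnd N m A B) :=
  stabilizer (LinearMap.range (inclusion N m A B))

theorem inclusion_opA (a : Module.End ℂ A) (x : LaurentSpace N m A B) :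
    inclusion N m A B (ev N m (Laurent N) A B (opA N m (Laurent N) A B a) x) =
      ev N m (Hol N) A B (opA N m (Hol N) A B a) (inclusion N m A B x) := by
  have : inclusion N m A B ∘ₗ ev N m (Laurent N) A B (opA N m (Laurent N) A B a) =
      ev N m (Hol N) A B (opA N m (Hol N) A B a) ∘ₗ inclusion N m A B :=
    TensorProduct.ext' fun _ _ => rfl
  exact LinearMap.congr_fun this x

theorem inclusion_opV (v : Module.End ℂ (VecPower N m)) (x : LaurentSpace N m A B) :
    inclusion N m A B (ev N m (Laurent N) A B (opV N m (Laurent N) A B v) x) =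
      ev N m (Hol N) A B (opV N m (Hol N) A B v) (inclusion N m A B x) := by
  have : inclusion N m A B ∘ₗ ev N m (Laurent N) A B (opV N m (Laurent N) A B v) =
      ev N m (Hol N) A B (opV N m (Hol N) A B v) ∘ₗ inclusion N m A B :=
    TensorProduct.ext <| LinearMap.ext fun _ => TensorProduct.ext' fun _ _ => rfl
  exact LinearMap.congr_fun this x

theorem inclusion_opB (b : Module.End ℂ B) (x : LaurentSpace N m A B) :
    inclusion N m A B (ev N m (Laurent N) A B (opB N m (Laurent N) A B b) x) =
      ev N m (Hol N) A B (opB N m (Hol N) A B b) (inclusion N m A B x) := by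
  have : inclusion N m A B ∘ₗ ev N m (Laurent N) A B (opB N m (Laurent N) A B b) =
      ev N m (Hol N) A B (opB N m (Hol N) A B b) ∘ₗ inclusion N m A B :=
    TensorProduct.ext <| LinearMap.ext fun _ => TensorProduct.ext' fun _ _ => rfl
  exact LinearMap.congr_fun this x

theorem inclusion_opM (f : Laurent N) (x : LaurentSpace N m A B) :
    inclusion N m A B (ev N m (Laurent N) A B (opM N m (Laurent N) A B f) x) =
      ev N m (Hol N) A B (opM N m (Hol N) A B (laurentToHol N f)) (inclusion N m A B x) := by
  have : inclusion N m A B ∘ₗ ev N m (Laurent N) A B (opM N m (Laurent N) A B f) =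
      ev N m (Hol N) A B (opM N m (Hol N) A B (laurentToHol N f)) ∘ₗ inclusion N m A B := by
    refine TensorProduct.ext <| LinearMap.ext fun a => TensorProduct.ext' fun s w => ?_
    change a ⊗ₜ[ℂ] (laurentToHol N (f * s) ⊗ₜ[ℂ] w) =
      a ⊗ₜ[ℂ] ((laurentToHol N f * laurentToHol N s) ⊗ₜ[ℂ] w)
    rw [map_mul]
  exact LinearMap.congr_fun this x

theorem opA_mem (a : Module.End ℂ A) : opA N m (Hol N) A B a ∈ laurentStab N m A B := by
  rintro _ ⟨x, rfl⟩
  exact ⟨_, inclusion_opA a x⟩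

theorem opV_mem (v : Module.End ℂ (VecPower N m)) :
    opV N m (Hol N) A B v ∈ laurentStab N m A B := by
  rintro _ ⟨x, rfl⟩
  exact ⟨_, inclusion_opV v x⟩

theorem opB_mem (b : Module.End ℂ B) : opB N m (Hol N) A B b ∈ laurentStab N m A B := by
  rintro _ ⟨x, rfl⟩
  exact ⟨_, inclusion_opB b x⟩

theorem opS_mem (i : Fin N) (M : Matrix (Fin m) (Fin m) ℂ) :
    opS N m (Hol N) A B i M ∈ laurentStab N m A B := opV_mem _

theorem opF_mem {f : Module.End ℂ (Hol N)}
    (hf : ∀ s ∈ (laurentToHol N).range, f s ∈ (laurentToHol N).range) :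
    opF N m (Hol N) A B f ∈ laurentStab N m A B := by
  rintro _ ⟨x, rfl⟩
  induction x using TensorProduct.induction_on with
  | zero => simp
  | add x y hx hy =>
    rw [map_add, map_add]
    exact Submodule.add_mem _ hx hy
  | tmul a u =>
    induction u using TensorProduct.induction_on with
    | zero => simp
    | add u v hu hv =>
      rw [TensorProduct.tmul_add, map_add, map_add]
      exact Submodule.add_mem _ hu hv
    | tmul s w =>
      obtain ⟨s', hs⟩ := hf _ ⟨s, rfl⟩
      refine ⟨a ⊗ₜ (s' ⊗ₜ w), ?_⟩
      change a ⊗ₜ[ℂ] (laurentToHol N s' ⊗ₜ[ℂ] w) = a ⊗ₜ[ℂ] (f (laurentToHol N s) ⊗ₜ[ℂ] w)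
      exact congrArg (fun t => a ⊗ₜ[ℂ] (t ⊗ₜ[ℂ] w)) hs

theorem opM_mem {f : Hol N} (hf : f ∈ (laurentToHol N).range) :
    opM N m (Hol N) A B f ∈ laurentStab N m A B :=
  opF_mem fun _ hs => Subalgebra.mul_mem _ hf hs

theorem opD_mem (i : Fin N) : opD N m A B i ∈ laurentStab N m A B := by
  refine opF_mem ?_
  rintro _ ⟨s, rfl⟩
  exact ⟨_, laurentToHol_euler i s⟩

theorem opT_mem (w : Equiv.Perm (Fin N)) : opT N m A B w ∈ laurentStab N m A B :=
  Subalgebra.mul_mem _ (opF_mem fun _ hs => perm_mem_range w hs) (opV_mem _)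

/-- The pole of `φ_ij` is harmless because it enters only through a divided difference. -/
theorem mid_mem {i j : Fin N} (h : i ≠ j) : mid N m A B i j ∈ laurentStab N m A B := by
  rw [mid_eq h]
  have hp (g) : pairing (unitAt N m (Hol N) A B i) (unitAt N m (Hol N) A B j) g ∈
      laurentStab N m A B := pairing_mem _ _ (fun _ _ => opS_mem _ _) fun _ _ => opS_mem _ _
  exact Subalgebra.sub_mem _ (hp _)
    (Subalgebra.mul_mem _ (opF_mem fun _ hs => divDiff_mem_range h hs) (hp _))

theorem coordPow_mem_range (i : Fin N) (n : ℤ) : coordPow (Hol N) i n ∈ (laurentToHol N).range :=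
  coord_zpow_mem_range i n

end Stabilizer

/-! ### The action preserves the Laurent polynomials. -/

section Preservation

variable {N m : ℕ} {ℓ k : ℂ} {A B : Type*}
  [AddCommGroup A] [Module ℂ A] [LieRingModule (AffineSl m) A] [LieModule ℂ (AffineSl m) A]
  [AddCommGroup B] [Module ℂ B] [LieRingModule (AffineSl m) B] [LieModule ℂ (AffineSl m) B]
  {L R : Fin N → HEnd N m A B}

theorem IsRLimit.left_mem (h : IsRLimit A B L R) (i : Fin N) : L i ∈ laurentStab N m A B :=
  (h.left i).mem_stabilizer fun K => truncated_mem _ _ (fun _ _ _ => opA_mem _)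
    (fun _ _ => opS_mem _ _) (opM_mem (coordPow_mem_range i _)) K

theorem IsRLimit.right_mem (h : IsRLimit A B L R) (i : Fin N) : R i ∈ laurentStab N m A B :=
  (h.right i).mem_stabilizer fun K => truncated_mem _ _ (fun _ _ _ => opB_mem _)
    (fun _ _ => opS_mem _ _) (opM_mem (coordPow_mem_range i _)) K

theorem IsRLimit.dunklOp_mem (h : IsRLimit A B L R) (i : Fin N) :
    dunklOp k L R i ∈ laurentStab N m A B := by
  have h1 : oneSite k L R i ∈ laurentStab N m A B :=
    Subalgebra.add_mem _ (Subalgebra.sub_mem _ (Subalgebra.add_mem _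
      (Subalgebra.smul_mem _ (opD_mem i) k) (h.left_mem i)) (h.right_mem i)) (opS_mem _ _)
  refine Subalgebra.add_mem _ h1 (Subalgebra.sub_mem _
    (Subalgebra.sum_mem _ fun j hj => mid_mem (Finset.mem_Iio.mp hj).ne)
    (Subalgebra.sum_mem _ fun j hj => mid_mem (Finset.mem_Ioi.mp hj).ne))

variable [NeZero N]

theorem heckeHom_mem (h : CurrentOps L R) (T : Subalgebra ℂ (HEnd N m A B))
    (hd : ∀ i, dunklOp k L R i ∈ T) (hp : ∀ w, opT N m A B w ∈ T)
    (ht : ∀ η : Fin N → ℤ, opM N m (Hol N) A B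
      ((coordMonomial (Hol N) (Multiplicative.ofAdd η) : (Hol N)ˣ) : Hol N) ∈ T) (x : DDAHA N) :
    heckeHom k h x ∈ T := by
  induction x using DDAHA.induction with
  | algebraMap a => rw [AlgHom.commutes]; exact T.algebraMap_mem a
  | add x y hx hy => rw [map_add]; exact T.add_mem hx hy
  | mul x y hx hy => rw [map_mul]; exact T.mul_mem hx hy
  | central =>
    rw [heckeHom_cartan]
    exact T.add_mem (T.sum_mem fun i _ => T.smul_mem (hd i) _) (T.smul_mem T.one_mem _)
  | cartan ξ =>
    rw [heckeHom_cartan]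
    exact T.add_mem (T.sum_mem fun i _ => T.smul_mem (hd i) _) (T.smul_mem T.one_mem _)
  | perm w => rw [heckeHom_weyl, weylOp_ofPerm]; exact hp w
  | translation η => rw [heckeHom_weyl, weylOp_translation]; exact ht η

theorem coordMonomial_mem_range (η : Fin N → ℤ) :
    ((coordMonomial (Hol N) (Multiplicative.ofAdd η) : (Hol N)ˣ) : Hol N) ∈
      (laurentToHol N).range := ⟨_, laurentToHol_single_one η⟩

theorem heckeHom_mem_laurentStab (hc : CurrentOps L R) (h : IsRLimit A B L R) (x : DDAHA N) :
    heckeHom k hc x ∈ laurentStab N m A B :=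
  heckeHom_mem hc _ h.dunklOp_mem opT_mem (fun η => opM_mem (coordMonomial_mem_range η)) x

end Preservation

/-! ### Commutators of matrix units with a matrix -/

section AdjUnit

variable {m : ℕ}

/-- The commutator `[M, E_{ab}]`. -/
def adjUnit (M : Matrix (Fin m) (Fin m) ℂ) (a b : Fin m) : Matrix (Fin m) (Fin m) ℂ :=
  M * Matrix.single a b 1 - Matrix.single a b 1 * M

theorem toMatrix_lie_slUnit (X : Sl m) (a b : Fin m) :
    Sl.toMatrix m ⁅X, slUnit m a b⁆ = adjUnit (Sl.toMatrix m X) a b := by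
  rw [Sl.toMatrix_lie, slUnit, toMatrix_traceless, adjUnit, mul_sub, sub_mul, mul_smul_comm,
    smul_mul_assoc, mul_one, one_mul, sub_sub_sub_cancel_right]

theorem traceless_adjUnit (X : Sl m) (a b : Fin m) :
    traceless m (adjUnit (Sl.toMatrix m X) a b) = ⁅X, slUnit m a b⁆ := by
  rw [← toMatrix_lie_slUnit, traceless_toMatrix]

theorem adjUnit_eq_sum (M : Matrix (Fin m) (Fin m) ℂ) (a b : Fin m) :
    adjUnit M a b = ∑ c, M c a • Matrix.single c b 1 - ∑ c, M b c • Matrix.single a c 1 := by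
  ext i j
  rw [adjUnit, Matrix.sub_apply, Matrix.sub_apply, Matrix.sum_apply, Matrix.sum_apply]
  congr 1
  · by_cases h : j = b
    · subst h; simp [Matrix.single_apply]
    · simp [h, Ne.symm h]
  · by_cases h : i = a
    · subst h; simp [Matrix.single_apply]
    · simp [h, Ne.symm h]

/-- Invariance of the Casimir tensor `∑ E_ab ⊗ E_ba` under `ad M`, in a form in which the two legs
are mapped to operators by arbitrary linear maps. -/
theorem pairing_adjUnit {R : Type*} [Ring R] [Algebra ℂ R]
    (F G : Matrix (Fin m) (Fin m) ℂ →ₗ[ℂ] R) (M : Matrix (Fin m) (Fin m) ℂ) :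
    pairing (fun a b => F (adjUnit M a b)) (fun a b => G (Matrix.single a b 1)) 1 +
      pairing (fun a b => F (Matrix.single a b 1)) (fun a b => G (adjUnit M a b)) 1 = 0 := by
  have e1 : ∑ a, ∑ b, ∑ c, M c a • (F (Matrix.single c b 1) * G (Matrix.single b a 1)) =
      ∑ a, ∑ b, ∑ c, M a c • (F (Matrix.single a b 1) * G (Matrix.single b c 1)) :=
    (Finset.sum_congr rfl fun a _ => Finset.sum_comm).trans
      (Finset.sum_comm.trans (Finset.sum_congr rfl fun a _ => Finset.sum_comm))
  have e2 : ∑ a, ∑ b, ∑ c, M b c • (F (Matrix.single a c 1) * G (Matrix.single b a 1)) =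
      ∑ a, ∑ b, ∑ c, M c b • (F (Matrix.single a b 1) * G (Matrix.single c a 1)) :=
    Finset.sum_congr rfl fun a _ => Finset.sum_comm
  simp only [pairing, adjUnit_eq_sum, map_sub, map_sum, map_smul, sub_mul, mul_sub, Finset.sum_mul,
    Finset.mul_sum, smul_mul_assoc, mul_smul_comm, Finset.sum_sub_distrib, Pi.one_apply, one_smul]
  rw [e1, e2]
  abel

theorem diagonal_eq_sum_single (v : Fin m → ℂ) :
    Matrix.diagonal v = ∑ a, v a • Matrix.single a a (1 : ℂ) := by
  ext i j
  rw [Matrix.sum_apply, Matrix.diagonal_apply]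
  by_cases h : i = j
  · subst h; simp [Matrix.single_apply]
  · rw [if_neg h]
    refine (Finset.sum_eq_zero fun a _ => ?_).symm
    have : ¬ (a = i ∧ a = j) := fun ⟨h1, h2⟩ => h (h1.symm.trans h2)
    simp [this]

theorem sum_adjUnit_diag (M : Matrix (Fin m) (Fin m) ℂ) : ∑ a, adjUnit M a a = 0 := by
  have := diagonal_eq_sum_single (m := m) 1
  simp only [Pi.one_apply, one_smul] at this
  simp only [adjUnit, Finset.sum_sub_distrib, ← Finset.mul_sum, ← Finset.sum_mul, ← this]
  simp

/-- This computes a site paired with itself, where both legs lie in one matrix algebra. The products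
collapse to `M E_aa`, `E_aa M` and multiples `M_bb E_aa`; the last ones add up to `κ tr(M) = 0`. -/
theorem sum_adjUnit_mul {M : Matrix (Fin m) (Fin m) ℂ} (hM : M.trace = 0) {c d : Fin m → Fin m → ℂ}
    {κ : ℂ} (hκ : ∀ a b, d a b - c a b = κ) :
    ∑ a, ∑ b, c a b • (adjUnit M a b * Matrix.single b a 1) +
        ∑ a, ∑ b, d a b • (Matrix.single a b 1 * adjUnit M b a) =
      M * Matrix.diagonal (fun a => ∑ b, c a b) - Matrix.diagonal (fun a => ∑ b, d a b) * M := by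
  have h1 : ∀ a b, adjUnit M a b * Matrix.single b a 1 =
      M * Matrix.single a a 1 - M b b • Matrix.single a a 1 := by
    intro a b
    rw [adjUnit, sub_mul, mul_assoc, Matrix.single_mul_single_same, one_mul, Matrix.single_mul_mul_single]
    simp
  have h2 : ∀ a b, Matrix.single a b 1 * adjUnit M b a =
      M b b • Matrix.single a a 1 - Matrix.single a a 1 * M := by
    intro a b
    rw [adjUnit, mul_sub, ← mul_assoc, ← mul_assoc, Matrix.single_mul_single_same, one_mul,
      Matrix.single_mul_mul_single]
    simp
  have h3 : ∀ a, ∑ b, (d a b * M b b - c a b * M b b) = 0 := by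
    intro a
    simp only [← sub_mul, hκ, ← Finset.mul_sum]
    have : ∑ b, M b b = 0 := hM
    rw [this, mul_zero]
  rw [diagonal_eq_sum_single, diagonal_eq_sum_single, Finset.mul_sum, Finset.sum_mul,
    ← Finset.sum_add_distrib, ← Finset.sum_sub_distrib]
  refine Finset.sum_congr rfl fun a _ => ?_
  have h4 := congrArg (fun t => t • Matrix.single a a (1 : ℂ)) (h3 a)
  simp only [Finset.sum_smul, zero_smul, sub_smul] at h4
  simp only [h1, h2, smul_sub, Finset.sum_sub_distrib, Finset.sum_smul, mul_smul_comm, Finset.mul_sum,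
    smul_mul_assoc, Finset.sum_mul, smul_smul] at h4 ⊢
  rw [← sub_eq_zero, ← h4]
  abel

end AdjUnit

/-! ### The defect, and commutators of degree `±1` elements with the limits `L_i` and `R_i`. -/

section Defect

variable {N m : ℕ} {A B : Type*} [AddCommGroup A] [Module ℂ A] [AddCommGroup B] [Module ℂ B]

theorem pairing_eq_add_neg_flip {ι R : Type*} [Fintype ι] [Ring R] [Algebra ℂ R] {h : ι → ι → ℂ}
    (hh : ∀ a b, h a b + h b a = 1) (A U : ι → ι → R) :
    pairing A U (fun a b => - h b a) = pairing A U h - pairing A U 1 := by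
  rw [eq_sub_iff_add_eq, ← pairing_add]
  congr 1
  funext a b
  rw [Pi.one_apply, Pi.one_apply, ← hh a b]
  ring

theorem pairing_neg {ι R : Type*} [Fintype ι] [Ring R] [Algebra ℂ R] (h : ι → ι → ℂ)
    (A U : ι → ι → R) : pairing A U (fun a b => - h a b) = - pairing A U h := by
  simp only [pairing, neg_smul, Finset.sum_neg_distrib]

theorem pairing_smooth {J : ℕ → Fin m → Fin m → HEnd N m A B}
    (hJ : ∀ x, ∀ᶠ n in atTop, ∀ a b, ev N m (Hol N) A B (J n a b) x = 0) (h : Fin m → Fin m → ℂ)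
    (U : Fin m → Fin m → HEnd N m A B) (x : HolSpace N m A B) :
    ∀ᶠ n in atTop, ev N m (Hol N) A B (pairing (J n) U h) x = 0 := by
  have : ∀ᶠ n in atTop, ∀ a b, ∀ c d, ev N m (Hol N) A B (J n c d)
      (ev N m (Hol N) A B (U b a) x) = 0 :=
    eventually_all.mpr fun a => eventually_all.mpr fun b => hJ _
  filter_upwards [this] with n hn
  rw [pairing, ev_sum_apply]
  refine Finset.sum_eq_zero fun a _ => ?_
  rw [ev_sum_apply]
  refine Finset.sum_eq_zero fun b _ => ?_
  rw [ev_smul_apply, ev_mul_apply, hn, smul_zero]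

/-- The value of the commutator of `θ(X ⊗ t^e)` with a Dunkl operator, as a function of the family `Θ` of
operators replacing `θ`. -/
def defect (c d : Fin m → Fin m → ℂ) (e : ℤ) (X : Sl m) (i : Fin N) :
    (AffineSl m →ₗ[ℂ] HEnd N m A B) →+ HEnd N m A B :=
  AddMonoidHom.mk' (fun Θ =>
    pairing (fun a b => Θ (AffineSl.monomial e ⁅X, slUnit m a b⁆)) (unitAt N m (Hol N) A B i) c +
      opM N m (Hol N) A B (coordPow (Hol N) i e) *
        pairing (fun a b => Θ (AffineSl.monomial 0 (slUnit m a b)))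
          (fun a b => opS N m (Hol N) A B i (adjUnit (Sl.toMatrix m X) a b)) d)
    fun Θ Θ' => by
      simp only [pairing, LinearMap.add_apply, add_mul, smul_add, Finset.sum_add_distrib, mul_add]
      abel

theorem defect_apply (c d : Fin m → Fin m → ℂ) (e : ℤ) (X : Sl m) (i : Fin N)
    (Θ : AffineSl m →ₗ[ℂ] HEnd N m A B) : defect c d e X i Θ =
    pairing (fun a b => Θ (AffineSl.monomial e ⁅X, slUnit m a b⁆)) (unitAt N m (Hol N) A B i) c +
      opM N m (Hol N) A B (coordPow (Hol N) i e) *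
        pairing (fun a b => Θ (AffineSl.monomial 0 (slUnit m a b)))
          (fun a b => opS N m (Hol N) A B i (adjUnit (Sl.toMatrix m X) a b)) d := rfl

theorem defect_neg (c d : Fin m → Fin m → ℂ) (e : ℤ) (X : Sl m) (i : Fin N)
    (Θ : AffineSl m →ₗ[ℂ] HEnd N m A B) :
    defect (fun a b => - c a b) (fun a b => - d a b) e X i Θ = - defect c d e X i Θ := by
  rw [defect_apply, defect_apply, pairing_neg, pairing_neg, mul_neg, neg_add]

/-- The formal properties of the actions on `A` and on `B`, where `s` is the sign of the powers of `t` which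
act locally nilpotently. -/
structure IsEndAction (Θ : AffineSl m →ₗ[ℂ] HEnd N m A B) (s : ℤ) (κ : ℂ) : Prop where
  lie (p q : ℤ) (X Y : Sl m) : ⁅Θ (AffineSl.monomial p X), Θ (AffineSl.monomial q Y)⁆ =
    Θ (AffineSl.monomial (p + q) ⁅X, Y⁆) +
      algebraMap ℂ _ (if p + q = 0 then (p : ℂ) * traceForm m X Y * κ else 0)
  opM (f : Hol N) (Y : AffineSl m) : Commute (opM N m (Hol N) A B f) (Θ Y)
  opS (i : Fin N) (M : Matrix (Fin m) (Fin m) ℂ) (Y : AffineSl m) :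
    Commute (opS N m (Hol N) A B i M) (Θ Y)
  smooth (x : HolSpace N m A B) :
    ∀ᶠ n : ℕ in atTop, ∀ X, ev N m (Hol N) A B (Θ (AffineSl.monomial (s * n) X)) x = 0

variable {Θ : AffineSl m →ₗ[ℂ] HEnd N m A B} {s : ℤ} {κ : ℂ} {J : ℕ → Fin m → Fin m → HEnd N m A B}
  {g : Fin m → Fin m → ℂ} {i : Fin N} {T : HEnd N m A B}

theorem opS_lie_unitAt (X : Matrix (Fin m) (Fin m) ℂ) (a b : Fin m) :
    ⁅opS N m (Hol N) A B i X, unitAt N m (Hol N) A B i a b⁆ =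
      opS N m (Hol N) A B i (adjUnit X a b) := by
  rw [Ring.lie_def, unitAt, ← opS_mul, ← opS_mul, ← map_sub, adjUnit]

/-- The cocycle produces the scalars `tr(X E_ab)`; paired with `E_ba` they reassemble the matrix of
`X`. -/
theorem pairing_traceForm (X : Sl m) (r : ℂ) :
    pairing (fun a b => algebraMap ℂ (HEnd N m A B) (r * traceForm m X (slUnit m a b)))
      (unitAt N m (Hol N) A B i) 1 = r • opS N m (Hol N) A B i (Sl.toMatrix m X) := by
  conv_rhs => rw [Matrix.matrix_eq_sum_single (Sl.toMatrix m X)]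
  rw [pairing, Finset.sum_comm, map_sum, Finset.smul_sum]
  refine Finset.sum_congr rfl fun a _ => ?_
  rw [map_sum, Finset.smul_sum]
  refine Finset.sum_congr rfl fun b _ => ?_
  rw [traceForm_slUnit, Pi.one_apply, Pi.one_apply, one_smul, ← Algebra.smul_def, mul_smul, unitAt,
    ← map_smul, Matrix.smul_single, smul_eq_mul, mul_one]

theorem IsEndAction.pairing_adjUnit (Θ : AffineSl m →ₗ[ℂ] HEnd N m A B) (p : ℤ) (X : Sl m) :
    pairing (fun a b => Θ (AffineSl.monomial p ⁅X, slUnit m a b⁆)) (unitAt N m (Hol N) A B i) 1 +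
      pairing (fun a b => Θ (AffineSl.monomial p (slUnit m a b)))
        (fun a b => AffineKZ.opS N m (Hol N) A B i (adjUnit (Sl.toMatrix m X) a b)) 1 = 0 := by
  rw [← AffineKZ.pairing_adjUnit (Θ ∘ₗ AffineSl.monomial p ∘ₗ traceless m)
    (AffineKZ.opS N m (Hol N) A B i) (Sl.toMatrix m X)]
  simp only [LinearMap.comp_apply, traceless_adjUnit]
  rfl

theorem opM_coordPow_mul (p q : ℤ) (h : p + q = 0) :
    opM N m (Hol N) A B (coordPow (Hol N) i p) * opM N m (Hol N) A B (coordPow (Hol N) i q) = 1 := by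
  rw [← map_mul, coordPow, coordPow, ← Units.val_mul, ← zpow_add, h, zpow_zero, Units.val_one, map_one]

theorem IsEndAction.currents_smooth (hΘ : IsEndAction Θ s κ) (X : Sl m) (h : Fin m → Fin m → ℂ)
    (U : Fin m → Fin m → HEnd N m A B) (v : ℕ → HEnd N m A B) (x : HolSpace N m A B) :
    ∀ᶠ K : ℕ in atTop, ev N m (Hol N) A B (v K * pairing (fun a b =>
      Θ (AffineSl.monomial (s * (K + 1 : ℕ)) ⁅X, slUnit m a b⁆)) U h) x = 0 := by
  have := pairing_smooth (J := fun n a b => Θ (AffineSl.monomial (s * n) ⁅X, slUnit m a b⁆))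
    (fun x => (hΘ.smooth x).mono fun _ h a b => h _) h U x
  filter_upwards [(tendsto_add_atTop_nat 1).eventually this] with K hK
  rw [ev_mul_apply, hK, map_zero]

/-- By `lie_truncated_pos` only boundary terms remain, and the top one, a current of degree `K + 1`,
vanishes on any vector for large `K`. In degree zero the coefficients `h` minus `1` are the negative
transpose of `h`. -/
theorem IsEndAction.lie_pos (hΘ : IsEndAction Θ s κ) (hs : s ≠ 0)
    (hJ : ∀ n a b, J n a b = Θ (AffineSl.monomial (s * n) (slUnit m a b)))
    (hg : ∀ a b, g a b + g b a = 1)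
    (hT : IsPtLim (siteTrunc J g (fun i => coordPow (Hol N) i (-s)) i) T) (X : Sl m) :
    ⁅Θ (AffineSl.monomial s X) + AffineKZ.opM N m (Hol N) A B (coordPow (Hol N) i s) *
        AffineKZ.opS N m (Hol N) A B i (Sl.toMatrix m X), T⁆ =
      defect (fun a b => - g b a) g s X i Θ := by
  have hJ0 : ∀ a b, J 0 a b = Θ (AffineSl.monomial 0 (slUnit m a b)) := fun a b => by
    rw [hJ, Nat.cast_zero, mul_zero]
  have key := lie_truncated_pos (A := J) (h := g)
    (C := fun n a b => Θ (AffineSl.monomial (s * n) ⁅X, slUnit m a b⁆))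
    (U := unitAt N m (Hol N) A B i)
    (D := fun a b => AffineKZ.opS N m (Hol N) A B i (adjUnit (Sl.toMatrix m X) a b))
    (y := Θ (AffineSl.monomial s X)) (w := AffineKZ.opS N m (Hol N) A B i (Sl.toMatrix m X))
    (u := AffineKZ.opM N m (Hol N) A B (coordPow (Hol N) i (-s)))
    (u' := AffineKZ.opM N m (Hol N) A B (coordPow (Hol N) i s))
    (fun n a b => by
      -- The degree is only raised, so the cocycle does not contribute.
      have h0 : s + s * (n : ℤ) ≠ 0 := by
        rw [← mul_one_add]
        exact mul_ne_zero hs (by omega)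
      rw [hJ, hΘ.lie, if_neg h0, map_zero, add_zero]
      push_cast
      rw [mul_add, mul_one, add_comm])
    (opS_lie_unitAt _) (fun a b => (hΘ.opS _ _ _).symm) (fun n a b => by rw [hJ]; exact hΘ.opS _ _ _)
    (fun n => by rw [funext fun a => funext (hJ n a)]; exact pairing_adjUnit Θ _ X)
    (opM_coordPow_mul _ _ (add_neg_cancel s)) (hΘ.opM _ _) (opS_commute_opM _ _ _).symm
    (fun n a b => by rw [hJ]; exact hΘ.opM _ _) (fun a b => (opS_commute_opM _ _ _).symm)
    (opM_commute_opM _ _)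
  refine ((IsPtLim.const _).lie hT).unique fun x => ?_
  filter_upwards [hΘ.currents_smooth X 1 (unitAt N m (Hol N) A B i)
    (fun K => AffineKZ.opM N m (Hol N) A B (coordPow (Hol N) i (-s)) ^ K) x] with K hK
  rw [siteTrunc, key, ev_add_apply, hK, add_zero, defect_apply,
    pairing_eq_add_neg_flip hg, Nat.cast_one, mul_one, funext fun a => funext (hJ0 a)]
  congr 2
  abel

/-- The roles of the two coefficient families are exchanged, and the current of degree one meets the
cocycle, which adds a multiple of `z_i^{-s} X_i` proportional to the level. -/
theorem IsEndAction.lie_neg (hΘ : IsEndAction Θ s κ) (hs : s ≠ 0)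
    (hJ : ∀ n a b, J n a b = Θ (AffineSl.monomial (s * n) (slUnit m a b)))
    (hg : ∀ a b, g a b + g b a = 1)
    (hT : IsPtLim (siteTrunc J g (fun i => coordPow (Hol N) i (-s)) i) T) (X : Sl m) :
    ⁅Θ (AffineSl.monomial (-s) X) + AffineKZ.opM N m (Hol N) A B (coordPow (Hol N) i (-s)) *
        AffineKZ.opS N m (Hol N) A B i (Sl.toMatrix m X), T⁆ =
      defect g (fun a b => - g b a) (-s) X i Θ -
        (s * κ) • (AffineKZ.opM N m (Hol N) A B (coordPow (Hol N) i (-s)) *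
          AffineKZ.opS N m (Hol N) A B i (Sl.toMatrix m X)) := by
  have hJ0 : ∀ a b, J 0 a b = Θ (AffineSl.monomial 0 (slUnit m a b)) := fun a b => by
    rw [hJ, Nat.cast_zero, mul_zero]
  have key := lie_truncated_neg (A := J) (h := g)
    (C := fun n a b => Θ (AffineSl.monomial (s * n) ⁅X, slUnit m a b⁆))
    (U := unitAt N m (Hol N) A B i)
    (D := fun a b => AffineKZ.opS N m (Hol N) A B i (adjUnit (Sl.toMatrix m X) a b))
    (Z := fun a b => algebraMap ℂ _ (-(s * κ) * traceForm m X (slUnit m a b)))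
    (y := Θ (AffineSl.monomial (-s) X)) (w := AffineKZ.opS N m (Hol N) A B i (Sl.toMatrix m X))
    (u := AffineKZ.opM N m (Hol N) A B (coordPow (Hol N) i (-s)))
    (fun n a b => by
      have h0 : -s + s * ((n + 1 : ℕ) : ℤ) = s * n := by push_cast; ring
      rw [hJ, hΘ.lie, h0]
      congr 1
      by_cases hn : n = 0
      · rw [if_pos hn, if_pos (by simp [hn])]
        congr 1
        push_cast
        ring
      · rw [if_neg hn, if_neg (mul_ne_zero hs (by exact_mod_cast hn)), map_zero])
    (C' := fun a b => Θ (AffineSl.monomial (-s) ⁅X, slUnit m a b⁆))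
    (fun a b => by
      rw [hJ0, hΘ.lie, add_zero, if_neg (neg_ne_zero.mpr hs), map_zero, add_zero])
    (opS_lie_unitAt _) (fun a b => (hΘ.opS _ _ _).symm) (fun n a b => by rw [hJ]; exact hΘ.opS _ _ _)
    (fun n => by rw [funext fun a => funext (hJ n a)]; exact pairing_adjUnit Θ _ X)
    (hΘ.opM _ _) (opS_commute_opM _ _ _).symm
    (fun n a b => by rw [hJ]; exact hΘ.opM _ _) (fun a b => (opS_commute_opM _ _ _).symm)
  have hinv := pairing_adjUnit (i := i) Θ 0 X
  -- The truncations are shifted by one, so that all of them contain the current of degree one.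
  refine ((IsPtLim.const _).lie (hT.comp_add 1)).unique fun x => ?_
  filter_upwards [hΘ.currents_smooth X 1 (unitAt N m (Hol N) A B i)
    (fun K => AffineKZ.opM N m (Hol N) A B (coordPow (Hol N) i (-s)) ^ (K + 2)) x] with K hK
  rw [siteTrunc, key, ev_sub_apply, hK, sub_zero, defect_apply,
    pairing_eq_add_neg_flip hg, Nat.cast_zero, mul_zero, funext fun a => funext (hJ0 a),
    pairing_traceForm, mul_sub, eq_neg_of_add_eq_zero_left hinv, mul_neg, mul_smul_comm, neg_smul]
  congr 2
  abel

end Defect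

/-! ### Loops acting at the sites and their commutators with `M_ij`. -/

section Sites

variable {N m : ℕ} {A B : Type*} [AddCommGroup A] [Module ℂ A] [AddCommGroup B] [Module ℂ B]

theorem pairing_mul_left {ι R : Type*} [Fintype ι] [Ring R] [Algebra ℂ R] (x : R)
    (J U : ι → ι → R) (h : ι → ι → ℂ) :
    pairing (fun a b => x * J a b) U h = x * pairing J U h := by
  simp only [pairing, Finset.mul_sum, mul_smul_comm, mul_assoc]

variable (A B) in
/-- The family of operators `[X, E_{ab}]` at the `i`-th site. -/
def adjAt (M : Matrix (Fin m) (Fin m) ℂ) (i : Fin N) (a b : Fin m) : HEnd N m A B :=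
  opS N m (Hol N) A B i (adjUnit M a b)

variable (A B) in
/-- The operator `f_i M` at the `i`-th site. -/
def siteOp (f : Fin N → Hol N) (M : Matrix (Fin m) (Fin m) ℂ) (i : Fin N) : HEnd N m A B :=
  opM N m (Hol N) A B (f i) * opS N m (Hol N) A B i M

variable {f : Fin N → Hol N} {M : Matrix (Fin m) (Fin m) ℂ} {i j l : Fin N}

theorem siteOp_commute_opM (g : Hol N) : Commute (opM N m (Hol N) A B g) (siteOp A B f M i) :=
  (opM_commute_opM _ _).mul_right (opS_commute_opM _ _ _).symm

theorem siteOp_commute_opS (h : i ≠ j) (M' : Matrix (Fin m) (Fin m) ℂ) :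
    Commute (siteOp A B f M i) (opS N m (Hol N) A B j M') :=
  (opS_commute_opM _ _ _).symm.mul_left (opS_commute h _ _)

theorem opT_siteOp (hf : ∀ w i, Hol.perm w (f i) = f (w i)) (w : Equiv.Perm (Fin N)) :
    opT N m A B w * siteOp A B f M i = siteOp A B f M (w i) * opT N m A B w := by
  rw [siteOp, ← mul_assoc, opT_opM, hf, mul_assoc, opT_opS, ← mul_assoc, siteOp]

theorem siteOp_commute_mid (hf : ∀ w i, Hol.perm w (f i) = f (w i)) (hi : l ≠ i) (hj : l ≠ j) :
    Commute (siteOp A B f M l) (mid N m A B i j) := by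
  refine mid_commute (fun a b => siteOp_commute_opS hi _) (fun a b => siteOp_commute_opS hj _)
    (siteOp_commute_opM _).symm ?_
  have := opT_siteOp (A := A) (B := B) (M := M) (i := l) hf (Equiv.swap i j)
  rw [Equiv.swap_apply_of_ne_of_ne hi hj] at this
  exact this.symm

/-- The sum over both sites is symmetric, so `τ(s_ij)` does not contribute. By invariance the two
legs of the flip contribute opposite terms, which leaves the factor `φ_ji (f_i - f_j)`; for `f =
z^{±1}` this has no pole. -/
theorem siteOp_add_lie_mid (hf : ∀ w i, Hol.perm w (f i) = f (w i)) (h : j ≠ i) :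
    ⁅siteOp A B f M i + siteOp A B f M j, mid N m A B j i⁆ =
      opM N m (Hol N) A B (f j) * pairing (adjAt A B M j) (unitAt N m (Hol N) A B i) (stdHalf m) +
      opM N m (Hol N) A B (f i) * pairing (unitAt N m (Hol N) A B j) (adjAt A B M i) (stdHalf m) -
      opM N m (Hol N) A B (phi j i * (f i - f j)) *
        pairing (unitAt N m (Hol N) A B j) (adjAt A B M i) 1 := by
  have hu : ∀ g (k : Fin N) (a b : Fin m), Commute (opM N m (Hol N) A B g)
    (unitAt N m (Hol N) A B k a b) := fun _ _ _ _ => (opS_commute_opM _ _ _).symm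
  have hp : ∀ g h', Commute (opM N m (Hol N) A B g)
      (pairing (unitAt N m (Hol N) A B j) (unitAt N m (Hol N) A B i) h') := fun g h' =>
    pairing_commute h' (hu g j) (hu g i)
  have e1 : ∀ h', ⁅siteOp A B f M i, pairing (unitAt N m (Hol N) A B j) (unitAt N m (Hol N) A B i) h'⁆ =
      opM N m (Hol N) A B (f i) * pairing (unitAt N m (Hol N) A B j) (adjAt A B M i) h' := fun h' => by
    rw [siteOp, lie_mul_left_of_commute (hp _ _)]
    congr 1
    exact (pairing_lie (y := 0) (C := 0) (by simp) (opS_lie_unitAt M) (by simp)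
      (fun a b => opS_commute h.symm _ _)).2
  have e2 : ∀ h', ⁅siteOp A B f M j, pairing (unitAt N m (Hol N) A B j) (unitAt N m (Hol N) A B i) h'⁆ =
      opM N m (Hol N) A B (f j) * pairing (adjAt A B M j) (unitAt N m (Hol N) A B i) h' := fun h' => by
    rw [siteOp, lie_mul_left_of_commute (hp _ _)]
    congr 1
    exact (pairing_lie (w := 0) (D := 0) (opS_lie_unitAt M) (by simp)
      (fun a b => opS_commute h _ _) (by simp)).1
  have e3 : ⁅siteOp A B f M i + siteOp A B f M j, opT N m A B (Equiv.swap j i)⁆ = 0 := by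
    refine lie_eq_zero_of_commute (Commute.symm ?_)
    rw [commute_iff_eq, mul_add, opT_siteOp hf, opT_siteOp hf, Equiv.swap_apply_left,
      Equiv.swap_apply_right, ← add_mul, add_comm]
  have e4 : pairing (adjAt A B M j) (unitAt N m (Hol N) A B i) 1 =
      - pairing (unitAt N m (Hol N) A B j) (adjAt A B M i) 1 :=
    eq_neg_of_add_eq_zero_left
      (pairing_adjUnit (opS N m (Hol N) A B j) (opS N m (Hol N) A B i) M)
  have hc : Commute (opM N m (Hol N) A B (phi j i)) (siteOp A B f M i + siteOp A B f M j) :=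
    (siteOp_commute_opM _).add_right (siteOp_commute_opM _)
  rw [mid, lie_sub, lie_mul_right_of_commute hc, lie_sub, e3, sub_zero, add_lie, add_lie, e1, e1, e2,
    e2, e4, map_mul, map_sub]
  simp only [mul_neg, mul_add, sub_mul, mul_sub, mul_assoc]
  abel

theorem siteOp_lie_opD {e : ℤ} (hf : Hol.euler i (f i) = (e : ℂ) • f i) :
    ⁅siteOp A B f M i, opD N m A B i⁆ = - ((e : ℂ) • siteOp A B f M i) := by
  have hc : Commute (opS N m (Hol N) A B i M) (opD N m A B i) := opS_commute_opDer _ _ _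
  have h := opD_opM (m := m) (A := A) (B := B) i (f i)
  rw [← lie_skew, siteOp, lie_leibniz_mul, h, hf, lie_eq_zero_of_commute hc.symm, mul_zero, add_zero,
    map_smul, smul_mul_assoc]

theorem siteOp_lie_opS (M' : Matrix (Fin m) (Fin m) ℂ) :
    ⁅siteOp A B f M i, opS N m (Hol N) A B i M'⁆ =
      opM N m (Hol N) A B (f i) * opS N m (Hol N) A B i (M * M' - M' * M) := by
  rw [siteOp, lie_mul_left_of_commute (opS_commute_opM _ _ _).symm, Ring.lie_def, ← opS_mul,
    ← opS_mul, ← map_sub]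

end Sites

/-! ### The commutator of the diagonal action with a Dunkl operator. -/

section Total

variable {N m : ℕ} {ℓ k : ℂ} {A B : Type*}
  [AddCommGroup A] [Module ℂ A] [LieRingModule (AffineSl m) A] [LieModule ℂ (AffineSl m) A]
  [AddCommGroup B] [Module ℂ B] [LieRingModule (AffineSl m) B] [LieModule ℂ (AffineSl m) B]
  {L R : Fin N → HEnd N m A B} {c d : Fin m → Fin m → ℂ} {e : ℤ} {X : Sl m} {i : Fin N}

variable (N m A B) in
/-- The diagonal action with values in the algebra of operators. -/
def opTotal : AffineSl m →ₗ[ℂ] HEnd N m A B :=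
  opLeft N m (Hol N) A B + ∑ i, opSite N m (Hol N) A B i + opRight N m (Hol N) A B

theorem opSite_monomial_eq (j : Fin N) (n : ℤ) (X : Sl m) :
    opSite N m (Hol N) A B j (AffineSl.monomial n X) =
      siteOp A B (fun i => coordPow (Hol N) i n) (Sl.toMatrix m X) j := opSite_monomial j n X

theorem opTotal_monomial (n : ℤ) (X : Sl m) : opTotal N m A B (AffineSl.monomial n X) =
    opLeft N m (Hol N) A B (AffineSl.monomial n X) +
      ∑ j, siteOp A B (fun i => coordPow (Hol N) i n) (Sl.toMatrix m X) j +
      opRight N m (Hol N) A B (AffineSl.monomial n X) := by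
  rw [opTotal, LinearMap.add_apply, LinearMap.add_apply, LinearMap.sum_apply]
  simp only [opSite_monomial_eq]

/-- Trace corrections are absent: in the first sum a scalar matrix commutes with `X`, and in the
second the correction is multiplied by `∑ [X, E_aa] = 0`, as `d` is constant on the diagonal. -/
theorem defect_opSite {η : ℂ} (hd : ∀ a, d a a = η) (j : Fin N) :
    defect c d e X i (opSite N m (Hol N) A B j) =
      opM N m (Hol N) A B (coordPow (Hol N) j e) *
          pairing (adjAt A B (Sl.toMatrix m X) j) (unitAt N m (Hol N) A B i) c +
        opM N m (Hol N) A B (coordPow (Hol N) i e) *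
          pairing (unitAt N m (Hol N) A B j) (adjAt A B (Sl.toMatrix m X) i) d := by
  have h1 : ∀ a b, opSite N m (Hol N) A B j (AffineSl.monomial 0 (slUnit m a b)) =
      unitAt N m (Hol N) A B j a b - if a = b then algebraMap ℂ _ (1 / m : ℂ) else 0 := fun a b => by
    rw [opSite_monomial, coordPow_zero, map_one, one_mul, opS_slUnit]
  have h2 : ∑ a, adjAt A B (Sl.toMatrix m X) i a a = 0 := by
    simp only [adjAt]
    rw [← map_sum, sum_adjUnit_diag, map_zero]
  rw [defect_apply]
  simp only [opSite_monomial, toMatrix_lie_slUnit, h1]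
  refine congrArg₂ (· + ·) (pairing_mul_left _ _ _ _) (congrArg _ ?_)
  simp only [pairing, sub_mul, smul_sub, Finset.sum_sub_distrib, ite_mul, zero_mul, smul_ite,
    smul_zero, Finset.sum_ite_eq, Finset.mem_univ, if_true, hd, ← Finset.smul_sum, ← Finset.mul_sum]
  have h3 : ∑ a, opS N m (Hol N) A B i (adjUnit (Sl.toMatrix m X) a a) = 0 := h2
  rw [h3, mul_zero, smul_zero, sub_zero]
  rfl

theorem defect_opSite_self {η κ : ℂ} (hd : ∀ a, d a a = η) (hκ : ∀ a b, d a b - c a b = κ) :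
    defect c d e X i (opSite N m (Hol N) A B i) =
      opM N m (Hol N) A B (coordPow (Hol N) i e) * opS N m (Hol N) A B i
        (Sl.toMatrix m X * Matrix.diagonal (fun a => ∑ b, c a b) -
          Matrix.diagonal (fun a => ∑ b, d a b) * Sl.toMatrix m X) := by
  rw [defect_opSite hd, ← mul_add, ← sum_adjUnit_mul (trace_toMatrix X) hκ]
  simp only [pairing, map_add, map_sum, map_smul, opS_mul]
  rfl

theorem opTotal_lie {Z : HEnd N m A B} (s : Finset (Fin N))
    (hl : Commute (opLeft N m (Hol N) A B (AffineSl.monomial e X)) Z)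
    (hr : Commute (opRight N m (Hol N) A B (AffineSl.monomial e X)) Z)
    (hs : ∀ j ∉ s, Commute (siteOp A B (fun i => coordPow (Hol N) i e) (Sl.toMatrix m X) j) Z) :
    ⁅opTotal N m A B (AffineSl.monomial e X), Z⁆ =
      ⁅∑ j ∈ s, siteOp A B (fun i => coordPow (Hol N) i e) (Sl.toMatrix m X) j, Z⁆ := by
  rw [opTotal_monomial, add_lie, add_lie, lie_eq_zero_of_commute hl, lie_eq_zero_of_commute hr,
    zero_add, add_zero, sum_lie, sum_lie]
  exact (Finset.sum_subset (Finset.subset_univ s) fun j _ hj =>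
    lie_eq_zero_of_commute (hs j hj)).symm

theorem perm_coordPow (n : ℤ) (w : Equiv.Perm (Fin N)) (i : Fin N) :
    Hol.perm w (coordPow (Hol N) i n) = coordPow (Hol N) (w i) n := by
  have h : Units.map (Hol.perm w : Hol N →* Hol N) (TorusAlgebra.coord i) =
      (TorusAlgebra.coord (w i) : (Hol N)ˣ) := Units.ext (Hol.perm_coord w i)
  rw [coordPow, coordPow, ← h, ← map_zpow]
  rfl

theorem euler_coordPow (n : ℤ) (i : Fin N) :
    Hol.euler i (coordPow (Hol N) i n) = (n : ℂ) • coordPow (Hol N) i n := by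
  have := Derivation.apply_zpow (Hol.euler i) (Hol.coord i) 1
    (by rw [Hol.euler_coord, if_pos rfl, one_smul]) n
  rw [mul_one] at this
  exact this

theorem euler_coordPow_of_ne (n : ℤ) {i j : Fin N} (h : i ≠ j) :
    Hol.euler i (coordPow (Hol N) j n) = 0 := by
  have := Derivation.apply_zpow (Hol.euler i) (Hol.coord j) 0
    (by rw [Hol.euler_coord, if_neg h, zero_smul]) n
  rw [mul_zero, zero_smul] at this
  exact this

/-- Here every other site enters through `M_ji`, whichever side of `i` it lies on, so that each `j`
contributes its own defect in a uniform way. The remaining transpositions commute with the diagonal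
action. -/
theorem dunklOp_eq_sub (k : ℂ) (L R : Fin N → HEnd N m A B) (i : Fin N) :
    dunklOp k L R i = oneSite k L R i + ∑ j ∈ Finset.univ.erase i, mid N m A B j i -
      ∑ j ∈ Finset.Ioi i, opT N m A B (Equiv.swap i j) := by
  have h1 : ∀ j ∈ Finset.Ioi i, mid N m A B i j =
      opT N m A B (Equiv.swap i j) - mid N m A B j i := fun j hj => by
    rw [← mid_add (Finset.mem_Ioi.mp hj).ne, add_sub_cancel_right]
  have h2 : Finset.univ.erase i = (Finset.Iio i).disjUnion (Finset.Ioi i)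
      (Finset.disjoint_left.mpr fun j h h' =>
        (Finset.mem_Iio.mp h).not_gt (Finset.mem_Ioi.mp h')) := by
    ext j; simp
  rw [dunklOp, Finset.sum_congr rfl h1, h2, Finset.sum_disjUnion, Finset.sum_sub_distrib]
  abel

theorem opTotal_lie_opT (e : ℤ) (X : Sl m) (w : Equiv.Perm (Fin N)) :
    Commute (opTotal N m A B (AffineSl.monomial e X)) (opT N m A B w) := by
  rw [opTotal_monomial]
  refine ((Commute.symm ?_).add_left (Commute.symm ?_)).add_left (opB_commute_opT _ _)
  · exact opT_commute_opA _ _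
  · rw [commute_iff_eq, Finset.mul_sum, Finset.sum_mul, ← Equiv.sum_comp w (fun j => _ * opT N m A B w)]
    exact Finset.sum_congr rfl fun j _ => opT_siteOp (perm_coordPow e) w

set_option maxHeartbeats 1000000 in
-- Since `defect` is additive in the action, the contributions of `A`, of the sites and of `B` add
-- up to the defect of the diagonal action. The leftover multiples of `z_i^e X_i` are `-ke` from
-- `∂_i`, `a` and `-b` from the two cocycles, balanced by `r` from the site `i` itself; `hr` states
-- that they cancel.
theorem opTotal_lie_dunklOp (hc : CurrentOps L R) {a b r : ℂ}
    (hLB : Commute (opRight N m (Hol N) A B (AffineSl.monomial e X)) (L i))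
    (hRA : Commute (opLeft N m (Hol N) A B (AffineSl.monomial e X)) (R i))
    (hL : ⁅opLeft N m (Hol N) A B (AffineSl.monomial e X) +
        siteOp A B (fun i => coordPow (Hol N) i e) (Sl.toMatrix m X) i, L i⁆ =
      defect c d e X i (opLeft N m (Hol N) A B) +
        a • siteOp A B (fun i => coordPow (Hol N) i e) (Sl.toMatrix m X) i)
    (hR : ⁅opRight N m (Hol N) A B (AffineSl.monomial e X) +
        siteOp A B (fun i => coordPow (Hol N) i e) (Sl.toMatrix m X) i, R i⁆ =
      - defect c d e X i (opRight N m (Hol N) A B) +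
        b • siteOp A B (fun i => coordPow (Hol N) i e) (Sl.toMatrix m X) i)
    (hmid : ∀ j ≠ i, ⁅siteOp A B (fun i => coordPow (Hol N) i e) (Sl.toMatrix m X) i +
        siteOp A B (fun i => coordPow (Hol N) i e) (Sl.toMatrix m X) j, mid N m A B j i⁆ =
      defect c d e X i (opSite N m (Hol N) A B j))
    (hself : defect c d e X i (opSite N m (Hol N) A B i) =
      opM N m (Hol N) A B (coordPow (Hol N) i e) * opS N m (Hol N) A B i
        (Sl.toMatrix m X * Matrix.diagonal (rhoDiag m) - Matrix.diagonal (rhoDiag m) * Sl.toMatrix m X) +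
        r • siteOp A B (fun i => coordPow (Hol N) i e) (Sl.toMatrix m X) i)
    (hr : -(k * e) + a - b = r) :
    ⁅opTotal N m A B (AffineSl.monomial e X), dunklOp k L R i⁆ =
      defect c d e X i (opTotal N m A B) := by
  set f : Fin N → Hol N := fun i => coordPow (Hol N) i e with hf
  set σ := siteOp A B f (Sl.toMatrix m X) with hσ
  have h1 : ⁅opTotal N m A B (AffineSl.monomial e X), opD N m A B i⁆ = - ((e : ℂ) • σ i) := by
    rw [opTotal_lie (Z := opD N m A B i) {i} (opDer_commute_opA _ _).symm (opB_commute_opDer _ _),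
      Finset.sum_singleton, siteOp_lie_opD (euler_coordPow e i)]
    intro j hj
    refine Commute.mul_left (commute_iff_lie_eq.mpr ?_) (opS_commute_opDer _ _ _)
    have := opD_opM (m := m) (A := A) (B := B) i (coordPow (Hol N) j e)
    rw [← lie_skew, this, euler_coordPow_of_ne e (Ne.symm (by simpa using hj)), map_zero, neg_zero]
  have h2 : ⁅opTotal N m A B (AffineSl.monomial e X), L i⁆ =
      defect c d e X i (opLeft N m (Hol N) A B) + a • σ i := by
    rw [← hL, opTotal_monomial, add_lie, add_lie, add_lie, lie_eq_zero_of_commute hLB, add_zero, sum_lie,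
      Finset.sum_eq_single i]
    · intro j _ hj
      exact lie_eq_zero_of_commute ((hc.left.opM _ _).mul_left (hc.left.opS hj.symm _))
    · simp
  have h3 : ⁅opTotal N m A B (AffineSl.monomial e X), R i⁆ =
      - defect c d e X i (opRight N m (Hol N) A B) + b • σ i := by
    rw [← hR, opTotal_monomial, add_lie, add_lie, add_lie, lie_eq_zero_of_commute hRA, zero_add, sum_lie,
      Finset.sum_eq_single i, add_comm]
    · intro j _ hj
      exact lie_eq_zero_of_commute ((hc.right.opM _ _).mul_left (hc.right.opS hj.symm _))
    · simp
  have h4 : ⁅opTotal N m A B (AffineSl.monomial e X),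
      opS N m (Hol N) A B i (Matrix.diagonal (rhoDiag m))⁆ =
      opM N m (Hol N) A B (coordPow (Hol N) i e) * opS N m (Hol N) A B i
        (Sl.toMatrix m X * Matrix.diagonal (rhoDiag m) -
          Matrix.diagonal (rhoDiag m) * Sl.toMatrix m X) := by
    rw [opTotal_lie {i} (opS_commute_opA _ _ _).symm (opB_commute_opS _ _ _), Finset.sum_singleton,
      siteOp_lie_opS]
    intro j hj
    exact siteOp_commute_opS (by simpa using hj) _
  have h5 : ∀ j ∈ Finset.univ.erase i, ⁅opTotal N m A B (AffineSl.monomial e X), mid N m A B j i⁆ =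
      defect c d e X i (opSite N m (Hol N) A B j) := by
    intro j hj
    have hj := Finset.ne_of_mem_erase hj
    rw [← hmid j hj, opTotal_lie {i, j}, Finset.sum_pair hj.symm]
    · exact mid_commute (fun _ _ => (opS_commute_opA _ _ _).symm)
        (fun _ _ => (opS_commute_opA _ _ _).symm) (opM_commute_opA _ _).symm (opT_commute_opA _ _).symm
    · exact mid_commute (fun _ _ => opB_commute_opS _ _ _) (fun _ _ => opB_commute_opS _ _ _)
        (opB_commute_opM _ _) (opB_commute_opT _ _)
    · intro l hl
      simp only [Finset.mem_insert, Finset.mem_singleton, not_or] at hl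
      exact siteOp_commute_mid (perm_coordPow e) hl.2 hl.1
  have h6 : defect c d e X i (opTotal N m A B) = defect c d e X i (opLeft N m (Hol N) A B) +
      (defect c d e X i (opSite N m (Hol N) A B i) +
        ∑ j ∈ Finset.univ.erase i, defect c d e X i (opSite N m (Hol N) A B j)) +
      defect c d e X i (opRight N m (Hol N) A B) := by
    rw [opTotal, map_add, map_add, map_sum, Finset.add_sum_erase _
      (fun j => defect c d e X i (opSite N m (Hol N) A B j)) (Finset.mem_univ i)]
  rw [dunklOp_eq_sub, lie_sub, lie_add, lie_sum, lie_sum, Finset.sum_congr rfl h5,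
    Finset.sum_eq_zero (fun j _ => lie_eq_zero_of_commute (opTotal_lie_opT e X _)), sub_zero, oneSite,
    lie_add, lie_sub, lie_add, lie_smul, h1, h2, h3, h4, h6, hself, ← hr]
  rw [smul_neg, smul_smul, sub_smul, add_smul, neg_smul]
  abel

end Total

/-! ### The commutators with `X ⊗ t` and `X ⊗ t⁻¹`. -/

section DunklCommutator

variable {N m : ℕ} {ℓ : ℂ} {A B : Type*}
  [AddCommGroup A] [Module ℂ A] [LieRingModule (AffineSl m) A] [LieModule ℂ (AffineSl m) A]
  [AddCommGroup B] [Module ℂ B] [LieRingModule (AffineSl m) B] [LieModule ℂ (AffineSl m) B]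
  {L R : Fin N → HEnd N m A B}

theorem opLeft_isEndAction (hA : CategoryO m ℓ A) : IsEndAction (opLeft N m (Hol N) A B) 1 ℓ where
  lie p q X Y := opLeft_monomial_lie hA.level p q X Y
  opM f Y := opM_commute_opA _ _
  opS i M Y := opS_commute_opA _ _ _
  smooth x := by simpa only [one_mul] using leftCurrent_smooth hA x

theorem opRight_isEndAction (hB : CategoryODagger m ℓ B) :
    IsEndAction (opRight N m (Hol N) A B) (-1) (-ℓ) where
  lie p q X Y := opRight_monomial_lie hB.level p q X Y
  opM f Y := (opB_commute_opM _ _).symm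
  opS i M Y := (opB_commute_opS _ _ _).symm
  smooth x := by simpa only [neg_mul, one_mul] using rightCurrent_smooth hB x

theorem leftCurrent_eq (n : ℕ) (a b : Fin m) : leftCurrent N m (Hol N) A B n a b =
    opLeft N m (Hol N) A B (AffineSl.monomial (1 * n) (slUnit m a b)) := by rw [one_mul]; rfl

theorem rightCurrent_eq (n : ℕ) (a b : Fin m) : rightCurrent N m (Hol N) A B n a b =
    opRight N m (Hol N) A B (AffineSl.monomial (-1 * n) (slUnit m a b)) := by
  rw [neg_mul, one_mul]; rfl

theorem IsRLimit.opRight_commute_left (h : IsRLimit A B L R) (i : Fin N) (Y : AffineSl m) :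
    Commute (opRight N m (Hol N) A B Y) (L i) :=
  (h.left i).commute fun K => truncated_commute (fun _ _ _ => opB_commute_opA _ _)
    (fun _ _ => opB_commute_opS _ _ _) (opB_commute_opM _ _) K

theorem IsRLimit.opLeft_commute_right (h : IsRLimit A B L R) (i : Fin N) (Y : AffineSl m) :
    Commute (opLeft N m (Hol N) A B Y) (R i) :=
  (h.right i).commute fun K => truncated_commute (fun _ _ _ => (opB_commute_opA _ _).symm)
    (fun _ _ => (opS_commute_opA _ _ _).symm) (opM_commute_opA _ _).symm K

theorem sum_stdHalf (a : Fin m) : ∑ b, stdHalf m a b = rhoDiag m a + m / 2 := by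
  rw [rhoDiag, sub_add_cancel]

theorem sum_neg_stdHalf_flip (a : Fin m) : ∑ b, -stdHalf m b a = rhoDiag m a - m / 2 := by
  have h : ∑ b, (stdHalf m a b + stdHalf m b a) = m := by
    simp [(stdHalf_isHalf m).add_flip]
  rw [Finset.sum_add_distrib, sum_stdHalf] at h
  rw [Finset.sum_neg_distrib]
  linear_combination -h

theorem diagonal_add_const (v : Fin m → ℂ) (r : ℂ) :
    Matrix.diagonal (fun a => v a + r) = Matrix.diagonal v + r • (1 : Matrix (Fin m) (Fin m) ℂ) := by
  rw [Matrix.smul_one_eq_diagonal, Matrix.diagonal_add]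

theorem opS_diagonal_shift (e : ℤ) (X : Sl m) (i : Fin N) (r s : ℂ) :
    opM N m (Hol N) A B (coordPow (Hol N) i e) * opS N m (Hol N) A B i
        (Sl.toMatrix m X * Matrix.diagonal (fun a => rhoDiag m a + r) -
          Matrix.diagonal (fun a => rhoDiag m a + s) * Sl.toMatrix m X) =
      opM N m (Hol N) A B (coordPow (Hol N) i e) * opS N m (Hol N) A B i
        (Sl.toMatrix m X * Matrix.diagonal (rhoDiag m) -
          Matrix.diagonal (rhoDiag m) * Sl.toMatrix m X) +
      (r - s) • siteOp A B (fun i => coordPow (Hol N) i e) (Sl.toMatrix m X) i := by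
  rw [siteOp, ← mul_smul_comm, ← map_smul, ← mul_add, ← map_add, diagonal_add_const,
    diagonal_add_const]
  congr 2
  rw [mul_add, add_mul, mul_smul_comm, smul_mul_assoc, mul_one, one_mul, sub_smul]
  abel

/-- Only `B` meets the cocycle, with coefficient `-ℓ`, and the value `-m` comes from the shifts
`∓m/2` of the sums of the coefficients relative to `ρ^∨`. The balance `-(ℓ + m) + ℓ = -m` singles
out the coefficient `ℓ + m` of `∂_i`. -/
theorem opTotal_lie_dunklOp_one (hA : CategoryO m ℓ A) (hB : CategoryODagger m ℓ B)
    (h : IsRLimit A B L R) (X : Sl m) (i : Fin N) :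
    ⁅opTotal N m A B (AffineSl.monomial 1 X), dunklOp (ℓ + m) L R i⁆ =
      defect (fun a b => -stdHalf m b a) (stdHalf m) 1 X i (opTotal N m A B) := by
  have hh := (stdHalf_isHalf m).add_flip
  refine opTotal_lie_dunklOp (a := 0) (b := -ℓ) (r := -m) (h.currentOps hA hB)
    (h.opRight_commute_left i _) (h.opLeft_commute_right i _) ?_ ?_ ?_ ?_ ?_
  · rw [zero_smul, add_zero]
    exact (opLeft_isEndAction hA).lie_pos one_ne_zero leftCurrent_eq hh (h.left i) X
  · have := (opRight_isEndAction (A := A) hB).lie_neg (by decide) rightCurrent_eq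
      (fun a b => hh b a) (h.right i) X
    rw [neg_neg] at this
    refine this.trans ?_
    rw [← defect_neg, Int.cast_neg, Int.cast_one, neg_mul_neg, one_mul, neg_smul, sub_eq_add_neg]
    simp only [neg_neg]
    rfl
  · intro j hj
    -- The pole cancels, and by invariance the extra term changes the coefficients `h` of the leg
    -- with `z_j` into the negative transpose of `h`, as the defect requires.
    have e : phi j i * ((Hol.coord i : Hol N) - Hol.coord j) = -(Hol.coord j : Hol N) := by
      linear_combination -phi_mul hj
    rw [siteOp_add_lie_mid (perm_coordPow 1) hj, defect_opSite (η := 1 / 2) (by simp [stdHalf]),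
      pairing_eq_add_neg_flip hh, coordPow_one, coordPow_one, e, map_neg, neg_mul, mul_sub]
    have e4 : pairing (adjAt A B (Sl.toMatrix m X) j) (unitAt N m (Hol N) A B i) 1 =
        - pairing (unitAt N m (Hol N) A B j) (adjAt A B (Sl.toMatrix m X) i) 1 :=
      eq_neg_of_add_eq_zero_left
        (pairing_adjUnit (opS N m (Hol N) A B j) (opS N m (Hol N) A B i) _)
    rw [e4, mul_neg]
    abel
  · rw [defect_opSite_self (η := 1 / 2) (κ := 1) (by simp [stdHalf])
      (fun a b => by rw [sub_neg_eq_add, hh])]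
    simp only [sum_stdHalf, sum_neg_stdHalf_flip, sub_eq_add_neg (rhoDiag m _)]
    rw [opS_diagonal_shift]
    congr 2
    ring
  · push_cast; ring

/-- The mirror image: now `A` meets the cocycle and the balance of the leftover terms is `(ℓ + m) -
ℓ = m`. -/
theorem opTotal_lie_dunklOp_neg_one (hA : CategoryO m ℓ A) (hB : CategoryODagger m ℓ B)
    (h : IsRLimit A B L R) (X : Sl m) (i : Fin N) :
    ⁅opTotal N m A B (AffineSl.monomial (-1) X), dunklOp (ℓ + m) L R i⁆ =
      defect (stdHalf m) (fun a b => -stdHalf m b a) (-1) X i (opTotal N m A B) := by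
  have hh := (stdHalf_isHalf m).add_flip
  refine opTotal_lie_dunklOp (a := -ℓ) (b := 0) (r := m) (h.currentOps hA hB)
    (h.opRight_commute_left i _) (h.opLeft_commute_right i _) ?_ ?_ ?_ ?_ ?_
  · refine ((opLeft_isEndAction hA).lie_neg one_ne_zero leftCurrent_eq hh (h.left i) X).trans ?_
    rw [Int.cast_one, one_mul, neg_smul, sub_eq_add_neg]
    rfl
  · rw [zero_smul, add_zero, ← defect_neg]
    simp only [neg_neg]
    exact (opRight_isEndAction (A := A) hB).lie_pos (by decide) rightCurrent_eq
      (fun a b => hh b a) (h.right i) X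
  · intro j hj
    have e := phi_mul_inv hj
    rw [siteOp_add_lie_mid (perm_coordPow (-1)) hj, defect_opSite (η := -(1 / 2)) (by simp [stdHalf]),
      pairing_eq_add_neg_flip hh, coordPow_neg_one, coordPow_neg_one, e, mul_sub]
    abel
  · rw [defect_opSite_self (η := -(1 / 2)) (κ := -1) (by simp [stdHalf])
      (fun a b => by rw [← neg_add', add_comm, hh])]
    simp only [sum_stdHalf, sum_neg_stdHalf_flip, sub_eq_add_neg (rhoDiag m _)]
    rw [opS_diagonal_shift]
    congr 2
    ring
  · push_cast; ring

end DunklCommutator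

/-! ### Perfectness of `sl_m` and spanning elements of the derived algebra. -/

section Perfect

variable {m : ℕ}

/-- Off the diagonal `E_ab = [E_aa, E_ab]`. On it, `∑_b [E_ab, E_ba]` is `m` times the traceless
part of `E_aa`, because the traceless parts of the `E_bb` add up to zero. The argument includes `m =
1`, where the algebra is zero. -/
theorem Sl.eq_top_of_lie_mem [NeZero m] (W : Submodule ℂ (Sl m)) (h : ∀ X Y : Sl m, ⁅X, Y⁆ ∈ W) :
    W = ⊤ := by
  have h1 : ∀ a b, slUnit m a b ∈ W := by
    intro a b
    by_cases hab : a = b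
    · subst hab
      have h2 : ∑ b, ⁅slUnit m a b, slUnit m b a⁆ = (m : ℂ) • slUnit m a a := by
        simp only [slUnit_lie, if_true, Finset.sum_sub_distrib, sum_slUnit_diag, sub_zero,
          Finset.sum_const, Finset.card_univ, Fintype.card_fin, Nat.cast_smul_eq_nsmul]
      have h3 := W.smul_mem (m : ℂ)⁻¹ (h2 ▸ W.sum_mem fun b _ => h (slUnit m a b) (slUnit m b a))
      rwa [smul_smul, inv_mul_cancel₀ (Nat.cast_ne_zero.mpr (NeZero.ne m)), one_smul] at h3
    · have := h (slUnit m a a) (slUnit m a b)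
      rwa [slUnit_lie, if_pos rfl, if_neg (Ne.symm hab), sub_zero] at this
  refine eq_top_iff.mpr fun X _ => ?_
  rw [← traceless_toMatrix m X, Matrix.matrix_eq_sum_single (Sl.toMatrix m X), map_sum]
  refine W.sum_mem fun a _ => ?_
  rw [map_sum]
  refine W.sum_mem fun b _ => ?_
  rw [← mul_one (Sl.toMatrix m X a b), ← smul_eq_mul, ← Matrix.smul_single, map_smul]
  exact W.smul_mem _ (h1 a b)

/-- The inclusion of the loop algebra. -/
def AffineSl.ofLoop : LoopSl m →ₗ[ℂ] AffineSl m where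
  toFun x := ⟨x, 0, 0⟩
  map_add' X Y := by ext1 <;> simp
  map_smul' a X := by ext1 <;> simp

theorem AffineSl.derived_le {V : Submodule ℂ (AffineSl m)} (h : ∀ n X, AffineSl.monomial n X ∈ V)
    (hc : AffineSl.c ∈ V) : AffineSl.derived m ≤ V := by
  intro x (hx : x.degree = 0)
  have h1 : V.mkQ ∘ₗ AffineSl.ofLoop = 0 := loop_ext fun n X =>
    (Submodule.Quotient.mk_eq_zero V).mpr (h n X)
  have h2 : AffineSl.ofLoop x.loop ∈ V :=
    (Submodule.Quotient.mk_eq_zero V).mp (LinearMap.congr_fun h1 x.loop)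
  have h3 : x = AffineSl.ofLoop x.loop + x.central • AffineSl.c := by
    ext1
    · simp [AffineSl.ofLoop, AffineSl.c]
    · simp [AffineSl.ofLoop, AffineSl.c]
    · simpa [AffineSl.ofLoop, AffineSl.c] using hx
  rw [h3]
  exact V.add_mem h2 (V.smul_mem _ hc)

theorem AffineSl.monomial_mem_derived (n : ℤ) (X : Sl m) :
    AffineSl.monomial n X ∈ AffineSl.derived m := rfl

end Perfect

/-! ### Invariance of the subspace spanned by the derived algebra. -/

section Derived

variable {N m : ℕ} {ℓ : ℂ} {A B : Type*}
  [AddCommGroup A] [Module ℂ A] [LieRingModule (AffineSl m) A] [LieModule ℂ (AffineSl m) A]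
  [AddCommGroup B] [Module ℂ B] [LieRingModule (AffineSl m) B] [LieModule ℂ (AffineSl m) B]
  {L R : Fin N → HEnd N m A B}

variable (N m A B) in
/-- The image of `𝔤'(A ⊗ ℂ[P] ⊗ (ℂ^m)^{⊗N} ⊗ B)` in the holomorphic space. -/
abbrev derivedImage : Submodule ℂ (HolSpace N m A B) :=
  (derivedSpan m N (Laurent N) A B).map (inclusion N m A B)

theorem laurentToHol_coordPow (i : Fin N) (n : ℤ) :
    laurentToHol N (coordPow (Laurent N) i n) = coordPow (Hol N) i n := by
  have h : Units.map (laurentToHol N : Laurent N →* Hol N) (TorusAlgebra.coord i) =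
      (TorusAlgebra.coord i : (Hol N)ˣ) := Units.ext <| by
    refine (laurentToHol_single_one (Pi.single i 1)).trans ?_
    rw [coordMonomial_single, zpow_one]
  rw [coordPow, coordPow, ← h, ← map_zpow]
  rfl

theorem inclusion_thetaTotal {Y : AffineSl m} (hY : Y ∈ AffineSl.derived m)
    (x : LaurentSpace N m A B) :
    inclusion N m A B (thetaTotal N (Laurent N) A B Y x) =
      ev N m (Hol N) A B (opTotal N m A B Y) (inclusion N m A B x) := by
  have hsite : ∀ i, AffineSl.derived m ≤ LinearMap.eqLocus
      (inclusion N m A B ∘ₗ (theta N (Laurent N) A B i).flip x)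
      (((ev N m (Hol N) A B).toLinearMap ∘ₗ opSite N m (Hol N) A B i).flip (inclusion N m A B x)) := by
    intro i
    refine AffineSl.derived_le (fun n X => ?_) ?_
    · change inclusion N m A B (ev N m (Laurent N) A B (opSite N m (Laurent N) A B i _) x) =
        ev N m (Hol N) A B (opSite N m (Hol N) A B i _) _
      rw [opSite_monomial, opSite_monomial, ev_mul_apply, ev_mul_apply, inclusion_opM,
        laurentToHol_coordPow]
      congr 1
      exact inclusion_opV _ x
    · change inclusion N m A B (ev N m (Laurent N) A B (opSite N m (Laurent N) A B i _) x) =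
        ev N m (Hol N) A B (opSite N m (Hol N) A B i _) _
      rw [opSite_c, opSite_c, map_zero, map_zero, LinearMap.zero_apply, map_zero, LinearMap.zero_apply]
  rw [thetaTotal, opTotal]
  simp only [LinearMap.add_apply, LinearMap.sum_apply, map_add, map_sum]
  exact congrArg₂ (· + ·) (congrArg₂ (· + ·) (inclusion_opA _ x)
    (Finset.sum_congr rfl fun i _ => hsite i hY)) (inclusion_opB _ x)

theorem opTotal_mem_derivedImage {Y : AffineSl m} (hY : Y ∈ AffineSl.derived m)
    {v : HolSpace N m A B} (hv : v ∈ LinearMap.range (inclusion N m A B)) :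
    ev N m (Hol N) A B (opTotal N m A B Y) v ∈ derivedImage N m A B := by
  obtain ⟨x, rfl⟩ := hv
  rw [← inclusion_thetaTotal hY]
  exact ⟨_, Submodule.mem_iSup_of_mem (p := fun X : AffineSl.derived m =>
    LinearMap.range (thetaTotal N (Laurent N) A B (X : AffineSl m))) ⟨Y, hY⟩ ⟨x, rfl⟩, rfl⟩

theorem derivedImage_le {W : Submodule ℂ (HolSpace N m A B)}
    (h : ∀ Y ∈ AffineSl.derived m, ∀ v ∈ LinearMap.range (inclusion N m A B),
      ev N m (Hol N) A B (opTotal N m A B Y) v ∈ W) : derivedImage N m A B ≤ W := by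
  refine Submodule.map_le_iff_le_comap.mpr (iSup_le fun Y => ?_)
  rintro _ ⟨x, rfl⟩
  rw [Submodule.mem_comap, inclusion_thetaTotal Y.2]
  exact h Y Y.2 _ ⟨x, rfl⟩

theorem derivedImage_le_range : derivedImage N m A B ≤ LinearMap.range (inclusion N m A B) :=
  LinearMap.map_le_range

variable (N m A B) in
/-- The operators mapping `A ⊗ ℂ[P] ⊗ (ℂ^m)^{⊗N} ⊗ B` to the image of the derived algebra. -/
def intoDerived : Submodule ℂ (HEnd N m A B) where
  carrier := {Z | ∀ v ∈ LinearMap.range (inclusion N m A B), ev N m (Hol N) A B Z v ∈ derivedImage N m A B}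
  add_mem' hT hU x hx := Submodule.add_mem _ (hT x hx) (hU x hx)
  zero_mem' x _ := Submodule.zero_mem _
  smul_mem' k T hT x hx := Submodule.smul_mem _ k (hT x hx)

theorem opTotal_mem_intoDerived {Y : AffineSl m} (hY : Y ∈ AffineSl.derived m) :
    opTotal N m A B Y ∈ intoDerived N m A B := fun _ hv => opTotal_mem_derivedImage hY hv

theorem mul_mem_intoDerived_right {Z T : HEnd N m A B} (hZ : Z ∈ intoDerived N m A B)
    (hT : T ∈ laurentStab N m A B) : Z * T ∈ intoDerived N m A B := fun _ hv => hZ _ (hT _ hv)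

theorem mul_mem_intoDerived_left {Z T : HEnd N m A B} (hT : T ∈ stabilizer (derivedImage N m A B))
    (hZ : Z ∈ intoDerived N m A B) : T * Z ∈ intoDerived N m A B := fun _ hv => hT _ (hZ _ hv)

theorem intoDerived_laurentStab {Z : HEnd N m A B} (hZ : Z ∈ intoDerived N m A B) :
    Z ∈ laurentStab N m A B := fun _ hv => derivedImage_le_range (hZ _ hv)

/-- For `v` in the Laurent space, `T θ(Y) v = θ(Y) T v - ⁅θ(Y), T⁆ v`, and both terms lie in the
span. -/
theorem mem_stabilizer_derivedImage {T : HEnd N m A B} (hT : T ∈ laurentStab N m A B)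
    (h : ∀ Y ∈ AffineSl.derived m, ⁅opTotal N m A B Y, T⁆ ∈ intoDerived N m A B) :
    T ∈ stabilizer (derivedImage N m A B) := by
  refine derivedImage_le (W := (derivedImage N m A B).comap (ev N m (Hol N) A B T)) fun Y hY v hv => ?_
  have h1 := Submodule.sub_mem _ (mul_mem_intoDerived_right (opTotal_mem_intoDerived hY) hT) (h Y hY)
  rw [Ring.lie_def, sub_sub_cancel] at h1
  exact h1 v hv

theorem opTotal_c (hA : HasLevel (m := m) A ℓ) (hB : HasLevel (m := m) B (-ℓ)) :
    opTotal N m A B AffineSl.c = 0 := by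
  rw [opTotal, LinearMap.add_apply, LinearMap.add_apply, LinearMap.sum_apply, opLeft_c hA,
    opRight_c hB, Finset.sum_eq_zero fun i _ => opSite_c i, add_zero, ← map_add, add_neg_cancel,
    map_zero]

theorem mem_stabilizer_derivedImage_of_commute (hA : HasLevel (m := m) A ℓ)
    (hB : HasLevel (m := m) B (-ℓ)) {T : HEnd N m A B} (hT : T ∈ laurentStab N m A B)
    (h : ∀ n X, Commute (opTotal N m A B (AffineSl.monomial n X)) T) :
    T ∈ stabilizer (derivedImage N m A B) := by
  refine mem_stabilizer_derivedImage hT fun Y hY => ?_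
  have := AffineSl.derived_le (V := LinearMap.ker
    ((LieModule.toEnd ℂ (HEnd N m A B) (HEnd N m A B)).toLinearMap.flip T ∘ₗ opTotal N m A B))
    (fun n X => lie_eq_zero_of_commute (h n X)) (by
      rw [LinearMap.mem_ker, LinearMap.comp_apply, opTotal_c hA hB, map_zero])
  rw [show ⁅opTotal N m A B Y, T⁆ = 0 from this hY]
  exact Submodule.zero_mem _

theorem opTotal_monomial_commute_opM (f : Hol N) (n : ℤ) (X : Sl m) :
    Commute (opTotal N m A B (AffineSl.monomial n X)) (opM N m (Hol N) A B f) := by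
  rw [opTotal_monomial]
  exact ((opM_commute_opA _ _).symm.add_left (Commute.symm (Commute.sum_right _ _ _ fun j _ =>
    siteOp_commute_opM f))).add_left (opB_commute_opM _ _)

/-- The levels `ℓ` and `-ℓ` make the two cocycles cancel, so the diagonal action is one of the loop
algebra without centre. -/
theorem opTotal_monomial_lie (hA : HasLevel (m := m) A ℓ) (hB : HasLevel (m := m) B (-ℓ)) (p q : ℤ)
    (X Y : Sl m) :
    ⁅opTotal N m A B (AffineSl.monomial p X), opTotal N m A B (AffineSl.monomial q Y)⁆ =
      opTotal N m A B (AffineSl.monomial (p + q) ⁅X, Y⁆) := by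
  have hs : ⁅∑ i, siteOp A B (fun i => coordPow (Hol N) i p) (Sl.toMatrix m X) i,
      ∑ i, siteOp A B (fun i => coordPow (Hol N) i q) (Sl.toMatrix m Y) i⁆ =
      ∑ i, siteOp A B (fun i => coordPow (Hol N) i (p + q)) (Sl.toMatrix m ⁅X, Y⁆) i := by
    rw [sum_lie]
    refine Finset.sum_congr rfl fun i _ => ?_
    rw [lie_sum, Finset.sum_eq_single i]
    · rw [siteOp, lie_mul_left_of_commute (siteOp_commute_opM _), siteOp,
        lie_mul_right_of_commute (opS_commute_opM _ _ _).symm, Ring.lie_def, ← opS_mul, ← opS_mul,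
        ← map_sub, ← mul_assoc, ← map_mul, siteOp, Sl.toMatrix_lie, coordPow, coordPow, coordPow,
        zpow_add, Units.val_mul]
    · intro j _ hj
      exact lie_eq_zero_of_commute ((siteOp_commute_opM _).symm.mul_right
        (siteOp_commute_opS hj.symm _))
    · simp
  have h1 : ∀ a b, Commute (opA N m (Hol N) A B a)
      (∑ i, siteOp A B (fun i => coordPow (Hol N) i q) b i) := fun a b =>
    Commute.sum_right _ _ _ fun j _ => (opM_commute_opA _ _).symm.mul_right (opS_commute_opA _ _ _).symm
  have h2 : ∀ a b, Commute (opB N m (Hol N) A B a)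
      (∑ i, siteOp A B (fun i => coordPow (Hol N) i q) b i) := fun a b =>
    Commute.sum_right _ _ _ fun j _ => (opB_commute_opM _ _).mul_right (opB_commute_opS _ _ _)
  have h3 : ∀ a b, Commute (∑ i, siteOp A B (fun i => coordPow (Hol N) i p) b i)
      (opA N m (Hol N) A B a) := fun a b =>
    Commute.sum_left _ _ _ fun j _ => (opM_commute_opA _ _).mul_left (opS_commute_opA _ _ _)
  have h4 : ∀ a b, Commute (∑ i, siteOp A B (fun i => coordPow (Hol N) i p) b i)
      (opB N m (Hol N) A B a) := fun a b =>
    Commute.sum_left _ _ _ fun j _ => ((opB_commute_opM _ _).mul_right (opB_commute_opS _ _ _)).symm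
  rw [opTotal_monomial, opTotal_monomial, opTotal_monomial, ← hs]
  simp only [add_lie, lie_add, opLeft_monomial_lie hA, opRight_monomial_lie hB]
  simp only [opLeft_eq, opRight_eq, lie_eq_zero_of_commute (h1 _ _), lie_eq_zero_of_commute (h2 _ _),
    lie_eq_zero_of_commute (h3 _ _), lie_eq_zero_of_commute (h4 _ _),
    lie_eq_zero_of_commute (opB_commute_opA _ _), lie_eq_zero_of_commute (opB_commute_opA _ _).symm]
  have h5 : (algebraMap ℂ (HEnd N m A B) (if p + q = 0 then p * traceForm m X Y * ℓ else 0)) +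
      algebraMap ℂ (HEnd N m A B) (if p + q = 0 then p * traceForm m X Y * -ℓ else 0) = 0 := by
    rw [← map_add]
    split_ifs
    · rw [mul_neg, add_neg_cancel, map_zero]
    · rw [add_zero, map_zero]
  rw [← eq_sub_iff_add_eq', zero_sub] at h5
  rw [h5]
  abel

theorem pairing_mem_intoDerived {J U : Fin m → Fin m → HEnd N m A B} (h : Fin m → Fin m → ℂ)
    (hJ : ∀ a b, J a b ∈ intoDerived N m A B) (hU : ∀ a b, U a b ∈ laurentStab N m A B) :
    pairing J U h ∈ intoDerived N m A B :=
  Submodule.sum_mem _ fun _ _ => Submodule.sum_mem _ fun _ _ =>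
    Submodule.smul_mem _ _ (mul_mem_intoDerived_right (hJ _ _) (hU _ _))

/-- Each term has an operator `θ(Y)` to the left of a matrix at a site, preceded at most by a
function, and functions commute with the loops. -/
theorem defect_mem_intoDerived (hA : HasLevel (m := m) A ℓ) (hB : HasLevel (m := m) B (-ℓ))
    (c d : Fin m → Fin m → ℂ) (e : ℤ) (X : Sl m) (i : Fin N) :
    defect c d e X i (opTotal N m A B) ∈ intoDerived N m A B := by
  rw [defect_apply]
  refine Submodule.add_mem _ ?_ (mul_mem_intoDerived_left ?_ ?_)
  · exact pairing_mem_intoDerived _ (fun _ _ => opTotal_mem_intoDerived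
      (AffineSl.monomial_mem_derived _ _)) fun _ _ => opS_mem _ _
  · exact mem_stabilizer_derivedImage_of_commute hA hB (opM_mem (coordPow_mem_range i e))
      (opTotal_monomial_commute_opM _)
  · exact pairing_mem_intoDerived _ (fun _ _ => opTotal_mem_intoDerived
      (AffineSl.monomial_mem_derived _ _)) fun _ _ => opS_mem _ _

/-- The set of `Y` with an admissible commutator is closed under brackets by the Jacobi identity.
Since `sl_m` is perfect, degrees `p` and `q` give all of degree `p + q`, so degrees `1` and `-1`
give every degree. -/
theorem mem_stabilizer_derivedImage_of_lie [NeZero m] (hA : HasLevel (m := m) A ℓ)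
    (hB : HasLevel (m := m) B (-ℓ)) {T : HEnd N m A B} (hT : T ∈ laurentStab N m A B)
    (h1 : ∀ X, ⁅opTotal N m A B (AffineSl.monomial 1 X), T⁆ ∈ intoDerived N m A B)
    (h2 : ∀ X, ⁅opTotal N m A B (AffineSl.monomial (-1) X), T⁆ ∈ intoDerived N m A B) :
    T ∈ stabilizer (derivedImage N m A B) := by
  let V : Submodule ℂ (AffineSl m) := (intoDerived N m A B).comap
    ((LieModule.toEnd ℂ (HEnd N m A B) (HEnd N m A B)).toLinearMap.flip T ∘ₗ opTotal N m A B)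
  have hV : ∀ Y, Y ∈ V ↔ ⁅opTotal N m A B Y, T⁆ ∈ intoDerived N m A B := fun _ => Iff.rfl
  have h1' : ∀ X, AffineSl.monomial 1 X ∈ V := fun X => (hV _).mpr (h1 X)
  have h2' : ∀ X, AffineSl.monomial (-1) X ∈ V := fun X => (hV _).mpr (h2 X)
  have hmul : ∀ Y ∈ AffineSl.derived m, ∀ Z ∈ intoDerived N m A B,
      ⁅opTotal N m A B Y, Z⁆ ∈ intoDerived N m A B := fun Y hY Z hZ => by
    have := opTotal_mem_intoDerived (N := N) (A := A) (B := B) hY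
    rw [Ring.lie_def]
    exact Submodule.sub_mem _ (mul_mem_intoDerived_right this (intoDerived_laurentStab hZ))
      (mul_mem_intoDerived_right hZ (intoDerived_laurentStab this))
  have hadd : ∀ p q : ℤ, (∀ X, AffineSl.monomial p X ∈ V) → (∀ X, AffineSl.monomial q X ∈ V) →
      ∀ X, AffineSl.monomial (p + q) X ∈ V := by
    intro p q hp hq
    have := Sl.eq_top_of_lie_mem (V.comap (AffineSl.monomial (p + q))) fun X Y => by
      rw [Submodule.mem_comap, hV, ← opTotal_monomial_lie hA hB, lie_lie]
      exact Submodule.sub_mem _ (hmul _ (AffineSl.monomial_mem_derived _ _) _ (hq Y))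
        (hmul _ (AffineSl.monomial_mem_derived _ _) _ (hp X))
    exact fun X => (this ▸ Submodule.mem_top : X ∈ V.comap (AffineSl.monomial (p + q)))
  have hall : ∀ n X, AffineSl.monomial n X ∈ V := by
    intro n
    induction n using Int.induction_on with
    -- Degree zero is not a hypothesis: it is reached as `1 + (-1)`.
    | zero => exact add_neg_cancel (1 : ℤ) ▸ hadd 1 (-1) h1' h2'
    | succ n ih => exact hadd _ _ ih h1'
    | pred n ih => exact sub_eq_add_neg (-(n : ℤ)) 1 ▸ hadd _ _ ih h2'
  refine mem_stabilizer_derivedImage hT fun Y hY => AffineSl.derived_le (V := V) hall ?_ hY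
  rw [hV, opTotal_c hA hB, zero_lie]
  exact Submodule.zero_mem _

theorem heckeHom_mem_stabilizer_derivedImage [NeZero N] [NeZero m] (hA : CategoryO m ℓ A)
    (hB : CategoryODagger m ℓ B) (h : IsRLimit A B L R) (x : DDAHA N) :
    heckeHom (ℓ + m) (h.currentOps hA hB) x ∈ stabilizer (derivedImage N m A B) := by
  refine heckeHom_mem _ _ (fun i => ?_) (fun w => ?_) (fun η => ?_) x
  · refine mem_stabilizer_derivedImage_of_lie hA.level hB.level (h.dunklOp_mem i) (fun X => ?_)
      fun X => ?_
    · rw [opTotal_lie_dunklOp_one hA hB h]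
      exact defect_mem_intoDerived hA.level hB.level _ _ _ _ _
    · rw [opTotal_lie_dunklOp_neg_one hA hB h]
      exact defect_mem_intoDerived hA.level hB.level _ _ _ _ _
  · exact mem_stabilizer_derivedImage_of_commute hA.level hB.level (opT_mem w) fun n X =>
      opTotal_lie_opT n X w
  · exact mem_stabilizer_derivedImage_of_commute hA.level hB.level
      (opM_mem (coordMonomial_mem_range η)) (opTotal_monomial_commute_opM _)

end Derived

/-! ### The induced action on the coinvariants. -/

section Induced

/-- Injectivity of `ι` makes the preimages `τ h x` unique, so linearity and the algebra relations on
`F` are inherited from `E` before passing to the quotient. -/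
theorem exists_quotientAction {H E F : Type*} [Ring H] [Algebra ℂ H] [AddCommGroup E] [Module ℂ E]
    [AddCommGroup F] [Module ℂ F] (ρ : H →ₐ[ℂ] Module.End ℂ E) {ι : F →ₗ[ℂ] E}
    (hι : Function.Injective ι) (D : Submodule ℂ F)
    (h1 : ∀ h, ∀ x ∈ LinearMap.range ι, ρ h x ∈ LinearMap.range ι)
    (h2 : ∀ h, ∀ x ∈ D.map ι, ρ h x ∈ D.map ι) :
    ∃ σ : H →ₐ[ℂ] Module.End ℂ (F ⧸ D), ∀ h x y, ρ h (ι x) = ι y →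
      σ h (Submodule.Quotient.mk x) = Submodule.Quotient.mk y := by
  choose τ hτ using fun h x => h1 h (ι x) ⟨x, rfl⟩
  let T : H → Module.End ℂ F := fun h =>
    { toFun := τ h
      map_add' := fun x y => hι (by simp only [map_add, hτ])
      map_smul' := fun a x => hι (by simp only [map_smul, hτ, RingHom.id_apply]) }
  have hT : ∀ h x, ι (T h x) = ρ h (ι x) := hτ
  have hD : ∀ h, D ≤ D.comap (T h) := fun h x hx => by
    obtain ⟨y, hy, hxy⟩ := h2 h (ι x) ⟨x, hx, rfl⟩
    rw [← hT] at hxy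
    have hy' : y = T h x := hι hxy
    rwa [hy'] at hy
  refine ⟨AlgHom.ofLinearMap
    { toFun := fun h => D.mapQ D (T h) (hD h)
      map_add' := fun h h' => ?_
      map_smul' := fun a h => ?_ } ?_ ?_, fun h x y hxy => ?_⟩
  · ext x
    exact congrArg Submodule.Quotient.mk (hι (by rw [map_add, hT, hT, hT, map_add]; rfl))
  · ext x
    exact congrArg Submodule.Quotient.mk (hι (by rw [map_smul, hT, hT, map_smul]; rfl))
  · ext x
    exact congrArg Submodule.Quotient.mk (hι (by rw [hT, map_one]; rfl))
  · intro h h'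
    ext x
    exact congrArg Submodule.Quotient.mk (hι (by rw [hT, hT, hT, map_mul]; rfl))
  · exact congrArg Submodule.Quotient.mk (hι (by rw [hT, hxy]))

/-- Tensoring over a field preserves injectivity of the inclusion of Laurent polynomials in `ℛ(X)`.
-/
theorem inclusion_injective (N m : ℕ) (A B : Type*) [AddCommGroup A] [Module ℂ A] [AddCommGroup B]
    [Module ℂ B] : Function.Injective (inclusion N m A B) :=
  Module.Flat.lTensor_preserves_injective_linearMap _
    (Module.Flat.rTensor_preserves_injective_linearMap _ laurentToHol_injective)

variable {N m : ℕ} [NeZero N] {A B : Type*}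
  [AddCommGroup A] [Module ℂ A] [LieRingModule (AffineSl m) A] [LieModule ℂ (AffineSl m) A]
  [AddCommGroup B] [Module ℂ B] [LieRingModule (AffineSl m) B] [LieModule ℂ (AffineSl m) B]
  {ρ : DDAHA N →ₐ[ℂ] Module.End ℂ (HolSpace N m A B)}

theorem IsInducedAction.ext {σ σ' : DDAHA N →ₐ[ℂ] Module.End ℂ (Coinvariants N m A B)}
    (hρ : ∀ h, ∀ x ∈ LinearMap.range (inclusion N m A B),
      ρ h x ∈ LinearMap.range (inclusion N m A B))
    (h : IsInducedAction ρ σ) (h' : IsInducedAction ρ σ') : σ = σ' := by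
  refine AlgHom.ext fun a => LinearMap.ext fun x => ?_
  obtain ⟨x, rfl⟩ := Submodule.Quotient.mk_surjective _ x
  obtain ⟨y, hy⟩ := hρ a _ ⟨x, rfl⟩
  rw [h a x y hy.symm, h' a x y hy.symm]

theorem IsInducedAction.central {ℓ : ℂ} {σ : DDAHA N →ₐ[ℂ] Module.End ℂ (Coinvariants N m A B)}
    (hρ : IsKZAction ℓ A B ρ) (h : IsInducedAction ρ σ) :
    σ (DDAHA.cartan (0, 1)) = algebraMap ℂ _ (ℓ + m) := by
  refine LinearMap.ext fun x => ?_
  obtain ⟨x, rfl⟩ := Submodule.Quotient.mk_surjective _ x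
  exact h _ x ((ℓ + m) • x) (by rw [hρ.central, map_smul]; rfl)

end Induced

/-! ### Functoriality in `A` and `B`. -/

section Functoriality

variable {N m : ℕ} {ℓ : ℂ} {A A' A'' B B' B'' : Type*}
  [AddCommGroup A] [Module ℂ A] [LieRingModule (AffineSl m) A] [LieModule ℂ (AffineSl m) A]
  [AddCommGroup A'] [Module ℂ A'] [LieRingModule (AffineSl m) A'] [LieModule ℂ (AffineSl m) A']
  [AddCommGroup A''] [Module ℂ A''] [LieRingModule (AffineSl m) A''] [LieModule ℂ (AffineSl m) A'']
  [AddCommGroup B] [Module ℂ B] [LieRingModule (AffineSl m) B] [LieModule ℂ (AffineSl m) B]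
  [AddCommGroup B'] [Module ℂ B'] [LieRingModule (AffineSl m) B'] [LieModule ℂ (AffineSl m) B']
  [AddCommGroup B''] [Module ℂ B''] [LieRingModule (AffineSl m) B''] [LieModule ℂ (AffineSl m) B'']

theorem coinvariantsMap_id : coinvariantsMap N (LieModuleHom.id : A →ₗ⁅ℂ, AffineSl m⁆ A)
    (LieModuleHom.id : B →ₗ⁅ℂ, AffineSl m⁆ B) = LinearMap.id := by
  have h : spaceMap N (LieModuleHom.id : A →ₗ⁅ℂ, AffineSl m⁆ A)
      (LieModuleHom.id : B →ₗ⁅ℂ, AffineSl m⁆ B) = LinearMap.id :=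
    TensorProduct.ext <| LinearMap.ext fun _ => TensorProduct.ext <| LinearMap.ext fun _ =>
      TensorProduct.ext' fun _ _ => rfl
  refine LinearMap.ext fun x => ?_
  obtain ⟨x, rfl⟩ := Submodule.Quotient.mk_surjective _ x
  exact congrArg Submodule.Quotient.mk (LinearMap.congr_fun h x)

theorem coinvariantsMap_comp (f : A →ₗ⁅ℂ, AffineSl m⁆ A') (g : B →ₗ⁅ℂ, AffineSl m⁆ B')
    (f' : A' →ₗ⁅ℂ, AffineSl m⁆ A'') (g' : B' →ₗ⁅ℂ, AffineSl m⁆ B'') :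
    coinvariantsMap N (f'.comp f) (g'.comp g) =
      coinvariantsMap N f' g' ∘ₗ coinvariantsMap N f g := by
  have h : spaceMap N (f'.comp f) (g'.comp g) = spaceMap N f' g' ∘ₗ spaceMap N f g :=
    TensorProduct.ext <| LinearMap.ext fun _ => TensorProduct.ext <| LinearMap.ext fun _ =>
      TensorProduct.ext' fun _ _ => rfl
  refine LinearMap.ext fun x => ?_
  obtain ⟨x, rfl⟩ := Submodule.Quotient.mk_surjective _ x
  exact congrArg Submodule.Quotient.mk (LinearMap.congr_fun h x)

variable (N) in
/-- The map induced by homomorphisms `A → A'` and `B → B'` on the holomorphic spaces. -/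
def holMap (f : A →ₗ⁅ℂ, AffineSl m⁆ A') (g : B →ₗ⁅ℂ, AffineSl m⁆ B') :
    HolSpace N m A B →ₗ[ℂ] HolSpace N m A' B' :=
  TensorProduct.map f (LinearMap.lTensor (Hol N) (LinearMap.lTensor (VecPower N m) g))

variable {f : A →ₗ⁅ℂ, AffineSl m⁆ A'} {g : B →ₗ⁅ℂ, AffineSl m⁆ B'}

theorem holMap_inclusion (x : LaurentSpace N m A B) :
    holMap N f g (inclusion N m A B x) = inclusion N m A' B' (spaceMap N f g x) := by
  have h : holMap N f g ∘ₗ inclusion N m A B = inclusion N m A' B' ∘ₗ spaceMap N f g :=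
    TensorProduct.ext <| LinearMap.ext fun _ => TensorProduct.ext <| LinearMap.ext fun _ =>
      TensorProduct.ext' fun _ _ => rfl
  exact LinearMap.congr_fun h x

/-- Pairs of operators which correspond to each other under the map induced by homomorphisms. -/
def Intertwines (f : A →ₗ⁅ℂ, AffineSl m⁆ A') (g : B →ₗ⁅ℂ, AffineSl m⁆ B') (T : HEnd N m A B)
    (T' : HEnd N m A' B') : Prop :=
  ∀ x, holMap N f g (ev N m (Hol N) A B T x) = ev N m (Hol N) A' B' T' (holMap N f g x)

namespace Intertwines

variable {T U : HEnd N m A B} {T' U' : HEnd N m A' B'}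

theorem add (h : Intertwines f g T T') (h' : Intertwines f g U U') :
    Intertwines f g (T + U) (T' + U') := fun x => by
  rw [ev_add_apply, ev_add_apply, map_add, h, h']

theorem sub (h : Intertwines f g T T') (h' : Intertwines f g U U') :
    Intertwines f g (T - U) (T' - U') := fun x => by
  rw [ev_sub_apply, ev_sub_apply, map_sub, h, h']

theorem mul (h : Intertwines f g T T') (h' : Intertwines f g U U') :
    Intertwines f g (T * U) (T' * U') := fun x => by
  rw [ev_mul_apply, ev_mul_apply, h, h']

theorem smul (k : ℂ) (h : Intertwines f g T T') : Intertwines f g (k • T) (k • T') := fun x => by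
  rw [ev_smul_apply, ev_smul_apply, map_smul, h]

theorem one : Intertwines f g (1 : HEnd N m A B) 1 := fun _ => rfl

theorem scalar (k : ℂ) :
    Intertwines f g (algebraMap ℂ (HEnd N m A B) k) (algebraMap ℂ _ k) := by
  rw [Algebra.algebraMap_eq_smul_one, Algebra.algebraMap_eq_smul_one]
  exact one.smul k

theorem pow (h : Intertwines f g T T') (n : ℕ) : Intertwines f g (T ^ n) (T' ^ n) := by
  induction n with
  | zero => rw [pow_zero, pow_zero]; exact one
  | succ n ih => rw [pow_succ, pow_succ]; exact ih.mul h

theorem sum {ι : Type*} {s : Finset ι} {T : ι → HEnd N m A B} {T' : ι → HEnd N m A' B'}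
    (h : ∀ i ∈ s, Intertwines f g (T i) (T' i)) :
    Intertwines f g (∑ i ∈ s, T i) (∑ i ∈ s, T' i) := fun x => by
  rw [ev_sum_apply, ev_sum_apply, map_sum]
  exact Finset.sum_congr rfl fun i hi => h i hi x

theorem pairing {ι : Type*} [Fintype ι] {J U : ι → ι → HEnd N m A B}
    {J' U' : ι → ι → HEnd N m A' B'} (h : ι → ι → ℂ) (hJ : ∀ a b, Intertwines f g (J a b) (J' a b))
    (hU : ∀ a b, Intertwines f g (U a b) (U' a b)) :
    Intertwines f g (AffineKZ.pairing J U h) (AffineKZ.pairing J' U' h) :=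
  sum fun _ _ => sum fun _ _ => ((hJ _ _).mul (hU _ _)).smul _

theorem truncated {ι : Type*} [Fintype ι] {J : ℕ → ι → ι → HEnd N m A B}
    {U : ι → ι → HEnd N m A B} {J' : ℕ → ι → ι → HEnd N m A' B'} {U' : ι → ι → HEnd N m A' B'}
    (h : ι → ι → ℂ) {u : HEnd N m A B} {u' : HEnd N m A' B'}
    (hJ : ∀ n a b, Intertwines f g (J n a b) (J' n a b))
    (hU : ∀ a b, Intertwines f g (U a b) (U' a b)) (hu : Intertwines f g u u') (K : ℕ) :
    Intertwines f g (AffineKZ.truncated J U h u K) (AffineKZ.truncated J' U' h u' K) :=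
  (pairing h (hJ 0) hU).add (sum fun n _ => (hu.pow _).mul (pairing 1 (hJ _) hU))

/-- The limits `L_i` and `R_i` are the only ingredients of the action that are not algebraic in the
factors; a truncation valid for both `x` and its image transfers compatibility to them. -/
theorem lim {T : ℕ → HEnd N m A B} {T' : ℕ → HEnd N m A' B'} {U : HEnd N m A B}
    {U' : HEnd N m A' B'} (hT : IsPtLim T U) (hT' : IsPtLim T' U')
    (h : ∀ K, Intertwines f g (T K) (T' K)) : Intertwines f g U U' := fun x => by
  obtain ⟨K, h1, h2⟩ := ((hT x).and (hT' (holMap N f g x))).exists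
  rw [← h1, ← h2, h]

theorem opF (s : Module.End ℂ (Hol N)) :
    Intertwines f g (opF N m (Hol N) A B s) (opF N m (Hol N) A' B' s) := by
  have h : holMap N f g ∘ₗ ev N m (Hol N) A B (AffineKZ.opF N m (Hol N) A B s) =
      ev N m (Hol N) A' B' (AffineKZ.opF N m (Hol N) A' B' s) ∘ₗ holMap N f g :=
    TensorProduct.ext <| LinearMap.ext fun _ => TensorProduct.ext <| LinearMap.ext fun _ =>
      TensorProduct.ext' fun _ _ => rfl
  exact LinearMap.congr_fun h

theorem opV (v : Module.End ℂ (VecPower N m)) :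
    Intertwines f g (opV N m (Hol N) A B v) (opV N m (Hol N) A' B' v) := by
  have h : holMap N f g ∘ₗ ev N m (Hol N) A B (AffineKZ.opV N m (Hol N) A B v) =
      ev N m (Hol N) A' B' (AffineKZ.opV N m (Hol N) A' B' v) ∘ₗ holMap N f g :=
    TensorProduct.ext <| LinearMap.ext fun _ => TensorProduct.ext <| LinearMap.ext fun _ =>
      TensorProduct.ext' fun _ _ => rfl
  exact LinearMap.congr_fun h

theorem opLeft (Y : AffineSl m) :
    Intertwines f g (opLeft N m (Hol N) A B Y) (opLeft N m (Hol N) A' B' Y) := by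
  have h : holMap N f g ∘ₗ ev N m (Hol N) A B (AffineKZ.opLeft N m (Hol N) A B Y) =
      ev N m (Hol N) A' B' (AffineKZ.opLeft N m (Hol N) A' B' Y) ∘ₗ holMap N f g :=
    TensorProduct.ext' fun a u => congrArg (fun v => v ⊗ₜ[ℂ] (LinearMap.lTensor (Hol N)
      (LinearMap.lTensor (VecPower N m) (g : B →ₗ[ℂ] B')) u)) (f.map_lie Y a)
  exact LinearMap.congr_fun h

theorem opRight (Y : AffineSl m) :
    Intertwines f g (opRight N m (Hol N) A B Y) (opRight N m (Hol N) A' B' Y) := by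
  have h : holMap N f g ∘ₗ ev N m (Hol N) A B (AffineKZ.opRight N m (Hol N) A B Y) =
      ev N m (Hol N) A' B' (AffineKZ.opRight N m (Hol N) A' B' Y) ∘ₗ holMap N f g :=
    TensorProduct.ext <| LinearMap.ext fun a => TensorProduct.ext <| LinearMap.ext fun s =>
      TensorProduct.ext' fun v b =>
        congrArg (fun b => f a ⊗ₜ[ℂ] (s ⊗ₜ[ℂ] (v ⊗ₜ[ℂ] b))) (g.map_lie Y b)
  exact LinearMap.congr_fun h

theorem opM (s : Hol N) : Intertwines f g (opM N m (Hol N) A B s) (opM N m (Hol N) A' B' s) := opF _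

theorem opS (i : Fin N) (M : Matrix (Fin m) (Fin m) ℂ) :
    Intertwines f g (opS N m (Hol N) A B i M) (opS N m (Hol N) A' B' i M) := opV _

theorem opT (w : Equiv.Perm (Fin N)) : Intertwines f g (opT N m A B w) (opT N m A' B' w) :=
  (opF _).mul (opV _)

theorem mid (i j : Fin N) : Intertwines f g (mid N m A B i j) (mid N m A' B' i j) :=
  (pairing _ (fun _ _ => opS _ _) fun _ _ => opS _ _).sub
    ((opM _).mul ((pairing _ (fun _ _ => opS _ _) fun _ _ => opS _ _).sub (opT _)))

variable {L R : Fin N → HEnd N m A B} {L' R' : Fin N → HEnd N m A' B'}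

theorem dunklOp (k : ℂ) (h : IsRLimit A B L R) (h' : IsRLimit A' B' L' R') (i : Fin N) :
    Intertwines f g (dunklOp k L R i) (dunklOp k L' R' i) := by
  have hL : Intertwines f g (L i) (L' i) := lim (h.left i) (h'.left i) fun K =>
    truncated _ (fun _ _ _ => opLeft _) (fun _ _ => opS _ _) (opM _) K
  have hR : Intertwines f g (R i) (R' i) := lim (h.right i) (h'.right i) fun K =>
    truncated _ (fun _ _ _ => opRight _) (fun _ _ => opS _ _) (opM _) K
  exact (((((opF _).smul k).add hL).sub hR).add (opS _ _)).add
    ((sum fun _ _ => mid _ _).sub (sum fun _ _ => mid _ _))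

theorem heckeHom [NeZero N] (k : ℂ) (hc : CurrentOps L R) (hc' : CurrentOps L' R')
    (h : IsRLimit A B L R) (h' : IsRLimit A' B' L' R') (x : DDAHA N) :
    Intertwines f g (heckeHom k hc x) (heckeHom k hc' x) := by
  have hd : ∀ ξ, Intertwines f g (cartanOp k L R ξ) (cartanOp k L' R' ξ) := fun ξ =>
    (sum fun i _ => (dunklOp k h h' i).smul _).add (one.smul _)
  induction x using DDAHA.induction with
  | algebraMap a => rw [AlgHom.commutes, AlgHom.commutes]; exact scalar a
  | add x y hx hy => rw [map_add, map_add]; exact hx.add hy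
  | mul x y hx hy => rw [map_mul, map_mul]; exact hx.mul hy
  | central => rw [heckeHom_cartan, heckeHom_cartan]; exact hd _
  | cartan ξ => rw [heckeHom_cartan, heckeHom_cartan]; exact hd _
  | perm w => rw [heckeHom_weyl, heckeHom_weyl, weylOp_ofPerm, weylOp_ofPerm]; exact opT w
  | translation η =>
    rw [heckeHom_weyl, heckeHom_weyl, weylOp_translation, weylOp_translation]; exact opM _

end Intertwines

variable [NeZero N]

theorem IsInducedAction.coinvariantsMap_apply
    {ρ : DDAHA N →ₐ[ℂ] Module.End ℂ (HolSpace N m A B)}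
    {ρ' : DDAHA N →ₐ[ℂ] Module.End ℂ (HolSpace N m A' B')}
    {σ : DDAHA N →ₐ[ℂ] Module.End ℂ (Coinvariants N m A B)}
    {σ' : DDAHA N →ₐ[ℂ] Module.End ℂ (Coinvariants N m A' B')}
    (hρ : ∀ h, ∀ x ∈ LinearMap.range (inclusion N m A B),
      ρ h x ∈ LinearMap.range (inclusion N m A B))
    (hσ : IsInducedAction ρ σ) (hσ' : IsInducedAction ρ' σ')
    (h : ∀ a x, holMap N f g (ρ a x) = ρ' a (holMap N f g x)) (a : DDAHA N)
    (x : Coinvariants N m A B) :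
    coinvariantsMap N f g (σ a x) = σ' a (coinvariantsMap N f g x) := by
  obtain ⟨x, rfl⟩ := Submodule.Quotient.mk_surjective _ x
  obtain ⟨y, hy⟩ := hρ a _ ⟨x, rfl⟩
  rw [hσ a x y hy.symm]
  refine (hσ' a (spaceMap N f g x) (spaceMap N f g y) ?_).symm
  rw [← holMap_inclusion, ← holMap_inclusion, hy, h]

end Functoriality

/-! ### Finiteness of the sums, and cross relations with functions. -/

section CrossRelations

variable {N m : ℕ} {ℓ : ℂ} {A B : Type*}
  [AddCommGroup A] [Module ℂ A] [LieRingModule (AffineSl m) A] [LieModule ℂ (AffineSl m) A]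
  [AddCommGroup B] [Module ℂ B] [LieRingModule (AffineSl m) B] [LieModule ℂ (AffineSl m) B]

theorem finite_support_left [NeZero m] (hA : CategoryO m ℓ A) (i : Fin N) (x : HolSpace N m A B) :
    (Function.support fun n : ℕ => pairAction (thetaLeft N (Hol N) A B) (theta N (Hol N) A B i)
      (AffineSl.rTerm m (n + 1)) x).Finite := by
  simp only [pairAction_left_rTerm hA]
  exact (eventually_sum_range_eq ((leftCurrent_isCurrent hA).term_smooth
    (f := fun i => coordPow (Hol N) i (-1)) i x)).1

theorem finite_support_right [NeZero m] (hB : CategoryODagger m ℓ B) (i : Fin N)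
    (x : HolSpace N m A B) :
    (Function.support fun n : ℕ => pairAction (theta N (Hol N) A B i) (thetaRight N (Hol N) A B)
      (AffineSl.rTerm m (n + 1)) x).Finite := by
  simp only [pairAction_right_rTerm hB]
  exact (eventually_sum_range_eq ((rightCurrent_isCurrent hB).term_smooth
    (f := fun i => coordPow (Hol N) i 1) i x)).1

theorem tau_mulOp (w : Equiv.Perm (Fin N)) (f : Hol N) (x : HolSpace N m A B) :
    tau m A B w (mulOp m A B f x) = mulOp m A B (Hol.perm w f) (tau m A B w x) := by
  rw [tau_eq, mulOp_eq, mulOp_eq, ← ev_mul_apply, ← ev_mul_apply, opT_opM]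

theorem dunkl_mulOp [NeZero m] (hA : CategoryO m ℓ A) (hB : CategoryODagger m ℓ B)
    (ξ : Fin N → ℂ) (f : Hol N) (x : HolSpace N m A B) :
    dunkl A B ξ (mulOp m A B f x) - mulOp m A B f (dunkl A B ξ x) =
      (ℓ + m) • mulOp m A B (eulerAlong ξ f) x +
        ∑ i, ∑ j ∈ Finset.Ioi i, (ξ i - ξ j) • mulOp m A B
          ((f - Hol.perm (Equiv.swap i j) f) * Ring.inverse (1 - ratio j i))
          (tau m A B (Equiv.swap i j) x) := by
  obtain ⟨L, R, h⟩ := exists_isRLimit (N := N) hA hB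
  have key := congrArg (fun T => ev N m (Hol N) A B T x)
    (dunklAlong_lie_opM (k := ℓ + m) (h.currentOps hA hB) ξ f)
  simp only [Ring.lie_def, ev_sub_apply, ev_add_apply, ev_mul_apply, ev_smul_apply, ev_sum_apply] at key
  simp only [dunkl_eq hA hB h, mulOp_eq, tau_eq]
  exact key

end CrossRelations

end AffineKZ

end

/-! ### The theorem. -/

theorem mainTheorem6 (N m : ℕ) [NeZero N] [NeZero m] (ℓ : ℂ)
    (A : Type*) [AddCommGroup A] [Module ℂ A]
    [LieRingModule (AffineKZ.AffineSl m) A] [LieModule ℂ (AffineKZ.AffineSl m) A]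
    (B : Type*) [AddCommGroup B] [Module ℂ B]
    [LieRingModule (AffineKZ.AffineSl m) B] [LieModule ℂ (AffineKZ.AffineSl m) B]
    (hA : AffineKZ.CategoryO m ℓ A) (hB : AffineKZ.CategoryODagger m ℓ B) :
    -- the infinite sums in the KZ connections are finite on every vector
    (∀ (i : Fin N) (x : AffineKZ.HolSpace N m A B),
      (Function.support fun n : ℕ =>
        AffineKZ.pairAction (AffineKZ.thetaLeft N (AffineKZ.Hol N) A B)
          (AffineKZ.theta N (AffineKZ.Hol N) A B i) (AffineKZ.AffineSl.rTerm m (n + 1)) x).Finite ∧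
      (Function.support fun n : ℕ =>
        AffineKZ.pairAction (AffineKZ.theta N (AffineKZ.Hol N) A B i)
          (AffineKZ.thetaRight N (AffineKZ.Hol N) A B)
          (AffineKZ.AffineSl.rTerm m (n + 1)) x).Finite) ∧
    -- multiplication by holomorphic functions satisfies the cross relations
    (∀ (w : Equiv.Perm (Fin N)) (f : AffineKZ.Hol N) (x : AffineKZ.HolSpace N m A B),
      AffineKZ.tau m A B w (AffineKZ.mulOp m A B f x) =
        AffineKZ.mulOp m A B (AffineKZ.Hol.perm w f) (AffineKZ.tau m A B w x)) ∧
    (∀ (ξ : Fin N → ℂ) (f : AffineKZ.Hol N) (x : AffineKZ.HolSpace N m A B),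
      AffineKZ.dunkl A B ξ (AffineKZ.mulOp m A B f x) -
          AffineKZ.mulOp m A B f (AffineKZ.dunkl A B ξ x) =
        (ℓ + m) • AffineKZ.mulOp m A B (AffineKZ.eulerAlong ξ f) x +
          ∑ i, ∑ j ∈ Finset.Ioi i, (ξ i - ξ j) •
            AffineKZ.mulOp m A B
              ((f - AffineKZ.Hol.perm (Equiv.swap i j) f) *
                Ring.inverse (1 - AffineKZ.ratio j i))
              (AffineKZ.tau m A B (Equiv.swap i j) x)) ∧
    -- the action on the holomorphic space, and the induced one on the coinvariants
    ∃ ρ : AffineKZ.DDAHA N →ₐ[ℂ] Module.End ℂ (AffineKZ.HolSpace N m A B),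
      AffineKZ.IsKZAction ℓ A B ρ ∧
      (∀ ρ₁, AffineKZ.IsKZAction ℓ A B ρ₁ → ρ₁ = ρ) ∧
      (∀ h, ∀ x ∈ LinearMap.range (AffineKZ.inclusion N m A B),
        ρ h x ∈ LinearMap.range (AffineKZ.inclusion N m A B)) ∧
      (∀ h, ∀ x ∈ (AffineKZ.derivedSpan m N (AffineKZ.Laurent N) A B).map
          (AffineKZ.inclusion N m A B),
        ρ h x ∈ (AffineKZ.derivedSpan m N (AffineKZ.Laurent N) A B).map
          (AffineKZ.inclusion N m A B)) ∧
      ∃ σ : AffineKZ.DDAHA N →ₐ[ℂ] Module.End ℂ (AffineKZ.Coinvariants N m A B),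
        AffineKZ.IsInducedAction ρ σ ∧
        (∀ σ₁, AffineKZ.IsInducedAction ρ σ₁ → σ₁ = σ) ∧
        σ (AffineKZ.DDAHA.cartan (0, 1)) = algebraMap ℂ _ (ℓ + m) ∧
        -- functoriality
        AffineKZ.coinvariantsMap N (LieModuleHom.id : A →ₗ⁅ℂ, AffineKZ.AffineSl m⁆ A)
          (LieModuleHom.id : B →ₗ⁅ℂ, AffineKZ.AffineSl m⁆ B) = LinearMap.id ∧
        ∀ (A' : Type*) [AddCommGroup A'] [Module ℂ A']
          [LieRingModule (AffineKZ.AffineSl m) A'] [LieModule ℂ (AffineKZ.AffineSl m) A']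
          (B' : Type*) [AddCommGroup B'] [Module ℂ B']
          [LieRingModule (AffineKZ.AffineSl m) B'] [LieModule ℂ (AffineKZ.AffineSl m) B']
          (f : A →ₗ⁅ℂ, AffineKZ.AffineSl m⁆ A') (g : B →ₗ⁅ℂ, AffineKZ.AffineSl m⁆ B'),
          AffineKZ.CategoryO m ℓ A' → AffineKZ.CategoryODagger m ℓ B' →
          (∀ (ρ' : AffineKZ.DDAHA N →ₐ[ℂ] Module.End ℂ (AffineKZ.HolSpace N m A' B'))
            (σ' : AffineKZ.DDAHA N →ₐ[ℂ] Module.End ℂ (AffineKZ.Coinvariants N m A' B')),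
            AffineKZ.IsKZAction ℓ A' B' ρ' → AffineKZ.IsInducedAction ρ' σ' →
            ∀ (h : AffineKZ.DDAHA N) (x : AffineKZ.Coinvariants N m A B),
              AffineKZ.coinvariantsMap N f g (σ h x) =
                σ' h (AffineKZ.coinvariantsMap N f g x)) ∧
          ∀ (A'' : Type*) [AddCommGroup A''] [Module ℂ A'']
            [LieRingModule (AffineKZ.AffineSl m) A''] [LieModule ℂ (AffineKZ.AffineSl m) A'']
            (B'' : Type*) [AddCommGroup B''] [Module ℂ B'']
            [LieRingModule (AffineKZ.AffineSl m) B''] [LieModule ℂ (AffineKZ.AffineSl m) B'']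
            (f' : A' →ₗ⁅ℂ, AffineKZ.AffineSl m⁆ A'') (g' : B' →ₗ⁅ℂ, AffineKZ.AffineSl m⁆ B''),
            AffineKZ.coinvariantsMap N (f'.comp f) (g'.comp g) =
              AffineKZ.coinvariantsMap N f' g' ∘ₗ AffineKZ.coinvariantsMap N f g := by
  obtain ⟨L, R, h⟩ := AffineKZ.exists_isRLimit (N := N) hA hB
  have hρ := AffineKZ.isKZAction_heckeHom hA hB h
  set ρ := (AffineKZ.ev N m (AffineKZ.Hol N) A B).comp
    (AffineKZ.heckeHom (ℓ + m) (h.currentOps hA hB)) with hρ_def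
  have h1 : ∀ a, ∀ x ∈ LinearMap.range (AffineKZ.inclusion N m A B),
      ρ a x ∈ LinearMap.range (AffineKZ.inclusion N m A B) := fun a =>
    AffineKZ.heckeHom_mem_laurentStab (h.currentOps hA hB) h a
  have h2 : ∀ a, ∀ x ∈ AffineKZ.derivedImage N m A B, ρ a x ∈ AffineKZ.derivedImage N m A B :=
    fun a => AffineKZ.heckeHom_mem_stabilizer_derivedImage hA hB h a
  obtain ⟨σ, hσ⟩ := AffineKZ.exists_quotientAction ρ (AffineKZ.inclusion_injective N m A B)
    (AffineKZ.derivedSpan m N (AffineKZ.Laurent N) A B) h1 h2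
  replace hσ : AffineKZ.IsInducedAction ρ σ := hσ
  refine ⟨fun i x => ⟨AffineKZ.finite_support_left hA i x, AffineKZ.finite_support_right hB i x⟩,
    AffineKZ.tau_mulOp, AffineKZ.dunkl_mulOp hA hB, ρ, hρ, fun ρ₁ h₁ => h₁.ext hρ, h1, h2, σ, hσ,
    fun σ₁ h₁ => h₁.ext h1 hσ, hσ.central hρ, AffineKZ.coinvariantsMap_id, ?_⟩
  intro A' _ _ _ _ B' _ _ _ _ f g hA' hB'
  refine ⟨fun ρ' σ' hρ' hσ' a x => ?_, fun A'' _ _ _ _ B'' _ _ _ _ f' g' =>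
    AffineKZ.coinvariantsMap_comp f g f' g'⟩
  obtain ⟨L', R', h'⟩ := AffineKZ.exists_isRLimit (N := N) hA' hB'
  -- By uniqueness the given action `ρ'` is the one built from `L'` and `R'`, for which
  -- compatibility with homomorphisms has been checked on generators.
  rw [hρ'.ext (AffineKZ.isKZAction_heckeHom hA' hB' h')] at hσ'
  exact AffineKZ.IsInducedAction.coinvariantsMap_apply h1 hσ hσ' (fun a x =>
    AffineKZ.Intertwines.heckeHom (ℓ + m) (h.currentOps hA hB) (h'.currentOps hA' hB') h h' a x) a x
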